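/- **Conventions.** Let $Q$ be a finite quiver with vertex set $I$ and let $\mathbb{C}Q$ be its path algebra (basis: all paths; product: concatenation). A superpotential is an element $W\in\mathbb{C}Q$ all of whose monomials are cycles; write $\tilde W$ for its class in $\mathbb{C}Q/[\mathbb{C}Q,\mathbb{C}Q]$. We say that $W$ has a linear factor, with factorization $L\cdot R$, if $L,R\in\mathbb{C}Q$ are such that * $L\cdot R$ is a superpotential with the same class as $W$ modulo $[\mathbb{C}Q,\mathbb{C}Q]$; * $L$ is a linear combination of arrows, and for each ordered pair of vertices $(i,j)$ at most one arrow $i\to j$ occurs in $L$; * no arrow that occurs in $L$ occurs in $R$; * every path that occurs in $R$ starts at the head of some arrow that occurs in $L$ (that is, no monomial of $R$ is annihilated by left multiplication by $L$). For a dimension vector $\mathbf v\in\mathbb{Z}_{\ge0}^I$ let $M(\mathbf v)=\prod_{\alpha:i\to j}\mathrm{Hom}(\mathbb{C}^{v_i},\mathbb{C}^{v_j})$, on which $\mathrm{GL}(\mathbf v)=\prod_{i\in I}\mathrm{GL}_{v_i}$ acts by change of basis. For $m\in M(\mathbf v)$ and $x\in\mathbb{C}Q$ let $x(m)$ be the endomorphism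 of $\bigoplus_i\mathbb{C}^{v_i}$ obtained by inserting the matrices of $m$ for the arrows in $x$. Put $$M_c(\mathbf v)=\{m\mid \mathrm{Tr}\,W(m)=c\}\ (c=0,1),\qquad R(\mathbf v)=\{m\mid R(m)=0\},$$ closed $\mathrm{GL}(\mathbf v)$-invariant subschemes of $M(\mathbf v)$, and let $\mathfrak M_0(\mathbf v)$, $\mathfrak M_1(\mathbf v)$, $\mathfrak R(\mathbf v)$ be their quotient stacks by $\mathrm{GL}(\mathbf v)$. Let $K_0(\mathrm{St}_{\mathbb{C}})$ be the Grothendieck ring of stacks: its additive group is the free abelian group on isomorphism classes of (quasi-separated) Artin stacks of finite type over $\mathbb{C}$ with affine stabilizers at all $\mathbb{C}$-points, modulo the relations 1. $[\mathfrak X\sqcup\mathfrak Y]=[\mathfrak X]+[\mathfrak Y]$; 2. $[\mathfrak X]=[\mathfrak Y]$ for every geometric bijection $\mathfrak X\to\mathfrak Y$, i.e. every morphism that is representable by algebraic spaces and induces an equivalence $\mathfrak X(\mathbb{C})\to\mathfrak Y(\mathbb{C})$; 3. $[\mathfrak X]=[\mathfrak Y]$ whenever there are Zariski fibrations $\mathfrak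 X\to\mathfrak B$ and $\mathfrak Y\to\mathfrak B$ with the same base and the same fibre (a morphism is a Zariski fibration if its pull-back to every scheme is Zariski-locally on that scheme a product with the fibre, a fixed scheme). **Proposition 7.1.** Let $Q$ be a finite quiver with a superpotential $W$ that has a linear factor, with factorization $L\cdot R$ as above. Then for every dimension vector $\mathbf v\in\mathbb{Z}_{\ge0}^I$ the stacks $\mathfrak M_0(\mathbf v)$, $\mathfrak M_1(\mathbf v)$, $\mathfrak R(\mathbf v)$ are Artin stacks of finite type over $\mathbb{C}$ with affine stabilizers, and $$[\mathfrak M_0(\mathbf v)]-[\mathfrak M_1(\mathbf v)]=[\mathfrak R(\mathbf v)]\quad\text{in } K_0(\mathrm{St}_{\mathbb{C}}).$$ -/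

import Mathlib

open CategoryTheory Limits AlgebraicGeometry Opposite

noncomputable section

namespace QuiverStack

/-! ## The étale site of complex schemes and categories fibred in groupoids over it -/

/-- The category of schemes over `ℂ`. -/
abbrev SchC : Type 1 := Over (Spec (CommRingCat.of ℂ))

/-- The (big) étale topology on the category of schemes over `ℂ`. -/
abbrev etaleC : GrothendieckTopology SchC :=
  Scheme.etaleTopology.over (Spec (CommRingCat.of ℂ))

/-- Categories over the category of complex schemes: a category `𝒳.obj` with a projection functor
`𝒳.p` to `SchC`. The morphisms of such are the functors commuting with the projections
(`CategoryTheory.BasedFunctor`). -/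
abbrev CatOver := BasedCategory.{0, 1} SchC

/-- The category `𝒳` over `SchC` is fibred in groupoids: pull-backs exist, and every arrow
is (strongly) cartesian. -/
structure IsFibredInGroupoids (𝒳 : CatOver) : Prop where
  exists_lift : ∀ (x : 𝒳.obj) {T : SchC} (f : T ⟶ 𝒳.p.obj x),
    ∃ (y : 𝒳.obj) (φ : y ⟶ x), 𝒳.p.IsHomLift f φ
  cartesian : ∀ {y x : 𝒳.obj} (φ : y ⟶ x), 𝒳.p.IsStronglyCartesian (𝒳.p.map φ) φ

/-- `𝒳` is a stack in groupoids for the étale topology.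

* `glue_hom`: morphisms glue. A morphism `x ⟶ y` over `g : S ⟶ S'` is the same as an isomorphism
  from `x` to the pull-back `g^* y`, so this says that the presheaf `Isom(x, g^* y)` on schemes
  over `S` is an étale sheaf. A section of it over all members `f` of a sieve `R` is a compatible
  family of morphisms `z ⟶ y`, one for each `φ : z ⟶ x` lying over a member of `R`.
* `glue_obj`: every descent datum relative to a covering sieve `R` of `S` is effective. A descent
  datum is a functor from the members of `R` (a full subcategory of `Over S`) to `𝒳` over the base,
  and it is effective if it comes by restriction from an object `x` over `S`. -/
structure IsStack (𝒳 : CatOver) : Prop where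
  fibred : IsFibredInGroupoids 𝒳
  glue_hom : ∀ (x y : 𝒳.obj) (g : 𝒳.p.obj x ⟶ 𝒳.p.obj y) (R : Sieve (𝒳.p.obj x)),
    R ∈ etaleC (𝒳.p.obj x) →
    ∀ ψ : (∀ (z : 𝒳.obj) (φ : z ⟶ x), R (𝒳.p.map φ) → (z ⟶ y)),
      (∀ z φ hφ, 𝒳.p.map (ψ z φ hφ) = 𝒳.p.map φ ≫ g) →
      (∀ (z z' : 𝒳.obj) (χ : z' ⟶ z) (φ : z ⟶ x) (hφ : R (𝒳.p.map φ))
        (hχ : R (𝒳.p.map (χ ≫ φ))), ψ z' (χ ≫ φ) hχ = χ ≫ ψ z φ hφ) →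
      ∃! h : x ⟶ y, 𝒳.p.map h = g ∧ ∀ z φ hφ, φ ≫ h = ψ z φ hφ
  glue_obj : ∀ (S : SchC) (R : Sieve S), R ∈ etaleC S →
    ∀ (σ : R.arrows.category ⥤ 𝒳.obj) (θ : σ ⋙ 𝒳.p ≅ R.arrows.diagram),
      ∃ (x : 𝒳.obj) (e : 𝒳.p.obj x ≅ S) (c : σ ⟶ (Functor.const _).obj x),
        ∀ f : R.arrows.category, 𝒳.p.map (c.app f) ≫ e.hom = θ.hom.app f ≫ f.obj.hom

/-! ## Fibre products with schemes, representability -/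

/-- For a morphism `F : 𝒳 ⟶ 𝒴` of categories fibred in groupoids and an object `y` of `𝒴` over a
scheme `S`, that is a morphism `y : S ⟶ 𝒴`, this is the 2-fibre product `𝒳 ×_𝒴 S`: an object of
it over `T` is an `x` in `𝒳(T)`, a morphism `f : T ⟶ S` and an isomorphism `F x ≅ f^* y`; the last
two together are the same as one morphism `F x ⟶ y` in `𝒴`. -/
def fibre {𝒳 𝒴 : CatOver} (F : BasedFunctor 𝒳 𝒴) (y : 𝒴.obj) : CatOver :=
  BasedCategory.ofFunctor (CostructuredArrow.proj F.toFunctor y ⋙ 𝒳.p)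

/-- The projection `𝒳 ×_𝒴 S ⟶ S`, on an object over the scheme `T`: it is a morphism `T ⟶ S`. -/
def baseMap {𝒳 𝒴 : CatOver} (F : BasedFunctor 𝒳 𝒴) (y : 𝒴.obj) (t : (fibre F y).obj) :
    (fibre F y).p.obj t ⟶ 𝒴.p.obj y :=
  eqToHom (F.w_obj (CostructuredArrow.proj F.toFunctor y |>.obj t)).symm ≫
    𝒴.p.map (CostructuredArrow.hom (S := F.toFunctor) t)

/-- The slice of `𝒳` over an object `u` of `𝒳(U)`. If `𝒳` is fibred in groupoids, it is equivalent
over the base to the category of schemes over `U`, that is to the scheme `U` itself. -/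
def slice {𝒳 : CatOver} (u : 𝒳.obj) : CatOver :=
  BasedCategory.ofFunctor (Over.forget u ⋙ 𝒳.p)

/-- The morphism `U ⟶ 𝒳` that corresponds to an object `u` of `𝒳(U)` (2-Yoneda lemma). The fibre
product `U ×_𝒳 T` of two such morphisms, given by `u` and `y`, is `fibre (classify u) y`; it
parametrizes the isomorphisms between pull-backs of `u` and of `y`. -/
def classify {𝒳 : CatOver} (u : 𝒳.obj) : BasedFunctor (slice u) 𝒳 where
  toFunctor := Over.forget u
  w := rfl

/-- A category fibred in groupoids is (represented by) a scheme `V` if and only if it has a terminal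
object: the universal object over `V`. This predicate says that `t` is such a universal object;
the representing scheme is then `𝒳.p.obj t`. -/
def IsUniversal {𝒳 : CatOver} (t : 𝒳.obj) : Prop := Nonempty (IsTerminal t)

/-- `u` in `𝒳(U)` gives an étale surjective morphism `U ⟶ 𝒳` that is representable by schemes. -/
def IsEtaleAtlas {𝒳 : CatOver} (u : 𝒳.obj) : Prop :=
  ∀ y : 𝒳.obj, ∃ t : (fibre (classify u) y).obj, IsUniversal t ∧
    Etale (baseMap (classify u) y t).left ∧ Surjective (baseMap (classify u) y t).left

/-- Algebraic spaces over `ℂ`: étale stacks without automorphisms (sheaves of sets) whose diagonal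
is representable by schemes, and which have an étale surjective morphism from a scheme. -/
structure IsAlgebraicSpace (𝒳 : CatOver) : Prop where
  stack : IsStack 𝒳
  faithful : 𝒳.p.Faithful
  diagonal : ∀ x y : 𝒳.obj, ∃ t : (fibre (classify x) y).obj, IsUniversal t
  atlas : ∃ u : 𝒳.obj, IsEtaleAtlas u

/-- `u` in `𝒳(U)` gives a smooth surjective morphism `U ⟶ 𝒳`: for every `y` in `𝒳(S)`,
the algebraic space `U ×_𝒳 S` has an étale atlas that is smooth and surjective over `S`. -/
def IsSmoothAtlas {𝒳 : CatOver} (u : 𝒳.obj) : Prop :=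
  ∀ y : 𝒳.obj, IsAlgebraicSpace (fibre (classify u) y) ∧
    ∃ t : (fibre (classify u) y).obj, IsEtaleAtlas t ∧
      Smooth (baseMap (classify u) y t).left ∧ Surjective (baseMap (classify u) y t).left

/-- The diagonal of `𝒳` is quasi-compact: for morphisms `S ⟶ 𝒳` and `T ⟶ 𝒳` from affine schemes,
`S ×_𝒳 T` is quasi-compact, that is, it has an étale atlas by a quasi-compact scheme. -/
def HasQuasiCompactDiagonal (𝒳 : CatOver) : Prop :=
  ∀ x y : 𝒳.obj, IsAffine (𝒳.p.obj x).left → IsAffine (𝒳.p.obj y).left →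
    ∃ t : (fibre (classify x) y).obj, IsEtaleAtlas t ∧
      CompactSpace ((fibre (classify x) y).p.obj t).left

/-- `𝒳` is quasi-separated: its diagonal is quasi-compact and quasi-separated. -/
def IsQuasiSeparated (𝒳 : CatOver) : Prop :=
  HasQuasiCompactDiagonal 𝒳 ∧
    ∀ x y : 𝒳.obj, IsAffine (𝒳.p.obj x).left → IsAffine (𝒳.p.obj y).left →
      HasQuasiCompactDiagonal (fibre (classify x) y)

/-- An object of `𝒳` over `Spec ℂ` (which is terminal among the complex schemes), that is a
`ℂ`-valued point of `𝒳`. All morphisms between such objects lie over the identity of `Spec ℂ`. -/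
def IsPoint {𝒳 : CatOver} (x : 𝒳.obj) : Prop := Nonempty (IsTerminal (𝒳.p.obj x))

/-- Artin stacks of finite type over `ℂ` with affine stabilizers: étale stacks

* whose diagonal is representable by algebraic spaces, and which are quasi-separated,
* with a smooth surjective morphism from a scheme that is of finite type over `ℂ`,
* such that for each `x` in `𝒳(ℂ)` the group scheme `Isom(x, x)` is an affine algebraic group. -/
structure IsArtinStack (𝒳 : CatOver) : Prop where
  stack : IsStack 𝒳
  diagonal : ∀ x y : 𝒳.obj, IsAlgebraicSpace (fibre (classify x) y)
  quasiSeparated : IsQuasiSeparated 𝒳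
  atlas : ∃ u : 𝒳.obj, IsSmoothAtlas u ∧
    LocallyOfFiniteType (𝒳.p.obj u).hom ∧ QuasiCompact (𝒳.p.obj u).hom
  stabilizers : ∀ x : 𝒳.obj, IsPoint x → ∃ t : (fibre (classify x) x).obj, IsUniversal t ∧
    IsAffine ((fibre (classify x) x).p.obj t).left ∧
    LocallyOfFiniteType ((fibre (classify x) x).p.obj t).hom

/-! ## The Grothendieck ring of stacks (its additive group) -/

/-- The collection of Artin stacks of finite type over `ℂ` with affine stabilizers. -/
structure ArtinStack where
  toCat : CatOver
  isArtin : IsArtinStack toCat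

/-- `𝒳` and `𝒴` are isomorphic (equivalent over the base) stacks. -/
def Isomorphic (𝒳 𝒴 : CatOver) : Prop := ∃ F : BasedFunctor 𝒳 𝒴, F.toFunctor.IsEquivalence

/-- `𝒵` is the disjoint union of `𝒳` and `𝒴` by means of `i : 𝒳 ⟶ 𝒵` and `j : 𝒴 ⟶ 𝒵`:
after base change to any scheme `S ⟶ 𝒵` one gets two schemes over `S` of which `S` is the
disjoint union (coproduct). -/
def IsDisjointUnion {𝒳 𝒴 𝒵 : CatOver} (i : BasedFunctor 𝒳 𝒵) (j : BasedFunctor 𝒴 𝒵) : Prop :=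
  ∀ z : 𝒵.obj, ∃ (s : (fibre i z).obj) (t : (fibre j z).obj), IsUniversal s ∧ IsUniversal t ∧
    Nonempty (IsColimit (BinaryCofan.mk (baseMap i z s) (baseMap j z t)))

/-- A geometric bijection: a morphism representable by algebraic spaces that induces
an equivalence between the groupoids of `ℂ`-valued points. -/
structure IsGeometricBijection {𝒳 𝒴 : CatOver} (F : BasedFunctor 𝒳 𝒴) : Prop where
  representable : ∀ y : 𝒴.obj, IsAlgebraicSpace (fibre F y)
  fullyFaithful : ∀ x x' : 𝒳.obj, IsPoint x → IsPoint x' →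
    Function.Bijective fun φ : x ⟶ x' => F.map φ
  essSurj : ∀ y : 𝒴.obj, IsPoint y → ∃ x : 𝒳.obj, IsPoint x ∧ Nonempty (F.obj x ≅ y)

/-- `F : 𝒳 ⟶ 𝒴` is a Zariski fibration with fibre the scheme `Φ`: for every morphism `y : S ⟶ 𝒴`
from a scheme, each point of `S` has an open neighbourhood `S'`, with restriction `y'` of `y`, such
that `𝒳 ×_𝒴 S'` is a scheme isomorphic over `S'` to the product `S' × Φ`. -/
def IsZariskiFibration {𝒳 𝒴 : CatOver} (F : BasedFunctor 𝒳 𝒴) (Φ : SchC) : Prop :=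
  ∀ (y : 𝒴.obj) (s : (𝒴.p.obj y).left), ∃ (y' : 𝒴.obj) (φ : y' ⟶ y),
    IsOpenImmersion (𝒴.p.map φ).left ∧ s ∈ Set.range (𝒴.p.map φ).left ∧
    ∃ (t : (fibre F y').obj) (r : (fibre F y').p.obj t ⟶ Φ), IsUniversal t ∧
      Nonempty (IsLimit (BinaryFan.mk (baseMap F y' t) r))

/-- The defining relations of the Grothendieck ring of stacks. -/
inductive Relation : FreeAbelianGroup ArtinStack → Prop
  | isomorphic (X Y : ArtinStack) (h : Isomorphic X.toCat Y.toCat) :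
      Relation (FreeAbelianGroup.of X - FreeAbelianGroup.of Y)
  | disjointUnion (X Y Z : ArtinStack) (i : BasedFunctor X.toCat Z.toCat)
      (j : BasedFunctor Y.toCat Z.toCat) (h : IsDisjointUnion i j) :
      Relation (FreeAbelianGroup.of Z - (FreeAbelianGroup.of X + FreeAbelianGroup.of Y))
  | geometricBijection (X Y : ArtinStack) (F : BasedFunctor X.toCat Y.toCat)
      (h : IsGeometricBijection F) :
      Relation (FreeAbelianGroup.of X - FreeAbelianGroup.of Y)
  | zariskiFibration (X Y B : ArtinStack) (Φ : SchC) (F : BasedFunctor X.toCat B.toCat)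
      (G : BasedFunctor Y.toCat B.toCat) (hF : IsZariskiFibration F Φ)
      (hG : IsZariskiFibration G Φ) :
      Relation (FreeAbelianGroup.of X - FreeAbelianGroup.of Y)

/-- The Grothendieck ring of stacks `K₀(St_ℂ)`: the free abelian group on the isomorphism classes of
Artin stacks of finite type over `ℂ` with affine stabilizers, modulo the relations above.
The relations are stable under products with a stack, so that the fibre product over `ℂ` makes this
abelian group a ring; only its addition is used here. -/
abbrev K0St := FreeAbelianGroup ArtinStack ⧸ AddSubgroup.closure {r | Relation r}

/-- The class of a stack in `K₀(St_ℂ)`. -/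
def stackClass (X : ArtinStack) : K0St := QuotientAddGroup.mk (FreeAbelianGroup.of X)

/-! ## Quotient stacks -/

/-- An action of a group functor on a set-valued functor on complex schemes. If both are
represented by schemes, this is an action of a group scheme on a scheme. -/
structure GroupAction (G : SchCᵒᵖ ⥤ GrpCat.{0}) (X : SchCᵒᵖ ⥤ Type) where
  act : ∀ T : SchC, G.obj (op T) → X.obj (op T) → X.obj (op T)
  one_act : ∀ T x, act T 1 x = x
  mul_act : ∀ T g h x, act T (g * h) x = act T g (act T h x)
  map_act : ∀ {T T' : SchC} (f : T' ⟶ T) g x,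
    X.map f.op (act T g x) = act T' (G.map f.op g) (X.map f.op x)

variable {G : SchCᵒᵖ ⥤ GrpCat.{0}} {X : SchCᵒᵖ ⥤ Type}

/-- An object of the quotient stack `[X / G]` over the scheme `base`: an (étale) principal
`G`-bundle `π : total ⟶ base` with a `G`-equivariant morphism `total ⟶ X`. Points of `total` with
values in `T` are morphisms `T ⟶ total`, and a morphism `total ⟶ X` is an element of `X(total)`.
The bundle is principal if `G` acts simply transitively on the fibres and
`π` has sections étale-locally on `base`. -/
structure PrincipalBundle (ρ : GroupAction G X) : Type 1 where
  base : SchC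
  total : SchC
  π : total ⟶ base
  action : GroupAction G (yoneda.obj total)
  act_π : ∀ (T : SchC) (g : G.obj (op T)) (a : T ⟶ total), action.act T g a ≫ π = a ≫ π
  simplyTransitive : ∀ (T : SchC) (a b : T ⟶ total), a ≫ π = b ≫ π →
    ∃! g : G.obj (op T), action.act T g a = b
  locallyTrivial : Sieve.generate (Presieve.singleton π) ∈ etaleC base
  toX : X.obj (op total)
  equivariant : ∀ (T : SchC) (g : G.obj (op T)) (a : T ⟶ total),
    X.map (Quiver.Hom.op (V := SchC) (action.act T g a)) toX = ρ.act T g (X.map a.op toX)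

/-- A morphism of `[X / G]`: a `G`-equivariant morphism between the total spaces, compatible with
the morphisms to `X`, over a morphism between the bases. -/
@[ext]
structure PrincipalBundle.Hom {ρ : GroupAction G X} (P Q : PrincipalBundle ρ) : Type where
  base : P.base ⟶ Q.base
  total : P.total ⟶ Q.total
  comm : total ≫ Q.π = P.π ≫ base
  equivariant : ∀ (T : SchC) (g : G.obj (op T)) (a : T ⟶ P.total),
    (show T ⟶ P.total from P.action.act T g a) ≫ total = Q.action.act T g (a ≫ total)
  toX : X.map total.op Q.toX = P.toX

instance (ρ : GroupAction G X) : Category.{0} (PrincipalBundle ρ) where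
  Hom := PrincipalBundle.Hom
  id P :=
    { base := 𝟙 _
      total := 𝟙 _
      comm := by simp
      equivariant := by intros; simp
      toX := by simp }
  comp f g :=
    { base := f.base ≫ g.base
      total := f.total ≫ g.total
      comm := by rw [Category.assoc, g.comm, ← Category.assoc, f.comm, Category.assoc]
      equivariant := by
        intro T k a
        rw [← Category.assoc, f.equivariant, g.equivariant, Category.assoc]
      toX := by rw [op_comp, Functor.map_comp, ← f.toX, ← g.toX]; rfl }
  id_comp f := by apply PrincipalBundle.Hom.ext <;> exact Category.id_comp _
  comp_id f := by apply PrincipalBundle.Hom.ext <;> exact Category.comp_id _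
  assoc f g h := by apply PrincipalBundle.Hom.ext <;> exact Category.assoc _ _ _

/-- The quotient stack `[X / G]`. -/
def quotientStack (ρ : GroupAction G X) : CatOver where
  obj := PrincipalBundle ρ
  p :=
    { obj := fun P => P.base
      map := fun f => PrincipalBundle.Hom.base f
      map_id := fun _ => rfl
      map_comp := fun _ _ => rfl }

/-! ## Quivers, path algebra, superpotentials -/

section Quiver

variable {I : Type} [Quiver.{0} I]

/-- The paths of a quiver, with their starting and end points. -/
abbrev QPath (I : Type) [Quiver.{0} I] : Type := Σ i j : I, Quiver.Path i j

/-- The vector space underlying the path algebra `ℂQ`, with basis the set of all paths. -/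
abbrev PathAlgebra (I : Type) [Quiver.{0} I] : Type := QPath I →₀ ℂ

open Classical in
/-- The product of two paths in the path algebra: the concatenation `p`, then `q`, if `p` ends
where `q` starts, and zero otherwise. -/
def concat (p q : QPath I) : PathAlgebra I :=
  if h : p.2.1 = q.1 then
    Finsupp.single ⟨p.1, q.2.1, p.2.2.comp (q.2.2.cast h.symm rfl)⟩ 1 else 0

/-- The product of the path algebra `ℂQ`: the bilinear extension of concatenation. -/
def pathMul (x y : PathAlgebra I) : PathAlgebra I :=
  x.sum fun p a => y.sum fun q b => (a * b) • concat p q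

/-- The commutator subspace `[ℂQ, ℂQ]`. -/
def commutators (I : Type) [Quiver.{0} I] : Submodule ℂ (PathAlgebra I) :=
  Submodule.span ℂ {z | ∃ x y, z = pathMul x y - pathMul y x}

/-- A superpotential: all its monomials are cycles. -/
def IsSuperpotential (W : PathAlgebra I) : Prop := ∀ p ∈ W.support, p.1 = p.2.1

/-- The superpotential `W`, regarded up to cyclic permutation of its monomials (that is, modulo
`[ℂQ, ℂQ]`), has a linear factor `L`, with cofactor `R`. -/
structure IsLinearFactorization (W L R : PathAlgebra I) : Prop where
  /-- The product `L · R` is again a superpotential, with the same class as `W`. -/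
  superpotential : IsSuperpotential (pathMul L R)
  sub_mem : W - pathMul L R ∈ commutators I
  /-- `L` is a linear combination of arrows. -/
  linear : ∀ p ∈ L.support, p.2.2.length = 1
  /-- Between any two vertices at most one arrow occurs in `L`. -/
  atMostOne : ∀ p ∈ L.support, ∀ q ∈ L.support, p.1 = q.1 → p.2.1 = q.2.1 → p = q
  /-- No arrow of `L` occurs in `R`. -/
  notOccurs : ∀ p ∈ L.support, ∀ q ∈ R.support,
    ¬ ∃ (a : Quiver.Path q.1 p.1) (b : Quiver.Path p.2.1 q.2.1), q.2.2 = (a.comp p.2.2).comp b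
  /-- `R` has no superfluous terms: no monomial of `R` is annihilated by `L`. -/
  composable : ∀ q ∈ R.support, ∃ p ∈ L.support, p.2.1 = q.1

/-! ## Representations -/

variable (v : I → ℕ) (A : Type) [CommRing A] [Algebra ℂ A]

/-- The `A`-valued points of the space `∏_{α : i → j} Hom(ℂ^{v_i}, ℂ^{v_j})`
of representations. -/
abbrev Rep : Type := ∀ i j : I, (i ⟶ j) → Matrix (Fin (v j)) (Fin (v i)) A

/-- The `A`-valued points of `GL(v) = ∏_i GL(v_i)`. -/
abbrev GLPoints : Type := ∀ i : I, GL (Fin (v i)) A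

variable {v A}

/-- Change of basis. -/
def changeBasis (g : GLPoints v A) (m : Rep v A) : Rep v A :=
  fun i j α => (g j).val * m i j α * (g i)⁻¹.val

/-- The linear map `V_i ⟶ V_j` that a path from `i` to `j` induces. -/
def evalPath (m : Rep v A) {i : I} : {j : I} → Quiver.Path i j → Matrix (Fin (v j)) (Fin (v i)) A
  | _, .nil => 1
  | _, .cons p α => m _ _ α * evalPath m p

open Classical in
/-- For an element `x` of the path algebra, the block `V_i ⟶ V_j` of the linear map `x(m)` from
`⨁ V_i` to itself: the linear combination of the maps induced by those paths of `x` that go from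
`i` to `j`. -/
def evalBlock (x : PathAlgebra I) (m : Rep v A) (i j : I) : Matrix (Fin (v j)) (Fin (v i)) A :=
  open Classical in
  x.sum fun p c => if h : p.1 = i ∧ p.2.1 = j then c • evalPath m (p.2.2.cast h.1 h.2) else 0

/-- The trace of the linear map `x(m)`: the Chern–Simons functional of `x`. -/
def traceFun [Fintype I] (x : PathAlgebra I) (m : Rep v A) : A :=
  ∑ i : I, (evalBlock x m i i).trace

variable {B : Type} [CommRing B] [Algebra ℂ B]

/-- Extension of scalars for representations. -/
def Rep.map (f : A →ₐ[ℂ] B) (m : Rep v A) : Rep v B := fun i j α => (m i j α).map f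

/-- Extension of scalars for `GL(v)`. -/
def GLPoints.map (f : A →ₐ[ℂ] B) : GLPoints v A →* GLPoints v B where
  toFun g i := Matrix.GeneralLinearGroup.map f.toRingHom (g i)
  map_one' := by funext i; exact map_one _
  map_mul' g h := by funext i; exact map_mul _ _ _

theorem evalPath_changeBasis (g : GLPoints v A) (m : Rep v A) {i j : I} (p : Quiver.Path i j) :
    evalPath (changeBasis g m) p = (g j).val * evalPath m p * (g i)⁻¹.val := by
  induction p with
  | nil => simp [evalPath]
  | cons p α ih =>
    rename_i b c
    have h : (g b)⁻¹.val * (g b).val = 1 := (g b).inv_mul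
    simp only [evalPath, changeBasis] at ih ⊢
    rw [ih]
    calc _ = (g c).val * m _ _ α * ((g b)⁻¹.val * (g b).val) * evalPath m p * (g i)⁻¹.val := by
          simp only [Matrix.mul_assoc]
      _ = _ := by rw [h]; simp only [Matrix.mul_assoc, Matrix.one_mul]

theorem evalPath_map (f : A →ₐ[ℂ] B) (m : Rep v A) {i j : I} (p : Quiver.Path i j) :
    evalPath (m.map f) p = (evalPath m p).map f := by
  induction p with
  | nil => simp [evalPath, Matrix.map_one]
  | cons p α ih => simp only [evalPath]; rw [ih, Matrix.map_mul]; rfl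

theorem evalBlock_changeBasis (x : PathAlgebra I) (g : GLPoints v A) (m : Rep v A) (i j : I) :
    evalBlock x (changeBasis g m) i j = (g j).val * evalBlock x m i j * (g i)⁻¹.val := by
  simp only [evalBlock, Finsupp.sum, Matrix.mul_sum, Matrix.sum_mul]
  refine Finset.sum_congr rfl fun p _ => ?_
  split_ifs with h
  · rw [evalPath_changeBasis, Matrix.mul_smul, Matrix.smul_mul]
  · simp

theorem evalBlock_map (x : PathAlgebra I) (f : A →ₐ[ℂ] B) (m : Rep v A) (i j : I) :
    evalBlock x (m.map f) i j = (evalBlock x m i j).map f := by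
  have hs : (evalBlock x m i j).map f
      = f.toLinearMap.mapMatrix (evalBlock x m i j) := rfl
  rw [hs]
  simp only [evalBlock, Finsupp.sum, map_sum]
  refine Finset.sum_congr rfl fun p _ => ?_
  split_ifs with h
  · rw [evalPath_map, map_smul]; rfl
  · simp

theorem traceFun_changeBasis [Fintype I] (x : PathAlgebra I) (g : GLPoints v A) (m : Rep v A) :
    traceFun x (changeBasis g m) = traceFun x m := by
  refine Finset.sum_congr rfl fun i _ => ?_
  have h : (g i)⁻¹.val * (g i).val = 1 := (g i).inv_mul
  rw [evalBlock_changeBasis, Matrix.trace_mul_comm, ← Matrix.mul_assoc, h, Matrix.one_mul]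

theorem traceFun_map [Fintype I] (x : PathAlgebra I) (f : A →ₐ[ℂ] B) (m : Rep v A) :
    traceFun x (m.map f) = f (traceFun x m) := by
  simp only [traceFun, map_sum]
  refine Finset.sum_congr rfl fun i _ => ?_
  rw [evalBlock_map]
  exact (AddMonoidHom.map_trace f.toRingHom.toAddMonoidHom _).symm

/-- A `GL(v)`-invariant locus in the space of representations, given by its `A`-valued points
for all commutative `ℂ`-algebras `A`. -/
structure InvariantLocus (v : I → ℕ) where
  mem : ∀ (A : Type) [CommRing A] [Algebra ℂ A], Rep v A → Prop
  map_mem : ∀ {A B : Type} [CommRing A] [Algebra ℂ A] [CommRing B] [Algebra ℂ B]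
    (f : A →ₐ[ℂ] B) (m : Rep v A), mem A m → mem B (m.map f)
  changeBasis_mem : ∀ {A : Type} [CommRing A] [Algebra ℂ A] (g : GLPoints v A) (m : Rep v A),
    mem A m → mem A (changeBasis g m)

/-- The closed subscheme `Tr W = c` of the space of representations, the fibre over `c` of the
Chern–Simons functional: the central fibre `M_0` for `c = 0`, the general fibre `M_1` for
`c = 1`. -/
def traceFibre [Fintype I] (W : PathAlgebra I) (v : I → ℕ) (c : ℂ) : InvariantLocus v where
  mem A _ _ m := traceFun W m = algebraMap ℂ A c
  map_mem f m h := by rw [traceFun_map, h, AlgHom.commutes]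
  changeBasis_mem g m h := by rw [traceFun_changeBasis, h]

/-- The closed subscheme `R = 0` of the space of representations, the reduced space: the linear map
`R(m)` vanishes, that is, all its blocks do. -/
def zeroLocus (R : PathAlgebra I) (v : I → ℕ) : InvariantLocus v where
  mem _ _ _ m := ∀ i j, evalBlock R m i j = 0
  map_mem f m h i j := by rw [evalBlock_map, h]; ext; simp
  changeBasis_mem g m h i j := by rw [evalBlock_changeBasis, h]; simp

/-! ## The functors of points on complex schemes and the moduli stacks -/

/-- The `ℂ`-algebra of global functions of a scheme over `ℂ`. -/
def Functions (T : SchC) : Type := Γ(T.left, ⊤)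

instance (T : SchC) : CommRing (Functions T) := inferInstanceAs (CommRing Γ(T.left, ⊤))

instance (T : SchC) : Algebra ℂ (Functions T) :=
  ((Scheme.ΓSpecIso (CommRingCat.of ℂ)).inv ≫ T.hom.appTop).hom.toAlgebra

/-- Pull-back of global functions. -/
def Functions.map {T T' : SchC} (f : T' ⟶ T) : Functions T →ₐ[ℂ] Functions T' where
  __ := f.left.appTop.hom
  commutes' c := by
    have h : T.hom.appTop ≫ f.left.appTop = T'.hom.appTop := by
      rw [← Scheme.Hom.comp_appTop, Over.w]
    have h' := congrArg (fun k => k.hom ((Scheme.ΓSpecIso (CommRingCat.of ℂ)).inv.hom c)) h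
    exact h'

theorem Functions.map_id (T : SchC) : Functions.map (𝟙 T) = AlgHom.id ℂ _ := by
  ext x
  change ((𝟙 T : T ⟶ T).left.appTop).hom x = x
  rw [Over.id_left, Scheme.Hom.id_appTop]
  rfl

theorem Functions.map_comp {T T' T'' : SchC} (f : T' ⟶ T) (g : T'' ⟶ T') :
    Functions.map (g ≫ f) = (Functions.map g).comp (Functions.map f) := by
  ext x
  change ((g ≫ f).left.appTop).hom x = g.left.appTop.hom (f.left.appTop.hom x)
  rw [Over.comp_left, Scheme.Hom.comp_appTop]
  rfl

/-- The group scheme `GL(v) = ∏_i GL(v_i)` over `ℂ`, as a group functor. -/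
def GLFunctor (v : I → ℕ) : SchCᵒᵖ ⥤ GrpCat.{0} where
  obj T := GrpCat.of (GLPoints v (Functions T.unop))
  map f := GrpCat.ofHom (GLPoints.map (Functions.map f.unop))
  map_id T := by
    ext g i a b
    change Functions.map (𝟙 T.unop) _ = _
    rw [Functions.map_id]
    rfl
  map_comp f g := by
    ext k i a b
    change Functions.map (g.unop ≫ f.unop) _ = _
    rw [Functions.map_comp]
    rfl

/-- The scheme given by an invariant locus, as a functor on complex schemes: its `T`-valued points
are the families of matrices of global functions on `T` that lie in the locus. -/
def InvariantLocus.functor {v : I → ℕ} (Z : InvariantLocus v) : SchCᵒᵖ ⥤ Type where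
  obj T := {m : Rep v (Functions T.unop) // Z.mem _ m}
  map f := TypeCat.ofHom fun m => ⟨m.1.map (Functions.map f.unop), Z.map_mem _ _ m.2⟩
  map_id T := by
    ext m i j α a b
    change Functions.map (𝟙 T.unop) _ = _
    rw [Functions.map_id]
    rfl
  map_comp f g := by
    ext m i j α a b
    change Functions.map (g.unop ≫ f.unop) _ = _
    rw [Functions.map_comp]
    rfl

/-- The action of `GL(v)` on an invariant locus by change of basis. -/
def InvariantLocus.action {v : I → ℕ} (Z : InvariantLocus v) :
    GroupAction (GLFunctor v) Z.functor where
  act _ g m := ⟨changeBasis g m.1, Z.changeBasis_mem g _ m.2⟩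
  one_act T m := by
    apply Subtype.ext
    funext i j α
    change (1 : GL _ _).val * _ * (1 : GL _ _)⁻¹.val = _
    simp
  mul_act T g h m := by
    apply Subtype.ext
    funext i j α
    change (g j * h j).val * _ * (g i * h i)⁻¹.val
      = (g j).val * ((h j).val * _ * (h i)⁻¹.val) * (g i)⁻¹.val
    simp only [mul_inv_rev, Units.val_mul, Matrix.mul_assoc]
  map_act f g m := by
    apply Subtype.ext
    funext i j α
    change ((g j).val * m.1 i j α * (g i)⁻¹.val).map (Functions.map f)
      = (g j).val.map (Functions.map f) * (m.1 i j α).map (Functions.map f)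
        * (g i)⁻¹.val.map (Functions.map f)
    rw [Matrix.map_mul, Matrix.map_mul]

/-- The quotient stack `[Z / GL(v)]` of an invariant locus `Z` of representations. -/
def InvariantLocus.stack {v : I → ℕ} (Z : InvariantLocus v) : CatOver := quotientStack Z.action

end Quiver

end QuiverStack

end

open QuiverStack

/-! The trace of `W` depends only on the class of `W` modulo commutators, so Tr W(m) = Tr (L·R)(m).
No arrow of `L` occurs in `R`; hence this trace is a linear form Σ aₖρₖ in the matrix entries aₖ of
the arrows of `L`, and the coefficients ρₖ, which are scalar multiples of entries of R(m), depend on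
the other arrows only (`traceFun_eq_sum_coordL`). Since L·R is a superpotential and every monomial
of `R` can be composed with one of `L`, R(m) vanishes as soon as all ρₖ do
(`evalBlock_eq_zero_of_cofactor`).

Consequently Tr W = 0 wherever R = 0, and wherever R ≠ 0 the trace is a non-zero linear form in the
aₖ. Let B be the locus where the arrows of `L` vanish and R ≠ 0. Setting the arrows of `L` to zero
maps U = {Tr W = 0, R ≠ 0} and M₁ to B, with fibres the hyperplanes Σ aₖρₖ = 0 and Σ aₖρₖ = 1. Near
a point of B some ρₖ is invertible and the equation can be solved for aₖ, so both maps are Zariski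
fibrations with the same affine space as fibre (`isZariskiFibration_killL`), and [U] = [M₁]. It
remains to see [M₀] = [{R = 0}] + [U]. As the relations offer disjoint unions and geometric
bijections, an intermediate stack is inserted: `splitLocus` parametrizes pairs (m, e) with Tr W(m) =
0, e idempotent, eR(m) = 0 and no common zero of e and R(m). The idempotent splits it into {R = 0}
(e = 1) and U (e = 0), by `isDisjointUnion_split`; forgetting e is a monomorphism to M₀ that is
bijective on ℂ-points, by `isGeometricBijection_split`.

The geometric half shows that these quotients are Artin stacks and that equivariant maps of schemes
induce maps of quotient stacks of the required kinds. It rests on Hilbert's Theorem 90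
(`hasZariskiSections_GL`): torsors under GL(v) are Zariski-locally trivial. Therefore torsors are
representable by gluing (`Torsor.exists_isUniv`), descent of bundles is effective
(`isStack_quotientStack`), and a scheme N with an equivariant map to a principal bundle has a
quotient scheme (`exists_quotient`). The last fact makes the fibre products of quotient stacks that
occur representable by schemes. Properties of their projections can be checked after pull-back to
the total space of a bundle, because its projection has local sections. Torsors are treated as
presheaves, in an arbitrary universe, since a descended bundle is known by its sections before it is
known to be a scheme. -/

noncomputable section
namespace QuiverStack

universe w

/-! ## Presheaves on complex schemes -/

/-- Restriction of a section of a presheaf along a morphism. -/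
def res (F : SchCᵒᵖ ⥤ Type w) {T T' : SchC} (f : T' ⟶ T) (x : F.obj (op T)) : F.obj (op T') :=
  F.map f.op x

section Res

variable (F : SchCᵒᵖ ⥤ Type w)

@[simp] theorem res_id {T : SchC} (x : F.obj (op T)) : res F (𝟙 T) x = x := by
  simp [res]

theorem res_res {T T' T'' : SchC} (f : T' ⟶ T) (g : T'' ⟶ T') (x : F.obj (op T)) :
    res F g (res F f x) = res F (g ≫ f) x := by
  simp [res]

@[simp] theorem res_yoneda (Y : SchC) {T T' : SchC} (f : T' ⟶ T) (x : T ⟶ Y) :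
    res (yoneda.obj Y) f x = f ≫ x := rfl

end Res

/-- The element `ξ` of `F(E)` is universal: it exhibits `E` as a representing object of `F`. -/
def IsUniv (F : SchCᵒᵖ ⥤ Type w) {E : SchC} (ξ : F.obj (op E)) : Prop :=
  ∀ (T : SchC) (x : F.obj (op T)), ∃! f : T ⟶ E, res F f ξ = x

namespace IsUniv

variable {F : SchCᵒᵖ ⥤ Type w} {E : SchC} {ξ : F.obj (op E)} (h : IsUniv F ξ)

/-- The morphism to the representing object given by a section. -/
def lift {T : SchC} (x : F.obj (op T)) : T ⟶ E := (h T x).choose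

include h

@[simp] theorem res_lift {T : SchC} (x : F.obj (op T)) : res F (h.lift x) ξ = x :=
  (h T x).choose_spec.1

theorem hom_ext {T : SchC} {f g : T ⟶ E} (hfg : res F f ξ = res F g ξ) : f = g :=
  (h T _).unique hfg rfl

theorem comp_lift {T T' : SchC} (g : T' ⟶ T) (x : F.obj (op T)) :
    g ≫ h.lift x = h.lift (res F g x) := by
  apply h.hom_ext
  rw [← res_res, h.res_lift, h.res_lift]

end IsUniv

/-- The étale topology is coarser than the pro-étale one, which is subcanonical; slicing over Spec ℂ
preserves this. -/
instance : etaleC.Subcanonical := by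
  have : Scheme.etaleTopology.{0}.Subcanonical :=
    .of_le Scheme.etaleTopology_le_proetaleTopology
  infer_instance

theorem isSheaf_yoneda (Y : SchC) : Presieve.IsSheaf etaleC (yoneda.obj Y) :=
  GrothendieckTopology.Subcanonical.isSheaf_of_isRepresentable _

section Sheaf

variable {F : SchCᵒᵖ ⥤ Type w} (hF : Presieve.IsSheaf etaleC F)
include hF

theorem sheaf_ext {T : SchC} {R : Sieve T} (hR : R ∈ etaleC T) {x y : F.obj (op T)}
    (h : ∀ (W : SchC) (k : W ⟶ T), R k → res F k x = res F k y) : x = y :=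
  (hF R hR).isSeparatedFor.ext fun _ f hf => h _ f hf

/-- A section given locally by a compatible family. -/
theorem sheaf_glue {T : SchC} {R : Sieve T} (hR : R ∈ etaleC T)
    (y : ∀ (W : SchC) (k : W ⟶ T), R k → F.obj (op W))
    (hy : ∀ (W W' : SchC) (l : W' ⟶ W) (k : W ⟶ T) (hk : R k) (hk' : R (l ≫ k)),
      res F l (y W k hk) = y W' (l ≫ k) hk') :
    ∃! x : F.obj (op T), ∀ W k hk, res F k x = y W k hk := by
  let z : Presieve.FamilyOfElements F R.arrows := y
  have hc : z.Compatible := (Presieve.compatible_iff_sieveCompatible z).2 fun W W' k l hk =>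
    (hy W W' l k hk (R.downward_closed hk l)).symm
  obtain ⟨x, hx, hu⟩ := hF R hR z hc
  exact ⟨x, fun W k hk => hx k hk, fun x' hx' => hu x' fun W k hk => hx' W k hk⟩

/-- Sections that locally exist and are unique glue. -/
theorem sheaf_existsUnique {T : SchC} {R : Sieve T} (hR : R ∈ etaleC T)
    (Φ : ∀ W : SchC, (W ⟶ T) → F.obj (op W) → Prop)
    (hΦ : ∀ (W W' : SchC) (l : W' ⟶ W) (k : W ⟶ T) (y : F.obj (op W)), Φ W k y →
      Φ W' (l ≫ k) (res F l y))
    (h : ∀ (W : SchC) (k : W ⟶ T), R k → ∃! y, Φ W k y) :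
    ∃! y : F.obj (op T), ∀ (W : SchC) (k : W ⟶ T), R k → Φ W k (res F k y) := by
  obtain ⟨x, hx, hu⟩ := sheaf_glue hF hR (fun W k hk => (h W k hk).choose)
    (fun W W' l k hk hk' => (h W' _ hk').unique (hΦ _ _ _ _ _ (h W k hk).choose_spec.1)
      (h W' _ hk').choose_spec.1)
  refine ⟨x, fun W k hk => ?_, fun x' hx' => hu x' fun W k hk => ?_⟩
  · rw [hx W k hk]; exact (h W k hk).choose_spec.1
  · exact (h W k hk).unique (hx' W k hk) (h W k hk).choose_spec.1

end Sheaf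

/-- Through the universal element, sections are morphisms to `E`, and these glue because the étale
topology is subcanonical. -/
theorem IsUniv.isSheaf {F : SchCᵒᵖ ⥤ Type w} {E : SchC} {ξ : F.obj (op E)} (h : IsUniv F ξ) :
    Presieve.IsSheaf etaleC F := by
  intro T R hR x hx
  rw [Presieve.compatible_iff_sieveCompatible] at hx
  obtain ⟨f, hf, hu⟩ := sheaf_glue (isSheaf_yoneda E) hR (fun W k hk => h.lift (x k hk))
    (fun W W' l k hk hk' => by
      rw [res_yoneda, h.comp_lift]
      exact congrArg _ (hx k l hk).symm)
  refine ⟨res F f ξ, fun W k hk => ?_, fun y hy => ?_⟩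
  · have := hf W k hk
    rw [res_yoneda] at this
    change res F k _ = _
    rw [res_res, this, h.res_lift]
  · obtain ⟨g, rfl, -⟩ := h T y
    congr 1
    refine hu g fun W k hk => h.hom_ext ?_
    rw [res_yoneda, h.res_lift, ← res_res]
    exact hy k hk

/-! ## Étale coverings -/

/-- A covering is obtained by choosing one étale member through each point, so that it is indexed by
the points of `T`. -/
theorem mem_etaleC {T : SchC} {R : Sieve T}
    (h : ∀ t : T.left, ∃ (U : SchC) (f : U ⟶ T), Etale f.left ∧ R f ∧ t ∈ Set.range f.left) :
    R ∈ etaleC T := by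
  refine (GrothendieckTopology.mem_over_iff _ _).2 (Scheme.mem_grothendieckTopology_iff.2 ?_)
  choose U f hf hR ht using h
  choose u hu using ht
  refine ⟨Scheme.Cover.mkOfCovers T.left (fun t => (U t).left) (fun t => (f t).left)
    (fun t => ⟨t, u t, hu t⟩) (fun t => hf t), ?_⟩
  rintro _ _ ⟨t⟩
  refine (Sieve.overEquiv_iff _ _).2 ?_
  have e : (Over.homMk (f t).left rfl : Over.mk ((f t).left ≫ T.hom) ⟶ T) =
      (Over.homMk (𝟙 _) (by simp) : Over.mk ((f t).left ≫ T.hom) ⟶ U t) ≫ f t := by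
    ext1; simp
  have := R.downward_closed (hR t)
    (Over.homMk (𝟙 _) (by simp) : Over.mk ((f t).left ≫ T.hom) ⟶ U t)
  rw [← e] at this
  exact this

theorem exists_of_mem_etaleC {T : SchC} {R : Sieve T} (hR : R ∈ etaleC T) (t : T.left) :
    ∃ (U : SchC) (f : U ⟶ T), Etale f.left ∧ R f ∧ t ∈ Set.range f.left := by
  obtain ⟨𝒰, h𝒰⟩ := Scheme.mem_grothendieckTopology_iff.1
    ((GrothendieckTopology.mem_over_iff _ _).1 hR)
  obtain ⟨i, u, hu⟩ := ((Scheme.ofArrows_mem_precoverage_iff _).1 𝒰.mem₀).1 t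
  exact ⟨Over.mk (𝒰.f i ≫ T.hom), Over.homMk (𝒰.f i) rfl, 𝒰.map_prop i,
    (Sieve.overEquiv_iff _ _).1 (h𝒰 _ _ ⟨i⟩), u, hu⟩

theorem pullback_mem_etaleC {S T : SchC} (f : T ⟶ S) {R : Sieve S} (hR : R ∈ etaleC S) :
    R.pullback f ∈ etaleC T := etaleC.pullback_stable f hR

theorem generate_singleton_mem_etaleC {S T : SchC} (f : T ⟶ S) [Etale f.left]
    [Surjective f.left] : Sieve.generate (Presieve.singleton f) ∈ etaleC S :=
  mem_etaleC fun t => ⟨T, f, inferInstance, ⟨T, 𝟙 _, f, ⟨⟩, Category.id_comp _⟩,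
    f.left.surjective t⟩

theorem generate_singleton_apply {S T W : SchC} {f : T ⟶ S} {k : W ⟶ S} :
    Sieve.generate (Presieve.singleton f) k ↔ ∃ l : W ⟶ T, l ≫ f = k := by
  constructor
  · rintro ⟨_, l, _, ⟨⟩, rfl⟩
    exact ⟨l, rfl⟩
  · rintro ⟨l, rfl⟩
    exact ⟨T, l, f, ⟨⟩, rfl⟩

/-! ## Open subschemes -/

/-- The open subscheme of a complex scheme on an open subset. -/
def opn (S : SchC) (V : S.left.Opens) : SchC := Over.mk (V.ι ≫ S.hom)

/-- The inclusion of an open subscheme. -/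
def opnι (S : SchC) (V : S.left.Opens) : opn S V ⟶ S := Over.homMk V.ι rfl

instance (S : SchC) (V : S.left.Opens) : IsOpenImmersion (opnι S V).left :=
  inferInstanceAs (IsOpenImmersion V.ι)

theorem range_opnι (S : SchC) (V : S.left.Opens) : Set.range (opnι S V).left = V :=
  V.range_ι

theorem mono_of_isOpenImmersion {U S : SchC} (f : U ⟶ S) [IsOpenImmersion f.left] : Mono f := by
  have : Mono ((Over.forget _).map f) := inferInstanceAs (Mono f.left)
  exact (Over.forget _).mono_of_mono_map this

instance (S : SchC) (V : S.left.Opens) : Mono (opnι S V) := mono_of_isOpenImmersion _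

theorem exists_lift_of_range_subset {U S T : SchC} (j : U ⟶ S) [IsOpenImmersion j.left]
    (f : T ⟶ S) (h : Set.range f.left ⊆ Set.range j.left) : ∃ g : T ⟶ U, g ≫ j = f := by
  refine ⟨Over.homMk (IsOpenImmersion.lift j.left f.left h) ?_, ?_⟩
  · rw [← Over.w j, IsOpenImmersion.lift_fac_assoc, Over.w f]
  · ext1
    simp

theorem exists_opn_lift {S T : SchC} (V : S.left.Opens) (f : T ⟶ S)
    (h : Set.range f.left ⊆ V) : ∃ g : T ⟶ opn S V, g ≫ opnι S V = f :=
  exists_lift_of_range_subset _ _ (by rwa [range_opnι])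

theorem range_comp_subset {S T W : SchC} (g : W ⟶ T) (f : T ⟶ S) :
    Set.range (g ≫ f).left ⊆ Set.range f.left := by
  rintro _ ⟨x, rfl⟩
  exact ⟨g.left x, by simp⟩

end QuiverStack

end

noncomputable section
namespace QuiverStack

universe w

/-! ## Gluing of representing schemes -/

section OpensCover

variable {S : Scheme.{0}} (J : Set S.Opens)

/-- An open cover of a scheme, indexed by a set of open subsets. -/
def opensCover (hJ : ∀ s : S, ∃ V ∈ J, s ∈ V) : S.OpenCover where
  I₀ := J
  X V := V.1
  f V := V.1.ι
  mem₀ := by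
    rw [Scheme.presieve₀_mem_precoverage_iff]
    refine ⟨fun s => ?_, inferInstance⟩
    obtain ⟨V, hV, hs⟩ := hJ s
    exact ⟨⟨V, hV⟩, by simpa using hs⟩

variable (hJ : ∀ s : S, ∃ V ∈ J, s ∈ V)

instance : Preorder (opensCover J hJ).I₀ := inferInstanceAs (Preorder J)

/-- An open cover by a set of open subsets that is closed under passage to smaller open subsets
is locally directed. -/
@[reducible]
def opensCoverLocallyDirected (hJ' : ∀ V ∈ J, ∀ V' ≤ V, V' ∈ J) :
    Scheme.Cover.LocallyDirected (opensCover J hJ) := by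
  refine .ofIsBasisOpensRange ?_ ?_
  · intro i j
    change i.1 ≤ j.1 ↔ i.1.ι.opensRange ≤ j.1.ι.opensRange
    simp
  · rw [TopologicalSpace.Opens.isBasis_iff_nbhd]
    intro U x hx
    obtain ⟨V, hV, hs⟩ := hJ x
    refine ⟨U ⊓ V, ⟨⟨U ⊓ V, hJ' V hV _ inf_le_right⟩, ?_⟩, ⟨hx, hs⟩, inf_le_left⟩
    exact TopologicalSpace.Opens.ext (Scheme.Opens.range_ι (U ⊓ V))

end OpensCover

/-- Properties of the scheme that is glued from a relative gluing datum. -/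
theorem exists_glued_of_gluingData {S : Scheme.{0}} (𝒰 : S.OpenCover) [Category.{0} 𝒰.I₀]
    [𝒰.LocallyDirected] [Small.{0} 𝒰.I₀] [Quiver.IsThin 𝒰.I₀]
    (d : Scheme.Cover.RelativeGluingData 𝒰) :
    ∃ (E : Scheme.{0}) (b : E ⟶ S) (j : ∀ V, d.functor.obj V ⟶ E),
      (∀ V, IsOpenImmersion (j V)) ∧ (∀ V V' (h : V ⟶ V'), d.functor.map h ≫ j V' = j V) ∧
      (∀ V, j V ≫ b = d.natTrans.app V ≫ 𝒰.f V) ∧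
      ∀ V, Set.range (j V) = b ⁻¹' Set.range (𝒰.f V) :=
  ⟨d.glued, d.toBase, fun V => colimit.ι d.functor V, fun V => d.cover.map_prop V,
    fun _ _ h => colimit.w d.functor h, fun V => d.ι_toBase V,
    fun V => (d.preimage_toBase_eq_range_ι V).symm⟩

/-- Relative gluing along a set of open subsets of the base. -/
theorem exists_glued {S : Scheme.{0}} (J : Set S.Opens) (hJ : ∀ s : S, ∃ V ∈ J, s ∈ V)
    (hJ' : ∀ V ∈ J, ∀ V' ≤ V, V' ∈ J) (D : J ⥤ Scheme.{0}) (a : ∀ V : J, D.obj V ⟶ V.1)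
    (ha : ∀ (V V' : J) (h : V ≤ V'),
      IsPullback (D.map (homOfLE h)) (a V) (a V') (S.homOfLE h)) :
    ∃ (E : Scheme.{0}) (b : E ⟶ S) (j : ∀ V : J, D.obj V ⟶ E),
      (∀ V, IsOpenImmersion (j V)) ∧ (∀ V V' (h : V ≤ V'), D.map (homOfLE h) ≫ j V' = j V) ∧
      (∀ V, j V ≫ b = a V ≫ V.1.ι) ∧ ∀ V, Set.range (j V) = b ⁻¹' V.1 := by
  let _ := opensCoverLocallyDirected J hJ hJ'
  have : Quiver.IsThin (opensCover J hJ).I₀ := inferInstanceAs (Quiver.IsThin J)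
  have : Small.{0} (opensCover J hJ).I₀ := inferInstanceAs (Small.{0} J)
  obtain ⟨E, b, j, h₁, h₂, h₃, h₄⟩ := exists_glued_of_gluingData (opensCover J hJ)
    { functor := D
      natTrans :=
        { app := a
          naturality := fun V V' f => (ha V V' (leOfHom f)).w }
      equifibered := fun V V' f => ha V V' (leOfHom f) }
  refine ⟨E, b, j, h₁, fun V V' h => h₂ V V' (homOfLE h), h₃, fun V => (h₄ V).trans ?_⟩
  exact congrArg _ V.1.range_ι

/-- A sheaf over a scheme `S` is representable if it is so locally on `S`. -/
theorem exists_isUniv_of_local {S : SchC} (F : SchCᵒᵖ ⥤ Type w)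
    (hF : Presieve.IsSheaf etaleC F) (p : ∀ T : SchC, F.obj (op T) → (T ⟶ S))
    (hp : ∀ (T T' : SchC) (f : T' ⟶ T) (x : F.obj (op T)), p T' (res F f x) = f ≫ p T x)
    (H : ∀ s : S.left, ∃ V : S.left.Opens, s ∈ V ∧ ∃ (E : SchC) (ξ : F.obj (op E)),
      Set.range (p E ξ).left ⊆ V ∧ ∀ (T : SchC) (x : F.obj (op T)),
        Set.range (p T x).left ⊆ V → ∃! f : T ⟶ E, res F f ξ = x) :
    ∃ (E : SchC) (ξ : F.obj (op E)), IsUniv F ξ := by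
  -- All open subsets over which the sheaf is representable are used, not just a chosen cover: this
  -- family is closed under passage to smaller open subsets, so the gluing datum is a functor on `J`
  -- and no triple overlaps need be considered.
  let J : Set S.left.Opens := {V | ∃ (E : SchC) (ξ : F.obj (op E)),
      Set.range (p E ξ).left ⊆ V ∧ ∀ (T : SchC) (x : F.obj (op T)),
        Set.range (p T x).left ⊆ V → ∃! f : T ⟶ E, res F f ξ = x}
  have hJ : ∀ s : S.left, ∃ V ∈ J, s ∈ V := fun s => by
    obtain ⟨V, hs, hV⟩ := H s
    exact ⟨V, hV, hs⟩
  -- The part over V' is represented by the preimage of V' in the scheme that represents the part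
  -- over `V`.
  have hJ' : ∀ V ∈ J, ∀ V' ≤ V, V' ∈ J := by
    rintro V ⟨E, ξ, h₁, h₂⟩ V' hV'
    let V'' : E.left.Opens := (p E ξ).left ⁻¹ᵁ V'
    refine ⟨opn E V'', res F (opnι E V'') ξ, ?_, fun T x hx => ?_⟩
    · rw [hp]
      rintro _ ⟨y, rfl⟩
      have : (opnι E V'').left y ∈ (V'' : Set E.left) := by
        rw [← range_opnι]; exact ⟨y, rfl⟩
      exact this
    · obtain ⟨f, rfl, hf⟩ := h₂ T x (hx.trans hV')
      rw [hp] at hx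
      obtain ⟨g, hg⟩ := exists_opn_lift V'' f (by
        rintro _ ⟨y, rfl⟩
        have := hx ⟨y, rfl⟩
        exact this)
      refine ⟨g, (res_res ..).trans (by rw [hg]), fun g' hg' => ?_⟩
      rw [← cancel_mono (opnι E V''), hg]
      exact hf _ ((res_res ..).symm.trans hg')
  choose E ξ hξ hu using fun V : J => V.2
  choose m hm using fun (V V' : J) (h : V ≤ V') =>
    (hu V' (E V) (ξ V) ((hξ V).trans h)).exists
  have hext : ∀ (V : J) (T : SchC) (f g : T ⟶ E V),
      res F f (ξ V) = res F g (ξ V) → f = g := fun V T f g hfg =>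
    (hu V T (res F g (ξ V)) (by
      rw [hp]; exact (range_comp_subset _ _).trans (hξ V))).unique hfg rfl
  let D : J ⥤ Scheme.{0} :=
    { obj := fun V => (E V).left
      map := fun f => (m _ _ (leOfHom f)).left
      map_id := fun V => by
        rw [hext V _ (m _ _ (leOfHom (𝟙 V))) (𝟙 _) (by rw [hm, res_id])]
        rfl
      map_comp := fun {V V' V''} f g => by
        rw [hext V'' _ (m _ _ (leOfHom (f ≫ g))) (m _ _ (leOfHom f) ≫ m _ _ (leOfHom g)) (by
          rw [hm, ← res_res, hm, hm])]
        rfl }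
  have ha : ∀ V : J, ∃ a : (E V).left ⟶ V.1, a ≫ V.1.ι = (p _ (ξ V)).left := fun V =>
    ⟨IsOpenImmersion.lift V.1.ι (p _ (ξ V)).left (by rw [V.1.range_ι]; exact hξ V), by simp⟩
  choose a haι using ha
  -- `E V` is the part of `E V'` over `V`, by comparison of universal properties. A cone of schemes
  -- becomes a cone over ℂ by means of its leg to `E V'`.
  have hpull : ∀ (V V' : J) (h : V ≤ V'),
      IsPullback (D.map (homOfLE h)) (a V) (a V') (S.left.homOfLE h) := by
    intro V V' h
    have w : (m _ _ h).left ≫ a V' = a V ≫ S.left.homOfLE h := by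
      rw [← cancel_mono V'.1.ι, Category.assoc, haι, Category.assoc, Scheme.homOfLE_ι, haι,
        ← hm _ _ h, hp]
      rfl
    refine ⟨⟨w⟩, ⟨PullbackCone.IsLimit.mk w (fun s => ?_) (fun s => ?_) (fun s => ?_)
      (fun s k h₁ h₂ => ?_)⟩⟩
    all_goals
      let T : SchC := Over.mk (s.fst ≫ (E V').hom)
      let f : T ⟶ E V' := Over.homMk s.fst rfl
      have hr : Set.range (p T (res F f (ξ V'))).left ⊆ V.1 := by
        rw [hp]
        have : (f ≫ p _ (ξ V')).left = s.snd ≫ V.1.ι := by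
          refine (Over.comp_left _ _ _ _ _).trans
            ((congrArg (f.left ≫ ·) (haι V').symm).trans ?_)
          exact (by rw [← Category.assoc, s.condition, Category.assoc, Scheme.homOfLE_ι] :
            s.fst ≫ a V' ≫ V'.1.ι = s.snd ≫ V.1.ι)
        rw [this]
        rintro _ ⟨y, rfl⟩
        rw [← V.1.range_ι]
        exact ⟨s.snd y, by simp⟩
      have hg := (hu V T _ hr).choose_spec.1
    · exact (hu V T _ hr).choose.left
    · have : (hu V T _ hr).choose ≫ m _ _ h = f := hext V' _ _ _ (by rw [← res_res, hm, hg])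
      exact congrArg (fun k => k.left) this
    · rw [← cancel_mono V.1.ι]
      refine (Category.assoc _ _ _).trans ((congrArg (_ ≫ ·) (haι V)).trans ?_)
      have h3 := congrArg (p T) hg
      rw [hp, hp] at h3
      refine (congrArg (fun k => k.left) h3).trans ?_
      refine (Over.comp_left _ _ _ _ _).trans
        ((congrArg (f.left ≫ ·) (haι V').symm).trans ?_)
      exact (by rw [← Category.assoc, s.condition, Category.assoc, Scheme.homOfLE_ι] :
        s.fst ≫ a V' ≫ V'.1.ι = s.snd ≫ V.1.ι)
    · let k' : T ⟶ E V := Over.homMk k (by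
        rw [← Over.w (m _ _ h)]
        exact (congrArg (· ≫ (E V').hom) h₁ :))
      have : k' = (hu V T _ hr).choose := hext V _ _ _ (by
        rw [hg, ← hm _ _ h, res_res]
        congr 1
        ext1
        exact h₁)
      exact congrArg (fun k => k.left) this
  obtain ⟨X, b, j, hj, hjm, hjb, hr⟩ := exists_glued J hJ hJ' D (a) hpull
  let X' : SchC := Over.mk (b ≫ S.hom)
  let b' : X' ⟶ S := Over.homMk b rfl
  let j' : ∀ V : J, E V ⟶ X' := fun V => Over.homMk (j V) (by
    change j V ≫ b ≫ S.hom = _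
    rw [← Category.assoc, hjb, haι]
    exact Over.w _)
  have hj'b : ∀ V, j' V ≫ b' = p _ (ξ V) := fun V => by
    ext1
    exact (hjb V).trans (haι V)
  have hj'm : ∀ V V' (h : V ≤ V'), m _ _ h ≫ j' V' = j' V := fun V V' h => by
    ext1
    exact hjm V V' h
  have : ∀ V, IsOpenImmersion (j' V).left := hj
  have : ∀ V, Mono (j' V) := fun V => mono_of_isOpenImmersion _
  have hlift : ∀ (V : J) (T : SchC) (f : T ⟶ X'), Set.range (f ≫ b').left ⊆ V.1 →
      ∃ g, g ≫ j' V = f := fun V T f hf => exists_lift_of_range_subset (j' V) f (by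
    change _ ⊆ Set.range (j V)
    rw [hr]
    rintro _ ⟨y, rfl⟩
    exact hf ⟨y, by simp [b']⟩)
  -- the glued universal element
  let R : Sieve X' := Sieve.generate (Presieve.ofArrows E j')
  have hRj : ∀ V, R (j' V) := fun V => ⟨_, 𝟙 _, _, ⟨V⟩, Category.id_comp _⟩
  have hR : R ∈ etaleC X' := mem_etaleC fun t => by
    obtain ⟨V, hV, ht⟩ := hJ (b t)
    have : t ∈ Set.range (j ⟨V, hV⟩) := by rw [hr]; exact ht
    exact ⟨_, j' ⟨V, hV⟩, inferInstance, hRj _, this⟩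
  -- The local sections are the `ξ V`. The condition quantifies over all ways to factor a test
  -- morphism through a piece, so that agreement on overlaps is part of it.
  obtain ⟨Ξ, hΞ, -⟩ := sheaf_existsUnique hF hR
    (fun W k y => ∀ (V : J) (W' : SchC) (l : W' ⟶ W) (c : W' ⟶ E V), c ≫ j' V = l ≫ k →
      res F l y = res F c (ξ V))
    (fun W W' l k y h V W'' l' c hc => by
      rw [res_res]
      exact h V W'' (l' ≫ l) c (by rw [hc, Category.assoc]))
    (fun W k hk => by
      obtain ⟨_, c, _, ⟨V⟩, rfl⟩ := hk
      refine ⟨res F c (ξ V), fun V' W' l c' hc' => ?_, fun y hy => ?_⟩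
      · rw [res_res]
        -- Two pieces are compared over the intersection of the corresponding open subsets, which is
        -- again in `J`.
        let V₀ : J := ⟨V.1 ⊓ V'.1, hJ' _ V.2 _ inf_le_left⟩
        have h₁ : V₀ ≤ V := (inf_le_left : V.1 ⊓ V'.1 ≤ V.1)
        have h₂ : V₀ ≤ V' := (inf_le_right : V.1 ⊓ V'.1 ≤ V'.1)
        obtain ⟨g, hg⟩ := hlift V₀ W' (c' ≫ j' V') (by
          intro x hx
          refine ⟨?_, ?_⟩
          · rw [hc', Category.assoc, Category.assoc, hj'b] at hx
            exact hξ V (range_comp_subset _ _ (range_comp_subset _ _ hx))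
          · rw [Category.assoc, hj'b] at hx
            exact hξ V' (range_comp_subset _ _ hx))
        have e₁ : g ≫ m _ _ h₁ = l ≫ c := by
          rw [← cancel_mono (j' V), Category.assoc, hj'm, hg, hc', Category.assoc]
        have e₂ : g ≫ m _ _ h₂ = c' := by
          rw [← cancel_mono (j' V'), Category.assoc, hj'm, hg]
        rw [← e₁, ← e₂, ← res_res, ← res_res, hm, hm]
      · have := hy V W (𝟙 _) c (by simp)
        simpa using this)
  have hΞj : ∀ V, res F (j' V) Ξ = ξ V := fun V => by
    have := hΞ _ (j' V) (hRj V) V _ (𝟙 _) (𝟙 _) rfl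
    simpa using this
  have hpΞ : p _ Ξ = b' := sheaf_ext (isSheaf_yoneda S) hR fun W k hk => by
    obtain ⟨_, c, _, ⟨V⟩, rfl⟩ := hk
    rw [res_yoneda, res_yoneda, Category.assoc, Category.assoc, hj'b, ← hp, hΞj]
  refine ⟨X', Ξ, fun T x => ?_⟩
  have hinj : ∀ (V : J) (W : SchC) (f g : W ⟶ X'), Set.range (f ≫ b').left ⊆ V.1 →
      res F f Ξ = res F g Ξ → f = g := fun V W f g hf hfg => by
    have hfg' : f ≫ b' = g ≫ b' := by rw [← hpΞ, ← hp, ← hp, hfg]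
    obtain ⟨f', rfl⟩ := hlift V W f hf
    obtain ⟨g', rfl⟩ := hlift V W g (hfg' ▸ hf)
    rw [← res_res, ← res_res, hΞj] at hfg
    rw [hext V _ _ _ hfg]
  -- The morphisms to `T` whose image in `S` lies in some member of `J`; along these, sections of
  -- `F` correspond to morphisms to a single piece.
  let R' : Sieve T :=
    { arrows := fun W k => ∃ V : J, Set.range (k ≫ p T x).left ⊆ V.1
      downward_closed := by
        rintro W W' k ⟨V, hV⟩ l
        refine ⟨V, ?_⟩
        rw [Category.assoc]
        exact (range_comp_subset _ _).trans hV }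
  have hR' : R' ∈ etaleC T := mem_etaleC fun t => by
    obtain ⟨V, hV, ht⟩ := hJ ((p T x).left t)
    let U : T.left.Opens := (p T x).left ⁻¹ᵁ V
    refine ⟨opn T U, opnι T U, inferInstance, ⟨⟨V, hV⟩, ?_⟩, by rw [range_opnι]; exact ht⟩
    rintro _ ⟨y, rfl⟩
    have : (opnι T U).left y ∈ (U : Set T.left) := by
      rw [← range_opnι]; exact ⟨y, rfl⟩
    exact this
  obtain ⟨f, hf, hfu⟩ := sheaf_existsUnique (isSheaf_yoneda X') hR'
    (fun W k y => res F (show W ⟶ X' from y) Ξ = res F k x)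
    (fun W W' l k y h => by
      change res F (l ≫ (show W ⟶ X' from y)) Ξ = _
      rw [← res_res, h, res_res])
    (fun W k hk => by
      obtain ⟨V, hV⟩ := hk
      obtain ⟨g, hg, -⟩ := hu V W (res F k x) (by rwa [hp])
      refine ⟨g ≫ j' V, ?_, fun y hy => ?_⟩
      · change res F (g ≫ j' V) Ξ = _
        rw [← res_res, hΞj, hg]
      · refine (hinj V W _ _ ?_ ?_).symm
        · rw [Category.assoc, hj'b, ← hp, hg, hp]; exact hV
        · refine Eq.trans ?_ (Eq.symm hy)
          rw [← res_res, hΞj, hg])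
  refine ⟨f, sheaf_ext hF hR' fun W k hk => ?_, fun g hg => hfu g fun W k hk => ?_⟩
  · rw [res_res]; exact hf W k hk
  · change res F (k ≫ g) Ξ = _
    rw [← res_res, hg]

end QuiverStack

end

noncomputable section
namespace QuiverStack

universe w

/-! ## Principal bundles and their morphisms -/

/-- Restriction of sections of a group functor. -/
def gres (G : SchCᵒᵖ ⥤ GrpCat.{0}) {T T' : SchC} (f : T' ⟶ T) (g : G.obj (op T)) :
    G.obj (op T') := G.map f.op g

section Gres

variable (G : SchCᵒᵖ ⥤ GrpCat.{0})

@[simp] theorem gres_id {T : SchC} (g : G.obj (op T)) : gres G (𝟙 T) g = g := by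
  simp [gres]

theorem gres_gres {T T' T'' : SchC} (f : T' ⟶ T) (k : T'' ⟶ T') (g : G.obj (op T)) :
    gres G k (gres G f g) = gres G (k ≫ f) g := by
  simp [gres]

@[simp] theorem gres_one {T T' : SchC} (f : T' ⟶ T) : gres G f 1 = 1 := by
  simp [gres]

theorem gres_mul {T T' : SchC} (f : T' ⟶ T) (g h : G.obj (op T)) :
    gres G f (g * h) = gres G f g * gres G f h := by
  simp [gres]

theorem gres_inv {T T' : SchC} (f : T' ⟶ T) (g : G.obj (op T)) :
    gres G f g⁻¹ = (gres G f g)⁻¹ := by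
  simp [gres]

end Gres

variable {G : SchCᵒᵖ ⥤ GrpCat.{0}} {X : SchCᵒᵖ ⥤ Type} {ρ : GroupAction G X}

theorem GroupAction.res_act (ρ : GroupAction G X) {T T' : SchC} (f : T' ⟶ T) (g : G.obj (op T))
    (x : X.obj (op T)) : res X f (ρ.act T g x) = ρ.act T' (gres G f g) (res X f x) :=
  ρ.map_act f g x

namespace PrincipalBundle

variable (P Q : PrincipalBundle ρ)

/-- The action of the group on the points of the total space. -/
def smul {T : SchC} (g : G.obj (op T)) (a : T ⟶ P.total) : T ⟶ P.total := P.action.act T g a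

@[simp] theorem one_smul {T : SchC} (a : T ⟶ P.total) : P.smul 1 a = a := P.action.one_act T a

theorem mul_smul {T : SchC} (g h : G.obj (op T)) (a : T ⟶ P.total) :
    P.smul (g * h) a = P.smul g (P.smul h a) := P.action.mul_act T g h a

theorem comp_smul {T T' : SchC} (f : T' ⟶ T) (g : G.obj (op T)) (a : T ⟶ P.total) :
    f ≫ P.smul g a = P.smul (gres G f g) (f ≫ a) := P.action.map_act f g a

@[simp] theorem smul_π {T : SchC} (g : G.obj (op T)) (a : T ⟶ P.total) :
    P.smul g a ≫ P.π = a ≫ P.π := P.act_π T g a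

theorem existsUnique_smul_eq {T : SchC} {a b : T ⟶ P.total} (h : a ≫ P.π = b ≫ P.π) :
    ∃! g : G.obj (op T), P.smul g a = b := P.simplyTransitive T a b h

theorem smul_left_injective {T : SchC} {g h : G.obj (op T)} {a : T ⟶ P.total}
    (H : P.smul g a = P.smul h a) : g = h :=
  (P.existsUnique_smul_eq (by simp : a ≫ P.π = P.smul h a ≫ P.π)).unique H rfl

theorem res_smul_toX {T : SchC} (g : G.obj (op T)) (a : T ⟶ P.total) :
    res X (P.smul g a) P.toX = ρ.act T g (res X a P.toX) := P.equivariant T g a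

theorem exists_comp_π {W : SchC} {k : W ⟶ P.base}
    (hk : Sieve.generate (Presieve.singleton P.π) k) : ∃ a : W ⟶ P.total, a ≫ P.π = k :=
  generate_singleton_apply.1 hk

theorem mem_generate {W : SchC} (a : W ⟶ P.total) :
    Sieve.generate (Presieve.singleton P.π) (a ≫ P.π) :=
  generate_singleton_apply.2 ⟨a, rfl⟩

/-- Invariant sections on the total space descend to the base. -/
theorem existsUnique_desc {F : SchCᵒᵖ ⥤ Type w} (hF : Presieve.IsSheaf etaleC F)
    (y : F.obj (op P.total))
    (hy : ∀ (T : SchC) (g : G.obj (op T)) (a : T ⟶ P.total),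
      res F (P.smul g a) y = res F a y) :
    ∃! z : F.obj (op P.base), res F P.π z = y := by
  have hy' : ∀ (T : SchC) (a b : T ⟶ P.total), a ≫ P.π = b ≫ P.π → res F a y = res F b y := by
    intro T a b h
    obtain ⟨g, rfl, -⟩ := P.existsUnique_smul_eq h
    rw [hy]
  obtain ⟨z, hz, hu⟩ := sheaf_existsUnique hF P.locallyTrivial
    (fun W k z => ∀ (W' : SchC) (l : W' ⟶ W) (a : W' ⟶ P.total), a ≫ P.π = l ≫ k →
      res F l z = res F a y)
    (fun W W' l k z h W'' l' a ha => by
      rw [res_res]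
      exact h W'' (l' ≫ l) a (by rw [ha, Category.assoc]))
    (fun W k hk => by
      obtain ⟨a, rfl⟩ := P.exists_comp_π hk
      refine ⟨res F a y, fun W' l b hb => ?_, fun z hz => ?_⟩
      · rw [res_res]
        exact hy' _ _ _ (by rw [hb, Category.assoc])
      · simpa using hz W (𝟙 _) a (by simp))
  refine ⟨z, ?_, fun z' hz' => hu z' fun W k hk W' l a ha => ?_⟩
  · simpa using hz P.total P.π (by simpa using P.mem_generate (𝟙 _)) P.total (𝟙 _) (𝟙 _) rfl
  · rw [res_res, ← ha, ← res_res, hz']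

/-- Étale-locally on the base the projection has sections, so it is an epimorphism. -/
theorem hom_ext_of_π {Y : SchC} {f g : P.base ⟶ Y} (h : P.π ≫ f = P.π ≫ g) : f = g :=
  sheaf_ext (isSheaf_yoneda Y) P.locallyTrivial fun W k hk => by
    obtain ⟨a, rfl⟩ := P.exists_comp_π hk
    rw [res_yoneda, res_yoneda, Category.assoc, Category.assoc, h]

variable {P Q}

/-- The morphism of total spaces of a morphism of bundles. -/
def tot (φ : P ⟶ Q) : P.total ⟶ Q.total := Hom.total φ

/-- The morphism of bases of a morphism of bundles. -/
def bas (φ : P ⟶ Q) : P.base ⟶ Q.base := Hom.base φ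

theorem tot_comp_π (φ : P ⟶ Q) : tot φ ≫ Q.π = P.π ≫ bas φ := Hom.comm φ

theorem smul_comp_tot (φ : P ⟶ Q) {T : SchC} (g : G.obj (op T)) (a : T ⟶ P.total) :
    P.smul g a ≫ tot φ = Q.smul g (a ≫ tot φ) := Hom.equivariant φ T g a

@[simp] theorem res_tot_toX (φ : P ⟶ Q) : res X (tot φ) Q.toX = P.toX := Hom.toX φ

@[simp] theorem tot_id : tot (𝟙 P) = 𝟙 P.total := rfl

@[simp] theorem tot_comp {R : PrincipalBundle ρ} (φ : P ⟶ Q) (ψ : Q ⟶ R) :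
    tot (φ ≫ ψ) = tot φ ≫ tot ψ := rfl

theorem hom_ext {φ ψ : P ⟶ Q} (h : tot φ = tot ψ) : φ = ψ :=
  Hom.ext (P.hom_ext_of_π (by
    change P.π ≫ bas φ = P.π ≫ bas ψ
    rw [← tot_comp_π, ← tot_comp_π, h])) h

/-- An equivariant morphism of total spaces over `X` is a morphism of bundles. -/
theorem exists_hom (t : P.total ⟶ Q.total)
    (ht : ∀ (T : SchC) (g : G.obj (op T)) (a : T ⟶ P.total),
      P.smul g a ≫ t = Q.smul g (a ≫ t)) (hX : res X t Q.toX = P.toX) :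
    ∃ φ : P ⟶ Q, tot φ = t := by
  obtain ⟨b, hb, -⟩ := P.existsUnique_desc (isSheaf_yoneda Q.base) (t ≫ Q.π) (fun T g a => by
    rw [res_yoneda, res_yoneda, ← Category.assoc, ht, smul_π, Category.assoc])
  exact ⟨{ base := b, total := t, comm := Eq.symm hb, equivariant := ht, toX := hX }, rfl⟩

/-- The square of a morphism of bundles is cartesian. -/
theorem existsUnique_lift (φ : P ⟶ Q) {W : SchC} (b : W ⟶ P.base) (a : W ⟶ Q.total)
    (h : b ≫ bas φ = a ≫ Q.π) : ∃! c : W ⟶ P.total, c ≫ P.π = b ∧ c ≫ tot φ = a := by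
  -- Two points over the same base point differ by a group element; if their images in `Q` agree,
  -- this element is 1 since the action on `Q` is free.
  have huniq : ∀ {W' : SchC} {c d : W' ⟶ P.total}, c ≫ P.π = d ≫ P.π →
      c ≫ tot φ = d ≫ tot φ → c = d := by
    intro W' c d h₁ h₂
    obtain ⟨g, rfl, -⟩ := P.existsUnique_smul_eq h₁
    rw [smul_comp_tot] at h₂
    have : g = 1 := Q.smul_left_injective (h₂.symm.trans (Q.one_smul _).symm)
    rw [this, one_smul]
  have hR := pullback_mem_etaleC b P.locallyTrivial
  obtain ⟨c, hc, hu⟩ := sheaf_existsUnique (isSheaf_yoneda P.total) hR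
    (fun W' k (c : W' ⟶ P.total) => c ≫ P.π = k ≫ b ∧ c ≫ tot φ = k ≫ a)
    (fun W' W'' l k c hc => by
      constructor
      · rw [res_yoneda, Category.assoc, hc.1, Category.assoc]
      · rw [res_yoneda, Category.assoc, hc.2, Category.assoc])
    -- Existence is local: a local section `p` over `b` is moved by the group element that carries
    -- its image in `Q` to `a`.
    (fun W' k hk => by
      obtain ⟨p, hp⟩ := P.exists_comp_π hk
      obtain ⟨g, hg, -⟩ := Q.existsUnique_smul_eq (a := p ≫ tot φ) (b := k ≫ a) (by
        rw [Category.assoc, tot_comp_π, ← Category.assoc, hp, Category.assoc, Category.assoc, h])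
      refine ⟨P.smul g p, ⟨by rw [smul_π, hp], by rw [smul_comp_tot, hg]⟩, fun d hd => ?_⟩
      exact huniq (by rw [smul_π, hp, hd.1]) (by rw [smul_comp_tot, hg, hd.2]))
  refine ⟨c, ⟨?_, ?_⟩, fun d hd => hu d fun W' k hk => ⟨?_, ?_⟩⟩
  · refine sheaf_ext (isSheaf_yoneda _) hR fun W' k hk => ?_
    rw [res_yoneda, ← Category.assoc]
    exact (hc W' k hk).1
  · refine sheaf_ext (isSheaf_yoneda _) hR fun W' k hk => ?_
    rw [res_yoneda, ← Category.assoc]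
    exact (hc W' k hk).2
  · rw [res_yoneda, Category.assoc, hd.1]
  · rw [res_yoneda, Category.assoc, hd.2]

theorem isPullback_tot (φ : P ⟶ Q) : IsPullback (tot φ) P.π Q.π (bas φ) := by
  refine ⟨⟨tot_comp_π φ⟩, ⟨PullbackCone.IsLimit.mk (tot_comp_π φ)
    (fun s => (existsUnique_lift φ s.snd s.fst s.condition.symm).choose)
    (fun s => (existsUnique_lift φ s.snd s.fst s.condition.symm).choose_spec.1.2)
    (fun s => (existsUnique_lift φ s.snd s.fst s.condition.symm).choose_spec.1.1)
    (fun s m h₁ h₂ => (existsUnique_lift φ s.snd s.fst s.condition.symm).choose_spec.2 m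
      ⟨h₂, h₁⟩)⟩⟩

end PrincipalBundle

end QuiverStack

end

noncomputable section
namespace QuiverStack

universe w

/-! ## Torsors as presheaves -/

variable {G : SchCᵒᵖ ⥤ GrpCat.{0}} {X : SchCᵒᵖ ⥤ Type}

/-- A presheaf over a scheme `S` with a simply transitive action of `G` which étale-locally on `S`
has sections, and with an equivariant map to `X`. -/
structure Torsor (ρ : GroupAction G X) (S : SchC) where
  F : SchCᵒᵖ ⥤ Type w
  p : ∀ T : SchC, F.obj (op T) → (T ⟶ S)
  p_res : ∀ (T T' : SchC) (f : T' ⟶ T) (x : F.obj (op T)), p T' (res F f x) = f ≫ p T x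
  act : ∀ T : SchC, G.obj (op T) → F.obj (op T) → F.obj (op T)
  one_act : ∀ T x, act T 1 x = x
  mul_act : ∀ T g h x, act T (g * h) x = act T g (act T h x)
  res_act : ∀ (T T' : SchC) (f : T' ⟶ T) g x,
    res F f (act T g x) = act T' (gres G f g) (res F f x)
  p_act : ∀ T g x, p T (act T g x) = p T x
  simplyTransitive : ∀ (T : SchC) (x y : F.obj (op T)), p T x = p T y → ∃! g, act T g x = y
  locallyTrivial : ∃ R ∈ etaleC S, ∀ (T : SchC) (f : T ⟶ S), R f → ∃ x, p T x = f
  toX : ∀ T : SchC, F.obj (op T) → X.obj (op T)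
  toX_res : ∀ (T T' : SchC) (f : T' ⟶ T) (x : F.obj (op T)), toX T' (res F f x) = res X f (toX T x)
  toX_act : ∀ T g x, toX T (act T g x) = ρ.act T g (toX T x)

variable {ρ : GroupAction G X}

/-- The principal bundle whose total space represents a torsor. -/
abbrev Torsor.bundle {S E : SchC} (t : Torsor.{w} ρ S) {ξ : t.F.obj (op E)} (h : IsUniv t.F ξ) :
    PrincipalBundle ρ where
  base := S
  total := E
  π := t.p E ξ
  action :=
    { act := fun T g (a : T ⟶ E) => h.lift (t.act T g (res t.F a ξ))
      one_act := fun T a => h.hom_ext (by rw [h.res_lift, t.one_act])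
      mul_act := fun T g g' a => h.hom_ext (by
        rw [h.res_lift, h.res_lift, h.res_lift, t.mul_act])
      map_act := fun {T T'} f g (a : T ⟶ E) => by
        change f ≫ h.lift _ = h.lift (t.act T' (gres G f g) (res t.F (f ≫ a) ξ))
        rw [h.comp_lift, t.res_act, res_res] }
  act_π := fun T g a => by
    rw [← t.p_res, h.res_lift, t.p_act, t.p_res]
  simplyTransitive := fun T a b hab => by
    obtain ⟨g, hg, hu⟩ := t.simplyTransitive T (res t.F a ξ) (res t.F b ξ) (by
      rw [t.p_res, t.p_res, hab])
    refine ⟨g, h.hom_ext (by rw [h.res_lift, hg]), fun g' hg' => hu g' ?_⟩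
    rw [← show h.lift _ = b from hg', h.res_lift]
  locallyTrivial := by
    obtain ⟨R, hR, hx⟩ := t.locallyTrivial
    refine etaleC.superset_covering (fun T f hf => ?_) hR
    obtain ⟨x, rfl⟩ := hx T f hf
    refine generate_singleton_apply.2 ⟨h.lift x, ?_⟩
    rw [← t.p_res, h.res_lift]
  toX := t.toX E ξ
  equivariant := fun T g a => by
    change res X (h.lift _) _ = ρ.act T g (res X a _)
    rw [← t.toX_res, h.res_lift, t.toX_act, t.toX_res]

theorem Torsor.bundle_smul {S E : SchC} (t : Torsor.{w} ρ S) {ξ : t.F.obj (op E)}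
    (h : IsUniv t.F ξ) {T : SchC} (g : G.obj (op T)) (a : T ⟶ E) :
    res t.F ((t.bundle h).smul g a) ξ = t.act T g (res t.F a ξ) := h.res_lift _

namespace PrincipalBundle

/-- The torsor that is represented by the total space of a principal bundle. -/
def torsor (P : PrincipalBundle ρ) : Torsor.{0} ρ P.base where
  F := yoneda.obj P.total
  p T a := a ≫ P.π
  p_res T T' f a := Category.assoc _ _ _
  act T g a := P.smul g a
  one_act T a := P.one_smul a
  mul_act T g h a := P.mul_smul g h a
  res_act T T' f g a := P.comp_smul f g a
  p_act T g a := P.smul_π g a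
  simplyTransitive T a b h := P.existsUnique_smul_eq h
  locallyTrivial := ⟨_, P.locallyTrivial, fun _ _ h => P.exists_comp_π h⟩
  toX T a := res X a P.toX
  toX_res T T' f a := (res_res ..).symm
  toX_act T g a := P.res_smul_toX g a

/-- The points of the pull-back of a principal bundle. -/
def pullFunctor (P : PrincipalBundle ρ) {S : SchC} (f : S ⟶ P.base) : SchCᵒᵖ ⥤ Type where
  obj T := {x : (T.unop ⟶ S) × (T.unop ⟶ P.total) // x.1 ≫ f = x.2 ≫ P.π}
  map k := TypeCat.ofHom fun x => ⟨(k.unop ≫ x.1.1, k.unop ≫ x.1.2), by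
    rw [Category.assoc, x.2, Category.assoc]⟩
  map_id T := by
    refine ConcreteCategory.hom_ext _ _ fun x => Subtype.ext ?_
    exact Prod.ext (Category.id_comp _) (Category.id_comp _)
  map_comp k l := by
    refine ConcreteCategory.hom_ext _ _ fun x => Subtype.ext ?_
    exact Prod.ext (Category.assoc _ _ _) (Category.assoc _ _ _)

/-- The pull-back of a principal bundle, as a torsor. -/
def pullTorsor (P : PrincipalBundle ρ) {S : SchC} (f : S ⟶ P.base) : Torsor.{0} ρ S where
  F := P.pullFunctor f
  p T x := x.1.1
  p_res T T' k x := rfl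
  act T g x := ⟨(x.1.1, P.smul g x.1.2), by rw [smul_π]; exact x.2⟩
  one_act T x := Subtype.ext (Prod.ext rfl (P.one_smul _))
  mul_act T g h x := Subtype.ext (Prod.ext rfl (P.mul_smul _ _ _))
  res_act T T' k g x := Subtype.ext (Prod.ext rfl (P.comp_smul _ _ _))
  p_act T g x := rfl
  simplyTransitive T x y h := by
    obtain ⟨g, hg, hu⟩ := P.existsUnique_smul_eq (a := x.1.2) (b := y.1.2) (by
      rw [← x.2, ← y.2, h])
    exact ⟨g, Subtype.ext (Prod.ext h hg), fun g' hg' => hu g' (congrArg (fun z => z.1.2) hg')⟩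
  locallyTrivial := ⟨_, pullback_mem_etaleC f P.locallyTrivial, fun T k hk => by
    obtain ⟨a, ha⟩ := P.exists_comp_π hk
    exact ⟨⟨(k, a), ha.symm⟩, rfl⟩⟩
  toX T x := res X x.1.2 P.toX
  toX_res T T' k x := (res_res ..).symm
  toX_act T g x := P.res_smul_toX _ _

theorem isUniv_pull (P : PrincipalBundle ρ) {S : SchC} (f : S ⟶ P.base) :
    IsUniv (P.pullFunctor f) (E := pullback f P.π)
      ⟨(pullback.fst f P.π, pullback.snd f P.π), pullback.condition⟩ := fun T x =>
  ⟨pullback.lift x.1.1 x.1.2 x.2,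
    Subtype.ext (Prod.ext (pullback.lift_fst _ _ _) (pullback.lift_snd _ _ _)), fun k hk => by
      apply pullback.hom_ext
      · rw [pullback.lift_fst]; exact congrArg (fun z => z.1.1) hk
      · rw [pullback.lift_snd]; exact congrArg (fun z => z.1.2) hk⟩

/-- The pull-back of a principal bundle. -/
abbrev pull (P : PrincipalBundle ρ) {S : SchC} (f : S ⟶ P.base) : PrincipalBundle ρ :=
  (P.pullTorsor f).bundle (P.isUniv_pull f)

/-- The canonical morphism from a pull-back of a principal bundle. -/
def pullHom (P : PrincipalBundle ρ) {S : SchC} (f : S ⟶ P.base) : P.pull f ⟶ P where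
  base := f
  total := pullback.snd f P.π
  comm := pullback.condition.symm
  equivariant T g a :=
    congrArg (fun z => z.1.2) ((P.pullTorsor f).bundle_smul (P.isUniv_pull f) g a)
  toX := rfl

@[simp] theorem bas_pullHom (P : PrincipalBundle ρ) {S : SchC} (f : S ⟶ P.base) :
    bas (P.pullHom f) = f := rfl

/-- Morphisms of bundles are cartesian. -/
theorem existsUnique_factor {P P' Q : PrincipalBundle ρ} (φ : P ⟶ Q) (φ' : P' ⟶ Q)
    (b : P'.base ⟶ P.base) (h : b ≫ bas φ = bas φ') :
    ∃! χ : P' ⟶ P, bas χ = b ∧ χ ≫ φ = φ' := by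
  obtain ⟨t, ⟨ht₁, ht₂⟩, hu⟩ := existsUnique_lift φ (P'.π ≫ b) (tot φ') (by
    rw [Category.assoc, h, tot_comp_π])
  have huniq : ∀ {W : SchC} {c d : W ⟶ P.total}, c ≫ P.π = d ≫ P.π →
      c ≫ tot φ = d ≫ tot φ → c = d := fun {W c d} h₁ h₂ =>
    (existsUnique_lift φ (d ≫ P.π) (d ≫ tot φ) (by
      rw [Category.assoc, Category.assoc, tot_comp_π])).unique ⟨h₁, h₂⟩ ⟨rfl, rfl⟩
  obtain ⟨χ, hχ⟩ := exists_hom (P := P') (Q := P) t (fun T g a => by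
    apply huniq
    · rw [smul_π, Category.assoc, ht₁, ← Category.assoc, smul_π, Category.assoc, Category.assoc,
        ht₁]
    · rw [Category.assoc, ht₂, smul_comp_tot, smul_comp_tot, Category.assoc, ht₂])
    (by rw [← res_tot_toX φ, res_res, ht₂, res_tot_toX])
  refine ⟨χ, ⟨P'.hom_ext_of_π ?_, hom_ext ?_⟩, fun χ' hχ' => hom_ext ?_⟩
  · rw [← tot_comp_π, hχ, ht₁]
  · rw [tot_comp, hχ, ht₂]
  · rw [hχ]
    refine hu _ ⟨?_, ?_⟩
    · rw [tot_comp_π, hχ'.1]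
    · rw [← tot_comp, hχ'.2]

/-- Every section of a pull-back of a bundle lifts along the morphism from another pull-back. -/
theorem exists_pull_section (P : PrincipalBundle ρ) {W : SchC} (k : W ⟶ P.total) :
    ∃ w : W ⟶ (P.pull (k ≫ P.π)).total, w ≫ (P.pull (k ≫ P.π)).π = 𝟙 W ∧
      w ≫ tot (P.pullHom (k ≫ P.π)) = k := by
  obtain ⟨w, hw, -⟩ := existsUnique_lift (P.pullHom (k ≫ P.π)) (𝟙 W) k (Category.id_comp _)
  exact ⟨w, hw⟩

end PrincipalBundle

open PrincipalBundle

/-! ## Quotient stacks are fibred in groupoids -/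

/-- Trades the predicate `IsHomLift`, which involves equalities of objects, for equations between
morphisms; cartesian arrows are always verified and used in this form. -/
theorem isStronglyCartesian_iff {𝒳 : CatOver} {y x : 𝒳.obj} (φ : y ⟶ x) :
    𝒳.p.IsStronglyCartesian (𝒳.p.map φ) φ ↔
      ∀ (z : 𝒳.obj) (g : 𝒳.p.obj z ⟶ 𝒳.p.obj y) (φ' : z ⟶ x), 𝒳.p.map φ' = g ≫ 𝒳.p.map φ →
        ∃! χ : z ⟶ y, 𝒳.p.map χ = g ∧ χ ≫ φ = φ' := by
  constructor
  · intro h z g φ' e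
    have : 𝒳.p.IsHomLift (g ≫ 𝒳.p.map φ) φ' := e ▸ Functor.IsHomLift.map φ'
    obtain ⟨χ, ⟨h₁, h₂⟩, hu⟩ := h.universal_property' g φ'
    refine ⟨χ, ⟨(IsHomLift.eq_of_isHomLift 𝒳.p g χ).symm, h₂⟩, fun χ' hχ' => hu χ' ⟨?_, hχ'.2⟩⟩
    rw [← hχ'.1]
    exact Functor.IsHomLift.map χ'
  · intro h
    refine { toIsHomLift := Functor.IsHomLift.map φ, universal_property' := ?_ }
    intro z g φ' hφ'
    obtain ⟨χ, ⟨h₁, h₂⟩, hu⟩ := h z g φ' (IsHomLift.eq_of_isHomLift 𝒳.p _ φ').symm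
    refine ⟨χ, ⟨h₁ ▸ Functor.IsHomLift.map χ, h₂⟩, fun χ' hχ' => hu χ' ⟨?_, hχ'.2⟩⟩
    have := hχ'.1
    exact (IsHomLift.eq_of_isHomLift 𝒳.p g χ').symm

/-- Lifts are pull-backs of bundles, and every morphism is cartesian because its square of total
spaces is a pull-back. -/
theorem isFibredInGroupoids_quotientStack (ρ : GroupAction G X) :
    IsFibredInGroupoids (quotientStack ρ) where
  exists_lift x T f :=
    ⟨PrincipalBundle.pull x f, PrincipalBundle.pullHom x f,
      Functor.IsHomLift.map (p := (quotientStack ρ).p) (PrincipalBundle.pullHom x f)⟩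
  cartesian {y x} φ := (isStronglyCartesian_iff φ).2 fun z g φ' e =>
    existsUnique_factor (P := y) (P' := z) (Q := x) φ φ' g (Eq.symm e)

/-- Morphisms of bundles glue. -/
theorem existsUnique_glue_hom (hX : Presieve.IsSheaf etaleC X) (P Q : PrincipalBundle ρ)
    (g : P.base ⟶ Q.base) (R : Sieve P.base) (hR : R ∈ etaleC P.base)
    (ψ : ∀ (z : PrincipalBundle ρ) (φ : z ⟶ P), R (bas φ) → (z ⟶ Q))
    (hψ : ∀ z φ hφ, bas (ψ z φ hφ) = bas φ ≫ g)
    (hc : ∀ (z z' : PrincipalBundle ρ) (χ : z' ⟶ z) (φ : z ⟶ P) (hφ : R (bas φ))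
      (hχ : R (bas (χ ≫ φ))), ψ z' (χ ≫ φ) hχ = χ ≫ ψ z φ hφ) :
    ∃! h : P ⟶ Q, bas h = g ∧ ∀ z φ hφ, φ ≫ h = ψ z φ hφ := by
  have hR' := pullback_mem_etaleC P.π hR
  -- The glued map at a point `k` of the total space can be read off from any object over the sieve
  -- through which `k` factors. All of these are compared with one of them, the pull-back of `P`
  -- along `k ≫ P.π` with its tautological section.
  have key : ∀ (W : SchC) (k : W ⟶ P.total) (z : PrincipalBundle ρ) (φ : z ⟶ P) (hφ : R (bas φ))
      (w : W ⟶ z.total) (hw : w ≫ tot φ = k) (z' : PrincipalBundle ρ) (φ' : z' ⟶ P)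
      (hφ' : R (bas φ')) (w' : W ⟶ z'.total) (hw' : w' ≫ tot φ' = k),
      w ≫ tot (ψ z φ hφ) = w' ≫ tot (ψ z' φ' hφ') := by
    intro W k
    have main : ∀ (z : PrincipalBundle ρ) (φ : z ⟶ P) (hφ : R (bas φ))
      (w : W ⟶ z.total) (hw : w ≫ tot φ = k) (hk : R (k ≫ P.π)),
      w ≫ tot (ψ z φ hφ) =
        (P.exists_pull_section k).choose ≫ tot (ψ _ (P.pullHom (k ≫ P.π)) hk) := by
      intro z φ hφ w hw hk
      -- As `φ` is cartesian, the pull-back of `P` maps to `z`; compatibility of `ψ` with this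
      -- morphism is the comparison sought.
      obtain ⟨χ, ⟨hχ₁, hχ₂⟩, -⟩ := existsUnique_factor φ (P.pullHom (k ≫ P.π)) (w ≫ z.π) (by
        rw [Category.assoc, ← tot_comp_π, ← Category.assoc, hw]; rfl)
      have hs := (P.exists_pull_section k).choose_spec
      set s := (P.exists_pull_section k).choose
      have e : w = s ≫ tot χ := by
        refine (existsUnique_lift φ (w ≫ z.π) k (by
          rw [Category.assoc, ← tot_comp_π, ← Category.assoc, hw])).unique ⟨rfl, hw⟩ ⟨?_, ?_⟩
        · rw [Category.assoc, tot_comp_π, ← Category.assoc, hs.1, Category.id_comp, hχ₁]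
        · rw [Category.assoc, ← tot_comp, hχ₂, hs.2]
      have := hc _ _ χ φ hφ (by rw [hχ₂]; exact hk)
      rw [e, Category.assoc, ← tot_comp, ← this]
      congr 3
    intro z φ hφ w hw z' φ' hφ' w' hw'
    have hk : R (k ≫ P.π) := by
      rw [← hw, Category.assoc, tot_comp_π, ← Category.assoc]
      exact R.downward_closed hφ _
    rw [main z φ hφ w hw hk, main z' φ' hφ' w' hw' hk]
  obtain ⟨t, ht, htu⟩ := sheaf_existsUnique (isSheaf_yoneda Q.total) hR'
    (fun W k (y : W ⟶ Q.total) => ∀ (W' : SchC) (l : W' ⟶ W) (z : PrincipalBundle ρ) (φ : z ⟶ P)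
      (hφ : R (bas φ)) (w : W' ⟶ z.total), w ≫ tot φ = l ≫ k → l ≫ y = w ≫ tot (ψ z φ hφ))
    (fun W W' l k y h W'' l' z φ hφ w hw => by
      rw [res_yoneda, ← Category.assoc]
      exact h W'' (l' ≫ l) z φ hφ w (by rw [hw, Category.assoc]))
    (fun W k hk => by
      obtain ⟨s, hs₁, hs₂⟩ := P.exists_pull_section k
      refine ⟨s ≫ tot (ψ _ (P.pullHom (k ≫ P.π)) hk), ?_, fun y hy => ?_⟩
      · intro W' l z φ hφ w hw
        rw [← Category.assoc]
        exact key W' (l ≫ k) _ _ _ _ (by rw [Category.assoc, hs₂]) _ _ _ _ hw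
      · have := hy W (𝟙 W) _ (P.pullHom (k ≫ P.π)) hk s (by rw [hs₂, Category.id_comp])
        simpa using this)
  have ht' : ∀ (W : SchC) (z : PrincipalBundle ρ) (φ : z ⟶ P) (hφ : R (bas φ)) (w : W ⟶ z.total),
      (w ≫ tot φ) ≫ t = w ≫ tot (ψ z φ hφ) := by
    intro W z φ hφ w
    have hk : R ((w ≫ tot φ) ≫ P.π) := by
      rw [Category.assoc, tot_comp_π, ← Category.assoc]
      exact R.downward_closed hφ _
    have := ht W (w ≫ tot φ) hk W (𝟙 W) z φ hφ w (by simp)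
    simpa using this
  have hcov : ∀ {T : SchC} (a : T ⟶ P.total), ∃ R'' ∈ etaleC T, ∀ (W : SchC) (k : W ⟶ T), R'' k →
      ∃ (z : PrincipalBundle ρ) (φ : z ⟶ P) (w : W ⟶ z.total), R (bas φ) ∧ w ≫ tot φ = k ≫ a := by
    intro T a
    refine ⟨_, pullback_mem_etaleC a hR', fun W k hk => ?_⟩
    obtain ⟨s, hs₁, hs₂⟩ := P.exists_pull_section (k ≫ a)
    exact ⟨_, P.pullHom _, s, hk, hs₂⟩
  obtain ⟨h, hh⟩ := exists_hom (P := P) (Q := Q) t (fun T g a => by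
    obtain ⟨R'', hR'', hz⟩ := hcov a
    refine sheaf_ext (isSheaf_yoneda _) hR'' fun W k hk => ?_
    obtain ⟨z, φ, w, hφ, hw⟩ := hz W k hk
    rw [res_yoneda, res_yoneda, ← Category.assoc, P.comp_smul, Q.comp_smul, ← Category.assoc, ← hw,
      ← smul_comp_tot, ht' W z φ hφ, ht' W z φ hφ, smul_comp_tot])
    (by
      obtain ⟨R'', hR'', hz⟩ := hcov (𝟙 P.total)
      refine sheaf_ext hX hR'' fun W k hk => ?_
      obtain ⟨z, φ, w, hφ, hw⟩ := hz W k hk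
      rw [Category.comp_id] at hw
      rw [res_res, ← hw, ht' W z φ hφ, ← res_res, ← res_res, res_tot_toX, res_tot_toX])
  have hhz : ∀ z φ hφ, φ ≫ h = ψ z φ hφ := fun z φ hφ => hom_ext (by
    have := ht' z.total z φ hφ (𝟙 _)
    rw [tot_comp, hh]
    simpa using this)
  refine ⟨h, ⟨?_, hhz⟩, fun h' hh' => hom_ext ?_⟩
  · refine sheaf_ext (isSheaf_yoneda _) hR fun W k hk => ?_
    exact (congrArg bas (hhz _ (P.pullHom k) hk)).trans (hψ _ (P.pullHom k) hk)
  · rw [hh]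
    refine htu _ fun W k hk W' l z φ hφ w hw => ?_
    rw [res_yoneda, ← Category.assoc, ← hw, Category.assoc, ← tot_comp, hh'.2 z φ hφ]

end QuiverStack

end

noncomputable section
namespace QuiverStack

universe w

open PrincipalBundle

variable {G : SchCᵒᵖ ⥤ GrpCat.{0}} {X : SchCᵒᵖ ⥤ Type}

/-! ## Special groups -/

/-- Torsors under the group `G` that are étale sheaves have sections Zariski-locally. -/
def HasZariskiSections (G : SchCᵒᵖ ⥤ GrpCat.{0}) : Prop :=
  ∀ (X : SchCᵒᵖ ⥤ Type) (ρ : GroupAction G X) (S : SchC) (t : Torsor.{w} ρ S),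
    Presieve.IsSheaf etaleC t.F → ∀ s : S.left, ∃ V : S.left.Opens, s ∈ V ∧
      ∃ x : t.F.obj (op (opn S V)), t.p _ x = opnι S V

/-- The group functor `G` is represented by the scheme `G₀`, with universal element `γ`. -/
def IsUnivElement (G : SchCᵒᵖ ⥤ GrpCat.{0}) {G₀ : SchC} (γ : G.obj (op G₀)) : Prop :=
  ∀ (T : SchC) (g : G.obj (op T)), ∃! f : T ⟶ G₀, gres G f γ = g

theorem IsUnivElement.isUniv {G₀ : SchC} {γ : G.obj (op G₀)} (h : IsUnivElement G γ) :
    IsUniv (G ⋙ forget GrpCat) (E := G₀) γ := h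

theorem IsUnivElement.isSheaf {G₀ : SchC} {γ : G.obj (op G₀)} (h : IsUnivElement G γ) :
    Presieve.IsSheaf etaleC (G ⋙ forget GrpCat) := h.isUniv.isSheaf

/-- A torsor under a representable group with Zariski-local sections is representable. -/
theorem Torsor.exists_isUniv {G₀ : SchC} {γ : G.obj (op G₀)} (hγ : IsUnivElement G γ)
    (hG : HasZariskiSections.{w} G) {ρ : GroupAction G X} {S : SchC} (t : Torsor.{w} ρ S)
    (ht : Presieve.IsSheaf etaleC t.F) : ∃ (E : SchC) (ξ : t.F.obj (op E)), IsUniv t.F ξ := by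
  refine exists_isUniv_of_local t.F ht t.p t.p_res fun s => ?_
  obtain ⟨V, hs, x, hx⟩ := hG X ρ S t ht s
  -- Over `V` the section `x` trivializes the torsor, so that the product of `V` with the group
  -- represents it; the universal section is the universal group element applied to `x`.
  let Y : SchC := opn S V ⨯ G₀
  let ξ : t.F.obj (op Y) := t.act Y (gres G prod.snd γ) (res t.F prod.fst x)
  have hξ : t.p Y ξ = prod.fst ≫ opnι S V := by rw [t.p_act, t.p_res, hx]
  refine ⟨V, hs, Y, ξ, ?_, fun T y hy => ?_⟩
  · rw [hξ, ← range_opnι]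
    exact range_comp_subset _ _
  · obtain ⟨c, hc⟩ := exists_opn_lift V (t.p T y) hy
    obtain ⟨g, hg, hgu⟩ := t.simplyTransitive T (res t.F c x) y (by rw [t.p_res, hx, hc])
    obtain ⟨f, hf, hfu⟩ := hγ T g
    refine ⟨prod.lift c f, ?_, fun k hk => ?_⟩
    · change res t.F (prod.lift c f) (t.act Y _ _) = y
      rw [t.res_act, gres_gres, res_res, prod.lift_fst, prod.lift_snd, hf, hg]
    · have hk : t.act T (gres G (k ≫ prod.snd) γ) (res t.F (k ≫ prod.fst) x) = y := by
        rw [← gres_gres, ← res_res, ← t.res_act]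
        exact hk
      have h₁ : k ≫ prod.fst = c := by
        rw [← cancel_mono (opnι S V), hc, ← hk, t.p_act, t.p_res, hx]
      rw [h₁] at hk
      apply prod.hom_ext
      · rw [h₁, prod.lift_fst]
      · rw [prod.lift_snd]
        exact hfu _ (hgu _ hk)

/-- A criterion for being a sheaf. -/
theorem isSheaf_of_glue {F : SchCᵒᵖ ⥤ Type w}
    (h : ∀ (T : SchC) (R : Sieve T), R ∈ etaleC T →
      ∀ y : (∀ (W : SchC) (k : W ⟶ T), R k → F.obj (op W)),
        (∀ (W W' : SchC) (l : W' ⟶ W) (k : W ⟶ T) (hk : R k) (hk' : R (l ≫ k)),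
          res F l (y W k hk) = y W' (l ≫ k) hk') →
        ∃! x : F.obj (op T), ∀ W k hk, res F k x = y W k hk) :
    Presieve.IsSheaf etaleC F := by
  intro T R hR y hy
  have hy' := (Presieve.compatible_iff_sieveCompatible y).1 hy
  obtain ⟨x, hx, hu⟩ := h T R hR (fun W k hk => y k hk)
    (fun W W' l k hk hk' => (hy' k l hk).symm)
  exact ⟨x, fun W k hk => hx W k hk, fun x' hx' => hu x' fun W k hk => hx' k hk⟩

/-! ## Descent of principal bundles -/

section Descent

variable {ρ : GroupAction G X} {S : SchC} {R : Sieve S}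

/-- An object of the category of members of a sieve. -/
abbrev member {T : SchC} (f : T ⟶ S) (hf : R f) : R.arrows.category := ⟨Over.mk f, hf⟩

/-- A morphism of the category of members of a sieve. -/
abbrev memberHom {c c' : R.arrows.category} (l : c'.obj.left ⟶ c.obj.left)
    (h : l ≫ c.obj.hom = c'.obj.hom) : c' ⟶ c := ObjectProperty.homMk (Over.homMk l h)

theorem member_hom_ext {c c' : R.arrows.category} {u u' : c ⟶ c'}
    (h : u.hom.left = u'.hom.left) : u = u' := by
  ext1
  ext1
  exact h

theorem member_w {c c' : R.arrows.category} (u : c ⟶ c') :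
    u.hom.left ≫ c'.obj.hom = c.obj.hom := Over.w u.hom

variable (R) in
/-- A descent datum of principal bundles along a sieve. -/
structure DescentDatum (ρ : GroupAction G X) where
  σ : R.arrows.category ⥤ PrincipalBundle ρ
  θ : ∀ c, (σ.obj c).base ≅ c.obj.left
  natural : ∀ {c c' : R.arrows.category} (u : c ⟶ c'),
    bas (σ.map u) ≫ (θ c').hom = (θ c).hom ≫ u.hom.left

variable (D : DescentDatum R ρ)

namespace DescentDatum

theorem inv_bas {c c' : R.arrows.category} (u : c ⟶ c') :
    (D.θ c).inv ≫ bas (D.σ.map u) = u.hom.left ≫ (D.θ c').inv := by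
  rw [Iso.inv_comp_eq, ← Category.assoc, ← D.natural, Category.assoc, Iso.hom_inv_id,
    Category.comp_id]

/-- A section over `T` of the descended bundle: a morphism to the base and a compatible family of
sections of the given bundles. -/
structure Sec (T : SchC) : Type 1 where
  h : T ⟶ S
  s : ∀ (c : R.arrows.category) (k : c.obj.left ⟶ T), k ≫ h = c.obj.hom →
    (c.obj.left ⟶ (D.σ.obj c).total)
  s_π : ∀ c k hk, s c k hk ≫ (D.σ.obj c).π = (D.θ c).inv
  s_map : ∀ (c c' : R.arrows.category) (u : c' ⟶ c) (k : c.obj.left ⟶ T) (hk : k ≫ h = c.obj.hom)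
    (k' : c'.obj.left ⟶ T) (hk' : k' ≫ h = c'.obj.hom), k' = u.hom.left ≫ k →
    s c' k' hk' ≫ tot (D.σ.map u) = u.hom.left ≫ s c k hk

variable {D}

theorem Sec.ext' {T : SchC} {x y : D.Sec T} (h : x.h = y.h)
    (hs : ∀ c k hx hy, x.s c k hx = y.s c k hy) : x = y := by
  obtain ⟨xh, xs, _, _⟩ := x
  obtain ⟨yh, ys, _, _⟩ := y
  obtain rfl : xh = yh := h
  congr
  funext c k hk
  exact hs c k hk hk

/-- Two sections of one of the given bundles agree if they agree after transition. -/
theorem sec_ext {c c' : R.arrows.category} (u : c' ⟶ c) {W : SchC}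
    {a b : W ⟶ (D.σ.obj c').total} (h₁ : a ≫ (D.σ.obj c').π = b ≫ (D.σ.obj c').π)
    (h₂ : a ≫ tot (D.σ.map u) = b ≫ tot (D.σ.map u)) : a = b :=
  (existsUnique_lift (D.σ.map u) (b ≫ (D.σ.obj c').π) (b ≫ tot (D.σ.map u)) (by
    rw [Category.assoc, Category.assoc, tot_comp_π])).unique ⟨h₁, h₂⟩ ⟨rfl, rfl⟩

/-- Restriction of sections of the descended bundle. -/
def Sec.res {T T' : SchC} (f : T' ⟶ T) (x : D.Sec T) : D.Sec T' where
  h := f ≫ x.h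
  s c k hk := x.s c (k ≫ f) (by rw [Category.assoc, hk])
  s_π c k hk := x.s_π _ _ _
  s_map c c' u k hk k' hk' e := x.s_map _ _ _ _ _ _ _ (by rw [e, Category.assoc])

variable (D) in
/-- The presheaf of sections of the descended bundle. -/
def presheaf : SchCᵒᵖ ⥤ Type 1 where
  obj T := D.Sec T.unop
  map f := TypeCat.ofHom fun x => x.res f.unop
  map_id T := ConcreteCategory.hom_ext _ _ fun x =>
    Sec.ext' (Category.id_comp _) fun c k _ _ => by
      change x.s c (k ≫ 𝟙 _) _ = x.s c k _
      congr 1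
  map_comp f g := ConcreteCategory.hom_ext _ _ fun x =>
    Sec.ext' (Category.assoc _ _ _) fun c k _ _ => by
      change x.s c (k ≫ g.unop ≫ f.unop) _ = x.s c ((k ≫ g.unop) ≫ f.unop) _
      congr 1

theorem Sec.s_congr {T : SchC} {x y : D.Sec T} (e : x = y) (c : R.arrows.category)
    {k k' : c.obj.left ⟶ T} (ek : k = k') (hk : k ≫ x.h = c.obj.hom)
    (hk' : k' ≫ y.h = c.obj.hom) : x.s c k hk = y.s c k' hk' := by
  subst e ek
  rfl

/-- The action of the group on the sections of the descended bundle. -/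
def Sec.smul {T : SchC} (g : G.obj (op T)) (x : D.Sec T) : D.Sec T where
  h := x.h
  s c k hk := (D.σ.obj c).smul (gres G k g) (x.s c k hk)
  s_π c k hk := by rw [smul_π, x.s_π]
  s_map c c' u k hk k' hk' e := by
    rw [smul_comp_tot, x.s_map c c' u k hk k' hk' e, comp_smul, gres_gres, e]

/-- The section of the descended bundle that comes from a section of one of the given bundles. -/
theorem exists_sec (c : R.arrows.category) {W : SchC} (a : W ⟶ (D.σ.obj c).total) :
    ∃ x : D.Sec W, x.h = a ≫ (D.σ.obj c).π ≫ (D.θ c).hom ≫ c.obj.hom ∧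
      ∀ (c' : R.arrows.category) (u : c' ⟶ c) (k : c'.obj.left ⟶ W) (hk : k ≫ x.h = c'.obj.hom),
        u.hom.left = k ≫ a ≫ (D.σ.obj c).π ≫ (D.θ c).hom →
        x.s c' k hk ≫ tot (D.σ.map u) = k ≫ a := by
  let u : ∀ (c' : R.arrows.category) (k : c'.obj.left ⟶ W),
      k ≫ a ≫ (D.σ.obj c).π ≫ (D.θ c).hom ≫ c.obj.hom = c'.obj.hom → (c' ⟶ c) :=
    fun c' k hk => memberHom (k ≫ a ≫ (D.σ.obj c).π ≫ (D.θ c).hom) (by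
      simpa only [Category.assoc] using hk)
  have hl : ∀ c' k hk, ∃! d : c'.obj.left ⟶ (D.σ.obj c').total,
      d ≫ (D.σ.obj c').π = (D.θ c').inv ∧ d ≫ tot (D.σ.map (u c' k hk)) = k ≫ a :=
    fun c' k hk => existsUnique_lift _ _ _ (by
      rw [D.inv_bas]
      simp [u])
  refine ⟨⟨a ≫ (D.σ.obj c).π ≫ (D.θ c).hom ≫ c.obj.hom, fun c' k hk => (hl c' k hk).choose,
    fun c' k hk => (hl c' k hk).choose_spec.1.1, fun c₁ c' v k hk k' hk' e => ?_⟩, rfl,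
    fun c' v k hk hv => ?_⟩
  · apply sec_ext (u c₁ k hk)
    · rw [Category.assoc, tot_comp_π, ← Category.assoc, (hl c' k' hk').choose_spec.1.1, D.inv_bas,
        Category.assoc, (hl c₁ k hk).choose_spec.1.1]
    · have : v ≫ u c₁ k hk = u c' k' hk' := member_hom_ext (by
        change v.hom.left ≫ k ≫ a ≫ _ = k' ≫ a ≫ _
        rw [e, Category.assoc])
      rw [Category.assoc, ← tot_comp, ← D.σ.map_comp, this, (hl c' k' hk').choose_spec.1.2,
        Category.assoc, (hl c₁ k hk).choose_spec.1.2, e, Category.assoc]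
  · have : v = u c' k hk := member_hom_ext hv
    rw [this]
    exact (hl c' k hk).choose_spec.1.2

/-- For `k` in the pulled-back sieve, `k ≫ x.h` is itself a member of `R`; there both sections are
points of one given bundle in the same fibre and differ by a unique group element. These elements
glue since `G` is a sheaf. -/
theorem existsUnique_smul (hG : Presieve.IsSheaf etaleC (G ⋙ forget GrpCat)) (hR : R ∈ etaleC S)
    {T : SchC} (x y : D.Sec T) (hxy : x.h = y.h) : ∃! g : G.obj (op T), x.smul g = y := by
  obtain ⟨g, hg, hu⟩ := sheaf_existsUnique hG (pullback_mem_etaleC x.h hR)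
    (fun W k (g : G.obj (op W)) => ∀ (c : R.arrows.category) (l : c.obj.left ⟶ W)
      (hx : (l ≫ k) ≫ x.h = c.obj.hom) (hy : (l ≫ k) ≫ y.h = c.obj.hom),
      (D.σ.obj c).smul (gres G l g) (x.s c (l ≫ k) hx) = y.s c (l ≫ k) hy)
    (fun W W' l k g h c l' hx hy => by
      have := h c (l' ≫ l) (by rw [← hx]; simp) (by rw [← hy]; simp)
      change (D.σ.obj c).smul (gres G l' (gres G l g)) _ = _
      rw [gres_gres]
      simpa only [Category.assoc] using this)
    (fun W k hk => by
      let c₀ : R.arrows.category := member (k ≫ x.h) hk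
      obtain ⟨g, hg, hgu⟩ := (D.σ.obj c₀).existsUnique_smul_eq (a := x.s c₀ k rfl)
        (b := y.s c₀ k (show k ≫ y.h = k ≫ x.h by rw [hxy])) (by rw [x.s_π, y.s_π])
      refine ⟨g, fun c l hx hy => ?_, fun g' hg' => hgu g' ?_⟩
      · let u : c ⟶ c₀ := memberHom l ((Category.assoc _ _ _).symm.trans hx)
        apply sec_ext u
        · rw [smul_π, x.s_π, y.s_π]
        · rw [smul_comp_tot, x.s_map c₀ c u k rfl (l ≫ k) hx rfl,
            y.s_map c₀ c u k (show k ≫ y.h = k ≫ x.h by rw [hxy]) (l ≫ k) hy rfl, ← hg, comp_smul]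
          rfl
      · have := hg' c₀ (𝟙 W) (by simp [c₀]) (by rw [← hxy]; simp [c₀])
        rw [gres_id] at this
        refine Eq.trans ?_ (this.trans (Sec.s_congr rfl c₀ (Category.id_comp _) _ _))
        exact congrArg _ (Sec.s_congr rfl c₀ (Category.id_comp _).symm _ _))
  have hg' : x.smul g = y := Sec.ext' hxy fun c k hx hy => by
    have hk : R (k ≫ x.h) := by
      have := c.property
      rw [← show k ≫ x.h = c.obj.hom from hx] at this
      exact this
    have hx' : (𝟙 _ ≫ k) ≫ x.h = c.obj.hom := by rw [Category.id_comp]; exact hx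
    have := hg _ k hk c (𝟙 _) hx' (by rw [Category.id_comp]; exact hy)
    rw [gres_id] at this
    refine Eq.trans ?_ (this.trans (Sec.s_congr rfl c (Category.id_comp _) _ _))
    exact congrArg ((D.σ.obj c).smul (gres G k g)) (Sec.s_congr rfl c (Category.id_comp _).symm _ _)
  refine ⟨g, hg', fun g' h' => hu g' fun W k hk c l hx hy => ?_⟩
  change (D.σ.obj c).smul (gres G l (gres G k g')) _ = _
  rw [gres_gres]
  exact (Sec.s_congr h' c rfl hx hy)

/-- The transition maps of the datum are morphisms over `X`, so the values computed in the given
bundles agree and glue. -/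
theorem existsUnique_toX (hX : Presieve.IsSheaf etaleC X) (hR : R ∈ etaleC S) {T : SchC}
    (x : D.Sec T) : ∃! y : X.obj (op T), ∀ c k hk,
      QuiverStack.res X k y = QuiverStack.res X (x.s c k hk) (D.σ.obj c).toX := by
  obtain ⟨y, hy, hu⟩ := sheaf_existsUnique hX (pullback_mem_etaleC x.h hR)
    (fun W k y => ∀ (c : R.arrows.category) (l : c.obj.left ⟶ W)
      (hx : (l ≫ k) ≫ x.h = c.obj.hom),
      QuiverStack.res X l y = QuiverStack.res X (x.s c (l ≫ k) hx) (D.σ.obj c).toX)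
    (fun W W' l k y h c l' hx => by
      rw [res_res, h c (l' ≫ l) (by rw [← hx]; simp)]
      exact congrArg (fun z => QuiverStack.res X z _) (Sec.s_congr rfl c (Category.assoc _ _ _) _ _))
    (fun W k hk => by
      let c₀ : R.arrows.category := member (k ≫ x.h) hk
      refine ⟨QuiverStack.res X (x.s c₀ k rfl) (D.σ.obj c₀).toX, fun c l hx => ?_, fun y hy => ?_⟩
      · let u : c ⟶ c₀ := memberHom l ((Category.assoc _ _ _).symm.trans hx)
        rw [res_res, ← show _ = l ≫ x.s c₀ k rfl from x.s_map c₀ c u k rfl (l ≫ k) hx rfl,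
          ← res_res, res_tot_toX]
      · have := hy c₀ (𝟙 W) (by simp [c₀])
        rw [res_id] at this
        rw [this]
        exact congrArg (fun z => QuiverStack.res X z _)
          (Sec.s_congr rfl c₀ (Category.id_comp _) _ _))
  refine ⟨y, fun c k hx => ?_, fun y' hy' => hu y' fun W k hk c l hx => ?_⟩
  · have hk : R (k ≫ x.h) := by
      rw [hx]; exact c.property
    have := hy _ k hk c (𝟙 _) (by simpa using hx)
    rw [res_id] at this
    rw [this]
    exact congrArg (fun z => QuiverStack.res X z _) (Sec.s_congr rfl c (Category.id_comp _) _ _)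
  · rw [res_res]
    exact hy' c _ hx

/-- A section consists of morphisms to schemes (the base and the given total spaces), and these
glue. The difficulty is only that the components of the local sections are indexed by members of `R`
with smaller sources. -/
theorem Sec.existsUnique_glue {T : SchC} {R' : Sieve T} (hR' : R' ∈ etaleC T)
    (y : ∀ (W : SchC) (k : W ⟶ T), R' k → D.Sec W)
    (hy : ∀ (W W' : SchC) (l : W' ⟶ W) (k : W ⟶ T) (hk : R' k) (k' : W' ⟶ T) (hk' : R' k'),
      k' = l ≫ k → Sec.res l (y W k hk) = y W' k' hk') :
    ∃! x : D.Sec T, ∀ W k hk, Sec.res k x = y W k hk := by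
  obtain ⟨h, hh, hhu⟩ := sheaf_glue (isSheaf_yoneda S) hR' (fun W k hk => (y W k hk).h)
    (fun W W' l k hk hk' => congrArg Sec.h (hy W W' l k hk _ hk' rfl))
  replace hh : ∀ W k hk, k ≫ h = (y W k hk).h := hh
  -- The local section on W has components in the bundles at members c' lying over `c`, not at `c`
  -- itself; the comparison with a point of the bundle at `c` is made after transition along `u`.
  let Φ : ∀ (c : R.arrows.category) (_ : c.obj.left ⟶ T) (W : SchC) (_ : W ⟶ c.obj.left)
      (_ : W ⟶ (D.σ.obj c).total), Prop := fun c k W m s =>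
    ∃ hm : R' (m ≫ k), ∀ (c' : R.arrows.category) (u : c' ⟶ c) (l : c'.obj.left ⟶ W)
      (_ : l ≫ m = u.hom.left) (hs : l ≫ (y W (m ≫ k) hm).h = c'.obj.hom),
      l ≫ s = (y W (m ≫ k) hm).s c' l hs ≫ tot (D.σ.map u)
  -- Among the members over `c` there is one with source `W` itself, namely `m` followed by `c`. The
  -- mutually inverse maps `l` and `l'` are identities, but keep the two descriptions of its source
  -- apart.
  have hloc : ∀ (c : R.arrows.category) (k : c.obj.left ⟶ T) (hk : k ≫ h = c.obj.hom)
      (W : SchC) (m : W ⟶ c.obj.left) (hm : R' (m ≫ k)), ∃ (c₀ : R.arrows.category) (u₀ : c₀ ⟶ c)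
      (l : c₀.obj.left ⟶ W) (l' : W ⟶ c₀.obj.left), l' ≫ l = 𝟙 W ∧ l ≫ l' = 𝟙 _ ∧
        l ≫ m = u₀.hom.left ∧ l ≫ (y W (m ≫ k) hm).h = c₀.obj.hom := by
    intro c k hk W m hm
    refine ⟨member (m ≫ c.obj.hom) (R.downward_closed c.property m), memberHom m rfl, 𝟙 W, 𝟙 W,
      Category.id_comp _, Category.id_comp _, Category.id_comp _, ?_⟩
    rw [← hh, Category.assoc, hk]
    exact Category.id_comp _
  have key : ∀ (c : R.arrows.category) (k : c.obj.left ⟶ T), k ≫ h = c.obj.hom →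
      ∃! s : c.obj.left ⟶ (D.σ.obj c).total, ∀ (W : SchC) (m : W ⟶ c.obj.left), R' (m ≫ k) →
        Φ c k W m (m ≫ s) := by
    intro c k hk
    refine sheaf_existsUnique (isSheaf_yoneda (D.σ.obj c).total) (pullback_mem_etaleC k hR')
      (Φ c k) ?_ ?_
    · rintro W W' l₀ m s ⟨hm, hs⟩
      have hm' : R' ((l₀ ≫ m) ≫ k) := by
        rw [Category.assoc]; exact R'.downward_closed hm _
      refine ⟨hm', fun c' u l e hl => ?_⟩
      have e₁ := hy W W' l₀ (m ≫ k) hm _ hm' (Category.assoc _ _ _)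
      have hl' : (l ≫ l₀) ≫ (y W (m ≫ k) hm).h = c'.obj.hom := by
        rw [← hl, ← e₁, Category.assoc]; rfl
      have := hs c' u (l ≫ l₀) (by rw [← e, Category.assoc]) hl'
      rw [res_yoneda, ← Category.assoc, this]
      exact congrArg (· ≫ _) (Sec.s_congr e₁ c' rfl hl' hl)
    · intro W m hm
      obtain ⟨c₀, u₀, l₀, l₀', h₁, h₂, h₃, h₄⟩ := hloc c k hk W m hm
      refine ⟨l₀' ≫ (y W (m ≫ k) hm).s c₀ l₀ h₄ ≫ tot (D.σ.map u₀), ⟨hm, fun c' u l e hl => ?_⟩,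
        fun s' hs' => ?_⟩
      · let v : c' ⟶ c₀ := memberHom (l ≫ l₀') (by
          rw [← h₄, Category.assoc, ← Category.assoc l₀', h₁, Category.id_comp, hl])
        have hv : v ≫ u₀ = u := member_hom_ext (by
          change (l ≫ l₀') ≫ u₀.hom.left = _
          rw [← h₃, Category.assoc, ← Category.assoc l₀', h₁, Category.id_comp, e])
        rw [← hv, D.σ.map_comp, tot_comp, ← Category.assoc (Sec.s _ _ _ _),
          (y W (m ≫ k) hm).s_map c₀ c' v l₀ h₄ l hl (by
            change l = (l ≫ l₀') ≫ l₀
            rw [Category.assoc, h₁, Category.comp_id])]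
        change _ = ((l ≫ l₀') ≫ _) ≫ _
        simp only [Category.assoc]
      · obtain ⟨_, hs'⟩ := hs'
        rw [← hs' c₀ u₀ l₀ h₃ h₄, ← Category.assoc, h₁, Category.id_comp]
  choose s hs hsu using key
  have hs_loc : ∀ (c : R.arrows.category) (k : c.obj.left ⟶ T) (hk : k ≫ h = c.obj.hom)
      {U : SchC} {a b : c.obj.left ⟶ U}, (∀ (W : SchC) (m : W ⟶ c.obj.left), R' (m ≫ k) →
        m ≫ a = m ≫ b) → a = b := fun c k hk U a b hab =>
    sheaf_ext (isSheaf_yoneda U) (pullback_mem_etaleC k hR') hab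
  let x : D.Sec T :=
    { h := h
      s := s
      s_π := fun c k hk => hs_loc c k hk fun W m hm => by
        obtain ⟨c₀, u₀, l₀, l₀', h₁, h₂, h₃, h₄⟩ := hloc c k hk W m hm
        obtain ⟨_, h₅⟩ := hs c k hk W m hm
        have h₆ := congrArg (fun z => l₀' ≫ z) (h₅ c₀ u₀ l₀ h₃ h₄)
        simp only [← Category.assoc l₀', h₁, Category.id_comp] at h₆
        rw [← Category.assoc, h₆]
        simp only [Category.assoc]
        rw [tot_comp_π, ← Category.assoc (Sec.s _ _ _ _), Sec.s_π, D.inv_bas, ← h₃]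
        simp only [Category.assoc]
        rw [← Category.assoc l₀', h₁, Category.id_comp]
      s_map := fun c c' u k hk k' hk' e => hs_loc c' k' hk' fun W m hm => by
        obtain ⟨c₀, u₀, l₀, l₀', h₁, h₂, h₃, h₄⟩ := hloc c' k' hk' W m hm
        obtain ⟨_, h₅⟩ := hs c' k' hk' W m hm
        obtain ⟨hm', h₆⟩ := hs c k hk W (m ≫ u.hom.left) (by
          rw [Category.assoc, ← e]; exact hm)
        have e₁ : y W (m ≫ k') hm = y W ((m ≫ u.hom.left) ≫ k) hm' := by
          have : m ≫ k' = (m ≫ u.hom.left) ≫ k := by rw [Category.assoc, e]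
          simp only [this]
        have h₇ := h₅ c₀ u₀ l₀ h₃ h₄
        have h₈ := h₆ c₀ (u₀ ≫ u) l₀ (by
          rw [← Category.assoc, h₃]; rfl) (by rw [← e₁]; exact h₄)
        rw [D.σ.map_comp, tot_comp, ← Category.assoc (Sec.s _ _ _ _),
          ← Sec.s_congr e₁ c₀ rfl h₄ _, ← h₇] at h₈
        have h₉ := congrArg (fun z => l₀' ≫ z) h₈
        simp only [Category.assoc] at h₉
        simp only [← Category.assoc l₀', h₁, Category.id_comp] at h₉
        exact h₉.symm }
  refine ⟨x, fun W k hk => ?_, fun x' hx' => ?_⟩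
  · refine Sec.ext' (x := Sec.res k x) (hh W k hk) fun c l hl hl' => ?_
    have hl₁ : (l ≫ k) ≫ h = c.obj.hom := by rw [← hl, Category.assoc]; rfl
    have hm₀ : R' (𝟙 c.obj.left ≫ l ≫ k) := by
      rw [Category.id_comp]; exact R'.downward_closed hk l
    obtain ⟨hm, h₁⟩ := hs c (l ≫ k) hl₁ _ (𝟙 _) hm₀
    have e₁ := hy W _ l k hk _ hm (Category.id_comp _)
    have h₂ : 𝟙 _ ≫ (y _ (𝟙 _ ≫ l ≫ k) hm).h = c.obj.hom := by
      rw [← e₁, Category.id_comp]; exact hl'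
    have h₃ := h₁ c (𝟙 c) (𝟙 _) (Category.comp_id _) h₂
    rw [D.σ.map_id, tot_id, Category.comp_id, Category.id_comp, Category.id_comp] at h₃
    refine (show (Sec.res k x).s c l hl = _ from h₃).trans ?_
    have := Sec.s_congr e₁ c (k := 𝟙 _) rfl (by rw [Category.id_comp]; exact hl') h₂
    rw [← this]
    change (y W k hk).s c (𝟙 _ ≫ l) _ = _
    exact Sec.s_congr rfl c (Category.id_comp _) _ _
  · have e : x'.h = h := hhu _ fun W k hk => congrArg Sec.h (hx' W k hk)
    refine Sec.ext' e fun c k hk hk' => hsu c k hk' _ fun W m hm => ⟨hm, fun c' u l el hl => ?_⟩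
    have e₁ := hx' W (m ≫ k) hm
    have hl' : l ≫ (Sec.res (m ≫ k) x').h = c'.obj.hom := by
      rw [← hl, ← e₁]
    rw [← Sec.s_congr e₁ c' rfl hl' hl, ← Category.assoc, el]
    refine (x'.s_map c c' u k hk _ _ ?_).symm
    exact (Category.assoc _ _ _).symm.trans (congrArg (· ≫ k) el)

theorem isSheaf_presheaf : Presieve.IsSheaf etaleC D.presheaf :=
  isSheaf_of_glue fun T R' hR' y hy => Sec.existsUnique_glue (D := D) hR' y
    (by rintro W W' l k hk _ hk' rfl; exact hy W W' l k hk hk')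

/-- The descended bundle, as a torsor. -/
def torsor (hG : Presieve.IsSheaf etaleC (G ⋙ forget GrpCat)) (hX : Presieve.IsSheaf etaleC X)
    (hR : R ∈ etaleC S) (D : DescentDatum R ρ) : Torsor.{1} ρ S where
  F := D.presheaf
  p T x := Sec.h x
  p_res T T' f x := rfl
  act T g x := Sec.smul g x
  one_act T x := Sec.ext' (x := Sec.smul 1 x) (y := x) rfl fun c k _ _ => by
    change (D.σ.obj c).smul (gres G k 1) _ = _
    rw [gres_one, PrincipalBundle.one_smul]
  mul_act T g g' x := Sec.ext' (x := Sec.smul (g * g') x) (y := Sec.smul g (Sec.smul g' x)) rfl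
    fun c k _ _ => by
    change (D.σ.obj c).smul (gres G k (g * g')) _ = (D.σ.obj c).smul _ ((D.σ.obj c).smul _ _)
    rw [gres_mul, PrincipalBundle.mul_smul]
  res_act T T' f g x := Sec.ext' (x := Sec.res f (Sec.smul g x))
    (y := Sec.smul (gres G f g) (Sec.res f x)) rfl fun c k _ _ => by
    change (D.σ.obj c).smul (gres G (k ≫ f) g) _ = (D.σ.obj c).smul (gres G k (gres G f g)) _
    rw [gres_gres]
    rfl
  p_act T g x := rfl
  simplyTransitive T x y h := existsUnique_smul hG hR x y h
  locallyTrivial := by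
    let R₁ : Sieve S :=
      { arrows := fun T f => ∃ x : D.Sec T, x.h = f
        downward_closed := by
          rintro T T' f ⟨x, rfl⟩ g
          exact ⟨Sec.res g x, rfl⟩ }
    -- Sections exist in two steps: first pass to a member of `R`, then refine it so that the given
    -- bundle over it has a section.
    refine ⟨R₁, etaleC.transitive hR _ fun T f hf => ?_, fun T f hf => hf⟩
    let c : R.arrows.category := member f hf
    refine etaleC.superset_covering (fun W k hk => ?_)
      (pullback_mem_etaleC (D.θ c).inv (D.σ.obj c).locallyTrivial)
    obtain ⟨a, ha⟩ := (D.σ.obj c).exists_comp_π hk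
    obtain ⟨x, hx, -⟩ := exists_sec (D := D) c a
    refine ⟨x, hx.trans ?_⟩
    rw [← Category.assoc, ha, Category.assoc, Iso.inv_hom_id_assoc]
    rfl
  toX T x := (existsUnique_toX hX hR x).choose
  toX_res T T' f x := by
    refine ((existsUnique_toX hX hR (Sec.res f x)).choose_spec.2 _ fun c k hk => ?_).symm
    have := (existsUnique_toX hX hR x).choose_spec.1 c (k ≫ f) (by rw [← hk, Category.assoc]; rfl)
    rw [res_res]
    exact this
  toX_act T g x := by
    refine ((existsUnique_toX hX hR (Sec.smul g x)).choose_spec.2 _ fun c k hk => ?_).symm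
    have := (existsUnique_toX hX hR x).choose_spec.1 c k hk
    rw [ρ.res_act, this]
    exact ((D.σ.obj c).res_smul_toX _ _).symm

/-- Each total space of the datum carries a tautological section of the descended bundle, the one
obtained from its identity. The morphism to `P` that classifies this section is a morphism of
bundles, and these morphisms form the cocone exhibiting effectivity. -/
theorem exists_cocone (hX : Presieve.IsSheaf etaleC X) (hR : R ∈ etaleC S)
    (D : DescentDatum R ρ) (P : PrincipalBundle ρ) (e : P.base ≅ S) (ξ : D.Sec P.total)
    (hξ : ∀ (T : SchC) (x : D.Sec T), ∃! f : T ⟶ P.total, Sec.res f ξ = x)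
    (hsmul : ∀ (T : SchC) (g : G.obj (op T)) (a : T ⟶ P.total),
      Sec.res (P.smul g a) ξ = Sec.smul g (Sec.res a ξ))
    (hπ : P.π ≫ e.hom = ξ.h)
    (htoX : ∀ c k hk, QuiverStack.res X k P.toX = QuiverStack.res X (ξ.s c k hk) (D.σ.obj c).toX) :
    ∃ c : D.σ ⟶ (Functor.const _).obj P,
      ∀ f, bas (c.app f) ≫ e.hom = (D.θ f).hom ≫ f.obj.hom := by
  have hex := fun c => exists_sec (D := D) c (𝟙 (D.σ.obj c).total)
  choose x hxh hxs using hex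
  have hxh' : ∀ c, (x c).h = (D.σ.obj c).π ≫ (D.θ c).hom ≫ c.obj.hom := fun c => by
    rw [hxh, Category.id_comp]
  have hxs' : ∀ (c c' : R.arrows.category) (k : c'.obj.left ⟶ (D.σ.obj c).total)
      (_ : k ≫ (x c).h = c'.obj.hom), ∃ u : c' ⟶ c,
        u.hom.left = k ≫ (D.σ.obj c).π ≫ (D.θ c).hom ∧
        ∀ hk, (x c).s c' k hk ≫ tot (D.σ.map u) = k := by
    intro c c' k hk
    refine ⟨memberHom (k ≫ (D.σ.obj c).π ≫ (D.θ c).hom) ?_, rfl, fun hk => ?_⟩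
    · rw [← hk, hxh']
      simp only [Category.assoc]
    · refine (hxs c c' _ k hk ?_).trans (Category.comp_id _)
      rw [Category.id_comp]
      rfl
  choose t ht using fun c => (hξ _ (x c)).exists
  have hhom : ∀ c, ∃ φ : D.σ.obj c ⟶ P, tot φ = t c := by
    intro c
    apply exists_hom
    -- Morphisms to `P.total` are determined by the section they classify, so equivariance becomes
    -- an equality of sections, which is tested component by component after transition to the
    -- bundle at `c`.
    · intro T g a
      apply (hξ _ _).unique (y₁ := _ ≫ _) rfl
      refine (hsmul _ _ _).trans ?_
      have e₁ : Sec.res (a ≫ t c) ξ = Sec.res a (x c) := by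
        rw [← ht]; exact (congrArg (fun f => f) (res_res D.presheaf (t c) a ξ).symm)
      have e₂ : Sec.res ((D.σ.obj c).smul g a ≫ t c) ξ = Sec.res ((D.σ.obj c).smul g a) (x c) := by
        rw [← ht]; exact (congrArg (fun f => f) (res_res D.presheaf (t c) _ ξ).symm)
      rw [e₁, e₂]
      refine Sec.ext' ?_ fun c' k hk hk' => ?_
      · change a ≫ (x c).h = _ ≫ (x c).h
        rw [hxh', ← Category.assoc _ (D.σ.obj c).π, ← Category.assoc _ (D.σ.obj c).π, smul_π]
      · have hk₁ : (k ≫ a) ≫ (x c).h = c'.obj.hom := by rw [← hk, Category.assoc]; rfl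
        have hk₂ : (k ≫ (D.σ.obj c).smul g a) ≫ (x c).h = c'.obj.hom := by
          rw [← hk', Category.assoc]; rfl
        obtain ⟨u, hu, hu'⟩ := hxs' c c' (k ≫ a) hk₁
        obtain ⟨u₂, hu₂, hu₂'⟩ := hxs' c c' (k ≫ (D.σ.obj c).smul g a) hk₂
        have : u₂ = u := member_hom_ext (by
          rw [hu, hu₂, Category.assoc, ← Category.assoc ((D.σ.obj c).smul g a), smul_π]
          simp only [Category.assoc])
        subst this
        apply sec_ext u₂
        · exact (Sec.s_π _ _ _ _).trans (Sec.s_π _ _ _ _).symm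
        · refine Eq.trans ?_ (hu₂' hk₂).symm
          change (D.σ.obj c').smul (gres G k g) ((x c).s c' (k ≫ a) hk₁) ≫ _ = _
          rw [smul_comp_tot, hu' hk₁, comp_smul]
    · have hu := existsUnique_toX hX hR (x c)
      refine hu.unique (fun c' k hk => ?_) fun c' k hk => ?_
      · have hk' : (k ≫ t c) ≫ ξ.h = c'.obj.hom := by
          rw [← hk, ← ht, Category.assoc]; rfl
        rw [res_res, htoX c' (k ≫ t c) hk']
        refine congrArg (fun z => QuiverStack.res X z _) ?_
        exact Sec.s_congr (x := Sec.res (t c) ξ) (ht c) c' rfl hk' hk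
      · obtain ⟨u, hu, hu'⟩ := hxs' c c' k hk
        nth_rw 1 [← hu' hk]
        rw [← res_res, res_tot_toX]
  choose φ hφ using hhom
  refine ⟨{ app := φ, naturality := fun c' c v => ?_ }, fun c => ?_⟩
  · refine Eq.trans ?_ (Category.comp_id _).symm
    apply hom_ext
    rw [tot_comp, hφ, hφ]
    apply (hξ _ _).unique (y₁ := _ ≫ _) rfl
    have e₂ : Sec.res (tot (D.σ.map v) ≫ t c) ξ = Sec.res (tot (D.σ.map v)) (x c) := by
      rw [← ht]; exact (congrArg (fun f => f) (res_res D.presheaf (t c) _ ξ).symm)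
    rw [ht, e₂]
    refine Sec.ext' ?_ fun c'' k hk hk' => ?_
    · change _ = _ ≫ (x c).h
      rw [hxh', hxh', ← Category.assoc (tot _), tot_comp_π, Category.assoc,
        ← Category.assoc (bas _), D.natural, Category.assoc, member_w]
    · have hk₂ : (k ≫ tot (D.σ.map v)) ≫ (x c).h = c''.obj.hom := by
        rw [← hk', Category.assoc]; rfl
      obtain ⟨u, hu, hu'⟩ := hxs' c' c'' k hk
      obtain ⟨u₂, hu₂, hu₂'⟩ := hxs' c c'' _ hk₂
      have : u₂ = u ≫ v := member_hom_ext (by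
        change _ = u.hom.left ≫ v.hom.left
        rw [hu, hu₂, Category.assoc, ← Category.assoc (tot _), tot_comp_π]
        simp only [Category.assoc]
        rw [D.natural])
      subst this
      apply sec_ext (u ≫ v)
      · exact (Sec.s_π _ _ _ _).trans (Sec.s_π _ _ _ _).symm
      · refine Eq.trans ?_ (hu₂' hk₂).symm
        rw [D.σ.map_comp, tot_comp, ← Category.assoc, hu' hk]
  · apply (D.σ.obj c).hom_ext_of_π
    rw [← Category.assoc, ← tot_comp_π, hφ, Category.assoc, ← hxh', ← ht]
    exact congrArg (t c ≫ ·) hπ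

end DescentDatum

end Descent

/-- Quotients by representable groups with Zariski-locally trivial torsors are stacks. -/
theorem isStack_quotientStack {G₀ : SchC} {γ : G.obj (op G₀)} (hγ : IsUnivElement G γ)
    (hG : HasZariskiSections.{1} G) (hX : Presieve.IsSheaf etaleC X) (ρ : GroupAction G X) :
    IsStack (quotientStack ρ) where
  fibred := isFibredInGroupoids_quotientStack ρ
  glue_hom P Q g R hR ψ hψ hc := existsUnique_glue_hom hX P Q g R hR ψ hψ hc
  glue_obj S R hR σ θ := by
    let D : DescentDatum R ρ := ⟨σ, fun c => θ.app c, fun u => θ.hom.naturality u⟩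
    -- Sections of the descended bundle are families indexed by a large category and form a presheaf
    -- in `Type 1`; this is why local triviality of torsors is required in that universe.
    obtain ⟨E, ξ, hξ⟩ := (D.torsor hγ.isSheaf hX hR).exists_isUniv hγ hG
      DescentDatum.isSheaf_presheaf
    obtain ⟨c, hc⟩ := DescentDatum.exists_cocone hX hR D ((D.torsor hγ.isSheaf hX hR).bundle hξ)
      (Iso.refl S) ξ hξ (fun T g a => (D.torsor hγ.isSheaf hX hR).bundle_smul hξ g a)
      (Category.comp_id _) (DescentDatum.existsUnique_toX hX hR (T := E) ξ).choose_spec.1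
    exact ⟨(D.torsor hγ.isSheaf hX hR).bundle hξ, Iso.refl S, c, hc⟩

end QuiverStack

end

noncomputable section
namespace QuiverStack

/-! ## Affine complex schemes -/

/-- The spectrum of a `ℂ`-algebra, as a scheme over `ℂ`. -/
def SpecC (A : Type) [CommRing A] [Algebra ℂ A] : SchC :=
  Over.mk (Spec.map (CommRingCat.ofHom (algebraMap ℂ A)))

instance (A : Type) [CommRing A] [Algebra ℂ A] : IsAffine (SpecC A).left :=
  inferInstanceAs (IsAffine (Spec (CommRingCat.of A)))

/-- The functions on the spectrum of `A`. -/
def specUnit (A : Type) [CommRing A] [Algebra ℂ A] : A ≃ₐ[ℂ] Functions (SpecC A) :=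
  AlgEquiv.ofRingEquiv (f := (Scheme.ΓSpecIso (CommRingCat.of A)).symm.commRingCatIsoToRingEquiv)
    fun c => congrArg (fun k => k.hom c)
      (Scheme.ΓSpecIso_inv_naturality (CommRingCat.ofHom (algebraMap ℂ A)))

theorem Functions.map_apply_comp {T T' T'' : SchC} (f : T' ⟶ T) (g : T'' ⟶ T') (x : Functions T) :
    Functions.map g (Functions.map f x) = Functions.map (g ≫ f) x := by
  rw [Functions.map_comp]; rfl

/-- A morphism to an affine scheme is given by a homomorphism of algebras of functions. -/
theorem existsUnique_hom_of_isAffine (Y : SchC) [IsAffine Y.left] {T : SchC}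
    (φ : Functions Y →ₐ[ℂ] Functions T) : ∃! f : T ⟶ Y, Functions.map f = φ := by
  have hmap : ∀ f : T ⟶ Y, Functions.map f = φ ↔
      f.left.appTop = CommRingCat.ofHom (R := Γ(Y.left, ⊤)) (S := Γ(T.left, ⊤)) φ.toRingHom := by
    intro f
    constructor
    · rintro rfl; rfl
    · intro h
      ext x
      exact congrArg (fun k => k.hom x) h
  let ψ : Γ(Y.left, ⊤) ⟶ Γ(T.left, ⊤) := CommRingCat.ofHom φ.toRingHom
  obtain ⟨f₀, h₁⟩ : ∃ f₀ : T.left ⟶ Y.left, f₀ ≫ Y.left.toSpecΓ = T.left.toSpecΓ ≫ Spec.map ψ :=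
    ⟨T.left.toSpecΓ ≫ Spec.map ψ ≫ inv Y.left.toSpecΓ, by simp⟩
  have hf₀ : f₀.appTop = ψ := by
    have h₂ := congrArg Scheme.Hom.appTop h₁
    rw [Scheme.Hom.comp_appTop f₀, Scheme.Hom.comp_appTop T.left.toSpecΓ, Scheme.toSpecΓ_appTop,
      Scheme.toSpecΓ_appTop, Scheme.ΓSpecIso_naturality] at h₂
    exact (cancel_epi _).1 h₂
  refine ⟨Over.homMk f₀ ?_, (hmap _).2 hf₀, fun g hg => ?_⟩
  · apply ext_of_isAffine
    rw [Scheme.Hom.comp_appTop, hf₀, ← cancel_epi (Scheme.ΓSpecIso (CommRingCat.of ℂ)).inv]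
    ext c
    exact φ.commutes c
  · ext1
    apply ext_of_isAffine
    rw [(hmap g).1 hg]
    exact hf₀.symm

/-- A morphism to a spectrum is given by a homomorphism of algebras. -/
theorem existsUnique_hom_SpecC (A : Type) [CommRing A] [Algebra ℂ A] {T : SchC}
    (φ : A →ₐ[ℂ] Functions T) :
    ∃! f : T ⟶ SpecC A, (Functions.map f).comp (specUnit A).toAlgHom = φ := by
  obtain ⟨f, hf, hu⟩ := existsUnique_hom_of_isAffine (SpecC A)
    (φ.comp (specUnit A).symm.toAlgHom)
  refine ⟨f, ?_, fun g hg => hu g ?_⟩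
  · change (Functions.map f).comp _ = φ
    rw [hf]
    ext x
    simp
  · change Functions.map g = _
    rw [← hg]
    ext x
    simp

theorem flat_functions {U V : SchC} [IsAffine U.left] [IsAffine V.left] (f : U ⟶ V)
    [Flat f.left] : (Functions.map f).toRingHom.Flat :=
  (HasRingHomProperty.iff_of_isAffine (P := @Flat) (f := f.left)).1 inferInstance

end QuiverStack

end

noncomputable section
namespace QuiverStack

/-! ## Descent of free modules along flat ring extensions -/

section Frame

open TensorProduct

/-- By multilinearity, rows in the span may be replaced by rows in the generating set one at a time.
The use is contrapositive: if `M` spans everything, some determinant of vectors of `M` avoids a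
given proper ideal. -/
theorem det_mem_of_span {B : Type} [CommRing B] {n : Type} [Fintype n] [DecidableEq n]
    (M : Set (n → B)) (J : Ideal B) (h : ∀ x : n → n → B, (∀ i, x i ∈ M) → Matrix.detRowAlternating x ∈ J) :
    ∀ x : n → n → B, (∀ i, x i ∈ Submodule.span B M) → Matrix.detRowAlternating x ∈ J := by
  classical
  have key : ∀ (s : Finset n) (x : n → n → B), (∀ i ∈ s, x i ∈ Submodule.span B M) →
      (∀ i ∉ s, x i ∈ M) → Matrix.detRowAlternating x ∈ J := by
    intro s
    induction s using Finset.induction_on with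
    | empty => exact fun x _ hx => h x fun i => hx i (Finset.notMem_empty i)
    | insert a s ha ih =>
      intro x hx hx'
      have hgen : ∀ y ∈ Submodule.span B M, Matrix.detRowAlternating (Function.update x a y) ∈ J := by
        intro y hy
        induction hy using Submodule.span_induction with
        | mem y hy =>
          refine ih _ (fun i hi => ?_) fun i hi => ?_
          · rw [Function.update_of_ne (by rintro rfl; exact ha hi)]
            exact hx i (Finset.mem_insert_of_mem hi)
          · by_cases hia : i = a
            · subst hia; rwa [Function.update_self]
            · rw [Function.update_of_ne hia]
              exact hx' i (by simp [hia, hi])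
        | zero =>
          rw [AlternatingMap.map_update_zero]
          exact J.zero_mem
        | add y z _ _ hy hz =>
          rw [AlternatingMap.map_update_add]
          exact J.add_mem hy hz
        | smul c y _ hy =>
          rw [AlternatingMap.map_update_smul]
          exact J.mul_mem_left c hy
      have := hgen (x a) (hx a (Finset.mem_insert_self a s))
      rwa [Function.update_eq_self] at this
  exact fun x hx => key Finset.univ x (fun i _ => hx i) fun i hi => absurd (Finset.mem_univ i) hi

variable {A B : Type} [CommRing A] [CommRing B] [Algebra A B]

/-- The value of a cocycle on a pair of points. -/
abbrev cocycleAt {n : Type} (g : Matrix n n (B ⊗[A] B)) {C : Type} [CommRing C] [Algebra A C]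
    (a b : B →ₐ[A] C) : Matrix n n C := g.map (Algebra.TensorProduct.productMap a b)

/-- Vectors satisfying a descent condition along a flat ring extension span. -/
theorem exists_descended_vectors [Module.Flat A B] {n : Type} [Fintype n] [DecidableEq n]
    (g : n → n → B ⊗[A] B)
    (hg : ∀ (C : Type) [CommRing C] [Algebra A C] (a b c : B →ₐ[A] C) (i k : n),
      ∑ m, Algebra.TensorProduct.productMap b c (g i m) *
        Algebra.TensorProduct.productMap a b (g m k) = Algebra.TensorProduct.productMap a c (g i k))
    (hg₁ : ∀ i k, Algebra.TensorProduct.productMap (AlgHom.id A B) (AlgHom.id A B) (g i k) =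
      if i = k then 1 else 0)
    (𝔮 : Ideal B) (h𝔮 : 𝔮 ≠ ⊤) :
    ∃ x : n → n → B, Matrix.detRowAlternating x ∉ 𝔮 ∧ ∀ k i,
      ∑ j, g i j * Algebra.TensorProduct.includeLeft (S := A) (x k j) =
        (Algebra.TensorProduct.includeRight (x k i) : B ⊗[A] B) := by
  let l : B →ₐ[A] B ⊗[A] B := Algebra.TensorProduct.includeLeft
  let r : B →ₐ[A] B ⊗[A] B := Algebra.TensorProduct.includeRight
  -- The kernel of this A-linear map is the descended module: the vectors whose two pull-backs are
  -- identified by the cocycle.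
  let d : (n → B) →ₗ[A] (n → B ⊗[A] B) :=
    { toFun := fun x i => ∑ j, g i j * l (x j) - r (x i)
      map_add' := fun x y => by
        funext i
        simp only [Pi.add_apply, map_add, mul_add, Finset.sum_add_distrib]
        ring
      map_smul' := fun c x => by
        funext i
        simp only [Pi.smul_apply, map_smul, mul_smul_comm, RingHom.id_apply, smul_sub,
          Finset.smul_sum] }
  have hd : ∀ x, d x = 0 ↔ ∀ i, ∑ j, g i j * l (x j) = r (x i) := fun x => by
    rw [funext_iff]
    exact forall_congr' fun i => sub_eq_zero
  -- Let Y be g applied to the left pull-back of z. By the cocycle condition Y is killed by 1 ⊗ d,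
  -- so flatness places it in the image of B ⊗ ker d. The multiplication B ⊗ B → B turns Y into z,
  -- as g is the identity on the diagonal, and writes z as a B-combination of vectors in ker d.
  have hspan : ∀ z : n → B, z ∈ Submodule.span B {x : n → B | d x = 0} := by
    intro z
    let y : n → B ⊗[A] B := fun i => ∑ j, g i j * l (z j)
    let Y : B ⊗[A] (n → B) := (TensorProduct.piRight A A B (fun _ : n => B)).symm y
    -- The three coprojections to the triple tensor product. With them the cocycle condition reads
    -- g₁₂g₀₁ = g₀₂, and 1 ⊗ d involves g₁₂.
    let i₀ : B →ₐ[A] B ⊗[A] (B ⊗[A] B) := Algebra.TensorProduct.includeLeft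
    let j : B ⊗[A] B →ₐ[A] B ⊗[A] (B ⊗[A] B) := Algebra.TensorProduct.includeRight
    let i₁ : B →ₐ[A] B ⊗[A] (B ⊗[A] B) := j.comp l
    let i₂ : B →ₐ[A] B ⊗[A] (B ⊗[A] B) := j.comp r
    have hform : ∀ t : B ⊗[A] (n → B), ∀ i, TensorProduct.piRight A A B (fun _ : n => B ⊗[A] B)
        (d.lTensor B t) i = ∑ k, j (g i k) * Algebra.TensorProduct.productMap i₀ i₁
          (TensorProduct.piRight A A B (fun _ : n => B) t k) -
          Algebra.TensorProduct.productMap i₀ i₂ (TensorProduct.piRight A A B (fun _ : n => B) t i) := by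
      intro t i
      induction t using TensorProduct.induction_on with
      | zero => simp
      | add s t hs ht =>
        simp only [map_add, Pi.add_apply, hs, ht, mul_add, Finset.sum_add_distrib]
        ring
      | tmul b x =>
        simp only [LinearMap.lTensor_tmul, TensorProduct.piRight_apply,
          TensorProduct.piRightHom_tmul, Algebra.TensorProduct.productMap_apply_tmul]
        change b ⊗ₜ[A] (∑ k, g i k * l (x k) - r (x i)) = _
        rw [TensorProduct.tmul_sub, TensorProduct.tmul_sum]
        congr 1
        · refine Finset.sum_congr rfl fun k _ => ?_
          change _ = (1 ⊗ₜ[A] g i k) * ((b ⊗ₜ[A] 1) * (1 ⊗ₜ[A] l (x k)))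
          simp [Algebra.TensorProduct.tmul_mul_tmul]
        · change _ = (b ⊗ₜ[A] 1) * (1 ⊗ₜ[A] r (x i))
          simp [Algebra.TensorProduct.tmul_mul_tmul]
    have hgj : ∀ i k, j (g i k) = Algebra.TensorProduct.productMap i₁ i₂ (g i k) := by
      intro i k
      refine DFunLike.congr_fun (f := j) (g := Algebra.TensorProduct.productMap i₁ i₂) ?_ _
      ext x <;> simp [i₁, i₂, l, r, j, ← Algebra.TensorProduct.one_def]
    have hY : d.lTensor B Y = 0 := by
      apply (TensorProduct.piRight A A B (fun _ : n => B ⊗[A] B)).injective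
      rw [map_zero]
      funext i
      have hc := hg (B ⊗[A] (B ⊗[A] B)) i₀ i₁ i₂
      have hc' : ∀ k, ∑ m, j (g i m) * Algebra.TensorProduct.productMap i₀ i₁ (g m k) =
          Algebra.TensorProduct.productMap i₀ i₂ (g i k) := fun k => by
        simp only [hgj]
        exact hc i k
      rw [hform]
      simp only [Y, LinearEquiv.apply_symm_apply, y, map_sum, map_mul, Pi.zero_apply]
      simp only [Finset.mul_sum]
      rw [Finset.sum_comm, sub_eq_zero]
      refine Finset.sum_congr rfl fun k _ => ?_
      rw [← hc', Finset.sum_mul]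
      refine Finset.sum_congr rfl fun m _ => ?_
      simp [l, mul_assoc]
    have hex : Function.Exact ((LinearMap.ker d).subtype.lTensor B) (d.lTensor B) :=
      Module.Flat.lTensor_exact B (LinearMap.exact_subtype_ker_map d)
    obtain ⟨t, ht⟩ := (hex Y).1 hY
    have hgen : ∀ t : B ⊗[A] LinearMap.ker d,
        (fun i => Algebra.TensorProduct.productMap (AlgHom.id A B) (AlgHom.id A B)
          (TensorProduct.piRight A A B (fun _ : n => B) ((LinearMap.ker d).subtype.lTensor B t) i))
        ∈ Submodule.span B {x : n → B | d x = 0} := by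
      intro t
      induction t using TensorProduct.induction_on with
      | zero => simp only [map_zero, Pi.zero_apply]; exact Submodule.zero_mem _
      | add s t hs ht =>
        simp only [map_add, Pi.add_apply]
        exact Submodule.add_mem _ hs ht
      | tmul b x => exact Submodule.smul_mem _ b (Submodule.subset_span x.2)
    have := hgen t
    rw [ht] at this
    convert this using 1
    funext i
    simp only [Y, LinearEquiv.apply_symm_apply, y, map_sum, map_mul]
    simp only [hg₁]
    simp [l]
  -- If all determinants of descended vectors were in 𝔮, so would be those of all vectors, in
  -- particular det 1 = 1.
  obtain ⟨x, hx, hdet⟩ : ∃ x : n → n → B, (∀ i, d (x i) = 0) ∧ Matrix.detRowAlternating x ∉ 𝔮 := by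
    by_contra! hcon
    apply h𝔮
    rw [Ideal.eq_top_iff_one, ← Matrix.det_one (n := n)]
    exact det_mem_of_span _ 𝔮 hcon (fun i => (1 : Matrix n n B) i) fun i => hspan _
  exact ⟨x, hdet, fun k i => (hd (x k)).1 (hx k) i⟩

/-- Hilbert's Theorem 90 for a flat ring extension, locally at a prime. -/
theorem exists_frame [Module.Flat A B] {n : Type} [Fintype n] [DecidableEq n]
    (g : Matrix n n (B ⊗[A] B))
    (hg : ∀ (C : Type) [CommRing C] [Algebra A C] (a b c : B →ₐ[A] C),
      cocycleAt g b c * cocycleAt g a b = cocycleAt g a c)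
    (hg₁ : cocycleAt g (AlgHom.id A B) (AlgHom.id A B) = 1)
    (𝔮 : Ideal B) (h𝔮 : 𝔮 ≠ ⊤) :
    ∃ h : Matrix n n B, h.det ∉ 𝔮 ∧
      ∀ (C : Type) [CommRing C] [Algebra A C] (a b : B →ₐ[A] C),
        cocycleAt g a b * h.map a = h.map b := by
  obtain ⟨x, hdet, hx⟩ := exists_descended_vectors (fun i k => g i k)
    (fun C _ _ a b c i k => by
      have := congrFun (congrFun (hg C a b c) i) k
      rwa [Matrix.mul_apply] at this)
    (fun i k => (congrFun (congrFun hg₁ i) k).trans (Matrix.one_apply)) 𝔮 h𝔮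
  -- The descended vectors are the columns of the frame, whence the transposition.
  refine ⟨(Matrix.of x).transpose, by rw [Matrix.det_transpose]; exact hdet, fun C _ _ a b => ?_⟩
  ext i k
  have := congrArg (Algebra.TensorProduct.productMap a b) (hx k i)
  rw [Matrix.mul_apply]
  simpa using this

end Frame

end QuiverStack

end

noncomputable section
namespace QuiverStack

universe w

/-! ## Loci where a function is invertible -/

/-- The locus where a function is invertible. -/
def unitLocus {T : SchC} (x : Functions T) : T.left.Opens := T.left.basicOpen (U := ⊤) x

theorem isUnit_of_unitLocus_eq_top {T : SchC} {x : Functions T} (h : unitLocus x = ⊤) :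
    IsUnit x := by
  refine RingedSpace.isUnit_of_isUnit_germ T.left.toLocallyRingedSpace.toRingedSpace ⊤ x
    fun t ht => ?_
  have : t ∈ T.left.basicOpen (U := ⊤) x := h.ge (Set.mem_univ t)
  exact (Scheme.mem_basicOpen T.left x t ht).1 this

theorem mem_unitLocus_map {T T' : SchC} (f : T' ⟶ T) (x : Functions T) (t : T'.left) :
    t ∈ unitLocus (Functions.map f x) ↔ f.left t ∈ unitLocus x := by
  have := Scheme.preimage_basicOpen f.left (U := ⊤) x
  exact (this.ge.antisymm this.le ▸ Iff.rfl : t ∈ f.left ⁻¹ᵁ T.left.basicOpen (U := ⊤) x ↔ _).symm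

theorem isUnit_map_of_range_subset {T T' : SchC} (f : T' ⟶ T) (x : Functions T)
    (h : Set.range f.left ⊆ unitLocus x) : IsUnit (Functions.map f x) :=
  isUnit_of_unitLocus_eq_top (by
    ext t
    exact iff_of_true ((mem_unitLocus_map f x t).2 (h ⟨t, rfl⟩)) trivial)

/-- The functions that are not invertible at a point. -/
def pointIdeal (T : SchC) (t : T.left) : Ideal (Functions T) :=
  (IsLocalRing.maximalIdeal (T.left.presheaf.stalk t)).comap
    (T.left.presheaf.germ ⊤ t trivial).hom

instance (T : SchC) (t : T.left) : (pointIdeal T t).IsPrime :=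
  Ideal.IsPrime.comap _

theorem notMem_pointIdeal {T : SchC} {t : T.left} {x : Functions T} :
    x ∉ pointIdeal T t ↔ t ∈ unitLocus x := by
  refine Iff.trans ?_ (Scheme.mem_basicOpen T.left (U := ⊤) x t trivial).symm
  exact IsLocalRing.notMem_maximalIdeal

/-! ## Torsors under the general linear group -/

/-- Shrinks a member of an étale covering to an affine scheme étale over an affine open subscheme,
where descent becomes a statement about rings. -/
theorem exists_affine_etale {S : SchC} {R : Sieve S} (hR : R ∈ etaleC S) (s : S.left) :
    ∃ (V U : SchC) (ι : V ⟶ S) (f : U ⟶ V) (u : U.left), IsOpenImmersion ι.left ∧ IsAffine V.left ∧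
      IsAffine U.left ∧ Etale f.left ∧ R (f ≫ ι) ∧ (f ≫ ι).left u = s := by
  obtain ⟨U₁, f₁, hf₁, hRf₁, u₁, rfl⟩ := exists_of_mem_etaleC hR s
  obtain ⟨V, hV, hsV, -⟩ := exists_isAffineOpen_mem_and_subset (X := S.left)
    (x := f₁.left u₁) (U := ⊤) trivial
  obtain ⟨U, hU, huU, hUV⟩ := exists_isAffineOpen_mem_and_subset (X := U₁.left)
    (x := u₁) (U := f₁.left ⁻¹ᵁ V) hsV
  obtain ⟨f, hf⟩ := exists_opn_lift V (opnι U₁ U ≫ f₁) (by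
    rintro _ ⟨x, rfl⟩
    have hx : (opnι U₁ U).left x ∈ (U : Set U₁.left) := by
      rw [← range_opnι]; exact ⟨x, rfl⟩
    exact hUV hx)
  obtain ⟨u, hu⟩ : u₁ ∈ Set.range (opnι U₁ U).left := by rw [range_opnι]; exact huU
  refine ⟨opn S V, opn U₁ U, opnι S V, f, u, inferInstance, hV, hU, ?_, ?_, ?_⟩
  · have h := congrArg (fun k => k.left) hf
    rw [Over.comp_left _ _ _ _ _, Over.comp_left _ _ _ _ _] at h
    have : Etale (f.left ≫ (opnι S V).left) := h ▸ inferInstance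
    exact Etale.of_comp f.left (opnι S V).left
  · rw [hf]; exact R.downward_closed hRf₁ _
  · rw [hf, ← hu]
    exact congrArg (fun k : (opn U₁ U).left ⟶ S.left => k u) (Over.comp_left _ _ _ _ _)

section LinearGroup

variable {I : Type} [Quiver.{0} I] (v : I → ℕ)

open TensorProduct in
/-- A cocycle with values in the general linear group on an étale neighbourhood becomes trivial
on a smaller one. -/
theorem exists_GL_splitting [Finite I] {U V : SchC} [IsAffine U.left] [IsAffine V.left]
    (f : U ⟶ V) [Etale f.left] (u : U.left)
    (c : ∀ (T : SchC) (a b : T ⟶ U), a ≫ f = b ≫ f → GLPoints v (Functions T))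
    (hc : ∀ T a b d hab hbd had, c T b d hbd * c T a b hab = c T a d had)
    (hres : ∀ T T' (k : T' ⟶ T) a b hab hab',
      GLPoints.map (Functions.map k) (c T a b hab) = c T' (k ≫ a) (k ≫ b) hab') :
    ∃ (W : U.left.Opens) (γ : GLPoints v (Functions (opn U W))), u ∈ W ∧
      ∀ (T : SchC) (a b : T ⟶ opn U W) (hab : (a ≫ opnι U W) ≫ f = (b ≫ opnι U W) ≫ f),
        c T _ _ hab * GLPoints.map (Functions.map a) γ = GLPoints.map (Functions.map b) γ := by
  classical
  let _ := Fintype.ofFinite I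
  let _ : Algebra (Functions V) (Functions U) := (Functions.map f).toRingHom.toAlgebra
  -- Étaleness enters the splitting of the cocycle only through flatness.
  have : Module.Flat (Functions V) (Functions U) := flat_functions f
  have hone : ∀ T a h, c T a a h = 1 := fun T a h => mul_eq_left.1 (hc T a a a h h h)
  -- every algebra over the functions on `V` comes from a scheme
  have real : ∀ (C : Type) [CommRing C] [Algebra (Functions V) C], ∃ (T : SchC)
      (e : C ≃+* Functions T) (hat : (Functions U →ₐ[Functions V] C) → (T ⟶ U)),
      IsAffine T.left ∧ (∀ a x, Functions.map (hat a) x = e (a x)) ∧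
      ∀ a b, hat a ≫ f = hat b ≫ f := by
    intro C _ _
    let _ : Algebra ℂ C :=
      ((algebraMap (Functions V) C).comp (algebraMap ℂ (Functions V))).toAlgebra
    have hhat := fun a : Functions U →ₐ[Functions V] C =>
      existsUnique_hom_of_isAffine U (T := SpecC C)
        ((specUnit C).toAlgHom.comp ({ a.toRingHom with
          commutes' := fun z => by
            change a (algebraMap ℂ (Functions U) z) = algebraMap (Functions V) C (algebraMap ℂ _ z)
            rw [← a.commutes]
            exact congrArg a ((Functions.map f).commutes z).symm } : Functions U →ₐ[ℂ] C))
    refine ⟨SpecC C, (specUnit C).toRingEquiv, fun a => (hhat a).choose, inferInstance,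
      fun a x => ?_, fun a b => ?_⟩
    · exact DFunLike.congr_fun (hhat a).choose_spec.1 x
    · obtain ⟨k, -, hk⟩ := existsUnique_hom_of_isAffine V (T := SpecC C)
        (Functions.map ((hhat a).choose ≫ f))
      rw [hk _ rfl]
      refine (hk _ ?_).symm
      ext x
      rw [← Functions.map_apply_comp, ← Functions.map_apply_comp, (hhat a).choose_spec.1,
        (hhat b).choose_spec.1]
      exact congrArg (specUnit C) ((b.commutes x).trans (a.commutes x).symm)
  -- `T₂` is the spectrum of the tensor product and plays the role of U ×_V U; the cocycle on its
  -- two projections is the universal one, and gives the matrices `g`.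
  obtain ⟨T₂, e₂, hat₂, haff, he₂, hf₂⟩ := real (Functions U ⊗[Functions V] Functions U)
  let g : ∀ i, Matrix (Fin (v i)) (Fin (v i)) (Functions U ⊗[Functions V] Functions U) := fun i =>
    (c T₂ (hat₂ Algebra.TensorProduct.includeLeft) (hat₂ Algebra.TensorProduct.includeRight)
      (hf₂ _ _) i).val.map e₂.symm
  -- Two morphisms to `U` that agree on `V` factor through `T₂`, so every value of the cocycle is a
  -- specialization of `g`.
  have key : ∀ (T : SchC) (a b : T ⟶ U) (hab : a ≫ f = b ≫ f)
      (Ψ : Functions U ⊗[Functions V] Functions U →+* Functions T)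
      (_ : ∀ x, Ψ (Algebra.TensorProduct.includeLeft (S := Functions V) x) = Functions.map a x)
      (_ : ∀ x : Functions U, Ψ (Algebra.TensorProduct.includeRight x) = Functions.map b x) (i : I),
      (c T a b hab i).val = (g i).map Ψ := by
    intro T a b hab Ψ hΨa hΨb i
    obtain ⟨k, hk, -⟩ := existsUnique_hom_of_isAffine T₂ (T := T)
      ({ Ψ.comp e₂.symm.toRingHom with
        commutes' := fun z => by
          change Ψ (e₂.symm (algebraMap ℂ (Functions T₂) z)) = _
          rw [← (Functions.map (hat₂ Algebra.TensorProduct.includeLeft)).commutes z, he₂,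
            RingEquiv.symm_apply_apply, hΨa, AlgHom.commutes] } : Functions T₂ →ₐ[ℂ] Functions T)
    have hk' : ∀ x, Functions.map k x = Ψ (e₂.symm x) := fun x => DFunLike.congr_fun hk x
    have ha : k ≫ hat₂ Algebra.TensorProduct.includeLeft = a :=
      (existsUnique_hom_of_isAffine U (Functions.map a)).unique (by
        ext x
        rw [← Functions.map_apply_comp, he₂, hk', RingEquiv.symm_apply_apply, hΨa]) rfl
    have hb : k ≫ hat₂ Algebra.TensorProduct.includeRight = b :=
      (existsUnique_hom_of_isAffine U (Functions.map b)).unique (by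
        ext x
        rw [← Functions.map_apply_comp, he₂, hk', RingEquiv.symm_apply_apply, hΨb]) rfl
    subst ha hb
    rw [← hres _ _ k _ _ (hf₂ _ _) hab]
    ext p q
    exact hk' _
  have hfr : ∀ i, ∃ h : Matrix (Fin (v i)) (Fin (v i)) (Functions U), h.det ∉ pointIdeal U u ∧
      ∀ (C : Type) [CommRing C] [Algebra (Functions V) C] (a b : Functions U →ₐ[Functions V] C),
        cocycleAt (g i) a b * h.map a = h.map b := by
    intro i
    have hcoc : ∀ (C : Type) [CommRing C] [Algebra (Functions V) C], ∃ (T : SchC)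
        (e : C ≃+* Functions T) (hat : (Functions U →ₐ[Functions V] C) → (T ⟶ U))
        (hhat : ∀ a b, hat a ≫ f = hat b ≫ f), ∀ a b, (cocycleAt (g i) a b).map e =
          (c T (hat a) (hat b) (hhat a b) i).val := by
      intro C _ _
      obtain ⟨T, e, hat, -, he, hf⟩ := real C
      refine ⟨T, e, hat, hf, fun a b => ?_⟩
      rw [key T (hat a) (hat b) (hf a b)
        (e.toRingHom.comp (Algebra.TensorProduct.productMap a b).toRingHom)
        (fun x => by simp [he]) (fun x => by simp [he])]
      rfl
    refine exists_frame (g i) (fun C _ _ a b d => ?_) ?_ _ (Ideal.IsPrime.ne_top inferInstance)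
    · obtain ⟨T, e, hat, hhat, h⟩ := hcoc C
      apply Matrix.map_injective e.injective
      refine Matrix.map_mul.trans ?_
      refine Eq.trans ?_ (h a d).symm
      rw [h, h, ← hc T (hat a) (hat b) (hat d) (hhat _ _) (hhat _ _) (hhat _ _)]
      rfl
    · obtain ⟨T, e, hat, hhat, h⟩ := hcoc (Functions U)
      apply Matrix.map_injective e.injective
      refine (h _ _).trans (Eq.trans ?_ (Matrix.map_one _ (map_zero e) (map_one e)).symm)
      rw [hone]
      rfl
  choose h hdet hh using hfr
  -- The frames are invertible where all their determinants are. This open subset contains `u`: the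
  -- functions vanishing at `u` form a prime ideal, which contains none of the factors, hence not
  -- their product.
  let W := unitLocus (∏ i, (h i).det)
  have hW : IsUnit (Functions.map (opnι U W) (∏ i, (h i).det)) :=
    isUnit_map_of_range_subset _ _ (range_opnι U W).le
  have hWi : ∀ i, IsUnit (Matrix.det ((h i).map (Functions.map (opnι U W)))) := by
    intro i
    rw [map_prod] at hW
    have := isUnit_of_dvd_unit (Finset.dvd_prod_of_mem
      (fun i => Functions.map (opnι U W) (h i).det) (Finset.mem_univ i)) hW
    rw [AlgHom.map_det] at this
    exact this
  refine ⟨W, fun i => Matrix.GeneralLinearGroup.mk'' _ (hWi i), ?_, fun T a b hab => ?_⟩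
  · rw [← notMem_pointIdeal]
    intro hmem
    obtain ⟨i, -, hi⟩ := (Ideal.IsPrime.prod_mem_iff).1 hmem
    exact hdet i hi
  · funext i
    apply Units.ext
    let _ : Algebra (Functions V) (Functions T) :=
      (Functions.map ((a ≫ opnι U W) ≫ f)).toRingHom.toAlgebra
    let a' : Functions U →ₐ[Functions V] Functions T :=
      { (Functions.map (a ≫ opnι U W)).toRingHom with
        commutes' := fun x => Functions.map_apply_comp f (a ≫ opnι U W) x }
    let b' : Functions U →ₐ[Functions V] Functions T :=
      { (Functions.map (b ≫ opnι U W)).toRingHom with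
        commutes' := fun x => (Functions.map_apply_comp f (b ≫ opnι U W) x).trans
          (by rw [← hab]; rfl) }
    have h₁ := hh i (Functions T) a' b'
    have h₂ := key T _ _ hab (Algebra.TensorProduct.productMap a' b').toRingHom
      (fun x => by simp [a']) (fun x => by simp [b']) i
    have h₃ : ∀ d : T ⟶ opn U W, ((h i).map (Functions.map (opnι U W))).map (Functions.map d) =
        (h i).map (Functions.map (d ≫ opnι U W)) := fun d => by
      ext p q
      exact Functions.map_apply_comp _ _ _
    change (c T _ _ hab i).val * ((h i).map (Functions.map (opnι U W))).map (Functions.map a) =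
      ((h i).map (Functions.map (opnι U W))).map (Functions.map b)
    rw [h₂, h₃, h₃]
    exact h₁

/-- Hilbert's Theorem 90: torsors under the general linear group are Zariski-locally trivial. -/
theorem hasZariskiSections_GL [Finite I] : HasZariskiSections.{w} (GLFunctor v) := by
  intro X ρ S t ht s
  obtain ⟨R, hR, hRt⟩ := t.locallyTrivial
  obtain ⟨V, U, ι, f, u, hι, hV, hU, hf, hRf, hu⟩ := exists_affine_etale hR s
  have := mono_of_isOpenImmersion ι
  obtain ⟨p, hp⟩ := hRt _ _ hRf
  -- The pull-backs of the section `p` along two morphisms that agree on `V` differ by a unique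
  -- group element; uniqueness makes these elements a cocycle.
  have hex : ∀ (T : SchC) (a b : T ⟶ U), a ≫ f = b ≫ f →
      ∃! g : (GLFunctor v).obj (op T), t.act T g (res t.F a p) = res t.F b p :=
    fun T a b hab => t.simplyTransitive T _ _ (by
      rw [t.p_res, t.p_res, hp, ← Category.assoc, ← Category.assoc, hab])
  choose c hc hcu using hex
  obtain ⟨W, γ, huW, hγ⟩ : ∃ (W : U.left.Opens) (γ : (GLFunctor v).obj (op (opn U W))), u ∈ W ∧
      ∀ (T : SchC) (a b : T ⟶ opn U W) (hab : (a ≫ opnι U W) ≫ f = (b ≫ opnι U W) ≫ f),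
        c T _ _ hab * gres (GLFunctor v) a γ = gres (GLFunctor v) b γ := exists_GL_splitting v f u c
    (fun T a b d hab hbd had => hcu T a d had _ (by
      refine (t.mul_act T (c T b d hbd) (c T a b hab) _).trans ?_
      rw [hc, hc]))
    (fun T T' k a b hab hab' => hcu T' _ _ hab' _ (by
      refine Eq.trans (congrArg _ (res_res t.F a k p).symm) ?_
      refine (t.res_act T T' k (c T a b hab) _).symm.trans ?_
      rw [hc, res_res]))
  let j := opnι U W
  -- Corrected by the splitting of the cocycle, the section has equal pull-backs along morphisms
  -- that agree on `V`, and so it descends.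
  obtain ⟨q, hq⟩ : ∃ q, q = t.act (opn U W) γ⁻¹ (res t.F j p) := ⟨_, rfl⟩
  have hqp : t.p _ q = (j ≫ f) ≫ ι := by
    rw [hq, t.p_act, t.p_res, hp, Category.assoc]
  have hqc : ∀ (T : SchC) (a b : T ⟶ opn U W), a ≫ j ≫ f = b ≫ j ≫ f →
      res t.F a q = res t.F b q := by
    intro T a b hab
    have hab' : (a ≫ j) ≫ f = (b ≫ j) ≫ f := by simpa using hab
    have hi : ∀ d : T ⟶ opn U W, res t.F d q = t.act T
        (gres (GLFunctor v) d γ)⁻¹ (res t.F (d ≫ j) p) := fun d => by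
      rw [hq, t.res_act, res_res, gres_inv]
    rw [hi, hi, ← hc T _ _ hab', ← t.mul_act]
    congr 1
    have := hγ T a b hab'
    rw [← this]
    rw [mul_inv_rev, inv_mul_cancel_right]
  -- the image in `S`
  have hjf : Etale ((j ≫ f) ≫ ι).left := by
    rw [Over.comp_left _ _ _ _ _, Over.comp_left _ _ _ _ _]
    infer_instance
  let V' : S.left.Opens := ⟨Set.range ((j ≫ f) ≫ ι).left, ((j ≫ f) ≫ ι).left.isOpenMap.isOpen_range⟩
  obtain ⟨m, hm⟩ := exists_opn_lift V' ((j ≫ f) ≫ ι) le_rfl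
  have hml : m.left ≫ (opnι S V').left = ((j ≫ f) ≫ ι).left := by
    rw [← hm]; exact (Over.comp_left _ _ _ _ _).symm
  have : Etale m.left := by
    have : Etale (m.left ≫ (opnι S V').left) := hml ▸ hjf
    exact Etale.of_comp m.left (opnι S V').left
  have : Surjective m.left := ⟨fun y => by
    obtain ⟨x, hx⟩ : (opnι S V').left y ∈ Set.range ((j ≫ f) ≫ ι).left :=
      (range_opnι S V').le ⟨y, rfl⟩
    refine ⟨x, (opnι S V').left.isOpenEmbedding.injective ?_⟩
    rw [← hx, ← hml]
    rfl⟩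
  have hcov := generate_singleton_mem_etaleC m
  have hch : ∀ (W' : SchC) (k : W' ⟶ opn S V') (hk : Sieve.generate (Presieve.singleton m) k),
      (generate_singleton_apply.1 hk).choose ≫ j ≫ f ≫ ι = k ≫ opnι S V' := fun W' k hk => by
    rw [← Category.assoc j, ← hm, ← Category.assoc, (generate_singleton_apply.1 hk).choose_spec]
  -- `m` is an étale surjection onto an open subscheme of `S` and thus covers it. The chosen
  -- factorizations through `m` need not be compatible, but the restrictions of `q` along them are.
  obtain ⟨x, hx, -⟩ := sheaf_glue ht hcov
    (fun W k hk => res t.F (generate_singleton_apply.1 hk).choose q)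
    (fun W W' l k hk hk' => by
      rw [res_res]
      apply hqc
      rw [← cancel_mono ι]
      simp only [Category.assoc]
      rw [hch _ _ hk, hch _ _ hk', Category.assoc])
  refine ⟨V', ⟨(show (opn U W).left from ?_), ?_⟩, x, ?_⟩
  · exact ((range_opnι U W).ge huW).choose
  · have h₁ := ((range_opnι U W).ge huW).choose_spec
    rw [← hu]
    refine Eq.trans ?_ (congrArg (fun z => (f ≫ ι).left z) h₁)
    rw [Category.assoc]
    rfl
  · refine sheaf_ext (isSheaf_yoneda S) hcov fun W k hk => ?_
    have h₁ := congrArg (t.p W) (hx W k hk)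
    rw [t.p_res, t.p_res, hqp, Category.assoc, hch _ _ hk] at h₁
    exact h₁

end LinearGroup

end QuiverStack

end

noncomputable section
namespace QuiverStack

universe w

open PrincipalBundle

/-! ## Descent of properties of morphisms along Zariski-locally trivial maps -/

theorem isPullback_left {A B C D : SchC} {f : A ⟶ B} {g : A ⟶ C} {h : B ⟶ D} {k : C ⟶ D}
    (H : IsPullback f g h k) : IsPullback f.left g.left h.left k.left :=
  H.map (Over.forget _)

/-- The morphism `r` has sections Zariski-locally on its target. -/
def HasLocalSections {Q S : SchC} (r : Q ⟶ S) : Prop :=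
  ∀ s : S.left, ∃ V : S.left.Opens, s ∈ V ∧ ∃ x : opn S V ⟶ Q, x ≫ r = opnι S V

/-- Over `V` the inclusion into `S` factors through `r` by the section, so the restriction of `b` to
`V` is a base change of `q`. -/
theorem property_of_hasLocalSections {P : MorphismProperty Scheme.{0}} [IsZariskiLocalAtTarget P]
    [P.IsStableUnderBaseChange] {N E Q S : SchC} {t : N ⟶ E} {q : N ⟶ Q} {b : E ⟶ S} {r : Q ⟶ S}
    (H : IsPullback t q b r) (hr : HasLocalSections r) (hq : P q.left) : P b.left := by
  refine IsZariskiLocalAtTarget.of_forall_exists_morphismRestrict fun s => ?_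
  obtain ⟨V, hs, x, hx⟩ := hr s
  refine ⟨V, hs, ?_⟩
  have hx' : x.left ≫ r.left = V.ι := by
    rw [← Over.comp_left _ _ _ _ _, hx]; rfl
  have h₁ := (isPullback_morphismRestrict b.left V).flip
  rw [← hx'] at h₁
  exact P.of_isPullback (IsPullback.of_right' h₁ (isPullback_left H)) hq

variable {G : SchCᵒᵖ ⥤ GrpCat.{0}} {X X' : SchCᵒᵖ ⥤ Type} {ρ : GroupAction G X}
  {ρ' : GroupAction G X'}

namespace PrincipalBundle

variable (Q : PrincipalBundle ρ)

theorem hasLocalSections (hG : HasZariskiSections.{0} G) : HasLocalSections Q.π := fun s =>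
  hG X ρ Q.base Q.torsor (isSheaf_yoneda Q.total) s

/-- The pair (g·a, a) determines (a, g). Thus, pulled back along itself, the projection of a bundle
becomes the trivial bundle, and it has all properties of the group scheme that are local on the
target. -/
theorem isPullback_smul {G₀ : SchC} {γ : G.obj (op G₀)} (hγ : IsUnivElement G γ) :
    IsPullback (Q.smul (gres G prod.snd γ) (prod.fst : Q.total ⨯ G₀ ⟶ Q.total)) prod.fst Q.π Q.π := by
  have hex : ∀ s : PullbackCone Q.π Q.π, ∃! f : s.pt ⟶ Q.total ⨯ G₀,
      f ≫ Q.smul (gres G prod.snd γ) prod.fst = s.fst ∧ f ≫ prod.fst = s.snd := by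
    intro s
    obtain ⟨g, hg, hgu⟩ := Q.existsUnique_smul_eq s.condition.symm
    obtain ⟨k, hk, hku⟩ := hγ _ g
    have hcomp : ∀ f : s.pt ⟶ Q.total ⨯ G₀, f ≫ Q.smul (gres G prod.snd γ) prod.fst =
        Q.smul (gres G (f ≫ prod.snd) γ) (f ≫ prod.fst) := fun f => by
      rw [comp_smul, gres_gres]
    refine ⟨prod.lift s.snd k, ⟨?_, prod.lift_fst _ _⟩, fun f hf => ?_⟩
    · rw [hcomp, prod.lift_fst, prod.lift_snd, hk, hg]
    · apply prod.hom_ext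
      · rw [hf.2, prod.lift_fst]
      · rw [prod.lift_snd]
        refine hku _ (hgu _ ?_)
        change Q.smul _ _ = _
        rw [← hf.1, hcomp, hf.2]
  exact ⟨⟨by rw [smul_π]⟩, ⟨PullbackCone.IsLimit.mk _ (fun s => (hex s).choose)
    (fun s => (hex s).choose_spec.1.1) (fun s => (hex s).choose_spec.1.2)
    (fun s m h₁ h₂ => (hex s).choose_spec.2 m ⟨h₁, h₂⟩)⟩⟩

/-- The projection of a bundle inherits the properties of the group scheme. -/
theorem property_π {P : MorphismProperty Scheme.{0}} [IsZariskiLocalAtTarget P]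
    [P.IsStableUnderBaseChange] {G₀ : SchC} {γ : G.obj (op G₀)} (hγ : IsUnivElement G γ)
    (hG : HasZariskiSections.{0} G) (hP : P G₀.hom) : P Q.π.left := by
  refine property_of_hasLocalSections (Q.isPullback_smul hγ) (Q.hasLocalSections hG) ?_
  have h : IsPullback (prod.snd : Q.total ⨯ G₀ ⟶ G₀) prod.fst (terminal.from G₀)
      (terminal.from Q.total) := IsPullback.flip (IsPullback.of_is_product' (Limits.prodIsProd _ _) terminalIsTerminal)
  refine P.of_isPullback (isPullback_left h) ?_
  have : (terminal.from G₀).left ≫ (⊤_ SchC).hom = G₀.hom := Over.w _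
  have : IsIso (⊤_ SchC).hom := by
    have e : (⊤_ SchC) ≅ Over.mk (𝟙 _) := terminalIsTerminal.uniqueUpToIso Over.mkIdTerminal
    have h := Over.w e.hom
    have : IsIso e.hom.left := inferInstanceAs (IsIso ((Over.forget _).map e.hom))
    rw [← h]
    change IsIso (e.hom.left ≫ 𝟙 _)
    infer_instance
  rwa [← P.cancel_right_of_respectsIso _ (⊤_ SchC).hom, ‹_ ≫ _ = G₀.hom›]

end PrincipalBundle

/-! ## Quotients of schemes over a principal bundle -/

section Quot

variable (Q : PrincipalBundle ρ) {N : SchC} (α : GroupAction G (yoneda.obj N)) (q : N ⟶ Q.total)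

/-- An equivariant map over `Q` from the pull-back of the bundle `Q` to `N`. -/
structure QuotSec (T : SchC) : Type 1 where
  h : T ⟶ Q.base
  ψ : ∀ (W : SchC) (k : W ⟶ T) (a : W ⟶ Q.total), a ≫ Q.π = k ≫ h → (W ⟶ N)
  ψ_q : ∀ W k a e, ψ W k a e ≫ q = a
  comp_ψ : ∀ (W W' : SchC) (l : W' ⟶ W) k a e e', l ≫ ψ W k a e = ψ W' (l ≫ k) (l ≫ a) e'
  ψ_smul : ∀ (W : SchC) (g : G.obj (op W)) k a e e',
    ψ W k (Q.smul g a) e' = α.act W g (ψ W k a e)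

variable {Q α q}

namespace QuotSec

theorem ext {T : SchC} {x y : QuotSec Q α q T} (h : x.h = y.h)
    (hψ : ∀ W k a hx hy, x.ψ W k a hx = y.ψ W k a hy) : x = y := by
  obtain ⟨xh, xψ, _, _, _⟩ := x
  obtain ⟨yh, yψ, _, _, _⟩ := y
  obtain rfl : xh = yh := h
  congr
  funext W k a e
  exact hψ W k a e e

theorem ψ_congr {T : SchC} {x y : QuotSec Q α q T} (e : x = y) {W : SchC} {k k' : W ⟶ T}
    {a a' : W ⟶ Q.total} (ek : k = k') (ea : a = a') (h h') : x.ψ W k a h = y.ψ W k' a' h' := by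
  subst e ek ea
  rfl

/-- Restriction. -/
def res {T T' : SchC} (f : T' ⟶ T) (x : QuotSec Q α q T) : QuotSec Q α q T' where
  h := f ≫ x.h
  ψ W k a e := x.ψ W (k ≫ f) a (by rw [e, Category.assoc])
  ψ_q W k a e := x.ψ_q _ _ _ _
  comp_ψ W W' l k a e e' := (x.comp_ψ _ _ _ _ _ _ (by
    rw [e', Category.assoc, Category.assoc, Category.assoc])).trans
    (ψ_congr rfl (Category.assoc _ _ _).symm rfl _ _)
  ψ_smul W g k a e e' := x.ψ_smul _ _ _ _ _ _

theorem res_id' {T : SchC} (x : QuotSec Q α q T) : x.res (𝟙 T) = x :=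
  QuotSec.ext (Category.id_comp _) fun W k a _ _ => ψ_congr rfl (Category.comp_id k) rfl _ _

theorem res_res' {T T' T'' : SchC} (f : T' ⟶ T) (g : T'' ⟶ T') (x : QuotSec Q α q T) :
    (x.res f).res g = x.res (g ≫ f) :=
  QuotSec.ext (Category.assoc _ _ _).symm fun W k a _ _ =>
    ψ_congr rfl (Category.assoc _ _ _) rfl _ _

variable (Q α q) in
/-- The functor of points of the quotient. -/
def functor : SchCᵒᵖ ⥤ Type 1 where
  obj T := QuotSec Q α q T.unop
  map f := TypeCat.ofHom fun x => x.res f.unop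
  map_id T := ConcreteCategory.hom_ext _ _ fun x => QuotSec.res_id' x
  map_comp f g := ConcreteCategory.hom_ext _ _ fun x => (QuotSec.res_res' f.unop g.unop x).symm

/-- For fixed test data the value of `ψ` is a morphism to the scheme `N`, which is glued along the
pulled-back sieve; the identities that `ψ` must satisfy hold because they do so locally. -/
theorem existsUnique_glue {T : SchC} {R : Sieve T} (hR : R ∈ etaleC T)
    (y : ∀ (W : SchC) (k : W ⟶ T), R k → QuotSec Q α q W)
    (hy : ∀ (W W' : SchC) (l : W' ⟶ W) (k : W ⟶ T) (hk : R k) (k' : W' ⟶ T) (hk' : R k'),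
      k' = l ≫ k → (y W k hk).res l = y W' k' hk') :
    ∃! x : QuotSec Q α q T, ∀ W k hk, x.res k = y W k hk := by
  obtain ⟨h, hh, hhu⟩ := sheaf_glue (isSheaf_yoneda Q.base) hR (fun W k hk => (y W k hk).h)
    (fun W W' l k hk hk' => congrArg QuotSec.h (hy W W' l k hk _ hk' rfl))
  replace hh : ∀ W k hk, k ≫ h = (y W k hk).h := hh
  have hye : ∀ {W : SchC} {k k' : W ⟶ T} (_ : k = k') (hk : R k) (hk' : R k'),
      y W k hk = y W k' hk' := by
    rintro W k _ rfl _ _; rfl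
  have hcond : ∀ (W : SchC) (k : W ⟶ T) (a : W ⟶ Q.total) (_ : a ≫ Q.π = k ≫ h) (W' : SchC)
      (m : W' ⟶ W) (hm : R (m ≫ k)), (m ≫ a) ≫ Q.π = 𝟙 W' ≫ (y W' (m ≫ k) hm).h := by
    intro W k a e W' m hm
    rw [← hh, Category.assoc, e, Category.id_comp, Category.assoc]
  have key : ∀ (W : SchC) (k : W ⟶ T) (a : W ⟶ Q.total) (e : a ≫ Q.π = k ≫ h),
      ∃! n : W ⟶ N, ∀ (W' : SchC) (m : W' ⟶ W) (hm : R (m ≫ k)),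
        m ≫ n = (y W' (m ≫ k) hm).ψ W' (𝟙 W') (m ≫ a) (hcond W k a e W' m hm) := by
    intro W k a e
    refine sheaf_glue (isSheaf_yoneda N) (pullback_mem_etaleC k hR) (fun W' m hm =>
      (y W' (m ≫ k) hm).ψ W' (𝟙 W') (m ≫ a) (hcond W k a e W' m hm)) ?_
    intro W₁ W₂ l m hm hm'
    change R (m ≫ k) at hm
    change R ((l ≫ m) ≫ k) at hm'
    have h₁ := hy W₁ W₂ l (m ≫ k) hm ((l ≫ m) ≫ k) hm' (Category.assoc _ _ _)
    have e₁ : (l ≫ m ≫ a) ≫ Q.π = (l ≫ 𝟙 W₁) ≫ (y W₁ (m ≫ k) hm).h := by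
      rw [Category.assoc, hcond W k a e W₁ m hm, Category.assoc]
    refine ((y W₁ (m ≫ k) hm).comp_ψ W₁ W₂ l (𝟙 _) (m ≫ a) _ e₁).trans ?_
    have e₂ : (l ≫ m ≫ a) ≫ Q.π = 𝟙 _ ≫ ((y W₁ (m ≫ k) hm).res l).h := by
      rw [e₁, Category.comp_id, Category.id_comp]; rfl
    refine Eq.trans ?_ (ψ_congr h₁ rfl (Category.assoc _ _ _).symm e₂ _)
    exact ψ_congr rfl (by rw [Category.comp_id, Category.id_comp]) rfl _ _
  choose ψ hψ hψu using key
  have hloc : ∀ {W : SchC} (k : W ⟶ T) {U : SchC} {a b : W ⟶ U},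
      (∀ (W' : SchC) (m : W' ⟶ W), R (m ≫ k) → m ≫ a = m ≫ b) → a = b := fun k U a b hab =>
    sheaf_ext (isSheaf_yoneda U) (pullback_mem_etaleC k hR) hab
  have hψ' : ∀ W k a e (hk : R k) e', ψ W k a e = (y W k hk).ψ W (𝟙 W) a e' := by
    intro W k a e hk e'
    have hk' : R (𝟙 W ≫ k) := by rwa [Category.id_comp]
    rw [← Category.id_comp (ψ W k a e), hψ W k a e W (𝟙 W) hk']
    exact ψ_congr (hye (Category.id_comp k) _ _) rfl (Category.id_comp _) _ _
  let x : QuotSec Q α q T :=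
    { h := h
      ψ := ψ
      ψ_q := fun W k a e => hloc k fun W' m hm => by
        rw [← Category.assoc, hψ W k a e W' m hm, ψ_q]
      comp_ψ := fun W W' l k a e e' => hloc (l ≫ k) fun W'' m hm => by
        have hm' : R ((m ≫ l) ≫ k) := by rwa [Category.assoc]
        rw [hψ W' _ _ e' W'' m hm, ← Category.assoc, hψ W k a e W'' (m ≫ l) hm']
        exact ψ_congr (hye (Category.assoc _ _ _) _ _) rfl (Category.assoc _ _ _) _ _
      ψ_smul := fun W g k a e e' => hloc k fun W' m hm => by
        have e₁ := α.map_act m g (ψ W k a e)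
        refine Eq.trans ?_ (show α.act W' (gres G m g) (m ≫ ψ W k a e) = m ≫ _ from e₁.symm)
        rw [hψ W k a e W' m hm, hψ W k _ e' W' m hm]
        have e₂ : (Q.smul (gres G m g) (m ≫ a)) ≫ Q.π = 𝟙 _ ≫ (y W' (m ≫ k) hm).h := by
          rw [smul_π, hcond W k a e]
        refine Eq.trans ?_ ((y W' (m ≫ k) hm).ψ_smul W' (gres G m g) (𝟙 _) (m ≫ a) _ e₂)
        exact ψ_congr rfl rfl (Q.comp_smul _ _ _) _ _ }
  refine ⟨x, fun W k hk => ?_, fun x' hx' => ?_⟩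
  · refine QuotSec.ext (hh W k hk) fun W' l a e e' => ?_
    have hl : R (l ≫ k) := R.downward_closed hk l
    have e₁ : a ≫ Q.π = 𝟙 W' ≫ (y W' (l ≫ k) hl).h := by
      rw [← hh, e, Category.id_comp, Category.assoc]; rfl
    have h₁ := hy W W' l k hk (l ≫ k) hl rfl
    refine (hψ' W' (l ≫ k) a _ hl e₁).trans ?_
    have e₂ : a ≫ Q.π = 𝟙 W' ≫ ((y W k hk).res l).h := by rw [h₁]; exact e₁
    refine (ψ_congr h₁ rfl rfl e₂ e₁).symm.trans ?_
    exact ψ_congr rfl (Category.id_comp l) rfl _ _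
  · have eh : x'.h = h := hhu _ fun W k hk => congrArg QuotSec.h (hx' W k hk)
    refine QuotSec.ext eh fun W k a e e' => hψu W k a e' _ fun W' m hm => ?_
    have e₁ : (m ≫ a) ≫ Q.π = (m ≫ k) ≫ x'.h := by rw [Category.assoc, e, Category.assoc]
    have e₂ : (m ≫ a) ≫ Q.π = 𝟙 _ ≫ (x'.res (m ≫ k)).h := by
      rw [e₁, Category.id_comp]; rfl
    rw [x'.comp_ψ W W' m k a e e₁, ← ψ_congr (hx' W' (m ≫ k) hm) rfl rfl e₂ _]
    exact ψ_congr rfl (Category.id_comp _).symm rfl _ _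

theorem isSheaf_functor : Presieve.IsSheaf etaleC (functor Q α q) :=
  isSheaf_of_glue fun T R hR y hy => QuotSec.existsUnique_glue hR y
    (by rintro W W' l k hk _ hk' rfl; exact hy W W' l k hk hk')

variable (hq : ∀ (T : SchC) (g : G.obj (op T)) (n : T ⟶ N),
  (show T ⟶ N from α.act T g n) ≫ q = Q.smul g (n ≫ q))

theorem act_comp {T T' : SchC} (f : T' ⟶ T) (g : G.obj (op T)) (n : T ⟶ N) :
    f ≫ (show T ⟶ N from α.act T g n) = α.act T' (gres G f g) (f ≫ n) := α.map_act f g n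

include hq in
-- Equivariance forces the value at `g·q(n)` to be `g·n`, and every point in the fibre through
-- `q(n)` is of this form for a unique `g`.
theorem exists_ofPoint {T : SchC} (n : T ⟶ N) : ∃ x : QuotSec Q α q T, x.h = n ≫ q ≫ Q.π ∧
    ∀ W k g e, x.ψ W k (Q.smul g (k ≫ n ≫ q)) e = α.act W g (k ≫ n) := by
  have hex : ∀ (W : SchC) (k : W ⟶ T) (a : W ⟶ Q.total), a ≫ Q.π = k ≫ n ≫ q ≫ Q.π →
      ∃! g : G.obj (op W), Q.smul g (k ≫ n ≫ q) = a := fun W k a e =>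
    Q.existsUnique_smul_eq (by rw [e]; simp only [Category.assoc])
  choose g hg hgu using hex
  have hψ : ∀ W k a e g', Q.smul g' (k ≫ n ≫ q) = a →
      α.act W (g W k a e) (k ≫ n) = α.act W g' (k ≫ n) := fun W k a e g' h => by
    rw [hgu W k a e g' h]
  refine ⟨⟨n ≫ q ≫ Q.π, fun W k a e => α.act W (g W k a e) (k ≫ n), fun W k a e => ?_,
    fun W W' l k a e e' => ?_, fun W g' k a e e' => ?_⟩, rfl, fun W k g' e => hψ W k _ e g' rfl⟩
  · rw [hq, Category.assoc, hg]
  · rw [hψ W' (l ≫ k) (l ≫ a) e' (gres G l (g W k a e)) (by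
      rw [Category.assoc, ← comp_smul, hg])]
    refine (act_comp l _ _).trans ?_
    rw [Category.assoc]
  · rw [hψ W k _ e' (g' * g W k a e) (by rw [PrincipalBundle.mul_smul, hg])]
    exact α.mul_act _ _ _ _

/-- The orbit of a point. -/
def ofPoint {T : SchC} (n : T ⟶ N) : QuotSec Q α q T := (exists_ofPoint hq n).choose

theorem ofPoint_h {T : SchC} (n : T ⟶ N) : (ofPoint hq n).h = n ≫ q ≫ Q.π :=
  (exists_ofPoint hq n).choose_spec.1

theorem ofPoint_ψ {T : SchC} (n : T ⟶ N) (W : SchC) (k : W ⟶ T) (g : G.obj (op W)) (e) :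
    (ofPoint hq n).ψ W k (Q.smul g (k ≫ n ≫ q)) e = α.act W g (k ≫ n) :=
  (exists_ofPoint hq n).choose_spec.2 W k g e

/-- Once `a` is a section of the pulled-back bundle, an equivariant map is determined by its value
at `a`. -/
theorem eq_ofPoint {T : SchC} (x : QuotSec Q α q T) (a : T ⟶ Q.total) (e) :
    x = ofPoint hq (x.ψ T (𝟙 T) a e) := by
  have e₀ : x.h = (ofPoint hq (x.ψ T (𝟙 T) a e)).h := by
    rw [ofPoint_h, ← Category.assoc, x.ψ_q, e, Category.id_comp]
  refine QuotSec.ext e₀ fun W k b hx hy => ?_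
  obtain ⟨g, rfl, -⟩ := Q.existsUnique_smul_eq (a := k ≫ a) (b := b) (by
    rw [hx, Category.assoc, e, Category.id_comp])
  have e₁ : (k ≫ a) ≫ Q.π = k ≫ x.h := by rw [Category.assoc, e, Category.id_comp]
  have e₂ : (k ≫ a) ≫ Q.π = (k ≫ 𝟙 T) ≫ x.h := by rw [e₁, Category.comp_id]
  rw [x.ψ_smul W g k (k ≫ a) e₁ hx]
  have e₃ : Q.smul g (k ≫ a) = Q.smul g (k ≫ x.ψ T (𝟙 T) a e ≫ q) := by rw [x.ψ_q]
  refine Eq.trans ?_ ((ofPoint_ψ hq (x.ψ T (𝟙 T) a e) W k g (by rw [← e₃]; exact hy)).symm.trans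
    (ψ_congr rfl rfl e₃.symm _ _))
  refine congrArg (fun z => α.act W g z) ?_
  refine Eq.trans ?_ (x.comp_ψ T W k (𝟙 T) a e e₂).symm
  exact ψ_congr rfl (Category.comp_id k).symm rfl _ _

theorem ofPoint_ψ_id {T : SchC} (n : T ⟶ N) (a : T ⟶ Q.total) (ha : a = n ≫ q) (e) :
    (ofPoint hq n).ψ T (𝟙 T) a e = n := by
  have e₁ : a = Q.smul 1 (𝟙 T ≫ n ≫ q) := by
    rw [PrincipalBundle.one_smul, Category.id_comp, ha]
  refine (ψ_congr rfl rfl e₁ e (by rw [← e₁]; exact e)).trans ((ofPoint_ψ hq n T (𝟙 T) 1 _).trans ?_)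
  exact (α.one_act _ _).trans (Category.id_comp _)

theorem res_ofPoint {T T' : SchC} (f : T' ⟶ T) (n : T ⟶ N) :
    (ofPoint hq n).res f = ofPoint hq (f ≫ n) := by
  have e₁ : (f ≫ n ≫ q) ≫ Q.π = 𝟙 T' ≫ ((ofPoint hq n).res f).h := by
    change _ = 𝟙 _ ≫ f ≫ (ofPoint hq n).h
    rw [ofPoint_h, Category.id_comp, Category.assoc, Category.assoc]
  refine (eq_ofPoint hq _ (f ≫ n ≫ q) e₁).trans (congrArg _ ?_)
  have e₂ : (n ≫ q) ≫ Q.π = 𝟙 T ≫ (ofPoint hq n).h := by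
    rw [ofPoint_h, Category.id_comp, Category.assoc]
  have e₃ : (f ≫ n ≫ q) ≫ Q.π = (f ≫ 𝟙 T) ≫ (ofPoint hq n).h := by
    rw [Category.assoc, e₂, Category.assoc]
  have := (ofPoint hq n).comp_ψ T T' f (𝟙 T) (n ≫ q) e₂ e₃
  rw [ofPoint_ψ_id hq n _ rfl] at this
  rw [this]
  exact ψ_congr rfl ((Category.id_comp f).trans (Category.comp_id f).symm) rfl _ _

theorem ofPoint_act {T : SchC} (g : G.obj (op T)) (n : T ⟶ N) :
    ofPoint hq (show T ⟶ N from α.act T g n) = ofPoint hq n := by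
  have e₂ : Q.smul g (n ≫ q) ≫ Q.π = 𝟙 T ≫ (ofPoint hq n).h := by
    rw [ofPoint_h, Category.id_comp, smul_π, Category.assoc]
  have e₃ : Q.smul g (n ≫ q) = Q.smul g (𝟙 T ≫ n ≫ q) := by rw [Category.id_comp]
  refine Eq.symm ((eq_ofPoint hq (ofPoint hq n) (Q.smul g (n ≫ q)) e₂).trans (congrArg _ ?_))
  refine (ψ_congr rfl rfl e₃ e₂ (by rw [← e₃]; exact e₂)).trans
    ((ofPoint_ψ hq n T (𝟙 T) g _).trans ?_)
  rw [Category.id_comp]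

include hq in
-- Over an open subset where `Q` has a section, every orbit meets the preimage of this section in
-- exactly one point, so that preimage represents the quotient there.
theorem exists_isUniv (hG : HasZariskiSections.{0} G) :
    ∃ (E : SchC) (ξ : (functor Q α q).obj (op E)), IsUniv (functor Q α q) ξ := by
  refine exists_isUniv_of_local (functor Q α q) isSheaf_functor (fun T x => QuotSec.h x)
    (fun T T' f x => rfl) fun s => ?_
  obtain ⟨V, hs, x, hx⟩ := Q.hasLocalSections hG s
  have hξ : (ofPoint hq (pullback.snd x q)).h = pullback.fst x q ≫ opnι _ V := by
    rw [ofPoint_h, ← Category.assoc, ← pullback.condition, Category.assoc, hx]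
  refine ⟨V, hs, pullback x q, ofPoint hq (pullback.snd x q), ?_, fun T y hy => ?_⟩
  · rw [hξ]
    exact (range_comp_subset (pullback.fst x q) (opnι Q.base V)).trans (range_opnι Q.base V).le
  · obtain ⟨c, hc⟩ := exists_opn_lift V (QuotSec.h y) hy
    have e : (c ≫ x) ≫ Q.π = 𝟙 T ≫ QuotSec.h y := by
      rw [Category.assoc, hx, hc, Category.id_comp]
    refine ⟨pullback.lift c (QuotSec.ψ y T (𝟙 T) (c ≫ x) e) (QuotSec.ψ_q y _ _ _ _).symm, ?_,
      fun f hf => ?_⟩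
    · refine (res_ofPoint hq _ _).trans ?_
      exact (congrArg (ofPoint hq) (pullback.lift_snd _ _ _)).trans (eq_ofPoint hq y _ _).symm
    · replace hf : (ofPoint hq (pullback.snd x q)).res f = y := hf
      have h₁ : f ≫ pullback.fst x q = c := by
        rw [← cancel_mono (opnι Q.base V), hc, Category.assoc, ← hξ]
        exact congrArg QuotSec.h hf
      apply pullback.hom_ext
      · rw [h₁, pullback.lift_fst]
      · rw [pullback.lift_snd]
        rw [res_ofPoint] at hf
        have e₁ : (c ≫ x) ≫ Q.π = 𝟙 T ≫ (ofPoint hq (f ≫ pullback.snd x q)).h := by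
          rw [hf]; exact e
        refine Eq.trans ?_ (ψ_congr hf rfl rfl e₁ e)
        refine (ofPoint_ψ_id hq _ _ ?_ _).symm
        rw [Category.assoc, ← pullback.condition, ← Category.assoc, h₁]

end QuotSec

open QuotSec

/-- A scheme with an action of the group and an equivariant map to a principal bundle is itself
a principal bundle. -/
theorem exists_quotient (hG : HasZariskiSections.{0} G)
    (hq : ∀ (T : SchC) (g : G.obj (op T)) (n : T ⟶ N),
      (show T ⟶ N from α.act T g n) ≫ q = Q.smul g (n ≫ q))
    (ξ : X'.obj (op N)) (hξ : ∀ (T : SchC) (g : G.obj (op T)) (n : T ⟶ N),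
      res X' (show T ⟶ N from α.act T g n) ξ = ρ'.act T g (res X' n ξ)) :
    ∃ (P : PrincipalBundle ρ') (t : P.total ≅ N) (b : P.base ⟶ Q.base),
      (∀ (T : SchC) (g : G.obj (op T)) (a : T ⟶ P.total),
        P.smul g a ≫ t.hom = α.act T g (a ≫ t.hom)) ∧
      res X' t.hom ξ = P.toX ∧ IsPullback P.π (t.hom ≫ q) b Q.π := by
  obtain ⟨E, η, hη⟩ := QuotSec.exists_isUniv (Q := Q) (α := α) hq hG
  let o : ∀ {T : SchC} (n : T ⟶ N), (functor Q α q).obj (op T) := fun n => ofPoint hq n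
  have hcomp : ∀ {T : SchC} (n : T ⟶ N), n ≫ hη.lift (o (𝟙 N)) = hη.lift (o n) := fun n => by
    rw [hη.comp_lift]
    refine congrArg _ ((res_ofPoint hq n (𝟙 N)).trans ?_)
    rw [Category.comp_id]
  have hinj : ∀ {T : SchC} (n n' : T ⟶ N), hη.lift (o n) = hη.lift (o n') →
      ofPoint hq n = ofPoint hq n' := fun n n' h => by
    have := hη.res_lift (o n)
    rw [h, hη.res_lift] at this
    exact this.symm
  -- The total space is `N` itself with the given action, and the projection sends a point to its
  -- orbit.
  let P : PrincipalBundle ρ' :=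
    { base := E
      total := N
      π := hη.lift (o (𝟙 N))
      action := α
      act_π := fun T g n => by
        rw [hcomp, hcomp]
        exact congrArg _ (ofPoint_act hq g n)
      simplyTransitive := fun T n n' h => by
        rw [hcomp, hcomp] at h
        have h₁ := hinj _ _ h
        have h₂ : (n ≫ q) ≫ Q.π = (n' ≫ q) ≫ Q.π := by
          rw [Category.assoc, Category.assoc, ← ofPoint_h hq, ← ofPoint_h hq, h₁]
        obtain ⟨g, hg, hgu⟩ := Q.existsUnique_smul_eq h₂
        refine ⟨g, ?_, fun g' hg' => hgu g' ?_⟩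
        · have e₀ : (n' ≫ q) ≫ Q.π = 𝟙 T ≫ (ofPoint hq n').h := by
            rw [ofPoint_h, Category.id_comp, Category.assoc]
          have e₁ : n' ≫ q = Q.smul g (𝟙 T ≫ n ≫ q) := by rw [Category.id_comp, hg]
          have h₃ := ofPoint_ψ_id hq n' (n' ≫ q) rfl e₀
          have h₄ := ofPoint_ψ hq n T (𝟙 T) g (by rw [← e₁, e₀, h₁])
          refine (congrArg (fun z => α.act T g z) (Category.id_comp n)).symm.trans (h₄.symm.trans ?_)
          exact ((ψ_congr h₁ rfl e₁.symm _ e₀).trans h₃)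
        · change Q.smul g' (n ≫ q) = n' ≫ q
          rw [← hq]
          exact congrArg (· ≫ q) hg'
      locallyTrivial := by
        refine etaleC.superset_covering (fun W k hk => ?_)
          (pullback_mem_etaleC (show E ⟶ Q.base from QuotSec.h η) Q.locallyTrivial)
        obtain ⟨a, ha⟩ := Q.exists_comp_π hk
        have e : a ≫ Q.π = 𝟙 W ≫ (QuotSec.res k η).h := ha.trans (Category.id_comp _).symm
        refine generate_singleton_apply.2 ⟨(QuotSec.res k η).ψ W (𝟙 W) a e, ?_⟩
        rw [hcomp]
        apply hη.hom_ext
        rw [hη.res_lift]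
        exact (eq_ofPoint hq (QuotSec.res k η) a e).symm
      toX := ξ
      equivariant := fun T g n => hξ T g n }
  refine ⟨P, Iso.refl N, QuotSec.h η, fun T g a => ?_, res_id X' ξ, ?_⟩
  · exact (Category.comp_id _).trans (congrArg (fun z => α.act T g z) (Category.comp_id a).symm)
  -- An orbit and a point `a` of `Q` over the same point of the base determine the point of the
  -- orbit lying over `a`.
  · have hex : ∀ (W : SchC) (e : W ⟶ E) (a : W ⟶ Q.total), e ≫ QuotSec.h η = a ≫ Q.π →
        ∃! n : W ⟶ N, n ≫ hη.lift (o (𝟙 N)) = e ∧ n ≫ q = a := by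
      intro W e a hea
      have e₁ : a ≫ Q.π = 𝟙 W ≫ (QuotSec.res e η).h := hea.symm.trans (Category.id_comp _).symm
      refine ⟨(QuotSec.res e η).ψ W (𝟙 W) a e₁, ⟨?_, QuotSec.ψ_q _ _ _ _ _⟩, fun n hn => ?_⟩
      · rw [hcomp]
        apply hη.hom_ext
        rw [hη.res_lift]
        exact (eq_ofPoint hq (QuotSec.res e η) a e₁).symm
      · have h₁ : ofPoint hq n = QuotSec.res e η := by
          have h₂ := hη.res_lift (o n)
          rw [← hcomp, hn.1] at h₂
          exact h₂.symm
        have e₂ : a ≫ Q.π = 𝟙 W ≫ (ofPoint hq n).h := by rw [h₁]; exact e₁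
        exact (ofPoint_ψ_id hq n a hn.2.symm e₂).symm.trans (ψ_congr h₁ rfl rfl e₂ e₁)
    have hw : hη.lift (o (𝟙 N)) ≫ QuotSec.h η = (𝟙 N ≫ q) ≫ Q.π := by
      have h₁ := congrArg QuotSec.h (hη.res_lift (o (𝟙 N)))
      refine (show hη.lift (o (𝟙 N)) ≫ QuotSec.h η = (ofPoint hq (𝟙 N)).h from h₁).trans ?_
      rw [ofPoint_h, Category.assoc]
    exact ⟨⟨hw⟩, ⟨PullbackCone.IsLimit.mk hw
      (fun s => (hex _ s.fst s.snd s.condition).choose)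
      (fun s => (hex _ s.fst s.snd s.condition).choose_spec.1.1)
      (fun s => (congrArg (_ ≫ ·) (Category.id_comp q)).trans
        (hex _ s.fst s.snd s.condition).choose_spec.1.2)
      (fun s m h₁ h₂ => (hex _ s.fst s.snd s.condition).choose_spec.2 m
        ⟨h₁, (congrArg (m ≫ ·) (Category.id_comp q)).symm.trans h₂⟩)⟩⟩

end Quot

end QuiverStack

end

noncomputable section
namespace QuiverStack

/-! ## Categories fibred in groupoids -/

namespace IsFibredInGroupoids

variable {𝒳 : CatOver} (h : IsFibredInGroupoids 𝒳)
include h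

theorem existsUnique_factor {z y x : 𝒳.obj} (φ : y ⟶ x) (φ' : z ⟶ x) (g : 𝒳.p.obj z ⟶ 𝒳.p.obj y)
    (e : g ≫ 𝒳.p.map φ = 𝒳.p.map φ') : ∃! χ : z ⟶ y, 𝒳.p.map χ = g ∧ χ ≫ φ = φ' :=
  (isStronglyCartesian_iff φ).1 (h.cartesian φ) z g φ' e.symm

theorem exists_pullback (x : 𝒳.obj) {T : SchC} (f : T ⟶ 𝒳.p.obj x) :
    ∃ (y : 𝒳.obj) (e : 𝒳.p.obj y ≅ T) (φ : y ⟶ x), 𝒳.p.map φ = e.hom ≫ f := by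
  obtain ⟨y, φ, hφ⟩ := h.exists_lift x f
  have e := IsHomLift.domain_eq 𝒳.p f φ
  subst e
  exact ⟨y, Iso.refl _, φ, (IsHomLift.eq_of_isHomLift 𝒳.p f φ).symm.trans
    (Category.id_comp _).symm⟩

end IsFibredInGroupoids

theorem isFibredInGroupoids_of {𝒳 : CatOver}
    (h₁ : ∀ (x : 𝒳.obj) {T : SchC} (f : T ⟶ 𝒳.p.obj x),
      ∃ (y : 𝒳.obj) (φ : y ⟶ x), 𝒳.p.IsHomLift f φ)
    (h₂ : ∀ {z y x : 𝒳.obj} (φ : y ⟶ x) (φ' : z ⟶ x) (g : 𝒳.p.obj z ⟶ 𝒳.p.obj y),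
      g ≫ 𝒳.p.map φ = 𝒳.p.map φ' → ∃! χ : z ⟶ y, 𝒳.p.map χ = g ∧ χ ≫ φ = φ') :
    IsFibredInGroupoids 𝒳 where
  exists_lift := h₁
  cartesian φ := (isStronglyCartesian_iff φ).2 fun _ g φ' e => h₂ φ φ' g e.symm

theorem isHomLift_of_obj {𝒳 : CatOver} {C : Type 1} [Category.{0} C] (K : C ⥤ 𝒳.obj)
    {y x : C} (φ : y ⟶ x) {T : SchC} (f : T ⟶ 𝒳.p.obj (K.obj x))
    (h : 𝒳.p.IsHomLift f (K.map φ)) : (K ⋙ 𝒳.p).IsHomLift f φ := by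
  have e := IsHomLift.domain_eq 𝒳.p f (K.map φ)
  subst e
  rw [IsHomLift.eq_of_isHomLift 𝒳.p f (K.map φ)]
  exact Functor.IsHomLift.map (p := K ⋙ 𝒳.p) φ

/-- Lifts and factorizations are taken in `𝒳`; the structure morphism to `y` is transported by
composition, and the triangles over `y` commute automatically. -/
theorem isFibredInGroupoids_fibre {𝒳 𝒴 : CatOver} (h : IsFibredInGroupoids 𝒳)
    (F : BasedFunctor 𝒳 𝒴) (y : 𝒴.obj) : IsFibredInGroupoids (fibre F y) := by
  refine isFibredInGroupoids_of (fun t T f => ?_) fun {z s t} φ φ' g e => ?_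
  · let t' : CostructuredArrow F.toFunctor y := t
    obtain ⟨x, ψ, hψ⟩ := h.exists_lift t'.left f
    let s : CostructuredArrow F.toFunctor y := CostructuredArrow.mk (F.map ψ ≫ t'.hom)
    let χ : s ⟶ t' := CostructuredArrow.homMk ψ rfl
    exact ⟨s, χ, isHomLift_of_obj (CostructuredArrow.proj F.toFunctor y) χ f hψ⟩
  · let z' : CostructuredArrow F.toFunctor y := z
    let s' : CostructuredArrow F.toFunctor y := s
    let t' : CostructuredArrow F.toFunctor y := t
    let ψ : s' ⟶ t' := φ
    let ψ' : z' ⟶ t' := φ'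
    obtain ⟨χ, ⟨hχ, hχ'⟩, hu⟩ := h.existsUnique_factor ψ.left ψ'.left g e
    have hw : F.map χ ≫ s'.hom = z'.hom := by
      have h₁ : F.map ψ.left ≫ t'.hom = s'.hom := CostructuredArrow.w ψ
      have h₂ : F.map ψ'.left ≫ t'.hom = z'.hom := CostructuredArrow.w ψ'
      rw [← h₁, ← h₂, ← hχ', F.map_comp, Category.assoc]
    refine ⟨(CostructuredArrow.homMk χ hw : z' ⟶ s'), ⟨hχ, ?_⟩, fun χ₂ hχ₂ => ?_⟩
    · exact CostructuredArrow.hom_ext (f := (CostructuredArrow.homMk χ hw : z' ⟶ s') ≫ ψ) ψ' hχ'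
    · let χ₃ : z' ⟶ s' := χ₂
      refine CostructuredArrow.hom_ext χ₃ (CostructuredArrow.homMk χ hw : z' ⟶ s') ?_
      refine hu χ₃.left ⟨hχ₂.1, ?_⟩
      exact congrArg (fun k : z' ⟶ t' => k.left) hχ₂.2

theorem isFibredInGroupoids_slice {𝒳 : CatOver} (h : IsFibredInGroupoids 𝒳) (u : 𝒳.obj) :
    IsFibredInGroupoids (slice u) := by
  refine isFibredInGroupoids_of (fun t T f => ?_) fun {z s t} φ φ' g e => ?_
  · let t' : Over u := t
    obtain ⟨x, ψ, hψ⟩ := h.exists_lift t'.left f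
    let s : Over u := Over.mk (ψ ≫ t'.hom)
    let χ : s ⟶ t' := Over.homMk ψ rfl
    exact ⟨s, χ, isHomLift_of_obj (Over.forget u) χ f hψ⟩
  · let z' : Over u := z
    let s' : Over u := s
    let t' : Over u := t
    let ψ : s' ⟶ t' := φ
    let ψ' : z' ⟶ t' := φ'
    obtain ⟨χ, ⟨hχ, hχ'⟩, hu⟩ := h.existsUnique_factor ψ.left ψ'.left g e
    have hw : χ ≫ s'.hom = z'.hom := by
      rw [← Over.w ψ, ← Over.w ψ', ← hχ', Category.assoc]
    refine ⟨(Over.homMk χ hw : z' ⟶ s'), ⟨hχ, ?_⟩, fun χ₂ hχ₂ => ?_⟩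
    · exact Over.OverMorphism.ext (f := (Over.homMk χ hw : z' ⟶ s') ≫ ψ) (g := ψ') hχ'
    · let χ₃ : z' ⟶ s' := χ₂
      refine Over.OverMorphism.ext (f := χ₃) (g := (Over.homMk χ hw : z' ⟶ s')) ?_
      refine hu χ₃.left ⟨hχ₂.1, ?_⟩
      exact congrArg (fun k : z' ⟶ t' => k.left) hχ₂.2

/-! ## Products and universal objects -/

/-- `w` is the product of `x` and `y` by means of the projections `a` and `b`. -/
def IsProd {𝒳 : CatOver} {w x y : 𝒳.obj} (a : w ⟶ x) (b : w ⟶ y) : Prop :=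
  ∀ (z : 𝒳.obj) (f : z ⟶ x) (g : z ⟶ y), ∃! h : z ⟶ w, h ≫ a = f ∧ h ≫ b = g

/-- The object of `fibre (classify x) y` given by an object over `x` and `y`. -/
abbrev spanObj {𝒳 : CatOver} {w x y : 𝒳.obj} (a : w ⟶ x) (b : w ⟶ y) :
    (fibre (classify x) y).obj :=
  (CostructuredArrow.mk (S := Over.forget x) (Y := Over.mk a) b :
    CostructuredArrow (Over.forget x) y)

theorem baseMap_spanObj {𝒳 : CatOver} {w x y : 𝒳.obj} (a : w ⟶ x) (b : w ⟶ y) :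
    baseMap (classify x) y (spanObj a b) = 𝒳.p.map b := Category.id_comp _

/-- An object of the fibre product of the slices over `x` and `y` is an object of `𝒳` with morphisms
to both. Representability of the diagonal thereby becomes the existence of binary products in the
total category. -/
theorem isUniversal_spanObj {𝒳 : CatOver} {w x y : 𝒳.obj} {a : w ⟶ x} {b : w ⟶ y}
    (h : IsProd a b) : IsUniversal (spanObj a b) := by
  have hex : ∀ t : CostructuredArrow (Over.forget x) y,
      ∃! f : t ⟶ CostructuredArrow.mk (S := Over.forget x) (Y := Over.mk a) b, True := by
    intro t
    obtain ⟨k, ⟨hk₁, hk₂⟩, hu⟩ := h t.left.left t.left.hom t.hom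
    refine ⟨CostructuredArrow.homMk (Over.homMk k hk₁) hk₂, trivial, fun f _ => ?_⟩
    refine CostructuredArrow.hom_ext _ _ (Over.OverMorphism.ext ?_)
    exact hu _ ⟨Over.w f.left, CostructuredArrow.w f⟩
  exact ⟨IsTerminal.ofUniqueHom (fun t => (hex t).choose)
    (fun t m => (hex t).choose_spec.2 m trivial)⟩

section Terminal

variable {𝒳 : CatOver} (h : IsFibredInGroupoids 𝒳) {t : 𝒳.obj} (ht : IsUniversal t)

/-- The morphism to a universal object. -/
def toUniversal (ht : IsUniversal t) (x : 𝒳.obj) : x ⟶ t := ht.some.from x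

theorem toUniversal_unique (ht : IsUniversal t) {x : 𝒳.obj} (f g : x ⟶ t) : f = g :=
  ht.some.hom_ext f g

include h

/-- The morphisms in a representable category fibred in groupoids. -/
theorem existsUnique_hom_of_universal {x y : 𝒳.obj} (g : 𝒳.p.obj x ⟶ 𝒳.p.obj y)
    (e : g ≫ 𝒳.p.map (toUniversal ht y) = 𝒳.p.map (toUniversal ht x)) :
    ∃! χ : x ⟶ y, 𝒳.p.map χ = g := by
  obtain ⟨χ, hχ, hu⟩ := h.existsUnique_factor (toUniversal ht y) (toUniversal ht x) g e
  exact ⟨χ, hχ.1, fun χ' hχ' => hu χ' ⟨hχ', toUniversal_unique ht _ _⟩⟩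

theorem map_comp_toUniversal {x y : 𝒳.obj} (χ : x ⟶ y) :
    𝒳.p.map χ ≫ 𝒳.p.map (toUniversal ht y) = 𝒳.p.map (toUniversal ht x) := by
  rw [← 𝒳.p.map_comp]
  exact congrArg _ (toUniversal_unique ht _ _)

include ht

theorem hom_ext_of_universal {x y : 𝒳.obj} {f g : x ⟶ y} (e : 𝒳.p.map f = 𝒳.p.map g) : f = g :=
  (existsUnique_hom_of_universal h ht (𝒳.p.map g) (map_comp_toUniversal h ht g)).unique e rfl

/-- With a terminal object `t`, objects and morphisms amount to schemes and morphisms over the base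
of `t`; both descent conditions then follow from the sheaf property of representable functors. -/
theorem isStack_of_universal : IsStack 𝒳 where
  fibred := h
  glue_hom x y g R hR ψ hψ hc := by
    have e : g ≫ 𝒳.p.map (toUniversal ht y) = 𝒳.p.map (toUniversal ht x) := by
      refine sheaf_ext (isSheaf_yoneda _) hR fun W k hk => ?_
      obtain ⟨z, e, φ, hφ⟩ := h.exists_pullback x k
      have hk' : R (𝒳.p.map φ) := by rw [hφ]; exact R.downward_closed hk _
      have h₁ := map_comp_toUniversal h ht (ψ z φ hk')
      rw [hψ, hφ, ← map_comp_toUniversal h ht φ, hφ] at h₁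
      rw [res_yoneda, res_yoneda, ← cancel_epi e.hom]
      simpa only [Category.assoc] using h₁
    obtain ⟨χ, hχ, hu⟩ := existsUnique_hom_of_universal h ht g e
    exact ⟨χ, ⟨hχ, fun z φ hφ => hom_ext_of_universal h ht (by rw [hψ, 𝒳.p.map_comp, hχ])⟩,
      fun χ' hχ' => hu χ' hχ'.1⟩
  glue_obj S R hR σ θ := by
    obtain ⟨α, β, hαβ, hα, hβ, hα'⟩ : ∃ (α : ∀ c, 𝒳.p.obj (σ.obj c) ⟶ c.obj.left)
        (β : ∀ c : R.arrows.category, c.obj.left ⟶ 𝒳.p.obj (σ.obj c)),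
        (∀ c, α c ≫ β c = 𝟙 _) ∧
        (∀ {c c' : R.arrows.category} (u : c' ⟶ c), 𝒳.p.map (σ.map u) ≫ α c =
          α c' ≫ u.hom.left) ∧
        (∀ {c c' : R.arrows.category} (u : c' ⟶ c), u.hom.left ≫ β c =
          β c' ≫ 𝒳.p.map (σ.map u)) ∧ ∀ c, α c = θ.hom.app c :=
      ⟨fun c => θ.hom.app c, fun c => θ.inv.app c, fun c => θ.hom_inv_id_app c,
        fun u => θ.hom.naturality u, fun u => θ.inv.naturality u, fun _ => rfl⟩
    let m : ∀ c : R.arrows.category, c.obj.left ⟶ 𝒳.p.obj t := fun c =>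
      β c ≫ 𝒳.p.map (toUniversal ht (σ.obj c))
    have hm : ∀ {c c' : R.arrows.category} (u : c' ⟶ c), u.hom.left ≫ m c = m c' := by
      intro c c' u
      have h₂ := map_comp_toUniversal h ht (σ.map u)
      change u.hom.left ≫ β c ≫ _ = β c' ≫ _
      rw [← h₂, ← Category.assoc, hβ, Category.assoc]
    -- The structure morphisms of the descent datum to the base of `t` glue to a morphism from `S`,
    -- and a lift of it is the descended object.
    obtain ⟨f, hf, -⟩ := sheaf_glue (isSheaf_yoneda (𝒳.p.obj t)) hR (fun W k hk => m (member k hk))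
      (fun W W' l k hk hk' => hm (c := member k hk) (c' := member (l ≫ k) hk') (memberHom l rfl))
    obtain ⟨x, e, φ, hφ⟩ : ∃ (x : 𝒳.obj) (e : 𝒳.p.obj x ≅ S) (φ : x ⟶ t),
        𝒳.p.map φ = e.hom ≫ f := h.exists_pullback t f
    obtain ⟨δ, hδ, hδ', hδ''⟩ : ∃ δ : ∀ c : R.arrows.category, c.obj.left ⟶ S,
        (∀ c, δ c ≫ f = m c) ∧ (∀ {c c' : R.arrows.category} (u : c' ⟶ c),
          u.hom.left ≫ δ c = δ c') ∧ ∀ c, δ c = c.obj.hom :=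
      ⟨fun c => c.obj.hom, fun c => hf c.obj.left c.obj.hom c.property, fun u => member_w u,
        fun _ => rfl⟩
    have hex : ∀ c : R.arrows.category, ∃ χ : σ.obj c ⟶ x,
        𝒳.p.map χ = α c ≫ δ c ≫ e.inv := by
      intro c
      refine (existsUnique_hom_of_universal h ht _ ?_).exists
      rw [toUniversal_unique ht (toUniversal ht x) φ, hφ]
      simp only [Category.assoc, Iso.inv_hom_id_assoc]
      rw [hδ]
      change α c ≫ β c ≫ _ = _
      rw [← Category.assoc, hαβ, Category.id_comp]
    choose χ hχ using hex
    refine ⟨x, e, { app := χ, naturality := fun c c' u => ?_ }, fun c => ?_⟩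
    · refine Eq.trans ?_ (Category.comp_id _).symm
      apply hom_ext_of_universal h ht
      rw [𝒳.p.map_comp, hχ, hχ, ← Category.assoc, hα, Category.assoc, ← Category.assoc _ _ e.inv,
        hδ']
    · change 𝒳.p.map (χ c) ≫ e.hom = _
      rw [hχ]
      simp only [Category.assoc, Iso.inv_hom_id, Category.comp_id]
      rw [hα', hδ'']
      rfl

theorem exists_prod_of_universal (x y : 𝒳.obj) : ∃ (w : 𝒳.obj) (a : w ⟶ x) (b : w ⟶ y),
    IsProd a b ∧ Nonempty (𝒳.p.obj w ≅
      pullback (𝒳.p.map (toUniversal ht x)) (𝒳.p.map (toUniversal ht y))) := by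
  obtain ⟨w, e, a, ha⟩ := h.exists_pullback x
    (pullback.fst (𝒳.p.map (toUniversal ht x)) (𝒳.p.map (toUniversal ht y)))
  obtain ⟨b, hb, -⟩ := existsUnique_hom_of_universal h ht (x := w) (y := y)
    (e.hom ≫ pullback.snd (𝒳.p.map (toUniversal ht x)) (𝒳.p.map (toUniversal ht y))) (by
      rw [Category.assoc, ← pullback.condition, ← Category.assoc, ← ha, map_comp_toUniversal h ht])
  refine ⟨w, a, b, fun z f g => ?_, ⟨e⟩⟩
  have hw : 𝒳.p.map f ≫ 𝒳.p.map (toUniversal ht x) = 𝒳.p.map g ≫ 𝒳.p.map (toUniversal ht y) := by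
    rw [map_comp_toUniversal h ht, map_comp_toUniversal h ht]
  obtain ⟨k, hk, -⟩ := existsUnique_hom_of_universal h ht (x := z) (y := w)
    (pullback.lift (𝒳.p.map f) (𝒳.p.map g) hw ≫ e.inv) (by
      rw [← map_comp_toUniversal h ht a, ha, Category.assoc, Category.assoc, Iso.inv_hom_id_assoc,
        pullback.lift_fst_assoc, map_comp_toUniversal h ht])
  refine ⟨k, ⟨?_, ?_⟩, fun k' hk' => ?_⟩
  · apply hom_ext_of_universal h ht
    rw [𝒳.p.map_comp, hk, ha, Category.assoc, Iso.inv_hom_id_assoc, pullback.lift_fst]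
  · apply hom_ext_of_universal h ht
    rw [𝒳.p.map_comp, hk, hb, Category.assoc, Iso.inv_hom_id_assoc, pullback.lift_snd]
  · apply hom_ext_of_universal h ht
    rw [hk, ← cancel_mono e.hom, Category.assoc, Iso.inv_hom_id, Category.comp_id]
    apply pullback.hom_ext
    · rw [pullback.lift_fst, Category.assoc, ← ha, ← 𝒳.p.map_comp, hk'.1]
    · rw [pullback.lift_snd, Category.assoc, ← hb, ← 𝒳.p.map_comp, hk'.2]

/-- As `t` is terminal, its product with `y` is `y`, and the base map is an identity. -/
theorem isEtaleAtlas_of_universal : IsEtaleAtlas t := by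
  intro y
  have hp : IsProd (toUniversal ht y) (𝟙 y) := fun z f g =>
    ⟨g, ⟨toUniversal_unique ht _ _, Category.comp_id _⟩, fun k hk => by
      rw [← hk.2, Category.comp_id]⟩
  refine ⟨_, isUniversal_spanObj hp, ?_⟩
  rw [baseMap_spanObj, 𝒳.p.map_id]
  exact ⟨inferInstanceAs (Etale (𝟙 (𝒳.p.obj y).left)),
    inferInstanceAs (Surjective (𝟙 (𝒳.p.obj y).left))⟩

/-- A representable category fibred in groupoids is an algebraic space. -/
theorem isAlgebraicSpace_of_universal : IsAlgebraicSpace 𝒳 where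
  stack := isStack_of_universal h ht
  faithful := ⟨fun e => hom_ext_of_universal h ht e⟩
  diagonal x y := by
    obtain ⟨w, a, b, hab, -⟩ := exists_prod_of_universal h ht x y
    exact ⟨_, isUniversal_spanObj hab⟩
  atlas := ⟨t, isEtaleAtlas_of_universal h ht⟩

/-- The fibre product in question is a fibre product of three affine schemes, hence affine. -/
theorem hasQuasiCompactDiagonal_of_universal (haff : IsAffine (𝒳.p.obj t).left) :
    HasQuasiCompactDiagonal 𝒳 := by
  intro x y hx hy
  obtain ⟨w, a, b, hab, ⟨e⟩⟩ := exists_prod_of_universal h ht x y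
  refine ⟨spanObj a b, isEtaleAtlas_of_universal
    (isFibredInGroupoids_fibre (isFibredInGroupoids_slice h x) _ y) (isUniversal_spanObj hab), ?_⟩
  change CompactSpace (𝒳.p.obj w).left
  have hp := isPullback_left
    (IsPullback.of_hasPullback (𝒳.p.map (toUniversal ht x)) (𝒳.p.map (toUniversal ht y)))
  have e₁ := hp.isoPullback
  have e₂ : (𝒳.p.obj w).left ≅ _ := (Over.forget _).mapIso e
  have : IsAffine (𝒳.p.obj w).left := .of_isIso (e₂ ≪≫ e₁).hom
  infer_instance

end Terminal

/-- A criterion for being an Artin stack. -/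
theorem isArtinStack_of_prod {𝒳 : CatOver} (h : IsStack 𝒳)
    (hprod : ∀ x y : 𝒳.obj, ∃ (w : 𝒳.obj) (a : w ⟶ x) (b : w ⟶ y), IsProd a b ∧
      (IsAffine (𝒳.p.obj x).left → IsAffine (𝒳.p.obj y).left → IsAffine (𝒳.p.obj w).left) ∧
      (IsPoint x → IsPoint y → LocallyOfFiniteType (𝒳.p.obj w).hom))
    (u : 𝒳.obj) (hu : ∀ y : 𝒳.obj, ∃ (w : 𝒳.obj) (a : w ⟶ u) (b : w ⟶ y), IsProd a b ∧
      Smooth (𝒳.p.map b).left ∧ Surjective (𝒳.p.map b).left)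
    (hu' : LocallyOfFiniteType (𝒳.p.obj u).hom) (hu'' : QuasiCompact (𝒳.p.obj u).hom) :
    IsArtinStack 𝒳 := by
  have hf : ∀ x y : 𝒳.obj, IsFibredInGroupoids (fibre (classify x) y) := fun x y =>
    isFibredInGroupoids_fibre (isFibredInGroupoids_slice h.fibred x) _ y
  have hd : ∀ x y : 𝒳.obj, IsAlgebraicSpace (fibre (classify x) y) := fun x y => by
    obtain ⟨w, a, b, hab, -⟩ := hprod x y
    exact isAlgebraicSpace_of_universal (hf x y) (isUniversal_spanObj hab)
  refine ⟨h, hd, ⟨fun x y hx hy => ?_, fun x y hx hy => ?_⟩, ⟨u, fun y => ⟨hd u y, ?_⟩, hu', hu''⟩,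
    fun x hx => ?_⟩
  · obtain ⟨w, a, b, hab, haff, -⟩ := hprod x y
    refine ⟨_, isEtaleAtlas_of_universal (hf x y) (isUniversal_spanObj hab), ?_⟩
    have : IsAffine (𝒳.p.obj w).left := haff hx hy
    exact inferInstanceAs (CompactSpace (𝒳.p.obj w).left)
  · obtain ⟨w, a, b, hab, haff, -⟩ := hprod x y
    exact hasQuasiCompactDiagonal_of_universal (hf x y) (isUniversal_spanObj hab) (haff hx hy)
  · obtain ⟨w, a, b, hab, h₁, h₂⟩ := hu y
    refine ⟨_, isEtaleAtlas_of_universal (hf u y) (isUniversal_spanObj hab), ?_⟩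
    rw [baseMap_spanObj]
    exact ⟨h₁, h₂⟩
  · obtain ⟨w, a, b, hab, haff, hft⟩ := hprod x x
    -- A ℂ-point lies over a copy of Spec ℂ, so affineness of products over affine bases applies to
    -- its stabilizer.
    have : IsAffine (𝒳.p.obj x).left := by
      obtain ⟨e⟩ := hx
      have e₁ : 𝒳.p.obj x ≅ Over.mk (𝟙 _) := e.uniqueUpToIso Over.mkIdTerminal
      exact .of_isIso (show (𝒳.p.obj x).left ≅ Spec (CommRingCat.of ℂ) from (Over.forget _).mapIso e₁).hom
    exact ⟨_, isUniversal_spanObj hab, haff this this, hft hx hx⟩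

end QuiverStack

end

noncomputable section
namespace QuiverStack

open PrincipalBundle

/-! ## Quotient stacks are Artin stacks -/

variable {G : SchCᵒᵖ ⥤ GrpCat.{0}} {X : SchCᵒᵖ ⥤ Type} {ρ : GroupAction G X}

instance isZariskiLocalAtTarget_smooth : IsZariskiLocalAtTarget (@Smooth : MorphismProperty Scheme.{0}) :=
  HasRingHomProperty.instIsZariskiLocalAtTarget @Smooth

instance isZariskiLocalAtTarget_locallyOfFiniteType :
    IsZariskiLocalAtTarget (@LocallyOfFiniteType : MorphismProperty Scheme.{0}) :=
  HasRingHomProperty.instIsZariskiLocalAtTarget @LocallyOfFiniteType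

instance isZariskiLocalAtTarget_isAffineHom :
    IsZariskiLocalAtTarget (@IsAffineHom : MorphismProperty Scheme.{0}) :=
  @HasAffineProperty.instIsZariskiLocalAtTarget _ _ instHasAffinePropertyIsAffineHomIsAffine

/-- Products of bundles over a scheme `N` which is the fibre product of their total spaces
over `X`. -/
theorem exists_prod_quotientStack (hG : HasZariskiSections.{0} G) {X₀ : SchC} {x₀ : X.obj (op X₀)}
    (hX : IsUniv X x₀) (P Q : PrincipalBundle ρ) :
    ∃ (W : PrincipalBundle ρ) (a : W ⟶ P) (b : W ⟶ Q),
      IsProd (𝒳 := quotientStack ρ) a b ∧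
      ∀ (M : MorphismProperty Scheme.{0}) [IsZariskiLocalAtTarget M] [M.IsStableUnderBaseChange],
        M (hX.lift P.toX).left → M (bas b).left := by
  let p := hX.lift P.toX
  let q := hX.lift Q.toX
  let N : SchC := pullback p q
  have hcond : ∀ {T : SchC} (c : T ⟶ P.total) (d : T ⟶ Q.total),
      c ≫ p = d ≫ q ↔ res X c P.toX = res X d Q.toX := fun c d => by
    rw [hX.comp_lift, hX.comp_lift]
    exact ⟨fun h => by rw [← hX.res_lift (res X c P.toX), h, hX.res_lift], fun h => by rw [h]⟩
  have hact : ∀ {T : SchC} (g : G.obj (op T)) (n : T ⟶ N),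
      P.smul g (n ≫ pullback.fst p q) ≫ p = Q.smul g (n ≫ pullback.snd p q) ≫ q := fun g n => by
    rw [hcond, res_smul_toX, res_smul_toX]
    congr 1
    rw [← hcond, Category.assoc, pullback.condition, Category.assoc]
  -- The diagonal action on the fibre product of the two total spaces over `X`; it is well defined
  -- because both maps to `X` are equivariant.
  let α : GroupAction G (yoneda.obj N) :=
    { act := fun T g n => pullback.lift _ _ (hact g n)
      one_act := fun T n => pullback.hom_ext
        (by rw [pullback.lift_fst, PrincipalBundle.one_smul])
        (by rw [pullback.lift_snd, PrincipalBundle.one_smul])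
      mul_act := fun T g h n => pullback.hom_ext
        (by rw [pullback.lift_fst, pullback.lift_fst, pullback.lift_fst,
          PrincipalBundle.mul_smul])
        (by rw [pullback.lift_snd, pullback.lift_snd, pullback.lift_snd,
          PrincipalBundle.mul_smul])
      map_act := fun {T T'} f g n => by
        change f ≫ pullback.lift _ _ (hact g n) = pullback.lift _ _ (hact (gres G f g) (f ≫ n))
        apply pullback.hom_ext
        · rw [Category.assoc, pullback.lift_fst, pullback.lift_fst, comp_smul, Category.assoc]
        · rw [Category.assoc, pullback.lift_snd, pullback.lift_snd, comp_smul, Category.assoc] }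
  have hfst : ∀ {T : SchC} (g : G.obj (op T)) (n : T ⟶ N),
      (show T ⟶ N from α.act T g n) ≫ pullback.fst p q = P.smul g (n ≫ pullback.fst p q) :=
    fun g n => pullback.lift_fst _ _ _
  have hsnd : ∀ {T : SchC} (g : G.obj (op T)) (n : T ⟶ N),
      (show T ⟶ N from α.act T g n) ≫ pullback.snd p q = Q.smul g (n ≫ pullback.snd p q) :=
    fun g n => pullback.lift_snd _ _ _
  -- The quotient of `N` is the scheme of isomorphisms between the two bundles; `N` over it serves
  -- as the product of `P` and `Q`.
  obtain ⟨W, t, b, ht, hξ, hpb⟩ := exists_quotient (ρ' := ρ) (Q := Q) (α := α) (q := pullback.snd p q) hG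
    (fun T g n => hsnd g n) (res X (pullback.fst p q) P.toX) (fun T g n => by
      rw [res_res, res_res, hfst, res_smul_toX])
  obtain ⟨φ, hφ⟩ := exists_hom (P := W) (Q := P) (t.hom ≫ pullback.fst p q) (fun T g c => by
    rw [← Category.assoc, ht, ← Category.assoc]
    exact hfst g _) (by rw [← res_res]; exact hξ)
  obtain ⟨ψ, hψ⟩ := exists_hom (P := W) (Q := Q) (t.hom ≫ pullback.snd p q) (fun T g c => by
    rw [← Category.assoc, ht, ← Category.assoc]
    exact hsnd g _) (by
      rw [← res_res, ← (hcond _ _).1 pullback.condition]; exact hξ)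
  have hb : b = bas ψ := W.hom_ext_of_π (by rw [← tot_comp_π, hψ, hpb.w])
  have key : ∀ (Z : PrincipalBundle ρ) (f : Z ⟶ P) (g : Z ⟶ Q),
      ∃! h : Z ⟶ W, h ≫ φ = f ∧ h ≫ ψ = g := fun Z f g => by
    have hfg : tot f ≫ p = tot g ≫ q := (hcond _ _).2 (by rw [res_tot_toX, res_tot_toX])
    obtain ⟨χ, hχ⟩ := exists_hom (P := Z) (Q := W) (pullback.lift (tot f) (tot g) hfg ≫ t.inv)
      (fun T g c => by
        rw [← cancel_mono t.hom, ht]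
        simp only [Category.assoc, Iso.inv_hom_id, Category.comp_id]
        apply pullback.hom_ext
        · rw [hfst]
          simp only [Category.assoc, pullback.lift_fst, smul_comp_tot]
        · rw [hsnd]
          simp only [Category.assoc, pullback.lift_snd, smul_comp_tot])
      (by
        rw [← hξ, res_res, res_res]
        simp only [Category.assoc, pullback.lift_fst, Iso.inv_hom_id,
          Category.comp_id, res_tot_toX])
    refine ⟨χ, ⟨hom_ext ?_, hom_ext ?_⟩, fun χ₁ ⟨h₁, h₂⟩ => hom_ext ?_⟩
    · rw [tot_comp, hχ, hφ]
      simp only [Category.assoc, Iso.inv_hom_id_assoc, pullback.lift_fst]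
    · rw [tot_comp, hχ, hψ]
      simp only [Category.assoc, Iso.inv_hom_id_assoc, pullback.lift_snd]
    · rw [hχ, ← cancel_mono t.hom, Category.assoc, Iso.inv_hom_id, Category.comp_id]
      apply pullback.hom_ext
      · rw [pullback.lift_fst, ← h₁, tot_comp, hφ, Category.assoc]
      · rw [pullback.lift_snd, ← h₂, tot_comp, hψ, Category.assoc]
  refine ⟨W, φ, ψ, fun Z f g => key Z f g, fun M _ _ hM => ?_⟩
  · rw [← hb]
    -- Pulled back to the total space of `Q`, the base map becomes the projection from `N`, a base
    -- change of the map from the total space of `P` to `X`.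
    refine property_of_hasLocalSections hpb (Q.hasLocalSections hG) ?_
    have : IsIso t.hom.left := inferInstanceAs (IsIso ((Over.forget _).map t.hom))
    have h₁ : M (pullback.snd p q).left :=
      M.of_isPullback (isPullback_left (IsPullback.of_hasPullback p q)) hM
    exact (Over.comp_left _ _ _ t.hom (pullback.snd p q)) ▸
      (M.cancel_left_of_respectsIso t.hom.left _).2 h₁

/-! ### Trivial bundles and the action map -/

/-- Points of the total space of the trivial bundle over `S`. -/
@[ext]
structure TrivialPoint (G : SchCᵒᵖ ⥤ GrpCat.{0}) (S T : SchC) : Type where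
  base : T ⟶ S
  elem : G.obj (op T)

/-- Restriction of points of the trivial bundle. -/
def TrivialPoint.res {S T T' : SchC} (k : T' ⟶ T) (x : TrivialPoint G S T) :
    TrivialPoint G S T' :=
  ⟨k ≫ x.base, gres G k x.elem⟩

theorem TrivialPoint.res_id' {S T : SchC} (x : TrivialPoint G S T) : x.res (𝟙 T) = x :=
  TrivialPoint.ext (Category.id_comp _) (gres_id G _)

theorem TrivialPoint.res_res' {S T T' T'' : SchC} (f : T' ⟶ T) (g : T'' ⟶ T')
    (x : TrivialPoint G S T) : (x.res f).res g = x.res (g ≫ f) :=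
  TrivialPoint.ext (Category.assoc _ _ _).symm (gres_gres G f g _)

/-- The functor of points of the total space of the trivial bundle over `S`. -/
def trivialFunctor (G : SchCᵒᵖ ⥤ GrpCat.{0}) (S : SchC) : SchCᵒᵖ ⥤ Type where
  obj T := TrivialPoint G S T.unop
  map k := TypeCat.ofHom fun x => x.res k.unop
  map_id T := ConcreteCategory.hom_ext _ _ fun x => TrivialPoint.res_id' x
  map_comp k l := ConcreteCategory.hom_ext _ _ fun x =>
    (TrivialPoint.res_res' k.unop l.unop x).symm

/-- The trivial bundle, as a torsor. -/
def trivialTorsor (ρ : GroupAction G X) {S : SchC} (ξ : X.obj (op S)) : Torsor.{0} ρ S where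
  F := trivialFunctor G S
  p T (x : TrivialPoint G S T) := x.base
  p_res T T' f x := rfl
  act T g (x : TrivialPoint G S T) := (⟨x.base, g * x.elem⟩ : TrivialPoint G S T)
  one_act T x := TrivialPoint.ext rfl (one_mul _)
  mul_act T g h x := TrivialPoint.ext rfl (mul_assoc _ _ _)
  res_act T T' f g x := TrivialPoint.ext rfl (gres_mul G _ _ _)
  p_act T g x := rfl
  simplyTransitive T (x y : TrivialPoint G S T) h := ⟨y.elem * x.elem⁻¹,
    TrivialPoint.ext h (inv_mul_cancel_right _ _), fun g hg =>
      eq_mul_inv_of_mul_eq (congrArg TrivialPoint.elem hg)⟩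
  locallyTrivial := ⟨⊤, etaleC.top_mem S, fun T f _ => ⟨(⟨f, 1⟩ : TrivialPoint G S T), rfl⟩⟩
  toX T (x : TrivialPoint G S T) := ρ.act T x.elem (res X x.base ξ)
  toX_res T T' f (x : TrivialPoint G S T) := by
    rw [ρ.res_act, res_res]
    rfl
  toX_act T g x := ρ.mul_act _ _ _ _

theorem isUniv_trivialFunctor {S G₀ : SchC} {γ : G.obj (op G₀)} (hγ : IsUnivElement G γ) :
    IsUniv (trivialFunctor G S) (E := S ⨯ G₀)
      (⟨prod.fst, gres G prod.snd γ⟩ : TrivialPoint G S (S ⨯ G₀)) := by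
  intro T (x : TrivialPoint G S T)
  obtain ⟨k, hk, hku⟩ := hγ T x.elem
  refine ⟨prod.lift x.base k, TrivialPoint.ext (prod.lift_fst _ _) ?_, fun f hf => ?_⟩
  · refine (gres_gres G _ _ _).trans ?_
    rw [← hk]
    exact congrArg (fun z => gres G z γ) (prod.lift_snd x.base k)
  · apply prod.hom_ext
    · rw [prod.lift_fst]; exact congrArg TrivialPoint.base hf
    · rw [prod.lift_snd]
      exact hku _ ((gres_gres G _ _ _).symm.trans (congrArg TrivialPoint.elem hf))

/-- A bundle with a given section, inducing a given map to `X`. -/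
theorem exists_trivial (ρ : GroupAction G X) {S : SchC} (ξ : X.obj (op S)) {G₀ : SchC}
    {γ : G.obj (op G₀)} (hγ : IsUnivElement G γ) :
    ∃ (P : PrincipalBundle ρ) (e : P.base ≅ S) (s : P.base ⟶ P.total), s ≫ P.π = 𝟙 _ ∧
      res X s P.toX = res X e.hom ξ ∧ ∃ t : P.total ≅ S ⨯ G₀, t.hom ≫ prod.fst = P.π ≫ e.hom ∧
        P.toX = ρ.act _ (gres G (t.hom ≫ prod.snd) γ) (res X (P.π ≫ e.hom) ξ) := by
  have hu := isUniv_trivialFunctor (S := S) hγ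
  obtain ⟨s, hs, -⟩ := hu S (⟨𝟙 S, 1⟩ : TrivialPoint G S S)
  refine ⟨(trivialTorsor ρ ξ).bundle hu, Iso.refl S, s, congrArg TrivialPoint.base hs, ?_,
    Iso.refl (S ⨯ G₀), (Category.id_comp _).trans (Category.comp_id _).symm, ?_⟩
  · have h := (trivialTorsor ρ ξ).toX_res (S ⨯ G₀) S s
      (⟨prod.fst, gres G prod.snd γ⟩ : TrivialPoint G S (S ⨯ G₀))
    exact h.symm.trans ((congrArg ((trivialTorsor ρ ξ).toX S) hs).trans
      ((ρ.one_act _ _).trans rfl))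
  · change ρ.act _ (gres G prod.snd γ) (res X prod.fst ξ) = ρ.act _ (gres G (𝟙 _ ≫ prod.snd) γ)
      (res X (prod.fst ≫ 𝟙 S) ξ)
    rw [Category.id_comp, Category.comp_id]

theorem isIso_hom_terminal : IsIso (⊤_ SchC).hom := by
  have e : (⊤_ SchC) ≅ Over.mk (𝟙 _) := terminalIsTerminal.uniqueUpToIso Over.mkIdTerminal
  have h := Over.w e.hom
  have : IsIso e.hom.left := inferInstanceAs (IsIso ((Over.forget _).map e.hom))
  rw [← h]
  change IsIso (e.hom.left ≫ 𝟙 _)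
  infer_instance

theorem isIso_hom_of_isTerminal {T : SchC} (h : IsTerminal T) : IsIso T.hom := by
  have e : T ≅ Over.mk (𝟙 _) := h.uniqueUpToIso Over.mkIdTerminal
  have h := Over.w e.hom
  have : IsIso e.hom.left := inferInstanceAs (IsIso ((Over.forget _).map e.hom))
  rw [← h]
  change IsIso (e.hom.left ≫ 𝟙 _)
  infer_instance

theorem property_prod_fst {M : MorphismProperty Scheme.{0}} [M.IsStableUnderBaseChange]
    {Y Z : SchC} (hZ : M Z.hom) : M (prod.fst : Y ⨯ Z ⟶ Y).left := by
  have h : IsPullback (prod.snd : Y ⨯ Z ⟶ Z) prod.fst (terminal.from Z) (terminal.from Y) :=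
    IsPullback.flip (IsPullback.of_is_product' (Limits.prodIsProd _ _) terminalIsTerminal)
  refine M.of_isPullback (isPullback_left h) ?_
  have h₁ : (terminal.from Z).left ≫ (⊤_ SchC).hom = Z.hom := Over.w _
  have := isIso_hom_terminal
  rwa [← M.cancel_right_of_respectsIso _ (⊤_ SchC).hom, h₁]

/-- The action map inherits the properties of the group scheme. -/
theorem property_act {M : MorphismProperty Scheme.{0}} [M.IsStableUnderBaseChange] {G₀ X₀ : SchC}
    {γ : G.obj (op G₀)} (hM : M G₀.hom) {x₀ : X.obj (op X₀)} (hX : IsUniv X x₀) :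
    M (hX.lift (ρ.act _ (gres G prod.snd γ) (res X (prod.fst : X₀ ⨯ G₀ ⟶ X₀) x₀))).left := by
  let m := hX.lift (ρ.act _ (gres G prod.snd γ) (res X (prod.fst : X₀ ⨯ G₀ ⟶ X₀) x₀))
  let m' := hX.lift (ρ.act _ (gres G prod.snd γ)⁻¹ (res X (prod.fst : X₀ ⨯ G₀ ⟶ X₀) x₀))
  have hm : ∀ {T : SchC} (f : T ⟶ X₀ ⨯ G₀),
      res X (f ≫ m) x₀ = ρ.act _ (gres G (f ≫ prod.snd) γ) (res X (f ≫ prod.fst) x₀) := fun f => by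
    rw [← res_res, hX.res_lift, ρ.res_act, gres_gres, res_res]
  have hm' : ∀ {T : SchC} (f : T ⟶ X₀ ⨯ G₀),
      res X (f ≫ m') x₀ = ρ.act _ (gres G (f ≫ prod.snd) γ)⁻¹ (res X (f ≫ prod.fst) x₀) :=
    fun f => by
      rw [← res_res, hX.res_lift, ρ.res_act, gres_inv, gres_gres, res_res]
  -- The action map is the first projection preceded by the automorphism (x, g) ↦ (gx, g), so it
  -- inherits the properties of the projection.
  obtain ⟨e, he⟩ : ∃ e : X₀ ⨯ G₀ ≅ X₀ ⨯ G₀, e.hom ≫ prod.fst = m := ⟨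
    { hom := prod.lift m prod.snd
      inv := prod.lift m' prod.snd
      hom_inv_id := by
        apply prod.hom_ext
        · apply hX.hom_ext
          rw [Category.assoc, prod.lift_fst, hm', prod.lift_snd, prod.lift_fst,
            ← Category.id_comp m, hm, ← ρ.mul_act, Category.id_comp, inv_mul_cancel, ρ.one_act]
        · rw [Category.assoc, prod.lift_snd, prod.lift_snd, Category.id_comp]
      inv_hom_id := by
        apply prod.hom_ext
        · apply hX.hom_ext
          rw [Category.assoc, prod.lift_fst, hm, prod.lift_snd, prod.lift_fst,
            ← Category.id_comp m', hm', ← ρ.mul_act, Category.id_comp, mul_inv_cancel, ρ.one_act]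
        · rw [Category.assoc, prod.lift_snd, prod.lift_snd, Category.id_comp] },
    prod.lift_fst _ _⟩
  have : IsIso e.hom.left := inferInstanceAs (IsIso ((Over.forget _).map e.hom))
  change M m.left
  rw [← he]
  exact (Over.comp_left _ _ _ e.hom prod.fst) ▸
    (M.cancel_left_of_respectsIso e.hom.left _).2 (property_prod_fst hM)

/-- Quotients of separated schemes of finite type by smooth affine special groups are
Artin stacks. -/
theorem isArtinStack_quotientStack {G₀ X₀ : SchC} {γ : G.obj (op G₀)} (hγ : IsUnivElement G γ)
    (hG : HasZariskiSections.{0} G) (hG' : HasZariskiSections.{1} G) (hsm : Smooth G₀.hom)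
    (hsurj : Surjective G₀.hom) (haff : IsAffine G₀.left) {x₀ : X.obj (op X₀)} (hX : IsUniv X x₀)
    (hsep : IsSeparated X₀.hom) (hft : LocallyOfFiniteType X₀.hom) (hqc : QuasiCompact X₀.hom)
    (ρ : GroupAction G X) : IsArtinStack (quotientStack ρ) := by
  -- The atlas is the tautological morphism from `X₀` to the quotient, given by the trivial bundle.
  obtain ⟨U, e, s, hs, hsX, t, ht, htX⟩ := exists_trivial ρ x₀ hγ
  have haffG : IsAffineHom G₀.hom := inferInstance
  have he : e.hom.left ≫ X₀.hom = U.base.hom := Over.w e.hom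
  have heiso : IsIso e.hom.left := inferInstanceAs (IsIso ((Over.forget _).map e.hom))
  refine isArtinStack_of_prod (isStack_quotientStack hγ hG' hX.isSheaf ρ) (fun P Q => ?_) U
    (fun Q => ?_) ?_ ?_
  · obtain ⟨W, a, b, hab, hM⟩ := exists_prod_quotientStack (ρ := ρ) hG hX P Q
    refine ⟨W, a, b, hab, fun hP hQ => ?_, fun hP hQ => ?_⟩
    · have : IsAffine (PrincipalBundle.base P).left := hP
      have : IsAffine (PrincipalBundle.base Q).left := hQ
      have : IsAffineHom (PrincipalBundle.π P).left :=
        property_π (P := @IsAffineHom) P hγ hG haffG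
      have : IsAffine (PrincipalBundle.total P).left := isAffine_of_isAffineHom (PrincipalBundle.π P).left
      have hw := Over.w (hX.lift (PrincipalBundle.toX P))
      -- The total space is affine over an affine base, hence affine over ℂ; as `X₀` is separated,
      -- its map to `X₀` is affine as well.
      have : IsAffineHom ((hX.lift (PrincipalBundle.toX P)).left ≫ X₀.hom) := by
        rw [hw]; infer_instance
      have h₁ : IsAffineHom (hX.lift (PrincipalBundle.toX P)).left :=
        MorphismProperty.of_postcomp (W := @IsAffineHom) (W' := @IsSeparated) _ X₀.hom hsep this
      have h₂ : IsAffineHom (bas b).left := hM @IsAffineHom h₁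
      exact @isAffine_of_isAffineHom _ _ (bas b).left h₂ hQ
    · obtain ⟨hP⟩ := hP
      obtain ⟨hQ⟩ := hQ
      have : IsIso (PrincipalBundle.base P).hom := isIso_hom_of_isTerminal hP
      have : IsIso (PrincipalBundle.base Q).hom := isIso_hom_of_isTerminal hQ
      have : LocallyOfFiniteType (PrincipalBundle.π P).left :=
        property_π (P := @LocallyOfFiniteType) P hγ hG inferInstance
      have hw := Over.w (hX.lift (PrincipalBundle.toX P))
      have hw' : (PrincipalBundle.π P).left ≫ (PrincipalBundle.base P).hom =
        (PrincipalBundle.total P).hom := Over.w (PrincipalBundle.π P)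
      have : LocallyOfFiniteType ((hX.lift (PrincipalBundle.toX P)).left ≫ X₀.hom) := by
        rw [hw, ← hw']; infer_instance
      have h₁ : LocallyOfFiniteType (hX.lift (PrincipalBundle.toX P)).left :=
        locallyOfFiniteType_of_comp _ X₀.hom
      have h₂ : LocallyOfFiniteType (bas b).left := hM @LocallyOfFiniteType h₁
      have hw₃ : (bas b).left ≫ (PrincipalBundle.base Q).hom = W.base.hom := Over.w (bas b)
      change LocallyOfFiniteType W.base.hom
      rw [← hw₃]
      infer_instance
  · obtain ⟨W, a, b, hab, hM⟩ := exists_prod_quotientStack (ρ := ρ) hG hX U Q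
    have hU : ∀ (M : MorphismProperty Scheme.{0}) [IsZariskiLocalAtTarget M]
        [M.IsStableUnderBaseChange], M G₀.hom → M (bas b).left := fun M _ _ h => by
      refine hM M ?_
      have h₁ := property_act (M := M) (ρ := ρ) (γ := γ) h hX
      -- For the trivial bundle over `X₀` the map from the total space to `X` is the action map, so
      -- smoothness and surjectivity are those of the group scheme.
      have h₂ : hX.lift U.toX =
          t.hom ≫ hX.lift (ρ.act _ (gres G prod.snd γ) (res X (prod.fst : X₀ ⨯ G₀ ⟶ X₀) x₀)) := by
        rw [hX.comp_lift, ρ.res_act, gres_gres, res_res, ht, htX]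
      have : IsIso t.hom.left := inferInstanceAs (IsIso ((Over.forget _).map t.hom))
      rw [h₂]
      exact (Over.comp_left _ _ _ t.hom _) ▸ (M.cancel_left_of_respectsIso t.hom.left _).2 h₁
    exact ⟨W, a, b, hab, hU @Smooth hsm, hU @Surjective hsurj⟩
  · change LocallyOfFiniteType U.base.hom
    rw [← he]
    infer_instance
  · change QuasiCompact U.base.hom
    rw [← he]
    infer_instance

end QuiverStack

end

noncomputable section
namespace QuiverStack

open PrincipalBundle

/-! ## Morphisms of quotient stacks induced by equivariant maps -/

variable {G : SchCᵒᵖ ⥤ GrpCat.{0}} {X X' : SchCᵒᵖ ⥤ Type} {ρ : GroupAction G X}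
  {ρ' : GroupAction G X'}

/-- Equivariant maps between functors with an action. -/
structure EquivariantMap (ρ' : GroupAction G X') (ρ : GroupAction G X) where
  app : ∀ T : SchC, X'.obj (op T) → X.obj (op T)
  res_app : ∀ {T T' : SchC} (f : T' ⟶ T) (x : X'.obj (op T)),
    res X f (app T x) = app T' (res X' f x)
  act_app : ∀ (T : SchC) (g : G.obj (op T)) (x : X'.obj (op T)),
    app T (ρ'.act T g x) = ρ.act T g (app T x)

/-- The change of the target of the equivariant map of a bundle. -/
def PrincipalBundle.mapX (η : EquivariantMap ρ' ρ) (P : PrincipalBundle ρ') :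
    PrincipalBundle ρ where
  base := P.base
  total := P.total
  π := P.π
  action := P.action
  act_π := P.act_π
  simplyTransitive := P.simplyTransitive
  locallyTrivial := P.locallyTrivial
  toX := η.app _ P.toX
  equivariant T g a := by
    refine (η.res_app _ _).trans ?_
    refine (congrArg (η.app T) (P.equivariant T g a)).trans ?_
    refine (η.act_app _ _ _).trans ?_
    exact congrArg (ρ.act T g) (η.res_app a P.toX).symm

/-- The morphism of quotient stacks induced by an equivariant map. -/
def EquivariantMap.mapStack (η : EquivariantMap ρ' ρ) :
    BasedFunctor (quotientStack ρ') (quotientStack ρ) where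
  toFunctor :=
    { obj := fun P => PrincipalBundle.mapX η P
      map := fun {P Q} f =>
        { base := PrincipalBundle.Hom.base (P := P) (Q := Q) f
          total := PrincipalBundle.Hom.total (P := P) (Q := Q) f
          comm := PrincipalBundle.Hom.comm f
          equivariant := PrincipalBundle.Hom.equivariant f
          toX := (η.res_app _ _).trans (congrArg (η.app _) (PrincipalBundle.Hom.toX f)) }
      map_id := fun _ => rfl
      map_comp := fun _ _ => rfl }
  w := rfl

variable (η : EquivariantMap ρ' ρ)

/-- The morphism of total spaces of a morphism from the image of `P`. -/
def ftot {η : EquivariantMap ρ' ρ} {Q : PrincipalBundle ρ} {P : PrincipalBundle ρ'}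
    (φ : P.mapX η ⟶ Q) : P.total ⟶ Q.total := tot φ

/-- The morphism of bases of a morphism from the image of `P`. -/
def fbas {η : EquivariantMap ρ' ρ} {Q : PrincipalBundle ρ} {P : PrincipalBundle ρ'}
    (φ : P.mapX η ⟶ Q) : P.base ⟶ Q.base := bas φ

section

variable {η} {Q : PrincipalBundle ρ} {P : PrincipalBundle ρ'}

theorem isPullback_ftot (φ : P.mapX η ⟶ Q) : IsPullback (ftot φ) P.π Q.π (fbas φ) :=
  isPullback_tot φ

theorem ftot_comp_π (φ : P.mapX η ⟶ Q) : ftot φ ≫ Q.π = P.π ≫ fbas φ := (isPullback_ftot φ).w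

theorem res_ftot (φ : P.mapX η ⟶ Q) : res X (ftot φ) Q.toX = η.app _ P.toX := res_tot_toX φ

theorem smul_comp_ftot (φ : P.mapX η ⟶ Q) {T : SchC} (g : G.obj (op T)) (a : T ⟶ P.total) :
    P.smul g a ≫ ftot φ = Q.smul g (a ≫ ftot φ) := smul_comp_tot φ g a

theorem exists_ftot_eq (t : P.total ⟶ Q.total)
    (ht : ∀ (T : SchC) (g : G.obj (op T)) (a : T ⟶ P.total),
      P.smul g a ≫ t = Q.smul g (a ≫ t))
    (hX : res X t Q.toX = η.app _ P.toX) : ∃ φ : P.mapX η ⟶ Q, ftot φ = t :=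
  exists_hom (P := P.mapX η) (Q := Q) t ht hX

end

/-- Objects of the fibre product of `[X' / G]` with a scheme over `[X / G]`. -/
def fibreMk {Q : PrincipalBundle ρ} {P : PrincipalBundle ρ'} (φ : P.mapX η ⟶ Q) :
    (fibre η.mapStack Q).obj :=
  CostructuredArrow.mk (S := η.mapStack.toFunctor) (Y := P)
    (show η.mapStack.toFunctor.obj P ⟶ Q from φ)

theorem baseMap_mk {Q : PrincipalBundle ρ} {P : PrincipalBundle ρ'} (φ : P.mapX η ⟶ Q) :
    baseMap η.mapStack Q (fibreMk η φ) = fbas φ :=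
  Category.id_comp _

/-- An object of the fibre product is a bundle whose total space carries an equivariant map to that
of `Q` and a compatible point of `X'`. If the total space of `P` is universal for such pairs,
disregarding equivariance, the induced maps are equivariant by uniqueness. -/
theorem isUniversal_of_total {Q : PrincipalBundle ρ} {P : PrincipalBundle ρ'}
    (φ : P.mapX η ⟶ Q)
    (hφ : ∀ (T : SchC) (a : T ⟶ Q.total) (x : X'.obj (op T)), η.app T x = res X a Q.toX →
      ∃! f : T ⟶ P.total, f ≫ ftot φ = a ∧ res X' f P.toX = x) :
    IsUniversal (fibreMk η φ) := by
  have hext : ∀ {T : SchC} (f f' : T ⟶ P.total), f ≫ ftot φ = f' ≫ ftot φ →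
      res X' f P.toX = res X' f' P.toX → f = f' := fun {T} f f' h h' =>
    (hφ T (f' ≫ ftot φ) (res X' f' P.toX) (by
      rw [← η.res_app, ← res_res]
      exact congrArg (res X f') (res_ftot φ).symm)).unique ⟨h, h'⟩ ⟨rfl, rfl⟩
  have key : ∀ (P' : PrincipalBundle ρ') (φ' : P'.mapX η ⟶ Q),
      ∃! ψ : P' ⟶ P, tot ψ ≫ ftot φ = ftot φ' := fun P' φ' => by
    obtain ⟨f, ⟨hf, hfx⟩, -⟩ := hφ P'.total (ftot φ') P'.toX (res_ftot φ').symm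
    obtain ⟨ψ, hψ⟩ := exists_hom (P := P') (Q := P) f (fun T g a => hext _ _
      (by
        rw [Category.assoc, hf]
        refine (smul_comp_ftot φ' g a).trans ?_
        rw [← hf, ← Category.assoc]
        exact (smul_comp_ftot φ g (a ≫ f)).symm)
      (by
        rw [← res_res, hfx, res_smul_toX, res_smul_toX, ← res_res, hfx])) hfx
    refine ⟨ψ, show tot ψ ≫ ftot φ = ftot φ' by rw [hψ, hf],
      fun ψ' (h : tot ψ' ≫ ftot φ = ftot φ') => hom_ext (hext _ _ ?_ ?_)⟩
    · rw [h, hψ, hf]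
    · rw [res_tot_toX, res_tot_toX]
  refine ⟨IsTerminal.ofUniqueHom
    (fun y => CostructuredArrow.homMk (key y.left y.hom).choose
      (PrincipalBundle.hom_ext (key y.left y.hom).choose_spec.1)) fun y m => ?_⟩
  refine CostructuredArrow.hom_ext _ _ ((key y.left y.hom).choose_spec.2 m.left ?_)
  exact congrArg PrincipalBundle.Hom.total (CostructuredArrow.w m)

/-- The fibre product of `[X' / G]` with a scheme over `[X / G]` is a scheme if `X' ⟶ X` is
representable. -/
theorem exists_fibre_of_total (hG : HasZariskiSections.{0} G) (Q : PrincipalBundle ρ) {N : SchC}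
    (q : N ⟶ Q.total) (ξ : X'.obj (op N)) (hξ : η.app N ξ = res X q Q.toX)
    (hN : ∀ (T : SchC) (a : T ⟶ Q.total) (x : X'.obj (op T)), η.app T x = res X a Q.toX →
      ∃! f : T ⟶ N, f ≫ q = a ∧ res X' f ξ = x) :
    ∃ (P : PrincipalBundle ρ') (φ : P.mapX η ⟶ Q),
      (∀ (T : SchC) (a : T ⟶ Q.total) (x : X'.obj (op T)), η.app T x = res X a Q.toX →
        ∃! f : T ⟶ P.total, f ≫ ftot φ = a ∧ res X' f P.toX = x) ∧
      ∀ (M : MorphismProperty Scheme.{0}) [IsZariskiLocalAtTarget M]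
        [M.IsStableUnderBaseChange], M q.left → M (fbas φ).left := by
  have hext : ∀ {T : SchC} (f f' : T ⟶ N), f ≫ q = f' ≫ q →
      res X' f ξ = res X' f' ξ → f = f' := fun {T} f f' h h' =>
    (hN T (f' ≫ q) (res X' f' ξ) (by
      rw [← η.res_app, ← res_res, hξ])).unique ⟨h, h'⟩ ⟨rfl, rfl⟩
  have hact : ∀ {T : SchC} (g : G.obj (op T)) (n : T ⟶ N),
      ∃! f : T ⟶ N, f ≫ q = Q.smul g (n ≫ q) ∧ res X' f ξ = ρ'.act T g (res X' n ξ) :=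
    fun {T} g n => hN T _ _ (by
      rw [η.act_app, ← η.res_app, hξ, res_res, res_smul_toX])
  choose act hact using fun (T : SchC) (g : G.obj (op T)) (n : T ⟶ N) => (hact g n).exists
  -- The universal property of `N` dictates the action: act on the point of `Q` and on the point of
  -- `X'`.
  let α : GroupAction G (yoneda.obj N) :=
    { act := fun T g n => act T g n
      one_act := fun T n => hext (act T 1 n) n (by rw [(hact T _ _).1, PrincipalBundle.one_smul])
        (by rw [(hact T _ _).2, ρ'.one_act])
      mul_act := fun T g h n => hext (act T (g * h) n) (act T g (act T h n))
        (by rw [(hact T _ _).1, (hact T _ _).1, (hact T _ _).1, PrincipalBundle.mul_smul])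
        (by rw [(hact T _ _).2, (hact T _ _).2, (hact T _ _).2, ρ'.mul_act])
      map_act := fun {T T'} f g n => hext (f ≫ act T g n) (act T' (gres G f g) (f ≫ n))
        (by rw [Category.assoc, (hact T _ _).1, (hact T' _ _).1, comp_smul, Category.assoc])
        (by rw [← res_res, (hact T _ _).2, (hact T' _ _).2, ρ'.res_act, res_res]) }
  obtain ⟨P, t, b, ht, htξ, hpb⟩ := exists_quotient (ρ' := ρ') (Q := Q) (α := α) (q := q) hG
    (fun T g n => (hact T g n).1) ξ (fun T g n => (hact T g n).2)
  obtain ⟨φ, hφ⟩ := exists_ftot_eq (P := P) (Q := Q) (η := η) (t.hom ≫ q) (fun T g c => by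
    rw [← Category.assoc]
    refine (congrArg (fun z => z ≫ q) (ht T g c)).trans ?_
    refine ((hact T g _).1).trans ?_
    rw [Category.assoc]) (by
      rw [← res_res, ← hξ, η.res_app, htξ])
  have hb : b = fbas φ := P.hom_ext_of_π (by
    rw [← ftot_comp_π φ, hφ, hpb.w])
  refine ⟨P, φ, fun T a x hx => ?_, fun M _ _ hM => ?_⟩
  · obtain ⟨f, ⟨hf, hfx⟩, -⟩ := hN T a x hx
    refine ⟨f ≫ t.inv, ⟨?_, ?_⟩, fun f' ⟨hf', hfx'⟩ => ?_⟩
    · rw [hφ, Category.assoc, Iso.inv_hom_id_assoc, hf]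
    · rw [← htξ, res_res, Category.assoc, Iso.inv_hom_id, Category.comp_id, hfx]
    · rw [← cancel_mono t.hom, Category.assoc, Iso.inv_hom_id, Category.comp_id]
      apply hext
      · rw [hf, Category.assoc, ← hφ, hf']
      · rw [hfx, ← res_res, htξ, hfx']
  · rw [← hb]
    have : IsIso t.hom.left := inferInstanceAs (IsIso ((Over.forget _).map t.hom))
    refine property_of_hasLocalSections hpb (Q.hasLocalSections hG) ?_
    exact (Over.comp_left _ _ _ t.hom q) ▸ (M.cancel_left_of_respectsIso t.hom.left _).2 hM

/-- The scheme to be divided by the group is the fibre product over `X` of `X'` and the total space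
of `Q`; the last clause holds because its projection is a base change of the map from `X'` to `X`.
-/
theorem exists_fibre (hG : HasZariskiSections.{0} G) {X₀ X₀' : SchC} {x₀ : X.obj (op X₀)}
    {x₀' : X'.obj (op X₀')} (hX : IsUniv X x₀) (hX' : IsUniv X' x₀') (Q : PrincipalBundle ρ) :
    ∃ (P : PrincipalBundle ρ') (φ : P.mapX η ⟶ Q),
      (∀ (T : SchC) (a : T ⟶ Q.total) (x : X'.obj (op T)), η.app T x = res X a Q.toX →
        ∃! f : T ⟶ P.total, f ≫ ftot φ = a ∧ res X' f P.toX = x) ∧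
      ∀ (M : MorphismProperty Scheme.{0}) [IsZariskiLocalAtTarget M] [M.IsStableUnderBaseChange],
        M (hX.lift (η.app _ x₀')).left → M (fbas φ).left := by
  let p := hX.lift Q.toX
  let r := hX.lift (η.app _ x₀')
  have hw : ∀ {T : SchC} (a : T ⟶ Q.total) (k : T ⟶ X₀'),
      a ≫ p = k ≫ r ↔ res X a Q.toX = η.app T (res X' k x₀') := fun a k => by
    rw [hX.comp_lift, hX.comp_lift, η.res_app]
    exact ⟨fun h => by rw [← hX.res_lift (res X a Q.toX), h, hX.res_lift], fun h => by rw [h]⟩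
  obtain ⟨P, φ, h₁, h₂⟩ := exists_fibre_of_total η hG Q (N := pullback p r) (pullback.fst p r)
    (res X' (pullback.snd p r) x₀') ((hw _ _).1 pullback.condition).symm fun T a x hx => by
      refine ⟨pullback.lift a (hX'.lift x) ((hw _ _).2 (by rw [hX'.res_lift, hx])),
        ⟨pullback.lift_fst _ _ _, ?_⟩, fun f ⟨hf, hfx⟩ => pullback.hom_ext ?_ ?_⟩
      · rw [res_res, pullback.lift_snd, hX'.res_lift]
      · rw [pullback.lift_fst, hf]
      · rw [pullback.lift_snd]
        exact hX'.hom_ext (by rw [hX'.res_lift, ← hfx, res_res])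
  refine ⟨P, φ, h₁, fun M _ _ hM => h₂ M ?_⟩
  exact M.of_isPullback (isPullback_left (IsPullback.of_hasPullback p r).flip) hM

/-- In the situation of `exists_fibre` the fibre product represents the fibres of `X' ⟶ X` over
a section of the bundle. -/
theorem existsUnique_of_section {Q : PrincipalBundle ρ} {P : PrincipalBundle ρ'}
    (φ : P.mapX η ⟶ Q)
    (hφ : ∀ (T : SchC) (a : T ⟶ Q.total) (x : X'.obj (op T)), η.app T x = res X a Q.toX →
      ∃! f : T ⟶ P.total, f ≫ ftot φ = a ∧ res X' f P.toX = x)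
    (σ : Q.base ⟶ Q.total) (hσ : σ ≫ Q.π = 𝟙 _) :
    ∃ u : X'.obj (op P.base), η.app _ u = res X (fbas φ ≫ σ) Q.toX ∧
      ∀ (T : SchC) (f : T ⟶ Q.base) (x : X'.obj (op T)), η.app T x = res X (f ≫ σ) Q.toX →
        ∃! h : T ⟶ P.base, h ≫ fbas φ = f ∧ res X' h u = x := by
  have hpb : IsPullback (ftot φ) P.π Q.π (fbas φ) := isPullback_ftot φ
  have hw : (fbas φ ≫ σ) ≫ Q.π = 𝟙 _ ≫ fbas φ := by
    rw [Category.assoc, hσ, Category.comp_id, Category.id_comp]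
  obtain ⟨s, hs₁, hs₂⟩ : ∃ s : P.base ⟶ P.total, s ≫ ftot φ = fbas φ ≫ σ ∧ s ≫ P.π = 𝟙 _ :=
    ⟨hpb.lift _ _ hw, hpb.lift_fst _ _ _, hpb.lift_snd _ _ _⟩
  have hηP : η.app _ P.toX = res X (ftot φ) Q.toX := (res_ftot φ).symm
  refine ⟨res X' s P.toX, ?_, fun T f x hx => ?_⟩
  · rw [← η.res_app, hηP, res_res, hs₁]
  · obtain ⟨a, ⟨ha, hax⟩, hau⟩ := hφ T _ x hx
    have haf : (a ≫ P.π) ≫ fbas φ = f := by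
      rw [Category.assoc, ← hpb.w, ← Category.assoc, ha, Category.assoc, hσ, Category.comp_id]
    have has : (a ≫ P.π) ≫ s = a := hpb.hom_ext
      (by rw [Category.assoc, hs₁, ← Category.assoc, haf, ha])
      (by rw [Category.assoc, hs₂, Category.comp_id])
    refine ⟨a ≫ P.π, ⟨haf, by rw [res_res, has, hax]⟩, fun h ⟨h₁, h₂⟩ => ?_⟩
    have : h ≫ s = a := hau _ ⟨by rw [Category.assoc, hs₁, ← Category.assoc, h₁],
      by rw [← res_res, h₂]⟩
    rw [← this, Category.assoc, hs₂, Category.comp_id]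

end QuiverStack

end

noncomputable section
namespace QuiverStack

open PrincipalBundle

/-! ## Relations between classes of quotient stacks -/

variable {G : SchCᵒᵖ ⥤ GrpCat.{0}} {X X' X₁ X₂ : SchCᵒᵖ ⥤ Type} {ρ : GroupAction G X}
  {ρ' : GroupAction G X'} {ρ₁ : GroupAction G X₁} {ρ₂ : GroupAction G X₂}

/-- Equivariant monomorphisms that are bijective on `ℂ`-valued points. -/
theorem isGeometricBijection_mapStack (η : EquivariantMap ρ' ρ) (hG : HasZariskiSections.{0} G)
    {X₀ X₀' : SchC} {x₀ : X.obj (op X₀)} {x₀' : X'.obj (op X₀')} (hX : IsUniv X x₀)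
    (hX' : IsUniv X' x₀') (hinj : ∀ T, Function.Injective (η.app T))
    (hsurj : ∀ T : SchC, Nonempty (IsTerminal T) → Function.Surjective (η.app T)) :
    IsGeometricBijection η.mapStack where
  representable Q := by
    obtain ⟨P, φ, hφ, -⟩ := exists_fibre η hG hX hX' Q
    exact isAlgebraicSpace_of_universal
      (isFibredInGroupoids_fibre (isFibredInGroupoids_quotientStack ρ') _ _)
      (isUniversal_of_total η φ hφ)
  fullyFaithful P P' _ _ := by
    have key : ∀ (P P' : PrincipalBundle ρ'),
        Function.Bijective fun f : P ⟶ P' => η.mapStack.toFunctor.map f := fun P P' => by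
      refine ⟨fun f g h => PrincipalBundle.hom_ext
        (congrArg (fun z : P.mapX η ⟶ P'.mapX η => tot z) h), fun (φ : P.mapX η ⟶ P'.mapX η) => ?_⟩
      let t : P.total ⟶ P'.total := ftot (P := P) (Q := P'.mapX η) φ
      obtain ⟨f, hf⟩ := exists_hom (P := P) (Q := P') t
        (fun T g a => smul_comp_ftot (P := P) (Q := P'.mapX η) φ g a)
        (hinj _ ((η.res_app _ _).symm.trans (res_ftot (P := P) (Q := P'.mapX η) φ)))
      exact ⟨f, PrincipalBundle.hom_ext (P := P.mapX η) (Q := P'.mapX η) hf⟩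
    exact key P P'
  essSurj Q hQ := by
    -- Over a one-point base the local sections of the bundle are global. The value in `X` at a
    -- section lifts to `X'`, and translation by the group extends the lift to the total space.
    have key : ∀ Q : PrincipalBundle ρ, Nonempty (IsTerminal Q.base) →
        ∃ x : X'.obj (op Q.total), η.app _ x = Q.toX := fun Q ⟨hQ⟩ => by
      let s : Q.base.left := by
        have : IsIso Q.base.hom := isIso_hom_of_isTerminal hQ
        exact (inv Q.base.hom) (Nonempty.some (inferInstance :
          Nonempty (PrimeSpectrum ℂ)))
      obtain ⟨V, hs, σ, hσ⟩ := Q.hasLocalSections hG s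
      have : IsIso Q.base.hom := isIso_hom_of_isTerminal hQ
      have hsub : Set.range (𝟙 Q.base : Q.base ⟶ Q.base).left ⊆ V := by
        rintro t -
        have : t = s := by
          have : Subsingleton (PrimeSpectrum ℂ) := inferInstance
          have hinj : Function.Injective Q.base.hom :=
            (Scheme.homeoOfIso (asIso Q.base.hom)).injective
          exact hinj (this.elim _ _)
        exact this ▸ hs
      obtain ⟨j, hj⟩ := exists_opn_lift V (𝟙 Q.base) hsub
      obtain ⟨x₁, hx₁⟩ := hsurj Q.base ⟨hQ⟩ (res X (j ≫ σ) Q.toX)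
      obtain ⟨g, hg, -⟩ := Q.existsUnique_smul_eq (a := Q.π ≫ j ≫ σ) (b := 𝟙 Q.total) (by
        rw [Category.assoc, Category.assoc, hσ, hj, Category.comp_id, Category.id_comp])
      refine ⟨ρ'.act _ g (res X' Q.π x₁), ?_⟩
      rw [η.act_app, ← η.res_app, hx₁, res_res, ← res_smul_toX, hg, res_id]
    -- The bundle is taken apart so that its map to `X` becomes a variable that can be replaced by
    -- the image of the lift; equivariance of the lift follows from injectivity.
    have key' : ∀ Q : PrincipalBundle ρ, (∃ x : X'.obj (op Q.total), η.app _ x = Q.toX) →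
        ∃ P : PrincipalBundle ρ', P.mapX η = Q := by
      rintro ⟨B, E, π, α, hα, hs, hl, y, he⟩ ⟨x, hx⟩
      have aux : ∀ (y : X.obj (op E)) he, η.app E x = y →
          ∃ P : PrincipalBundle ρ', P.mapX η = ⟨B, E, π, α, hα, hs, hl, y, he⟩ := by
        rintro _ he rfl
        exact ⟨⟨B, E, π, α, hα, hs, hl, x, fun T g a => hinj _
          ((η.res_app _ _).symm.trans ((he T g a).trans
            ((congrArg (ρ.act T g) (η.res_app _ _)).trans (η.act_app _ _ _).symm)))⟩, rfl⟩
      exact aux y he hx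
    obtain ⟨P, hP⟩ := key' Q (key Q hQ)
    have hP' : η.mapStack.obj P = Q := hP
    refine ⟨P, ?_, ⟨eqToIso hP'⟩⟩
    subst hP'
    exact hQ

theorem nonempty_isColimit_over {A B S : SchC} (f : A ⟶ S) (g : B ⟶ S)
    (h : Nonempty (IsColimit (BinaryCofan.mk f.left g.left))) :
    Nonempty (IsColimit (BinaryCofan.mk f g)) := by
  obtain ⟨hc⟩ := h
  have hext : ∀ {Y : Scheme.{0}} {m m' : S.left ⟶ Y}, f.left ≫ m = f.left ≫ m' →
      g.left ≫ m = g.left ≫ m' → m = m' := fun h₁ h₂ => BinaryCofan.IsColimit.hom_ext hc h₁ h₂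
  have hex : ∀ {T : SchC} (a : A ⟶ T) (b : B ⟶ T), ∃! m : S ⟶ T, f ≫ m = a ∧ g ≫ m = b :=
    fun {T} a b => by
      obtain ⟨d, hd₁, hd₂⟩ : ∃ d : S.left ⟶ T.left, f.left ≫ d = a.left ∧ g.left ≫ d = b.left :=
        ⟨_, (BinaryCofan.IsColimit.desc' hc a.left b.left).2⟩
      refine ⟨Over.homMk d (hext ?_ ?_), ⟨Over.OverMorphism.ext hd₁, Over.OverMorphism.ext hd₂⟩,
        fun m ⟨h₁, h₂⟩ => Over.OverMorphism.ext (hext ?_ ?_)⟩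
      · rw [← Category.assoc, hd₁, Over.w, Over.w]
      · rw [← Category.assoc, hd₂, Over.w, Over.w]
      · exact ((congrArg (fun z : A ⟶ T => z.left) h₁)).trans hd₁.symm
      · exact ((congrArg (fun z : B ⟶ T => z.left) h₂)).trans hd₂.symm
  exact ⟨BinaryCofan.IsColimit.mk _ (fun a b => (hex a b).choose)
    (fun a b => (hex a b).choose_spec.1.1) (fun a b => (hex a b).choose_spec.1.2)
    fun a b m h₁ h₂ => (hex a b).choose_spec.2 m ⟨h₁, h₂⟩⟩

/-- A functor that is Zariski-locally covered by two disjoint open subfunctors. -/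
theorem isDisjointUnion_mapStack (η₁ : EquivariantMap ρ₁ ρ) (η₂ : EquivariantMap ρ₂ ρ)
    (hG : HasZariskiSections.{0} G) {X₀ Y₁ Y₂ : SchC} {x₀ : X.obj (op X₀)} {y₁ : X₁.obj (op Y₁)}
    {y₂ : X₂.obj (op Y₂)} (hX : IsUniv X x₀) (hX₁ : IsUniv X₁ y₁) (hX₂ : IsUniv X₂ y₂)
    (h₁ : IsOpenImmersion (hX.lift (η₁.app _ y₁)).left)
    (h₂ : IsOpenImmersion (hX.lift (η₂.app _ y₂)).left)
    (hcover : ∀ (T : SchC) (x : X.obj (op T)) (t : T.left), ∃ (U : SchC) (k : U ⟶ T),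
      t ∈ Set.range k.left ∧ ((∃ z, η₁.app U z = res X k x) ∨ ∃ z, η₂.app U z = res X k x))
    (hdisj : ∀ (T : SchC) (z₁ : X₁.obj (op T)) (z₂ : X₂.obj (op T)), η₁.app T z₁ = η₂.app T z₂ →
      IsEmpty T.left) :
    IsDisjointUnion η₁.mapStack η₂.mapStack := by
  have key : ∀ Q : PrincipalBundle ρ, ∃ (s : (fibre η₁.mapStack Q).obj)
      (t : (fibre η₂.mapStack Q).obj), IsUniversal s ∧ IsUniversal t ∧
      Nonempty (IsColimit (BinaryCofan.mk (baseMap η₁.mapStack Q s)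
        (baseMap η₂.mapStack Q t))) := by
    intro Q
    obtain ⟨P₁, φ₁, hφ₁, hM₁⟩ := exists_fibre η₁ hG hX hX₁ Q
    obtain ⟨P₂, φ₂, hφ₂, hM₂⟩ := exists_fibre η₂ hG hX hX₂ Q
    refine ⟨fibreMk η₁ φ₁, fibreMk η₂ φ₂, isUniversal_of_total η₁ φ₁ hφ₁,
      isUniversal_of_total η₂ φ₂ hφ₂, ?_⟩
    have ho₁ : IsOpenImmersion (fbas φ₁).left := hM₁ @IsOpenImmersion h₁
    have ho₂ : IsOpenImmersion (fbas φ₂).left := hM₂ @IsOpenImmersion h₂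
    rw [baseMap_mk, baseMap_mk]
    have hrange : ∀ {X' : SchCᵒᵖ ⥤ Type} {ρ' : GroupAction G X'} (η : EquivariantMap ρ' ρ)
        (P : PrincipalBundle ρ') (φ : P.mapX η ⟶ Q)
        (_ : ∀ (T : SchC) (a : T ⟶ Q.total) (x : X'.obj (op T)), η.app T x = res X a Q.toX →
          ∃! f : T ⟶ P.total, f ≫ ftot φ = a ∧ res X' f P.toX = x)
        {V U : SchC} (σ : V ⟶ Q.total) (k : U ⟶ V) (z : X'.obj (op U)),
        η.app U z = res X k (res X σ Q.toX) →
        Set.range (k ≫ σ ≫ Q.π).left ⊆ Set.range (fbas φ).left := by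
      intro X' ρ' η P φ hφ V U σ k z hz
      obtain ⟨f, ⟨hf, -⟩, -⟩ := hφ U (k ≫ σ) z (by rw [hz, res_res])
      have : k ≫ σ ≫ Q.π = (f ≫ P.π) ≫ fbas φ := by
        rw [Category.assoc, ← ftot_comp_π, ← Category.assoc f, hf, Category.assoc]
      rw [this]
      exact range_comp_subset _ _
    have hpt : ∀ {X' : SchCᵒᵖ ⥤ Type} {ρ' : GroupAction G X'} (η : EquivariantMap ρ' ρ)
        (P : PrincipalBundle ρ') (φ : P.mapX η ⟶ Q) [IsOpenImmersion (fbas φ).left]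
        {T : SchC} (τ : T ⟶ Q.total) (_ : Set.range (τ ≫ Q.π).left ⊆ Set.range (fbas φ).left),
        ∃ z, η.app T z = res X τ Q.toX := by
      intro X' ρ' η P φ _ T τ h
      obtain ⟨f, hf⟩ := exists_lift_of_range_subset (fbas φ) (τ ≫ Q.π) h
      refine ⟨res X' ((isPullback_ftot φ).lift τ f hf.symm) P.toX, ?_⟩
      rw [← η.res_app, ← res_ftot φ, res_res, IsPullback.lift_fst]
    -- Both claims are tested on local sections of `Q`. Over the intersection of the images such a
    -- section gives points of both subfunctors with the same image, so the intersection is empty;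
    -- elsewhere every point lies in one image by `hcover`.
    have hcompl : IsCompl (fbas φ₁).left.opensRange (fbas φ₂).left.opensRange := by
      refine ⟨?_, ?_⟩
      · rw [disjoint_iff]
        by_contra hne
        obtain ⟨s, hs⟩ : ∃ s, s ∈ (fbas φ₁).left.opensRange ⊓ (fbas φ₂).left.opensRange := by
          by_contra! hc
          exact hne (TopologicalSpace.Opens.ext (Set.eq_empty_of_forall_notMem hc))
        obtain ⟨V, hV, σ, hσ⟩ := Q.hasLocalSections hG s
        let W := V ⊓ ((fbas φ₁).left.opensRange ⊓ (fbas φ₂).left.opensRange)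
        have hsW : s ∈ (W : Set Q.base.left) := ⟨hV, hs⟩
        obtain ⟨j, hj⟩ := exists_opn_lift V (opnι Q.base W) (by
          rw [range_opnι]; exact fun x hx => hx.1)
        have hjr : Set.range ((j ≫ σ) ≫ Q.π).left = W := by
          rw [Category.assoc, hσ, hj, range_opnι]
        obtain ⟨z₁, hz₁⟩ := hpt η₁ P₁ φ₁ (j ≫ σ) (by rw [hjr]; exact fun x hx => hx.2.1)
        obtain ⟨z₂, hz₂⟩ := hpt η₂ P₂ φ₂ (j ≫ σ) (by rw [hjr]; exact fun x hx => hx.2.2)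
        rw [← range_opnι] at hsW
        obtain ⟨w, -⟩ := hsW
        exact (hdisj _ z₁ z₂ (hz₁.trans hz₂.symm)).elim w
      · rw [codisjoint_iff]
        refine top_le_iff.1 fun s _ => ?_
        obtain ⟨V, hV, σ, hσ⟩ := Q.hasLocalSections hG s
        have hs : s ∈ (V : Set Q.base.left) := hV
        rw [← range_opnι] at hs
        obtain ⟨s', hs'⟩ := hs
        obtain ⟨U, k, ⟨u, hu⟩, hz⟩ := hcover _ (res X σ Q.toX) s'
        have hmem : s ∈ Set.range (k ≫ σ ≫ Q.π).left := ⟨u, by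
          rw [hσ, ← hs', ← hu]; simp⟩
        rcases hz with ⟨z, hz⟩ | ⟨z, hz⟩
        · exact Or.inl (hrange η₁ P₁ φ₁ hφ₁ σ k z hz hmem)
        · exact Or.inr (hrange η₂ P₂ φ₂ hφ₂ σ k z hz hmem)
    exact nonempty_isColimit_over _ _
      (nonempty_isColimit_binaryCofanMk_of_isCompl (fbas φ₁).left (fbas φ₂).left hcompl)
  exact fun Q => key Q

/-- Maps that are, locally on the target, projections of products. -/
theorem isZariskiFibration_mapStack (η : EquivariantMap ρ' ρ) (hG : HasZariskiSections.{0} G)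
    {X₀ X₀' : SchC} {x₀ : X.obj (op X₀)} {x₀' : X'.obj (op X₀')} (hX : IsUniv X x₀)
    (hX' : IsUniv X' x₀') (Φ : SchC)
    (h : ∀ (T : SchC) (x : X.obj (op T)) (t : T.left), ∃ (U : SchC) (k : U ⟶ T),
      IsOpenImmersion k.left ∧ t ∈ Set.range k.left ∧
      ∃ c : ∀ W : SchC, (W ⟶ U) → (W ⟶ Φ) → X'.obj (op W),
        (∀ {W W' : SchC} (l : W' ⟶ W) f r, res X' l (c W f r) = c W' (l ≫ f) (l ≫ r)) ∧
        (∀ W f r, η.app W (c W f r) = res X (f ≫ k) x) ∧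
        ∀ W f z, η.app W z = res X (f ≫ k) x → ∃! r, c W f r = z) :
    IsZariskiFibration η.mapStack Φ := by
  have key : ∀ (Q : PrincipalBundle ρ) (s : Q.base.left), ∃ (Q' : PrincipalBundle ρ) (φ : Q' ⟶ Q),
    IsOpenImmersion (bas φ).left ∧ s ∈ Set.range (bas φ).left ∧
    ∃ (t : (fibre η.mapStack Q').obj) (r : (fibre η.mapStack Q').p.obj t ⟶ Φ), IsUniversal t ∧
      Nonempty (IsLimit (BinaryFan.mk (baseMap η.mapStack Q' t) r)) := by
    intro Q s
    obtain ⟨V, hV, σ, hσ⟩ := Q.hasLocalSections hG s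
    have hs : s ∈ (V : Set Q.base.left) := hV
    rw [← range_opnι] at hs
    obtain ⟨s', hs'⟩ := hs
    obtain ⟨U, k, hk, ⟨u, hu⟩, c, hc₁, hc₂, hc₃⟩ := h _ (res X σ Q.toX) s'
    obtain ⟨w, hw₁, hw₂⟩ := Q.exists_pull_section (k ≫ σ)
    have hb : (k ≫ σ) ≫ Q.π = k ≫ opnι Q.base V := by rw [Category.assoc, hσ]
    -- After pull-back to `U` the bundle has the section `w`. The fibre product is then the fibre of
    -- `X'` over a single point of `X`, which the chart `c` identifies with the product of `U` and
    -- `Φ`.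
    obtain ⟨P, φ, hφ, -⟩ := exists_fibre η hG hX hX' (Q.pull ((k ≫ σ) ≫ Q.π))
    obtain ⟨z, hz, hzu⟩ := existsUnique_of_section η φ hφ w hw₁
    have hres : ∀ {T : SchC} (f : T ⟶ U),
        res X (f ≫ w) (Q.pull ((k ≫ σ) ≫ Q.π)).toX = res X (f ≫ k) (res X σ Q.toX) := fun f => by
      rw [← res_tot_toX (Q.pullHom ((k ≫ σ) ≫ Q.π)), res_res, res_res, Category.assoc, hw₂,
        Category.assoc]
    obtain ⟨r, hr, -⟩ := hc₃ P.base (fbas φ) z (hz.trans (hres _))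
    refine ⟨_, Q.pullHom ((k ≫ σ) ≫ Q.π), ?_, ⟨u, ?_⟩, fibreMk η φ, r, isUniversal_of_total η φ hφ,
      ⟨?_⟩⟩
    · rw [bas_pullHom, hb, Over.comp_left _ _ _ k (opnι Q.base V)]
      infer_instance
    · rw [bas_pullHom, hb, ← hs', ← hu]
      simp
    · rw [baseMap_mk]
      have hex : ∀ {T : SchC} (f : T ⟶ U) (g : T ⟶ Φ),
          ∃! l : T ⟶ P.base, l ≫ fbas φ = f ∧ l ≫ r = g := fun {T} f g => by
        obtain ⟨l, ⟨hl₁, hl₂⟩, hlu⟩ := hzu T f (c T f g) ((hc₂ _ _ _).trans (hres _).symm)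
        have hcr : ∀ (l : T ⟶ P.base) (_ : l ≫ fbas φ = f), res X' l z = c T f (l ≫ r) :=
          fun l hl => by rw [← hr, hc₁, hl]
        refine ⟨l, ⟨hl₁, ?_⟩, fun l' ⟨hl₁', hl₂'⟩ => hlu l' ⟨hl₁', ?_⟩⟩
        · exact (hc₃ T f _ (hc₂ T f g)).unique ((hcr l hl₁).symm.trans hl₂) rfl
        · rw [hcr l' hl₁', hl₂']
      exact BinaryFan.IsLimit.mk _ (fun f g => (hex f g).choose)
        (fun f g => (hex f g).choose_spec.1.1) (fun f g => (hex f g).choose_spec.1.2)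
        fun f g m h₁ h₂ => (hex f g).choose_spec.2 m ⟨h₁, h₂⟩
  exact fun Q s => key Q s

end QuiverStack

end

noncomputable section
namespace QuiverStack

/-! ## The group scheme `GL(v)` -/

/-- A property of homomorphisms from `A` that determines the homomorphism defines an affine
scheme. -/
theorem existsUnique_hom_SpecC_of {A : Type} [CommRing A] [Algebra ℂ A] {T : SchC}
    {p : (A →ₐ[ℂ] Functions T) → Prop} (h : ∃! φ, p φ) :
    ∃! f : T ⟶ SpecC A, p ((Functions.map f).comp (specUnit A).toAlgHom) := by
  obtain ⟨φ, hφ, hu⟩ := h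
  obtain ⟨f, hf, hfu⟩ := existsUnique_hom_SpecC A φ
  exact ⟨f, show p _ from hf ▸ hφ, fun g hg => hfu g (hu _ hg)⟩

theorem smooth_SpecC (A : Type) [CommRing A] [Algebra ℂ A] [Algebra.Smooth ℂ A] :
    Smooth (SpecC A).hom := by
  change Smooth (Spec.map (CommRingCat.ofHom (algebraMap ℂ A)))
  refine (HasRingHomProperty.Spec_iff (P := @Smooth)).2 ?_
  exact RingHom.smooth_algebraMap.2 inferInstance

section GeneralLinear

variable {I : Type} (v : I → ℕ)

variable [Fintype I]

/-- The coordinate ring of the scheme of families of square matrices. -/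
abbrev MatRing : Type := MvPolynomial (Σ i : I, Fin (v i) × Fin (v i)) ℂ

/-- The product of the determinants of the generic matrices. -/
def detProd : MatRing v :=
  ∏ i : I, (Matrix.of fun a b => (MvPolynomial.X ⟨i, a, b⟩ : MatRing v)).det

/-- The coordinate ring of `GL(v)`. -/
abbrev GLRing : Type := Localization.Away (detProd v)

instance smooth_GLRing : Algebra.Smooth ℂ (GLRing v) := by
  have : Algebra.Smooth ℂ (MatRing v) :=
    { formallySmooth := inferInstance, finitePresentation := inferInstance }
  have : Algebra.Smooth (MatRing v) (GLRing v) :=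
    Algebra.Smooth.of_isLocalization_Away (detProd v)
  exact Algebra.Smooth.comp ℂ (MatRing v) (GLRing v)

/-- The generic matrices become invertible after inverting the product of their determinants, and a
family of matrices specializes them over the localization exactly when all its determinants are
units. -/
theorem exists_generic_GL : ∃ γ : GLPoints v (GLRing v),
    ∀ (B : Type) [CommRing B] [Algebra ℂ B] (g : GLPoints v B),
      ∃! φ : GLRing v →ₐ[ℂ] B, GLPoints.map φ γ = g := by
  let X : ∀ i, Matrix (Fin (v i)) (Fin (v i)) (MatRing v) :=
    fun i => Matrix.of fun a b => MvPolynomial.X ⟨i, a, b⟩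
  let M : ∀ i, Matrix (Fin (v i)) (Fin (v i)) (GLRing v) :=
    fun i => (X i).map (algebraMap (MatRing v) (GLRing v))
  have hM : ∀ i, IsUnit (M i).det := fun i => by
    have h : IsUnit (algebraMap (MatRing v) (GLRing v) (detProd v)) :=
      IsLocalization.Away.algebraMap_isUnit _
    have h₁ : (M i).det = algebraMap (MatRing v) (GLRing v) (X i).det :=
      (RingHom.map_det _ _).symm
    rw [h₁]
    exact isUnit_of_dvd_unit (map_dvd _ (Finset.dvd_prod_of_mem (fun i => (X i).det) (Finset.mem_univ i))) h
  obtain ⟨γ, hγ⟩ : ∃ γ : GLPoints v (GLRing v), ∀ i a b, (γ i).val a b =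
      algebraMap (MatRing v) (GLRing v) (X i a b) :=
    ⟨fun i => (M i).nonsingInvUnit (hM i), fun i a b => rfl⟩
  refine ⟨γ, fun B _ _ g => ?_⟩
  let ψ : MatRing v →ₐ[ℂ] B := MvPolynomial.aeval fun x => (g x.1).val x.2.1 x.2.2
  have hψ : ∀ i, (X i).map ψ = (g i).val := fun i => by
    ext a b
    exact MvPolynomial.aeval_X _ _
  have hdet : IsUnit (ψ (detProd v)) := by
    rw [detProd, map_prod]
    refine IsUnit.prod_iff.2 fun i _ => ?_
    have h : ψ (X i).det = (g i).val.det := by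
      rw [← hψ i]
      exact AlgHom.map_det ψ (X i)
    change IsUnit (ψ (X i).det)
    rw [h]
    exact (Matrix.isUnit_iff_isUnit_det _).1 (g i).isUnit
  have hpow : ∀ y : Submonoid.powers (detProd v), IsUnit (ψ y) := by
    rintro ⟨_, n, rfl⟩
    rw [map_pow]
    exact hdet.pow n
  refine ⟨IsLocalization.liftAlgHom (S := GLRing v) hpow, ?_, fun φ hφ => ?_⟩
  · funext i
    ext a b
    change IsLocalization.liftAlgHom (S := GLRing v) hpow ((γ i).val a b) = _
    rw [hγ, IsLocalization.liftAlgHom_apply, IsLocalization.lift_eq]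
    exact congrArg (fun m => m a b) (hψ i)
  · refine IsLocalization.algHom_ext (Submonoid.powers (detProd v)) ?_
    refine MvPolynomial.algHom_ext fun x => ?_
    have h : φ ((γ x.1).val x.2.1 x.2.2) = (g x.1).val x.2.1 x.2.2 :=
      congrArg (fun k : GLPoints v B => (k x.1).val x.2.1 x.2.2) hφ
    rw [hγ] at h
    have h' : IsLocalization.liftAlgHom (S := GLRing v) hpow
        (algebraMap (MatRing v) (GLRing v) (MvPolynomial.X x)) = (g x.1).val x.2.1 x.2.2 := by
      rw [IsLocalization.liftAlgHom_apply, IsLocalization.lift_eq]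
      exact MvPolynomial.aeval_X _ _
    exact h.trans h'.symm

theorem surjective_of_section {G₀ T : SchC} (hT : IsTerminal T) (e : T ⟶ G₀) :
    Surjective G₀.hom := by
  have : IsIso T.hom := isIso_hom_of_isTerminal hT
  have h : e.left ≫ G₀.hom = T.hom := Over.w e
  have : Surjective (e.left ≫ G₀.hom) := by rw [h]; infer_instance
  exact Surjective.of_comp e.left G₀.hom

/-- `GL(v)` is a smooth affine group scheme. -/
theorem exists_isUnivElement_GL : ∃ (G₀ : SchC) (γ : (GLFunctor v).obj (op G₀)),
    IsUnivElement (GLFunctor v) γ ∧ Smooth G₀.hom ∧ Surjective G₀.hom ∧ IsAffine G₀.left := by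
  obtain ⟨γ, hγ⟩ := exists_generic_GL v
  have hu : IsUnivElement (GLFunctor v) (G₀ := SpecC (GLRing v))
      (GLPoints.map (specUnit (GLRing v)).toAlgHom γ : GLPoints v (Functions (SpecC (GLRing v)))) := by
    intro T g
    exact existsUnique_hom_SpecC_of (hγ (Functions T) g)
  refine ⟨SpecC (GLRing v), _, hu, smooth_SpecC _, ?_, inferInstance⟩
  exact surjective_of_section terminalIsTerminal (hu (⊤_ SchC) 1).choose

end GeneralLinear

end QuiverStack

end

noncomputable section
namespace QuiverStack

/-! ## Schemes of representations given by equations and open conditions -/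

/-- At a point where a function is not invertible, it vanishes in the residue field. -/
theorem exists_residue_point (T : SchC) (t : T.left) : ∃ (T' : SchC) (f : T' ⟶ T),
    Nonempty T'.left ∧ ∀ x : Functions T, t ∉ unitLocus x → Functions.map f x = 0 := by
  let K := T.left.residueField t
  let T' : SchC := Over.mk (T.left.fromSpecResidueField t ≫ T.hom)
  let f : T' ⟶ T := Over.homMk (T.left.fromSpecResidueField t) rfl
  refine ⟨T', f, (inferInstance : Nonempty (PrimeSpectrum K)), fun x hx => ?_⟩
  by_contra h
  let e : K ≃+* Functions T' := (Scheme.ΓSpecIso K).symm.commRingCatIsoToRingEquiv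
  have hu : IsUnit (Functions.map f x) := by
    have h₁ : IsUnit (e.symm (Functions.map f x)) :=
      isUnit_iff_ne_zero.2 fun h' => h ((map_eq_zero_iff e.symm e.symm.injective).1 h')
    have h₂ := h₁.map e
    rwa [RingEquiv.apply_symm_apply] at h₂
  let s : T'.left := (Nonempty.some (inferInstance : Nonempty (PrimeSpectrum K)))
  have hs : s ∈ unitLocus (Functions.map f x) := by
    refine notMem_pointIdeal.1 fun hmem => ?_
    exact (inferInstance : (pointIdeal T' s).IsPrime).ne_top (Ideal.eq_top_of_isUnit_mem _ hmem hu)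
  have hst := (mem_unitLocus_map f x s).1 hs
  have h₃ : f.left s = t := Scheme.fromSpecResidueField_apply t s
  exact hx (h₃ ▸ hst)

theorem unitLocus_zero (T : SchC) : unitLocus (0 : Functions T) = ⊥ := by
  ext t
  refine iff_of_false (fun h => ?_) id
  exact notMem_pointIdeal.2 h (Ideal.zero_mem _)

theorem unitLocus_of_isUnit {T : SchC} {x : Functions T} (hx : IsUnit x) : unitLocus x = ⊤ := by
  ext t
  refine iff_of_true (notMem_pointIdeal.1 fun hmem => ?_) trivial
  exact (inferInstance : (pointIdeal T t).IsPrime).ne_top (Ideal.eq_top_of_isUnit_mem _ hmem hx)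

/-- Subfunctors given by the invertibility of a function are open. -/
theorem isOpenImmersion_of_isUnit {X X₁ : SchCᵒᵖ ⥤ Type} {X₀ Y₁ : SchC} {x₀ : X.obj (op X₀)}
    {y₁ : X₁.obj (op Y₁)} (hX : IsUniv X x₀) (hX₁ : IsUniv X₁ y₁)
    (η : ∀ T : SchC, X₁.obj (op T) → X.obj (op T))
    (hη : ∀ {T T' : SchC} (f : T' ⟶ T) x, res X f (η T x) = η T' (res X₁ f x))
    (hinj : ∀ T, Function.Injective (η T)) (c : ∀ T : SchC, X.obj (op T) → Functions T)
    (hc : ∀ {T T' : SchC} (f : T' ⟶ T) x, Functions.map f (c T x) = c T' (res X f x))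
    (h : ∀ T x, (∃ z, η T z = x) ↔ IsUnit (c T x)) :
    IsOpenImmersion (hX.lift (η _ y₁)).left := by
  let V := unitLocus (c X₀ x₀)
  have hy : IsUnit (c Y₁ (η _ y₁)) := (h _ _).1 ⟨y₁, rfl⟩
  obtain ⟨g, hg⟩ := exists_opn_lift V (hX.lift (η _ y₁)) (by
    rintro _ ⟨t, rfl⟩
    refine (mem_unitLocus_map _ _ t).1 ?_
    rw [hc, hX.res_lift, unitLocus_of_isUnit hy]
    trivial)
  -- On `V` the function is invertible, so the restricted universal point belongs to the subfunctor;
  -- the morphism it classifies is the inverse of `g`.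
  obtain ⟨z, hz⟩ := (h _ (res X (opnι X₀ V) x₀)).2 (by
    rw [← hc]
    exact isUnit_map_of_range_subset _ _ (range_opnι X₀ V).subset)
  have hmono : Mono (opnι X₀ V) := mono_of_isOpenImmersion _
  have hiso : IsIso g := by
    refine ⟨hX₁.lift z, ?_, ?_⟩
    · apply hX₁.hom_ext
      rw [res_id, ← res_res, hX₁.res_lift]
      apply hinj
      rw [← hη, hz, res_res, hg, hX.res_lift]
    · rw [← cancel_mono (opnι X₀ V), Category.assoc, hg, Category.id_comp]
      apply hX.hom_ext
      rw [← res_res, hX.res_lift, hη, hX₁.res_lift, hz]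
  rw [← hg, Over.comp_left _ _ _ _ _]
  have : IsIso g.left := inferInstanceAs (IsIso ((Over.forget _).map g))
  infer_instance

section Loci

variable {I : Type} [Quiver.{0} I] (v : I → ℕ)

/-- Functions on the space of pairs of a representation and a scalar. -/
structure PairFun where
  val : ∀ (A : Type) [CommRing A] [Algebra ℂ A], Rep v A → A → A
  map_val : ∀ {A B : Type} [CommRing A] [Algebra ℂ A] [CommRing B] [Algebra ℂ B]
    (f : A →ₐ[ℂ] B) (m : Rep v A) (e : A), f (val A m e) = val B (m.map f) (f e)

/-- An invariant locus of pairs of a representation and a scalar, where some functions vanish and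
others have no common zero. -/
structure PairLocus where
  eqs : Set (PairFun v)
  ineqs : Set (PairFun v)
  eqs_inv : ∀ {A : Type} [CommRing A] [Algebra ℂ A] (g : GLPoints v A) (m : Rep v A) (e : A),
    (∀ k ∈ eqs, k.val A m e = 0) → ∀ k ∈ eqs, k.val A (changeBasis g m) e = 0
  ineqs_inv : ∀ {A : Type} [CommRing A] [Algebra ℂ A] (g : GLPoints v A) (m : Rep v A) (e : A),
    (∀ k ∈ ineqs, k.val A m e = 0) → ∀ k ∈ ineqs, k.val A (changeBasis g m) e = 0

variable {v}

theorem Rep.map_map {A B C : Type} [CommRing A] [Algebra ℂ A] [CommRing B] [Algebra ℂ B]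
    [CommRing C] [Algebra ℂ C] (f : A →ₐ[ℂ] B) (g : B →ₐ[ℂ] C) (m : Rep v A) :
    (m.map f).map g = m.map (g.comp f) := rfl

theorem Rep.map_Functions_comp {T T' T'' : SchC} (f : T' ⟶ T) (g : T'' ⟶ T')
    (m : Rep v (Functions T)) :
    (m.map (Functions.map f)).map (Functions.map g) = m.map (Functions.map (g ≫ f)) := by
  rw [Functions.map_comp]; rfl

theorem Rep.map_Functions_id {T : SchC} (m : Rep v (Functions T)) :
    m.map (Functions.map (𝟙 T)) = m := by
  rw [Functions.map_id]; rfl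

theorem changeBasis_one {A : Type} [CommRing A] [Algebra ℂ A] (m : Rep v A) :
    changeBasis (1 : GLPoints v A) m = m := by
  funext i j α
  change (1 : GL _ _).val * _ * (1 : GL _ _)⁻¹.val = _
  simp

theorem changeBasis_mul {A : Type} [CommRing A] [Algebra ℂ A] (g h : GLPoints v A) (m : Rep v A) :
    changeBasis (g * h) m = changeBasis g (changeBasis h m) := by
  funext i j α
  change (g j * h j).val * _ * (g i * h i)⁻¹.val
    = (g j).val * ((h j).val * _ * (h i)⁻¹.val) * (g i)⁻¹.val
  simp only [mul_inv_rev, Units.val_mul, Matrix.mul_assoc]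

theorem changeBasis_map {A B : Type} [CommRing A] [Algebra ℂ A] [CommRing B] [Algebra ℂ B]
    (f : A →ₐ[ℂ] B) (g : GLPoints v A) (m : Rep v A) :
    (changeBasis g m).map f = changeBasis (GLPoints.map f g) (m.map f) := by
  funext i j α
  change ((g j).val * m i j α * (g i)⁻¹.val).map f
    = (g j).val.map f * (m i j α).map f * (g i)⁻¹.val.map f
  rw [Matrix.map_mul, Matrix.map_mul]

namespace PairLocus

variable (Z : PairLocus v)

/-- Points of a locus of pairs. -/
@[ext]
structure Pt (T : SchC) : Type where
  rep : Rep v (Functions T)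
  fn : Functions T
  eqs : ∀ k ∈ Z.eqs, k.val _ rep fn = 0
  -- Absence of common zeros, in a form that is visibly stable under restriction: only the empty
  -- scheme maps into the common zero locus.
  ineqs : ∀ (T' : SchC) (f : T' ⟶ T), (∀ k ∈ Z.ineqs,
    Functions.map f (k.val _ rep fn) = 0) → IsEmpty T'.left

variable {Z}

/-- Restriction of points. -/
def Pt.res {T T' : SchC} (f : T' ⟶ T) (x : Z.Pt T) : Z.Pt T' where
  rep := x.rep.map (Functions.map f)
  fn := Functions.map f x.fn
  eqs k hk := by rw [← k.map_val, x.eqs k hk, map_zero]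
  ineqs T'' g h := x.ineqs T'' (g ≫ f) fun k hk => by
    rw [← Functions.map_apply_comp, k.map_val (Functions.map f)]
    exact h k hk

variable (Z)

/-- The functor of points of a locus. -/
def functor : SchCᵒᵖ ⥤ Type where
  obj T := Z.Pt T.unop
  map f := TypeCat.ofHom fun x => x.res f.unop
  map_id T := ConcreteCategory.hom_ext _ _ fun x =>
    Pt.ext (Rep.map_Functions_id _) (by
      change Functions.map (𝟙 T.unop) x.fn = x.fn
      rw [Functions.map_id]; rfl)
  map_comp f g := ConcreteCategory.hom_ext _ _ fun x =>
    Pt.ext (Rep.map_Functions_comp f.unop g.unop _).symm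
      (Functions.map_apply_comp f.unop g.unop _).symm

/-- The change of basis on a point of a locus. -/
def Pt.changeBasis {Z : PairLocus v} {T : SchC} (g : GLPoints v (Functions T)) (x : Z.Pt T) :
    Z.Pt T where
  rep := QuiverStack.changeBasis g x.rep
  fn := x.fn
  eqs := Z.eqs_inv g _ _ x.eqs
  ineqs T' f h := x.ineqs T' f fun k hk => by
    -- Invariance is an implication, so it is applied with the inverse group element.
    have h₁ := Z.ineqs_inv (GLPoints.map (Functions.map f) g)⁻¹
      (QuiverStack.changeBasis (GLPoints.map (Functions.map f) g)
        (x.rep.map (Functions.map f))) (Functions.map f x.fn)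
      (fun k hk => by
        rw [← changeBasis_map, ← k.map_val]
        exact h k hk) k hk
    rw [← changeBasis_mul, inv_mul_cancel, changeBasis_one] at h₁
    rw [k.map_val, h₁]

/-- The action of `GL(v)` on a locus. -/
def action : GroupAction (GLFunctor v) Z.functor where
  act T g (x : Z.Pt T) := (x.changeBasis (show GLPoints v (Functions T) from g) : Z.Pt T)
  one_act T x := Pt.ext (changeBasis_one _) rfl
  mul_act T g h x := Pt.ext (changeBasis_mul _ _ _) rfl
  map_act f g x := Pt.ext (changeBasis_map _ _ _) rfl

/-- The polynomial ring in all matrix entries, with one more variable `none` for the scalar. -/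
theorem exists_generic [Finite I] [∀ i j : I, Finite (i ⟶ j)] : ∃ (P : Type) (_ : CommRing P)
    (_ : Algebra ℂ P) (_ : Algebra.FiniteType ℂ P) (m : Rep v P) (e : P),
    ∀ (B : Type) [CommRing B] [Algebra ℂ B] (n : Rep v B) (a : B),
      ∃! φ : P →ₐ[ℂ] B, m.map φ = n ∧ φ e = a := by
  refine ⟨MvPolynomial (Option (Σ (i : I) (j : I), (i ⟶ j) × Fin (v j) × Fin (v i))) ℂ,
    inferInstance, inferInstance, inferInstance,
    fun i j α => Matrix.of fun a b => MvPolynomial.X (some ⟨i, j, α, a, b⟩), MvPolynomial.X none,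
    fun B _ _ n a => ?_⟩
  refine ⟨MvPolynomial.aeval fun x => x.elim a fun y => n y.1 y.2.1 y.2.2.1 y.2.2.2.1 y.2.2.2.2,
    ⟨?_, MvPolynomial.aeval_X _ _⟩, fun φ hφ => ?_⟩
  · funext i j α
    ext a b
    exact MvPolynomial.aeval_X _ _
  · refine MvPolynomial.algHom_ext fun x => ?_
    rw [MvPolynomial.aeval_X]
    rcases x with _ | ⟨i, j, α, a, b⟩
    · exact hφ.2
    · exact congrArg (fun m : Rep v B => m i j α a b) hφ.1

theorem exists_generic_eqs [Finite I] [∀ i j : I, Finite (i ⟶ j)] (E : Set (PairFun v)) :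
    ∃ (P : Type) (_ : CommRing P)
    (_ : Algebra ℂ P) (_ : Algebra.FiniteType ℂ P) (m : Rep v P) (e : P),
    (∀ k ∈ E, k.val P m e = 0) ∧
    ∀ (B : Type) [CommRing B] [Algebra ℂ B] (n : Rep v B) (a : B), (∀ k ∈ E, k.val B n a = 0) →
      ∃! φ : P →ₐ[ℂ] B, m.map φ = n ∧ φ e = a := by
  obtain ⟨P, _, _, _, m, e, h⟩ := exists_generic (v := v)
  let J : Ideal P := Ideal.span {x | ∃ k ∈ E, x = k.val P m e}
  let q : P →ₐ[ℂ] P ⧸ J := Ideal.Quotient.mkₐ ℂ J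
  refine ⟨P ⧸ J, inferInstance, inferInstance, inferInstance, m.map q, q e, fun k hk => ?_,
    fun B _ _ n a hn => ?_⟩
  · rw [← k.map_val]
    exact Ideal.Quotient.eq_zero_iff_mem.2 (Ideal.subset_span ⟨k, hk, rfl⟩)
  · obtain ⟨φ, ⟨hφ₁, hφ₂⟩, hu⟩ := h B n a
    have hJ : ∀ x ∈ J, φ x = 0 := by
      intro x hx
      have : J ≤ RingHom.ker φ := Ideal.span_le.2 (by
        rintro _ ⟨k, hk, rfl⟩
        change φ _ = 0
        rw [k.map_val, hφ₁, hφ₂, hn k hk])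
      exact this hx
    have hq : (Ideal.Quotient.liftₐ J φ hJ).comp q = φ := AlgHom.ext fun x => rfl
    refine ⟨Ideal.Quotient.liftₐ J φ hJ, ⟨?_, ?_⟩, fun ψ ⟨h₁, h₂⟩ => ?_⟩
    · rw [Rep.map_map, hq, hφ₁]
    · rw [← AlgHom.comp_apply, hq, hφ₂]
    · refine Ideal.Quotient.algHom_ext ℂ ?_
      have h₃ : ψ.comp q = φ := hu _ ⟨by rw [← h₁, Rep.map_map], h₂⟩
      exact h₃.trans hq.symm

/-- Loci are represented by quasi-affine schemes. -/
theorem exists_isUniv [Finite I] [∀ i j : I, Finite (i ⟶ j)] :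
    ∃ (X₀ : SchC) (x₀ : Z.functor.obj (op X₀)), IsUniv Z.functor x₀ ∧ IsSeparated X₀.hom ∧
      LocallyOfFiniteType X₀.hom ∧ QuasiCompact X₀.hom := by
  obtain ⟨P, _, _, _, m, e, hm, hP⟩ := exists_generic_eqs Z.eqs
  let s : P →ₐ[ℂ] Functions (SpecC P) := (specUnit P).toAlgHom
  -- The open subset of the closed locus where at least one of the functions is invertible.
  let V : (SpecC P).left.Opens := ⨆ k ∈ Z.ineqs, unitLocus (s (k.val P m e))
  have hV : ∀ t : (SpecC P).left, t ∈ V ↔ ∃ k ∈ Z.ineqs, t ∈ unitLocus (s (k.val P m e)) :=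
    fun t => by simp [V]
  let x₀ : Z.Pt (opn (SpecC P) V) :=
    { rep := (m.map s).map (Functions.map (opnι _ V))
      fn := Functions.map (opnι _ V) (s e)
      eqs := fun k hk => by rw [← k.map_val, ← k.map_val, hm k hk, map_zero, map_zero]
      ineqs := fun T f h => ⟨fun t => by
        have ht : (opnι _ V).left (f.left t) ∈ (V : Set (SpecC P).left) := by
          rw [← range_opnι]; exact ⟨_, rfl⟩
        obtain ⟨k, hk, hkt⟩ := (hV _).1 ht
        have h₁ := h k hk
        rw [← k.map_val, ← k.map_val] at h₁
        have h₂ := (mem_unitLocus_map f _ t).2 ((mem_unitLocus_map (opnι _ V) _ _).2 hkt)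
        rw [h₁, unitLocus_zero] at h₂
        exact h₂⟩ }
  have hu : IsUniv Z.functor (E := opn (SpecC P) V) x₀ := by
    intro T (x : Z.Pt T)
    obtain ⟨f, ⟨hf₁, hf₂⟩, hfu⟩ := existsUnique_hom_SpecC_of (hP (Functions T) x.rep x.fn x.eqs)
    have hk : ∀ k : PairFun v, Functions.map f (s (k.val P m e)) = k.val _ x.rep x.fn := fun k => by
      rw [k.map_val, k.map_val, ← hf₁, ← hf₂]
      rfl
    obtain ⟨g, hg⟩ := exists_opn_lift V f (by
      rintro _ ⟨t, rfl⟩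
      refine (hV _).2 ?_
      -- At a point outside `V` all the functions would vanish in the residue field, although its
      -- spectrum is not empty.
      by_contra! hc
      obtain ⟨T', f', hne, hf'⟩ := exists_residue_point T t
      have := x.ineqs T' f' fun k hkk => hf' _ fun ht => hc k hkk (by
        rw [← mem_unitLocus_map, hk]; exact ht)
      exact hne.elim this.elim)
    refine ⟨g, Pt.ext ?_ ?_, fun g' hg' => ?_⟩
    · rw [← hf₁, ← hg]
      exact Rep.map_Functions_comp (opnι _ V) g _
    · rw [← hf₂, ← hg]
      exact Functions.map_apply_comp (opnι _ V) g _
    · have : Mono (opnι (SpecC P) V) := mono_of_isOpenImmersion _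
      rw [← cancel_mono (opnι (SpecC P) V), hg]
      refine hfu _ ⟨?_, ?_⟩
      · refine Eq.trans ?_ (congrArg Pt.rep hg')
        exact (Rep.map_Functions_comp (opnι _ V) g' _).symm
      · refine Eq.trans ?_ (congrArg Pt.fn hg')
        exact (Functions.map_apply_comp (opnι _ V) g' _).symm
  have hsep : IsSeparated (SpecC P).hom := inferInstance
  have hft : LocallyOfFiniteType (SpecC P).hom := by
    change LocallyOfFiniteType (Spec.map (CommRingCat.ofHom (algebraMap ℂ P)))
    refine (HasRingHomProperty.Spec_iff (P := @LocallyOfFiniteType)).2 ?_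
    exact RingHom.finiteType_algebraMap.2 inferInstance
  -- There may be infinitely many inequations; the open locus is quasi-compact because the ambient
  -- space is noetherian.
  have hN : IsNoetherianRing P := Algebra.FiniteType.isNoetherianRing ℂ P
  have hNS : TopologicalSpace.NoetherianSpace (SpecC P).left :=
    inferInstanceAs (TopologicalSpace.NoetherianSpace (PrimeSpectrum P))
  refine ⟨_, x₀, hu, ?_, ?_, ?_⟩
  · change IsSeparated (V.ι ≫ (SpecC P).hom)
    infer_instance
  · change LocallyOfFiniteType (V.ι ≫ (SpecC P).hom)
    infer_instance
  · have : TopologicalSpace.NoetherianSpace (opn (SpecC P) V).left :=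
      inferInstanceAs (TopologicalSpace.NoetherianSpace (V : Set (SpecC P).left))
    change QuasiCompact (opn (SpecC P) V).hom
    exact quasiCompact_of_noetherianSpace_source _

theorem isArtinStack [Fintype I] [∀ i j : I, Finite (i ⟶ j)] :
    IsArtinStack (quotientStack Z.action) := by
  obtain ⟨X₀, x₀, hX, h₁, h₂, h₃⟩ := Z.exists_isUniv
  obtain ⟨G₀, γ, hγ, hsm, hsurj, haff⟩ := exists_isUnivElement_GL v
  exact isArtinStack_quotientStack hγ (hasZariskiSections_GL v) (hasZariskiSections_GL v) hsm hsurj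
    haff hX h₁ h₂ h₃ _

end PairLocus

end Loci

end QuiverStack

end

noncomputable section
namespace QuiverStack

/-! ## Path algebras and traces -/

section Traces

variable {I : Type} [Quiver.{0} I] {v : I → ℕ} {A : Type} [CommRing A] [Algebra ℂ A]

open Classical in
/-- The block of the linear map that a path induces. -/
def pathBlock (m : Rep v A) (i j : I) (p : QPath I) : Matrix (Fin (v j)) (Fin (v i)) A :=
  if h : p.1 = i ∧ p.2.1 = j then evalPath m (p.2.2.cast h.1 h.2) else 0

theorem pathBlock_self (m : Rep v A) {i j : I} (p : Quiver.Path i j) :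
    pathBlock m i j ⟨i, j, p⟩ = evalPath m p := dif_pos ⟨rfl, rfl⟩

theorem pathBlock_of_ne (m : Rep v A) {i j : I} {p : QPath I} (h : ¬ (p.1 = i ∧ p.2.1 = j)) :
    pathBlock m i j p = 0 := dif_neg h

theorem evalBlock_eq (x : PathAlgebra I) (m : Rep v A) (i j : I) :
    evalBlock x m i j = Finsupp.linearCombination ℂ (pathBlock m i j) x := by
  rw [Finsupp.linearCombination_apply, evalBlock]
  refine Finset.sum_congr rfl fun p _ => ?_
  by_cases h : p.1 = i ∧ p.2.1 = j
  · exact (dif_pos h).trans (congrArg (x p • ·) (dif_pos h : pathBlock m i j p = _).symm)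
  · exact (dif_neg h).trans
      ((congrArg (x p • ·) (pathBlock_of_ne m h)).trans (smul_zero _)).symm

theorem evalPath_comp (m : Rep v A) {i j k : I} (p : Quiver.Path i j) (q : Quiver.Path j k) :
    evalPath m (p.comp q) = evalPath m q * evalPath m p := by
  induction q with
  | nil => rw [Quiver.Path.comp_nil, evalPath, Matrix.one_mul]
  | cons q α ih => rw [Quiver.Path.comp_cons, evalPath, ih, evalPath, Matrix.mul_assoc]

theorem evalBlock_single (p : QPath I) (m : Rep v A) (i j : I) :
    evalBlock (Finsupp.single p 1) m i j = pathBlock m i j p := by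
  rw [evalBlock_eq, Finsupp.linearCombination_single, one_smul]

theorem evalBlock_concat [Fintype I] (p q : QPath I) (m : Rep v A) (i k : I) :
    evalBlock (concat p q) m i k = ∑ j, pathBlock m j k q * pathBlock m i j p := by
  obtain ⟨a, b, p⟩ := p
  obtain ⟨b', c, q⟩ := q
  by_cases hb : b = b'
  · subst hb
    have hc : concat (⟨a, b, p⟩ : QPath I) ⟨b, c, q⟩ = Finsupp.single ⟨a, c, p.comp q⟩ 1 :=
      dif_pos rfl
    rw [hc, evalBlock_single, Finset.sum_eq_single b]
    · by_cases h : a = i ∧ c = k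
      · obtain ⟨rfl, rfl⟩ := h
        rw [pathBlock_self, pathBlock_self, pathBlock_self, evalPath_comp]
      · rw [pathBlock_of_ne m h]
        by_cases ha : a = i
        · rw [pathBlock_of_ne m (fun h' => h ⟨ha, h'.2⟩) (p := ⟨b, c, q⟩), Matrix.zero_mul]
        · rw [pathBlock_of_ne m (fun h' => ha h'.1) (p := ⟨a, b, p⟩), Matrix.mul_zero]
    · intro j _ hj
      rw [pathBlock_of_ne m (fun h' => hj h'.1.symm) (p := ⟨b, c, q⟩), Matrix.zero_mul]
    · exact fun h => (h (Finset.mem_univ _)).elim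
  · have hc : concat (⟨a, b, p⟩ : QPath I) ⟨b', c, q⟩ = 0 := dif_neg hb
    rw [hc, evalBlock_eq, map_zero]
    refine (Finset.sum_eq_zero fun j _ => ?_).symm
    by_cases hj : b = j
    · rw [pathBlock_of_ne m (fun h' => hb (hj.trans h'.1.symm)) (p := ⟨b', c, q⟩), Matrix.zero_mul]
    · rw [pathBlock_of_ne m (fun h' => hj h'.2) (p := ⟨a, b, p⟩), Matrix.mul_zero]

/-- Paths are concatenated from left to right while linear maps compose from right to left, so the
order of the factors is reversed. -/
theorem evalBlock_pathMul [Fintype I] (x y : PathAlgebra I) (m : Rep v A) (i k : I) :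
    evalBlock (pathMul x y) m i k = ∑ j, evalBlock y m j k * evalBlock x m i j := by
  have h₁ : evalBlock (pathMul x y) m i k =
      ∑ p ∈ x.support, ∑ q ∈ y.support, ∑ j,
        (y q • pathBlock m j k q) * (x p • pathBlock m i j p) := by
    rw [evalBlock_eq, pathMul, Finsupp.sum, map_sum]
    refine Finset.sum_congr rfl fun p _ => ?_
    rw [Finsupp.sum, map_sum]
    refine Finset.sum_congr rfl fun q _ => ?_
    rw [map_smul, ← evalBlock_eq, evalBlock_concat, Finset.smul_sum]
    refine Finset.sum_congr rfl fun j _ => ?_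
    rw [Matrix.smul_mul, Matrix.mul_smul, smul_smul, mul_comm]
  have h₂ : ∀ j, evalBlock y m j k * evalBlock x m i j = ∑ p ∈ x.support, ∑ q ∈ y.support,
      (y q • pathBlock m j k q) * (x p • pathBlock m i j p) := fun j => by
    rw [evalBlock_eq, evalBlock_eq, Finsupp.linearCombination_apply,
      Finsupp.linearCombination_apply, Finsupp.sum, Finsupp.sum, Matrix.mul_sum]
    refine Finset.sum_congr rfl fun p _ => ?_
    rw [Matrix.sum_mul]
  rw [h₁, Finset.sum_congr rfl fun j _ => h₂ j]
  exact (Finset.sum_congr rfl fun p _ => Finset.sum_comm).trans Finset.sum_comm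

theorem traceFun_pathMul [Fintype I] (x y : PathAlgebra I) (m : Rep v A) :
    traceFun (pathMul x y) m = ∑ i, ∑ j, (evalBlock y m j i * evalBlock x m i j).trace := by
  refine Finset.sum_congr rfl fun i _ => ?_
  rw [evalBlock_pathMul, Matrix.trace_sum]

theorem traceFun_pathMul_comm [Fintype I] (x y : PathAlgebra I) (m : Rep v A) :
    traceFun (pathMul x y) m = traceFun (pathMul y x) m := by
  rw [traceFun_pathMul, traceFun_pathMul, Finset.sum_comm]
  refine Finset.sum_congr rfl fun i _ => Finset.sum_congr rfl fun j _ => ?_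
  exact Matrix.trace_mul_comm _ _

/-- The trace, as a linear map on the path algebra. -/
def traceLinear [Fintype I] (m : Rep v A) : PathAlgebra I →ₗ[ℂ] A :=
  ∑ i, (Matrix.traceLinearMap (Fin (v i)) ℂ A).comp (Finsupp.linearCombination ℂ (pathBlock m i i))

theorem traceLinear_apply [Fintype I] (m : Rep v A) (x : PathAlgebra I) :
    traceLinear m x = traceFun x m := by
  rw [traceLinear, LinearMap.sum_apply]
  refine Finset.sum_congr rfl fun i _ => ?_
  rw [evalBlock_eq]
  rfl

/-- The trace depends only on the class modulo commutators. -/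
theorem traceFun_congr [Fintype I] {x y : PathAlgebra I} (h : x - y ∈ commutators I)
    (m : Rep v A) : traceFun x m = traceFun y m := by
  have hle : commutators I ≤ LinearMap.ker (traceLinear m) := Submodule.span_le.2 (by
    rintro _ ⟨x, y, rfl⟩
    change traceLinear m _ = 0
    rw [map_sub, traceLinear_apply, traceLinear_apply, traceFun_pathMul_comm, sub_self])
  have h₁ : traceLinear m (x - y) = 0 := hle h
  rw [map_sub, sub_eq_zero, traceLinear_apply, traceLinear_apply] at h₁
  exact h₁

/-- Expands only the first factor into monomials. With `L` as first factor each summand pairs one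
arrow with one block of `R`, which displays the trace as a linear form. -/
theorem traceFun_pathMul_eq_sum [Fintype I] (x y : PathAlgebra I) (m : Rep v A) :
    traceFun (pathMul x y) m =
      ∑ p ∈ x.support, x p • (evalBlock y m p.2.1 p.1 * evalPath m p.2.2).trace := by
  have h : ∀ p : QPath I, (evalBlock y m p.2.1 p.1 * evalPath m p.2.2).trace =
      ∑ i, ∑ j, (evalBlock y m j i * pathBlock m i j p).trace := by
    rintro ⟨a, b, p⟩
    rw [Finset.sum_eq_single a, Finset.sum_eq_single b, pathBlock_self]
    · intro j _ hj
      rw [pathBlock_of_ne m (fun h => hj h.2.symm) (p := ⟨a, b, p⟩), Matrix.mul_zero,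
        Matrix.trace_zero]
    · exact fun h => (h (Finset.mem_univ _)).elim
    · intro i _ hi
      refine Finset.sum_eq_zero fun j _ => ?_
      rw [pathBlock_of_ne m (fun h => hi h.1.symm) (p := ⟨a, b, p⟩), Matrix.mul_zero,
        Matrix.trace_zero]
    · exact fun h => (h (Finset.mem_univ _)).elim
  rw [traceFun_pathMul]
  have h₂ : ∀ i j, (evalBlock y m j i * evalBlock x m i j).trace =
      ∑ p ∈ x.support, x p • (evalBlock y m j i * pathBlock m i j p).trace := fun i j => by
    rw [evalBlock_eq x, Finsupp.linearCombination_apply, Finsupp.sum, Matrix.mul_sum,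
      Matrix.trace_sum]
    refine Finset.sum_congr rfl fun p _ => ?_
    rw [Matrix.mul_smul, Matrix.trace_smul]
  simp only [h₂, h, Finset.smul_sum]
  rw [Finset.sum_comm (s := x.support)]
  exact Finset.sum_congr rfl fun i _ => Finset.sum_comm

/-! ### Combinatorics of paths and their first arrows -/

theorem evalPath_congr {m m' : Rep v A} {i j : I} (q : Quiver.Path i j)
    (h : ∀ (k l : I) (α : k ⟶ l) (a : Quiver.Path i k) (b : Quiver.Path l j),
      q = (a.comp α.toPath).comp b → m k l α = m' k l α) : evalPath m q = evalPath m' q := by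
  induction q with
  | nil => rfl
  | cons q α ih =>
    rw [evalPath, evalPath, h _ _ α q .nil rfl, ih fun k l β a b hq => h k l β a (b.cons α) (by
      rw [hq, Quiver.Path.comp_cons])]

theorem exists_arrow_of_length_eq_one {p : QPath I} (h : p.2.2.length = 1) :
    ∃ (i j : I) (α : i ⟶ j), p = ⟨i, j, α.toPath⟩ := by
  obtain ⟨i, j, p⟩ := p
  cases p with
  | nil => exact absurd h (by simp)
  | cons p α =>
    cases p with
    | nil => exact ⟨i, j, α, rfl⟩
    | cons p β => exact absurd h (by simp)

/-- Unique decomposition into first arrow and remainder excludes cancellation in the product of a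
linear element with another one. Paths grow at their end, hence the induction over the remainder,
with lengths compared beforehand. -/
theorem toPath_comp_injective {i k k' l : I} (α : i ⟶ k) (β : i ⟶ k') (q : Quiver.Path k l)
    (q' : Quiver.Path k' l) (h : α.toPath.comp q = β.toPath.comp q') :
    (⟨k, α, q⟩ : Σ k, (i ⟶ k) × Quiver.Path k l) = ⟨k', β, q'⟩ := by
  have hlen : q.length = q'.length := by
    have := congrArg Quiver.Path.length h
    simpa [Quiver.Path.length_comp] using this
  induction q with
  | nil =>
    cases q' with
    | nil => cases h; rfl
    | cons q' γ => exact absurd hlen (by simp)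
  | cons q γ ih =>
    cases q' with
    | nil => exact absurd hlen (by simp)
    | cons q' γ' =>
      rw [Quiver.Path.comp_cons, Quiver.Path.comp_cons] at h
      have hm := Quiver.Path.obj_eq_of_cons_eq_cons h
      subst hm
      have h₁ := eq_of_heq (Quiver.Path.heq_of_cons_eq_cons h)
      have h₂ := eq_of_heq (Quiver.Path.hom_heq_of_cons_eq_cons h)
      have h₃ := ih q' h₁ (by simpa using hlen)
      subst h₂
      cases h₃
      rfl

end Traces

end QuiverStack

end

noncomputable section
namespace QuiverStack

/-! ## Linear factorizations -/

section Factorization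

variable {I : Type} [Quiver.{0} I] {v : I → ℕ} {A : Type} [CommRing A] [Algebra ℂ A]

/-- The arrow occurs in the linear element `L`. -/
def InL (L : PathAlgebra I) {i j : I} (α : i ⟶ j) : Prop :=
  (⟨i, j, α.toPath⟩ : QPath I) ∈ L.support

open Classical in
/-- Setting the arrows of `L` to zero. -/
def killL (L : PathAlgebra I) (m : Rep v A) : Rep v A :=
  fun i j α => if InL L α then 0 else m i j α

/-- The matrix entries of the arrows of `L`. -/
abbrev LIndex (L : PathAlgebra I) (v : I → ℕ) : Type :=
  Σ p : L.support, Fin (v p.1.2.1) × Fin (v p.1.1)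

/-- The values of the matrix entries of the arrows of `L`. -/
def coordL (L : PathAlgebra I) (m : Rep v A) (k : LIndex L v) : A :=
  evalPath m k.1.1.2.2 k.2.1 k.2.2

open Classical in
/-- Replacing the arrows of `L`. -/
def insertL (L : PathAlgebra I) (m : Rep v A) (a : LIndex L v → A) : Rep v A :=
  fun i j α => if h : InL L α then Matrix.of fun x y => a ⟨⟨_, h⟩, x, y⟩ else m i j α

/-- The coefficient of a matrix entry of an arrow of `L` in the trace of `L · R`. -/
def cofactor (L R : PathAlgebra I) (m : Rep v A) (k : LIndex L v) : A :=
  L k.1.1 • evalBlock R m k.1.1.2.1 k.1.1.1 k.2.2 k.2.1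

theorem evalPath_toPath (m : Rep v A) {i j : I} (α : i ⟶ j) : evalPath m α.toPath = m i j α := by
  change m i j α * 1 = _
  rw [Matrix.mul_one]

theorem insertL_of_mem (L : PathAlgebra I) (m : Rep v A) (a : LIndex L v → A) {i j : I}
    {α : i ⟶ j} (h : InL L α) :
    insertL L m a i j α = Matrix.of fun x y => a ⟨⟨⟨i, j, α.toPath⟩, h⟩, x, y⟩ := dif_pos h

theorem insertL_of_notMem (L : PathAlgebra I) (m : Rep v A) (a : LIndex L v → A) {i j : I}
    {α : i ⟶ j} (h : ¬ InL L α) : insertL L m a i j α = m i j α := dif_neg h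

theorem insertL_killL_coordL (L : PathAlgebra I) (m : Rep v A) :
    insertL L (killL L m) (coordL L m) = m := by
  funext i j α
  by_cases h : InL L α
  · refine (dif_pos h).trans ?_
    ext x y
    exact congrFun (congrFun (evalPath_toPath m α) x) y
  · exact (dif_neg h).trans (if_neg h)

theorem killL_insertL (L : PathAlgebra I) (m : Rep v A) (a : LIndex L v → A) :
    killL L (insertL L m a) = killL L m := by
  funext i j α
  by_cases h : InL L α
  · exact (if_pos h).trans (if_pos h).symm
  · exact ((if_neg h).trans (dif_neg h)).trans (if_neg h).symm

theorem killL_killL (L : PathAlgebra I) (m : Rep v A) : killL L (killL L m) = killL L m := by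
  funext i j α
  by_cases h : InL L α
  · exact (if_pos h).trans (if_pos h).symm
  · exact if_neg h

theorem killL_map {B : Type} [CommRing B] [Algebra ℂ B] (f : A →ₐ[ℂ] B) (L : PathAlgebra I)
    (m : Rep v A) : (killL L m).map f = killL L (m.map f) := by
  funext i j α
  by_cases h : InL L α
  · refine (congrArg (fun x => Matrix.map x f) (if_pos h)).trans (Eq.trans ?_ (if_pos h).symm)
    ext
    simp
  · exact (congrArg (fun x => Matrix.map x f) (if_neg h)).trans (if_neg h).symm

theorem killL_changeBasis (L : PathAlgebra I) (g : GLPoints v A) (m : Rep v A) :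
    changeBasis g (killL L m) = killL L (changeBasis g m) := by
  funext i j α
  by_cases h : InL L α
  · refine (congrArg (fun x => (g j).val * x * (g i)⁻¹.val) (if_pos h)).trans
      (Eq.trans ?_ (if_pos h).symm)
    rw [Matrix.mul_zero, Matrix.zero_mul]
  · exact (congrArg (fun x => (g j).val * x * (g i)⁻¹.val) (if_neg h)).trans (if_neg h).symm

theorem insertL_map {B : Type} [CommRing B] [Algebra ℂ B] (f : A →ₐ[ℂ] B) (L : PathAlgebra I)
    (m : Rep v A) (a : LIndex L v → A) :
    (insertL L m a).map f = insertL L (m.map f) (f ∘ a) := by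
  funext i j α
  by_cases h : InL L α
  · rw [insertL_of_mem _ _ _ h]
    exact congrArg (fun x => Matrix.map x f) (insertL_of_mem L m a h)
  · rw [insertL_of_notMem _ _ _ h]
    exact congrArg (fun x => Matrix.map x f) (insertL_of_notMem L m a h)

theorem cofactor_map {B : Type} [CommRing B] [Algebra ℂ B] (f : A →ₐ[ℂ] B) (L R : PathAlgebra I)
    (m : Rep v A) (k : LIndex L v) : cofactor L R (m.map f) k = f (cofactor L R m k) := by
  rw [cofactor, evalBlock_map, cofactor, map_smul]
  rfl

variable {W L R : PathAlgebra I} (hLR : IsLinearFactorization W L R)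

include hLR

theorem coordL_insertL (m : Rep v A) (a : LIndex L v → A) : coordL L (insertL L m a) = a := by
  funext ⟨⟨p, hp⟩, x, y⟩
  obtain ⟨i, j, α, rfl⟩ := exists_arrow_of_length_eq_one (hLR.linear p hp)
  refine (congrFun (congrFun (evalPath_toPath _ α) x) y).trans ?_
  exact congrFun (congrFun (insertL_of_mem L m a hp) x) y

/-- An arrow of `L` is never part of a monomial of `R`, so each monomial only sees arrows on which
the two representations agree. -/
theorem evalBlock_congr {m m' : Rep v A} (hm : ∀ i j (α : i ⟶ j), ¬ InL L α → m i j α = m' i j α)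
    (i j : I) : evalBlock R m i j = evalBlock R m' i j := by
  rw [evalBlock_eq, evalBlock_eq, Finsupp.linearCombination_apply, Finsupp.linearCombination_apply]
  refine Finset.sum_congr rfl fun q hq => congrArg (R q • ·) ?_
  obtain ⟨k, l, q⟩ := q
  by_cases h : k = i ∧ l = j
  · obtain ⟨rfl, rfl⟩ := h
    rw [pathBlock_self, pathBlock_self]
    exact evalPath_congr q fun _ _ α a b hab =>
      hm _ _ α fun hα => hLR.notOccurs _ hα _ hq ⟨a, b, hab⟩
  · rw [pathBlock_of_ne m h, pathBlock_of_ne m' h]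

theorem evalBlock_killL (m : Rep v A) (i j : I) : evalBlock R (killL L m) i j = evalBlock R m i j :=
  evalBlock_congr hLR (fun _ _ _ h => if_neg h) i j

theorem evalBlock_insertL (m : Rep v A) (a : LIndex L v → A) (i j : I) :
    evalBlock R (insertL L m a) i j = evalBlock R m i j :=
  evalBlock_congr hLR (fun _ _ _ h => dif_neg h) i j

theorem cofactor_killL (m : Rep v A) (k : LIndex L v) :
    cofactor L R (killL L m) k = cofactor L R m k := by
  rw [cofactor, evalBlock_killL hLR, cofactor]

theorem cofactor_insertL (m : Rep v A) (a : LIndex L v → A) (k : LIndex L v) :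
    cofactor L R (insertL L m a) k = cofactor L R m k := by
  rw [cofactor, evalBlock_insertL hLR, cofactor]

/-- The trace of `W` is linear in the arrows of `L`. -/
theorem traceFun_eq_sum_coordL [Fintype I] (m : Rep v A) :
    traceFun W m = ∑ k : LIndex L v, coordL L m k * cofactor L R m k := by
  rw [traceFun_congr hLR.sub_mem, traceFun_pathMul_eq_sum]
  -- The trace of a product pairs the entry (x, y) of the arrow with the entry (y, x) of the block,
  -- which accounts for the interchanged indices in `cofactor`.
  have h : ∀ p : QPath I, L p • (evalBlock R m p.2.1 p.1 * evalPath m p.2.2).trace =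
      ∑ x : Fin (v p.2.1) × Fin (v p.1),
        evalPath m p.2.2 x.1 x.2 * L p • evalBlock R m p.2.1 p.1 x.2 x.1 := fun p => by
    rw [Matrix.trace_mul_comm, Fintype.sum_prod_type, Matrix.trace, Finset.smul_sum]
    refine Finset.sum_congr rfl fun a _ => ?_
    rw [Matrix.diag_apply, Matrix.mul_apply, Finset.smul_sum]
    exact Finset.sum_congr rfl fun b _ => (mul_smul_comm _ _ _).symm
  rw [Finset.sum_congr rfl fun p _ => h p, ← Finset.sum_coe_sort L.support fun p =>
    ∑ x : Fin (v p.2.1) × Fin (v p.1),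
        evalPath m p.2.2 x.1 x.2 * L p • evalBlock R m p.2.1 p.1 x.2 x.1]
  exact (Fintype.sum_sigma fun k : LIndex L v => coordL L m k * cofactor L R m k).symm

/-- The concatenation of the two monomials arises from no other pair, so its coefficient in L·R is
the product of two non-zero numbers. It is therefore a monomial of the superpotential, that is, a
cycle. -/
theorem cycle_of_composable {p q : QPath I} (hp : p ∈ L.support) (hq : q ∈ R.support)
    (h : p.2.1 = q.1) : q.2.1 = p.1 := by
  obtain ⟨i, k, α, rfl⟩ := exists_arrow_of_length_eq_one (hLR.linear p hp)
  obtain ⟨k', l, q⟩ := q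
  change k = k' at h
  subst h
  let w : QPath I := ⟨i, l, α.toPath.comp q⟩
  have hc : concat (⟨i, k, α.toPath⟩ : QPath I) ⟨k, l, q⟩ = Finsupp.single w 1 := dif_pos rfl
  have hne : ∀ p' ∈ L.support, ∀ q' ∈ R.support, concat p' q' w ≠ 0 →
      p' = ⟨i, k, α.toPath⟩ ∧ q' = ⟨k, l, q⟩ := by
    intro p' hp' q' _ hw
    obtain ⟨i', j, β, rfl⟩ := exists_arrow_of_length_eq_one (hLR.linear p' hp')
    obtain ⟨j', l', q'⟩ := q'
    by_cases hj : j = j'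
    · subst hj
      have hc' : concat (⟨i', j, β.toPath⟩ : QPath I) ⟨j, l', q'⟩ =
          Finsupp.single ⟨i', l', β.toPath.comp q'⟩ 1 := dif_pos rfl
      rw [hc'] at hw
      have he : (⟨i', l', β.toPath.comp q'⟩ : QPath I) = w := by
        by_contra hne
        exact hw (Finsupp.single_eq_of_ne (Ne.symm hne))
      have h₁ : i' = i := congrArg Sigma.fst he
      subst h₁
      have he' := eq_of_heq (Sigma.mk.inj he).2
      have h₂ : l' = l := congrArg Sigma.fst he'
      subst h₂
      have h₃ := toPath_comp_injective _ _ _ _ (eq_of_heq (Sigma.mk.inj he').2)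
      cases h₃
      exact ⟨rfl, rfl⟩
    · rw [show concat (⟨i', j, β.toPath⟩ : QPath I) ⟨j', l', q'⟩ = 0 from dif_neg hj] at hw
      exact (hw rfl).elim
  have hcoef : pathMul L R w = L ⟨i, k, α.toPath⟩ * R ⟨k, l, q⟩ := by
    rw [pathMul, Finsupp.sum, Finsupp.finsetSum_apply, Finset.sum_eq_single_of_mem _ hp,
      Finsupp.sum, Finsupp.finsetSum_apply, Finset.sum_eq_single_of_mem _ hq, hc,
      Finsupp.smul_apply, Finsupp.single_eq_same, smul_eq_mul, mul_one]
    · intro q' hq' hqq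
      rw [Finsupp.smul_apply]
      by_contra hz
      exact hqq (hne _ hp _ hq' fun h => hz (by rw [h, smul_zero])).2
    · intro p' hp' hpp
      rw [Finsupp.sum, Finsupp.finsetSum_apply]
      refine Finset.sum_eq_zero fun q' hq' => ?_
      rw [Finsupp.smul_apply]
      by_contra hz
      exact hpp (hne _ hp' _ hq' fun h => hz (by rw [h, smul_zero])).1
  have hmem : w ∈ (pathMul L R).support := by
    rw [Finsupp.mem_support_iff, hcoef]
    exact mul_ne_zero (Finsupp.mem_support_iff.1 hp) (Finsupp.mem_support_iff.1 hq)
  exact (hLR.superpotential w hmem).symm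

/-- The cofactors generate the ideal of the entries of `R`. -/
theorem evalBlock_eq_zero_of_cofactor (m : Rep v A) (h : ∀ k, cofactor L R m k = 0) (i j : I) :
    evalBlock R m i j = 0 := by
  by_cases hq : ∃ q ∈ R.support, q.1 = i ∧ q.2.1 = j
  · obtain ⟨q, hq, rfl, rfl⟩ := hq
    obtain ⟨p, hp, hpq⟩ := hLR.composable q hq
    have hc := cycle_of_composable hLR hp hq hpq
    -- The block goes from the head of the arrow `p` back to its tail. Its entries are thus the
    -- cofactors of the entries of `p`, up to the non-zero coefficient of `p` in `L`.
    rw [hc, ← hpq]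
    ext a b
    have h₁ := h ⟨⟨p, hp⟩, b, a⟩
    have h₂ := congrArg (fun z => (L p)⁻¹ • z) h₁
    simp only [cofactor, smul_zero, smul_smul] at h₂
    rw [inv_mul_cancel₀ (Finsupp.mem_support_iff.1 hp), one_smul] at h₂
    exact h₂
  · rw [evalBlock_eq, Finsupp.linearCombination_apply]
    refine Finset.sum_eq_zero fun q hqs => ?_
    exact (congrArg (R q • ·) (pathBlock_of_ne m fun h' => hq ⟨q, hqs, h'⟩)).trans (smul_zero _)

end Factorization

end QuiverStack

end

noncomputable section
namespace QuiverStack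

/-! ## Affine spaces and linear equations -/

theorem exists_affineSpace (n : ℕ) : ∃ (Φ : SchC)
    (coord : ∀ W : SchC, (W ⟶ Φ) → Fin n → Functions W),
    (∀ W, Function.Bijective (coord W)) ∧
      ∀ {W W' : SchC} (l : W' ⟶ W) (r : W ⟶ Φ) (i : Fin n),
        coord W' (l ≫ r) i = Functions.map l (coord W r i) := by
  let P := MvPolynomial (Fin n) ℂ
  refine ⟨SpecC P, fun W r i => Functions.map r (specUnit P (MvPolynomial.X i)), fun W => ?_,
    fun l r i => (Functions.map_apply_comp r l _).symm⟩
  have h : ∀ y : Fin n → Functions W, ∃! φ : P →ₐ[ℂ] Functions W,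
      (fun i => φ (MvPolynomial.X i)) = y := fun y =>
    ⟨MvPolynomial.aeval y, funext fun i => MvPolynomial.aeval_X _ _, fun φ hφ =>
      MvPolynomial.algHom_ext fun i => (congrFun hφ i).trans (MvPolynomial.aeval_X _ _).symm⟩
  have h' := fun y => existsUnique_hom_SpecC_of (h y)
  exact ⟨fun r r' hr => (h' _).unique hr rfl, fun y => (h' y).exists⟩

section LinearEquation

variable {κ : Type} [Fintype κ] [DecidableEq κ] {A : Type} [CommRing A] (k₀ : κ)

/-- The solution of a linear equation with an invertible coefficient (with inverse `w`) for given
values of the other unknowns. -/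
def solveLinear (w c : A) (ρ : κ → A) (y : {k // k ≠ k₀} → A) (k : κ) : A :=
  if h : k = k₀ then w * (c - ∑ k', y k' * ρ k') else y ⟨k, h⟩

theorem solveLinear_self (w c : A) (ρ : κ → A) (y : {k // k ≠ k₀} → A) :
    solveLinear k₀ w c ρ y k₀ = w * (c - ∑ k', y k' * ρ k') := dif_pos rfl

theorem solveLinear_ne (w c : A) (ρ : κ → A) (y : {k // k ≠ k₀} → A) (k : {k // k ≠ k₀}) :
    solveLinear k₀ w c ρ y k = y k := dif_neg k.2

theorem sum_solveLinear {w c : A} {ρ : κ → A} (hw : w * ρ k₀ = 1) (y : {k // k ≠ k₀} → A) :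
    ∑ k, solveLinear k₀ w c ρ y k * ρ k = c := by
  rw [Fintype.sum_eq_add_sum_subtype_ne _ k₀, solveLinear_self]
  simp only [solveLinear_ne]
  linear_combination (c - ∑ k', y k' * ρ k') * hw

theorem solveLinear_eq {w c : A} {ρ : κ → A} (hw : w * ρ k₀ = 1) {a : κ → A}
    (ha : ∑ k, a k * ρ k = c) : solveLinear k₀ w c ρ (fun k => a k) = a := by
  funext k
  by_cases h : k = k₀
  · subst h
    rw [Fintype.sum_eq_add_sum_subtype_ne _ k] at ha
    rw [solveLinear_self]
    linear_combination (-w) * ha + a k * hw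
  · exact dif_neg h

theorem map_solveLinear {B : Type} [CommRing B] (f : A →+* B) (w c : A) (ρ : κ → A)
    (y : {k // k ≠ k₀} → A) :
    f ∘ solveLinear k₀ w c ρ y = solveLinear k₀ (f w) (f c) (f ∘ ρ) (f ∘ y) := by
  funext k
  by_cases h : k = k₀
  · subst h
    rw [Function.comp_apply, solveLinear_self, solveLinear_self]
    simp
  · have h₁ := solveLinear_ne k₀ w c ρ y ⟨k, h⟩
    have h₂ := solveLinear_ne k₀ (f w) (f c) (f ∘ ρ) (f ∘ y) ⟨k, h⟩
    exact (congrArg f h₁).trans h₂.symm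

end LinearEquation

theorem isEmpty_of_one_eq_zero {T : SchC} (h : (1 : Functions T) = 0) : IsEmpty T.left := by
  refine ⟨fun t => ?_⟩
  have h₁ : t ∈ unitLocus (1 : Functions T) := by rw [unitLocus_of_isUnit isUnit_one]; trivial
  rw [h, unitLocus_zero] at h₁
  exact h₁

/-- The functions on a terminal complex scheme are the constants, and ℂ is a field. -/
theorem isUnit_of_isTerminal {T : SchC} (hT : IsTerminal T) {x : Functions T} (hx : x ≠ 0) :
    IsUnit x := by
  have : IsIso T.hom := isIso_hom_of_isTerminal hT
  have hi : ∀ g : T.left ⟶ Spec (CommRingCat.of ℂ), IsIso g → IsIso g.appTop := fun g _ =>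
    inferInstanceAs (IsIso (g.app ⊤))
  have := hi T.hom this
  have hi' := IsIso.comp_isIso (f := (Scheme.ΓSpecIso (CommRingCat.of ℂ)).inv)
    (h := Scheme.Hom.appTop (X := T.left) (Y := Spec (CommRingCat.of ℂ)) T.hom)
  have hs : Function.Surjective (algebraMap ℂ (Functions T)) :=
    (@asIso _ _ _ _ _ hi').commRingCatIsoToRingEquiv.surjective
  obtain ⟨c, rfl⟩ := hs x
  refine (isUnit_iff_ne_zero.2 fun h => hx ?_).map _
  rw [h, map_zero]

/-- In a local ring one of f and 1 − f is a unit; so 1 − f is invertible at every point, and it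
annihilates f. -/
theorem eq_zero_of_idempotent {T : SchC} {f : Functions T} (hf : f * f = f)
    (h : ∀ t, t ∉ unitLocus f) : f = 0 := by
  have hu : IsUnit (1 - f) := isUnit_of_unitLocus_eq_top (by
    ext t
    refine iff_of_true (notMem_pointIdeal.1 fun h₁ => ?_) trivial
    have h₂ : f ∈ pointIdeal T t := by
      by_contra h₃
      exact h t (notMem_pointIdeal.1 h₃)
    have h₄ := Ideal.add_mem _ h₁ h₂
    rw [sub_add_cancel] at h₄
    exact (inferInstance : (pointIdeal T t).IsPrime).ne_top ((Ideal.eq_top_iff_one _).2 h₄))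
  refine hu.mul_left_cancel ?_
  rw [sub_mul, one_mul, hf, sub_self, mul_zero]

/-! ## Loci of pairs -/

section Loci

variable {I : Type} [Quiver.{0} I] {v : I → ℕ}

namespace PairFun

/-- The trace of `W` minus a constant. -/
def trace [Fintype I] (W : PathAlgebra I) (c : ℂ) : PairFun v where
  val A _ _ m _ := traceFun W m - algebraMap ℂ A c
  map_val f m e := by rw [map_sub, traceFun_map, AlgHom.commutes]

/-- The matrix entries of an element of the path algebra. -/
def entry (x : PathAlgebra I) (i j : I) (a : Fin (v j)) (b : Fin (v i)) : PairFun v where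
  val A _ _ m _ := evalBlock x m i j a b
  map_val f m e := by rw [evalBlock_map]; rfl

/-- The product of the scalar with a matrix entry. -/
def mulEntry (x : PathAlgebra I) (i j : I) (a : Fin (v j)) (b : Fin (v i)) : PairFun v where
  val A _ _ m e := e * evalBlock x m i j a b
  map_val f m e := by rw [map_mul, evalBlock_map]; rfl

/-- The matrix entries of an arrow. -/
def arrow {i j : I} (α : i ⟶ j) (a : Fin (v j)) (b : Fin (v i)) : PairFun v where
  val A _ _ m _ := m i j α a b
  map_val f m e := rfl

/-- The scalar. -/
def scalar : PairFun v where
  val A _ _ _ e := e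
  map_val f m e := rfl

/-- The function that defines idempotents. -/
def idem : PairFun v where
  val A _ _ _ e := e * e - e
  map_val f m e := by rw [map_sub, map_mul]

/-- The constant function. -/
def one : PairFun v where
  val A _ _ _ _ := 1
  map_val f m e := map_one f

/-- The matrix entries of an element of the path algebra. -/
def entries (x : PathAlgebra I) : Set (PairFun v) := {k | ∃ i j a b, k = entry x i j a b}

/-- The products of the scalar with the matrix entries of an element of the path algebra. -/
def mulEntries (x : PathAlgebra I) : Set (PairFun v) := {k | ∃ i j a b, k = mulEntry x i j a b}

/-- The matrix entries of the arrows of `L`. -/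
def arrows (L : PathAlgebra I) : Set (PairFun v) :=
  {k | ∃ (i j : I) (α : i ⟶ j) (a : _) (b : _), InL L α ∧ k = arrow α a b}

variable {A : Type} [CommRing A] [Algebra ℂ A]

theorem entries_iff {x : PathAlgebra I} {m : Rep v A} {e : A} :
    (∀ k ∈ entries (v := v) x, k.val A m e = 0) ↔ ∀ i j, evalBlock x m i j = 0 := by
  constructor
  · intro h i j
    ext a b
    exact h _ ⟨i, j, a, b, rfl⟩
  · rintro h _ ⟨i, j, a, b, rfl⟩
    exact congrFun (congrFun (h i j) a) b

theorem mulEntries_iff {x : PathAlgebra I} {m : Rep v A} {e : A} :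
    (∀ k ∈ mulEntries (v := v) x, k.val A m e = 0) ↔ ∀ i j, e • evalBlock x m i j = 0 := by
  constructor
  · intro h i j
    ext a b
    exact h _ ⟨i, j, a, b, rfl⟩
  · rintro h _ ⟨i, j, a, b, rfl⟩
    exact congrFun (congrFun (h i j) a) b

theorem arrows_iff {L : PathAlgebra I} {m : Rep v A} {e : A} :
    (∀ k ∈ arrows (v := v) L, k.val A m e = 0) ↔ killL L m = m := by
  constructor
  · intro h
    funext i j α
    by_cases hα : InL L α
    · refine (if_pos hα).trans ?_
      ext a b
      exact (h _ ⟨i, j, α, a, b, hα, rfl⟩).symm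
    · exact if_neg hα
  · rintro h _ ⟨i, j, α, a, b, hα, rfl⟩
    have h₁ : killL L m i j α = 0 := if_pos hα
    rw [h] at h₁
    exact congrFun (congrFun h₁ a) b

theorem trace_iff [Fintype I] {W : PathAlgebra I} {c : ℂ} {m : Rep v A} {e : A} :
    (trace W c).val A m e = 0 ↔ traceFun W m = algebraMap ℂ A c := sub_eq_zero

theorem idem_iff {m : Rep v A} {e : A} : (idem (v := v)).val A m e = 0 ↔ e * e = e := sub_eq_zero

theorem insert_iff {k₀ : PairFun v} {E : Set (PairFun v)} {m : Rep v A} {e : A} :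
    (∀ k ∈ insert k₀ E, k.val A m e = 0) ↔ k₀.val A m e = 0 ∧ ∀ k ∈ E, k.val A m e = 0 :=
  Set.forall_mem_insert

theorem singleton_iff {k₀ : PairFun v} {m : Rep v A} {e : A} :
    (∀ k ∈ ({k₀} : Set (PairFun v)), k.val A m e = 0) ↔ k₀.val A m e = 0 := by simp

end PairFun

theorem evalBlock_changeBasis_eq_zero {A : Type} [CommRing A] [Algebra ℂ A] {x : PathAlgebra I}
    {m : Rep v A} (g : GLPoints v A) (h : ∀ i j, evalBlock x m i j = 0) (i j : I) :
    evalBlock x (changeBasis g m) i j = 0 := by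
  rw [evalBlock_changeBasis, h, Matrix.mul_zero, Matrix.zero_mul]

open PairFun

/-- The locus `Tr W = 0`, `R ≠ 0`. -/
def openLocus [Fintype I] (W R : PathAlgebra I) (v : I → ℕ) : PairLocus v where
  -- The additional scalar is set to zero here, so that points are representations only.
  eqs := insert (trace W 0) {scalar}
  ineqs := entries R
  eqs_inv g m e h := by
    rw [insert_iff, singleton_iff, trace_iff] at h ⊢
    exact ⟨by rw [traceFun_changeBasis, h.1], h.2⟩
  ineqs_inv g m e h := by
    rw [entries_iff] at h ⊢
    exact evalBlock_changeBasis_eq_zero g h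

/-- The locus where the arrows of `L` vanish, and `R ≠ 0`. -/
def baseLocus (L R : PathAlgebra I) (v : I → ℕ) : PairLocus v where
  eqs := insert scalar (arrows L)
  ineqs := entries R
  eqs_inv g m e h := by
    rw [insert_iff, arrows_iff] at h ⊢
    exact ⟨h.1, by rw [← killL_changeBasis, h.2]⟩
  ineqs_inv g m e h := by
    rw [entries_iff] at h ⊢
    exact evalBlock_changeBasis_eq_zero g h

/-- The disjoint union of the loci `R = 0` and `Tr W = 0`, `R ≠ 0`. -/
def splitLocus [Fintype I] (W R : PathAlgebra I) (v : I → ℕ) : PairLocus v where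
  -- The scalar e is idempotent with eR = 0, and e and R have no common zero. Where e = 1 this
  -- forces R = 0, and where e = 0 it forces R ≠ 0: e is the indicator function of the closed
  -- stratum.
  eqs := insert (trace W 0) (insert idem (mulEntries R))
  ineqs := insert scalar (entries R)
  eqs_inv g m e h := by
    rw [insert_iff, insert_iff, mulEntries_iff, trace_iff] at h ⊢
    refine ⟨by rw [traceFun_changeBasis, h.1], h.2.1, fun i j => ?_⟩
    rw [evalBlock_changeBasis, ← Matrix.smul_mul, ← Matrix.mul_smul, h.2.2, Matrix.mul_zero,
      Matrix.zero_mul]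
  ineqs_inv g m e h := by
    rw [insert_iff, entries_iff] at h ⊢
    exact ⟨h.1, evalBlock_changeBasis_eq_zero g h.2⟩

/-! ### Representability of the closed loci -/

/-- Closed loci are represented by affine schemes. -/
theorem InvariantLocus.exists_isUniv [Finite I] [∀ i j : I, Finite (i ⟶ j)] (Y : InvariantLocus v)
    (E : Set (PairFun v)) (hE : ∀ {A : Type} [CommRing A] [Algebra ℂ A] (m : Rep v A) (e : A),
      (∀ k ∈ E, k.val A m e = 0) ↔ Y.mem A m) :
    ∃ (X₀ : SchC) (x₀ : Y.functor.obj (op X₀)), IsUniv Y.functor x₀ ∧ IsSeparated X₀.hom ∧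
      LocallyOfFiniteType X₀.hom ∧ QuasiCompact X₀.hom := by
  -- A closed locus is presented as a locus of pairs with scalar 0 and with the inequation 1 ≠ 0,
  -- which imposes nothing.
  let Z : PairLocus v :=
    { eqs := insert scalar E
      ineqs := {one}
      eqs_inv := fun g m e h => by
        rw [insert_iff, hE] at h ⊢
        exact ⟨h.1, Y.changeBasis_mem g m h.2⟩
      ineqs_inv := fun g m e h => by
        rw [singleton_iff] at h ⊢
        exact h }
  have hZ : ∀ {T : SchC} (x : Z.Pt T), x.fn = 0 ∧ Y.mem _ x.rep := fun x => by
    have h := x.eqs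
    rw [insert_iff, hE] at h
    exact h
  let j : ∀ T : SchC, Y.functor.obj (op T) → Z.Pt T := fun T y =>
    { rep := y.1
      fn := 0
      eqs := insert_iff.2 ⟨rfl, (hE _ _).2 y.2⟩
      ineqs := fun T' f h => isEmpty_of_one_eq_zero (by
        rw [← map_one (Functions.map f)]
        exact h one rfl) }
  obtain ⟨X₀, x₀, hX, h₁, h₂, h₃⟩ := Z.exists_isUniv
  let y₀ : Z.Pt X₀ := x₀
  refine ⟨X₀, (⟨y₀.rep, (hZ y₀).2⟩ : {m : Rep v (Functions X₀) // Y.mem _ m}), fun T y => ?_,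
    h₁, h₂, h₃⟩
  obtain ⟨f, hf, hu⟩ := hX T (j T y)
  refine ⟨f, Subtype.ext (congrArg PairLocus.Pt.rep hf), fun f' hf' => hu f' ?_⟩
  refine PairLocus.Pt.ext (congrArg Subtype.val hf') ?_
  refine Eq.trans ?_ (map_zero (Functions.map f'))
  exact congrArg (Functions.map f') (hZ y₀).1

theorem InvariantLocus.isArtinStack [Fintype I] {Y : InvariantLocus v} {X₀ : SchC}
    {x₀ : Y.functor.obj (op X₀)} (hX : IsUniv Y.functor x₀) (h₁ : IsSeparated X₀.hom)
    (h₂ : LocallyOfFiniteType X₀.hom) (h₃ : QuasiCompact X₀.hom) : IsArtinStack Y.stack := by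
  obtain ⟨G₀, γ, hγ, hsm, hsurj, haff⟩ := exists_isUnivElement_GL v
  exact isArtinStack_quotientStack hγ (hasZariskiSections_GL v) (hasZariskiSections_GL v) hsm hsurj
    haff hX h₁ h₂ h₃ _

theorem exists_isUniv_traceFibre [Fintype I] [∀ i j : I, Finite (i ⟶ j)] (W : PathAlgebra I)
    (v : I → ℕ) (c : ℂ) :
    ∃ (X₀ : SchC) (x₀ : (traceFibre W v c).functor.obj (op X₀)),
      IsUniv (traceFibre W v c).functor x₀ ∧ IsSeparated X₀.hom ∧
      LocallyOfFiniteType X₀.hom ∧ QuasiCompact X₀.hom :=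
  (traceFibre W v c).exists_isUniv {trace W c} fun m e => by rw [singleton_iff, trace_iff]; rfl

theorem exists_isUniv_zeroLocus [Finite I] [∀ i j : I, Finite (i ⟶ j)] (R : PathAlgebra I)
    (v : I → ℕ) :
    ∃ (X₀ : SchC) (x₀ : (zeroLocus R v).functor.obj (op X₀)),
      IsUniv (zeroLocus R v).functor x₀ ∧ IsSeparated X₀.hom ∧
      LocallyOfFiniteType X₀.hom ∧ QuasiCompact X₀.hom :=
  (zeroLocus R v).exists_isUniv (entries R) fun m e => by rw [entries_iff]; rfl

end Loci

end QuiverStack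

end

noncomputable section
namespace QuiverStack

/-! ## The strata of the central fibre -/

section Strata

variable {I : Type} [Fintype I] [Quiver.{0} I] {v : I → ℕ} {W L R : PathAlgebra I}

open PairFun

theorem openLocus_spec {T : SchC} (x : (openLocus W R v).Pt T) :
    traceFun W x.rep = 0 ∧ x.fn = 0 := by
  have h : ∀ k ∈ (insert (trace W 0) {scalar} : Set (PairFun v)), k.val _ x.rep x.fn = 0 := x.eqs
  rw [insert_iff, singleton_iff, trace_iff, map_zero] at h
  exact h

theorem baseLocus_spec {T : SchC} (x : (baseLocus L R v).Pt T) :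
    x.fn = 0 ∧ killL L x.rep = x.rep := by
  have h : ∀ k ∈ (insert scalar (arrows L) : Set (PairFun v)), k.val _ x.rep x.fn = 0 := x.eqs
  rw [insert_iff, arrows_iff] at h
  exact h

theorem splitLocus_spec {T : SchC} (x : (splitLocus W R v).Pt T) :
    traceFun W x.rep = 0 ∧ x.fn * x.fn = x.fn ∧ ∀ i j, x.fn • evalBlock R x.rep i j = 0 := by
  have h : ∀ k ∈ (insert (trace W 0) (insert idem (mulEntries R)) : Set (PairFun v)),
      k.val _ x.rep x.fn = 0 := x.eqs
  rw [insert_iff, insert_iff, mulEntries_iff, trace_iff, idem_iff, map_zero] at h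
  exact h

theorem entries_map_iff {T T' : SchC} (f : T' ⟶ T) (m : Rep v (Functions T)) (e : Functions T) :
    (∀ k ∈ entries (v := v) R, Functions.map f (k.val _ m e) = 0) ↔
      ∀ i j, evalBlock R (m.map (Functions.map f)) i j = 0 := by
  rw [← entries_iff (e := Functions.map f e)]
  exact forall₂_congr fun k _ => by rw [k.map_val]

theorem scalar_entries_map_iff {T T' : SchC} (f : T' ⟶ T) (m : Rep v (Functions T))
    (e : Functions T) :
    (∀ k ∈ insert scalar (entries (v := v) R), Functions.map f (k.val _ m e) = 0) ↔
      Functions.map f e = 0 ∧ ∀ i j, evalBlock R (m.map (Functions.map f)) i j = 0 := by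
  rw [Set.forall_mem_insert, entries_map_iff]
  rfl

include W in
-- Every coefficient of the linear form is a multiple of an entry of `R`. So the locus R = 0 lies in
-- the central fibre and does not meet the general one.
theorem traceFun_eq_zero (hLR : IsLinearFactorization W L R) {A : Type} [CommRing A] [Algebra ℂ A]
    {m : Rep v A} (h : ∀ i j, evalBlock R m i j = 0) : traceFun W m = 0 := by
  rw [traceFun_eq_sum_coordL hLR]
  refine Finset.sum_eq_zero fun k _ => ?_
  rw [cofactor, h, Matrix.zero_apply, smul_zero, mul_zero]

/-- The closed stratum. -/
def zeroLocusToSplit (hLR : IsLinearFactorization W L R) (v : I → ℕ) :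
    EquivariantMap (zeroLocus R v).action (splitLocus W R v).action where
  app T m := (
    { rep := m.1
      fn := 1
      eqs := by
        rw [splitLocus, insert_iff, insert_iff, mulEntries_iff, trace_iff, idem_iff, map_zero]
        exact ⟨traceFun_eq_zero hLR m.2, mul_one 1, fun i j => by rw [m.2 i j, smul_zero]⟩
      ineqs := fun T' f h => isEmpty_of_one_eq_zero (by
        rw [← map_one (Functions.map f)]
        exact h scalar (Set.mem_insert _ _)) } : (splitLocus W R v).Pt T)
  res_app f m := PairLocus.Pt.ext rfl (map_one (Functions.map f))
  act_app T g m := PairLocus.Pt.ext rfl rfl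

variable (W R v) in
/-- The open stratum. -/
def openLocusToSplit : EquivariantMap (openLocus W R v).action (splitLocus W R v).action where
  app T (x : (openLocus W R v).Pt T) := (
    { rep := x.rep
      fn := x.fn
      eqs := by
        obtain ⟨h₁, h₂⟩ := openLocus_spec x
        rw [splitLocus, insert_iff, insert_iff, mulEntries_iff, trace_iff, idem_iff, map_zero]
        exact ⟨h₁, by rw [h₂, mul_zero], fun i j => by rw [h₂, zero_smul]⟩
      ineqs := fun T' f h => x.ineqs T' f fun k hk => h k (Set.mem_insert_of_mem _ hk) } :
        (splitLocus W R v).Pt T)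
  res_app f m := rfl
  act_app T g m := rfl

variable (W R v) in
/-- The morphism from the disjoint union of the strata to the central fibre. -/
def splitToTraceFibre : EquivariantMap (splitLocus W R v).action (traceFibre W v 0).action where
  app T (x : (splitLocus W R v).Pt T) := (⟨x.rep, by
    change traceFun W x.rep = algebraMap ℂ _ 0
    rw [map_zero, (splitLocus_spec x).1]⟩ :
      {m : Rep v (Functions T) // (traceFibre W v 0).mem _ m})
  res_app f m := rfl
  act_app T g m := rfl

variable (W) in
/-- The projection of the open stratum to the base. -/
def openLocusToBase (hLR : IsLinearFactorization W L R) (v : I → ℕ) :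
    EquivariantMap (openLocus W R v).action (baseLocus L R v).action where
  app T (x : (openLocus W R v).Pt T) := (
    { rep := killL L x.rep
      fn := x.fn
      eqs := by
        rw [baseLocus, insert_iff, arrows_iff]
        exact ⟨(openLocus_spec x).2, killL_killL _ _⟩
      ineqs := fun T' f h => x.ineqs T' f ((entries_map_iff f _ _).2 fun i j => by
        have h₁ := (entries_map_iff f _ _).1 h i j
        rwa [killL_map, evalBlock_killL hLR] at h₁) } : (baseLocus L R v).Pt T)
  res_app f x := PairLocus.Pt.ext (killL_map _ _ _) rfl
  act_app T g x := PairLocus.Pt.ext (killL_changeBasis _ _ _).symm rfl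

/-- The projection of the general fibre to the base. -/
def traceFibreToBase (hLR : IsLinearFactorization W L R) (v : I → ℕ) :
    EquivariantMap (traceFibre W v 1).action (baseLocus L R v).action where
  app T m := (
    { rep := killL L m.1
      fn := 0
      eqs := by
        rw [baseLocus, insert_iff, arrows_iff]
        exact ⟨rfl, killL_killL _ _⟩
      -- On the general fibre R has no zeros: where it vanishes, so does the trace, which equals 1.
      ineqs := fun T' f h => isEmpty_of_one_eq_zero (by
        have h₁ := traceFun_eq_zero hLR (m := m.1.map (Functions.map f)) fun i j => by
          have h₂ := (entries_map_iff f _ _).1 h i j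
          rwa [killL_map, evalBlock_killL hLR] at h₂
        have h₃ : traceFun W m.1 = algebraMap ℂ _ 1 := m.2
        rwa [traceFun_map, h₃, map_one, map_one] at h₁) } : (baseLocus L R v).Pt T)
  res_app f m := PairLocus.Pt.ext (killL_map _ _ _) (map_zero (Functions.map f))
  act_app T g m := PairLocus.Pt.ext (killL_changeBasis _ _ _).symm rfl

/-- The idempotent is determined by the representation, so that forgetting it is a monomorphism.
Where e(1 − e') is invertible, eR = 0 gives R = 0 and idempotency gives e' = 0, against the absence
of common zeros for e'. -/
theorem splitLocus_fn_eq_of_rep_eq {T : SchC} (x y : (splitLocus W R v).Pt T)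
    (h : x.rep = y.rep) : x.fn = y.fn := by
  have key : ∀ x y : (splitLocus W R v).Pt T, x.rep = y.rep → x.fn * (1 - y.fn) = 0 := by
    intro x y h
    obtain ⟨-, hx, hxr⟩ := splitLocus_spec x
    obtain ⟨-, hy, -⟩ := splitLocus_spec y
    refine eq_zero_of_idempotent (by
      linear_combination (1 - y.fn) * (1 - y.fn) * hx + x.fn * hy) fun t ht => ?_
    let f := opnι T (unitLocus (x.fn * (1 - y.fn)))
    have hu : IsUnit (Functions.map f (x.fn * (1 - y.fn))) :=
      isUnit_map_of_range_subset _ _ (range_opnι _ _).subset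
    rw [map_mul] at hu
    have hu₁ := isUnit_of_mul_isUnit_left hu
    have hu₂ := isUnit_of_mul_isUnit_right hu
    have hE := y.ineqs _ f ((scalar_entries_map_iff f _ _).2 ⟨?_, fun i j => ?_⟩)
    · have ht' : t ∈ (unitLocus (x.fn * (1 - y.fn)) : Set T.left) := ht
      rw [← range_opnι] at ht'
      obtain ⟨s, -⟩ := ht'
      exact hE.elim s
    · refine hu₂.mul_left_cancel ?_
      rw [← map_mul, mul_zero]
      have : (1 - y.fn) * y.fn = 0 := by linear_combination -hy
      rw [this, map_zero]
    · rw [← h, evalBlock_map]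
      have h₁ := congrArg (fun m => m.map (Functions.map f)) (hxr i j)
      ext a b
      refine hu₁.mul_left_cancel ?_
      have h₂ := congrFun (congrFun h₁ a) b
      simp only [Matrix.map_apply, Matrix.smul_apply, smul_eq_mul, map_mul, Matrix.zero_apply,
        map_zero] at h₂ ⊢
      rw [h₂, mul_zero]
  -- By symmetry e(1 − e') = 0 = e'(1 − e), so both idempotents equal ee'.
  linear_combination key x y h - key y x h.symm

/-- Over ℂ either R(m) = 0, and e = 1 works, or some entry of R(m) is a non-zero constant, hence a
unit, and e = 0 works. In families no such choice of e need exist, which is why the comparison is a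
geometric bijection only. -/
theorem isGeometricBijection_split [∀ i j : I, Finite (i ⟶ j)] :
    IsGeometricBijection (splitToTraceFibre v W R).mapStack := by
  obtain ⟨X₀, x₀, hX, -⟩ := exists_isUniv_traceFibre W v 0
  obtain ⟨Y₀, y₀, hY, -⟩ := (splitLocus W R v).exists_isUniv
  refine isGeometricBijection_mapStack _ (hasZariskiSections_GL v) hX hY
    (fun T (x y : (splitLocus W R v).Pt T) h => ?_) fun T ⟨hT⟩
    (m : {m : Rep v (Functions T) // (traceFibre W v 0).mem _ m}) => ?_
  · have hr : x.rep = y.rep := congrArg Subtype.val h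
    exact PairLocus.Pt.ext hr (splitLocus_fn_eq_of_rep_eq x y hr)
  · have hm : traceFun W m.1 = algebraMap ℂ _ 0 := m.2
    by_cases hR : ∀ i j, evalBlock R m.1 i j = 0
    · exact ⟨(
        { rep := m.1
          fn := 1
          eqs := by
            rw [splitLocus, insert_iff, insert_iff, mulEntries_iff, trace_iff, idem_iff]
            exact ⟨hm, mul_one 1, fun i j => by rw [hR i j, smul_zero]⟩
          ineqs := fun T' f h => isEmpty_of_one_eq_zero (by
            rw [← map_one (Functions.map f)]
            exact h scalar (Set.mem_insert _ _)) } : (splitLocus W R v).Pt T), rfl⟩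
    · push Not at hR
      obtain ⟨i, j, hij⟩ := hR
      obtain ⟨a, b, hab⟩ : ∃ a b, evalBlock R m.1 i j a b ≠ 0 := by
        by_contra! hc
        exact hij (by ext a b; exact hc a b)
      exact ⟨(
        { rep := m.1
          fn := 0
          eqs := by
            rw [splitLocus, insert_iff, insert_iff, mulEntries_iff, trace_iff, idem_iff]
            exact ⟨hm, mul_zero 0, fun i j => by rw [zero_smul]⟩
          ineqs := fun T' f h => by
            have h₁ := ((scalar_entries_map_iff f _ _).1 h).2 i j
            rw [evalBlock_map] at h₁
            have h₂ : Functions.map f (evalBlock R m.1 i j a b) = 0 := congrFun (congrFun h₁ a) b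
            have h₃ := (isUnit_of_isTerminal hT hab).map (Functions.map f)
            rw [h₂] at h₃
            exact isEmpty_of_one_eq_zero (isUnit_zero_iff.1 h₃).symm } :
              (splitLocus W R v).Pt T), rfl⟩

theorem zeroLocusToSplit_iff (hLR : IsLinearFactorization W L R) {T : SchC}
    (x : (splitLocus W R v).Pt T) :
    (∃ z, (zeroLocusToSplit hLR v).app T z = x) ↔ IsUnit x.fn := by
  obtain ⟨-, hx, hxr⟩ := splitLocus_spec x
  constructor
  · rintro ⟨z, rfl⟩
    exact isUnit_one
  · intro hu
    have h₁ : x.fn = 1 := hu.mul_left_cancel (by rw [hx, mul_one])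
    refine ⟨(⟨x.rep, fun i j => ?_⟩ : {m : Rep v (Functions T) // (zeroLocus R v).mem _ m}),
      PairLocus.Pt.ext rfl h₁.symm⟩
    have h₂ := hxr i j
    rwa [h₁, one_smul] at h₂

theorem openLocusToSplit_iff {T : SchC} (x : (splitLocus W R v).Pt T) :
    (∃ z, (openLocusToSplit v W R).app T z = x) ↔ IsUnit (1 - x.fn) := by
  obtain ⟨hW, hx, hxr⟩ := splitLocus_spec x
  constructor
  · rintro ⟨z, rfl⟩
    change IsUnit (1 - PairLocus.Pt.fn (Z := openLocus W R v) z)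
    rw [(openLocus_spec (W := W) (R := R) (v := v) z).2, sub_zero]
    exact isUnit_one
  · intro hu
    have h₁ : x.fn = 0 := hu.mul_left_cancel (by linear_combination -hx)
    exact ⟨(
      { rep := x.rep
        fn := x.fn
        eqs := by
          rw [openLocus, insert_iff, singleton_iff, trace_iff, map_zero]
          exact ⟨hW, h₁⟩
        ineqs := fun T' f h => x.ineqs T' f ((scalar_entries_map_iff f _ _).2
          ⟨by rw [h₁, map_zero], (entries_map_iff f _ _).1 h⟩) } : (openLocus W R v).Pt T), rfl⟩

/-- The strata are the loci where e, respectively 1 − e, is invertible. Near each point one of the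
two is, and on a common point 1 = e = 0. -/
theorem isDisjointUnion_split [∀ i j : I, Finite (i ⟶ j)] (hLR : IsLinearFactorization W L R) :
    IsDisjointUnion (zeroLocusToSplit hLR v).mapStack (openLocusToSplit v W R).mapStack := by
  obtain ⟨X₀, x₀, hX, -⟩ := (splitLocus W R v).exists_isUniv
  obtain ⟨Y₁, y₁, hX₁, -⟩ := exists_isUniv_zeroLocus R v
  obtain ⟨Y₂, y₂, hX₂, -⟩ := (openLocus W R v).exists_isUniv
  refine isDisjointUnion_mapStack _ _ (hasZariskiSections_GL v) hX hX₁ hX₂ ?_ ?_ ?_ ?_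
  · refine isOpenImmersion_of_isUnit hX hX₁ _ (zeroLocusToSplit hLR v).res_app
      (fun T z z' h => Subtype.ext (congrArg PairLocus.Pt.rep h))
      (fun T (x : (splitLocus W R v).Pt T) => x.fn) (fun f x => rfl)
      (fun T x => zeroLocusToSplit_iff hLR x)
  · refine isOpenImmersion_of_isUnit hX hX₂ _ (openLocusToSplit v W R).res_app
      (fun T z z' h => PairLocus.Pt.ext (Z := openLocus W R v)
        (congrArg (PairLocus.Pt.rep (Z := splitLocus W R v)) h)
        (congrArg (PairLocus.Pt.fn (Z := splitLocus W R v)) h))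
      (fun T (x : (splitLocus W R v).Pt T) => 1 - x.fn)
      (fun {T T'} f (x : (splitLocus W R v).Pt T) => ?_) (fun T x => openLocusToSplit_iff x)
    rw [map_sub, map_one]
    rfl
  · intro T (x : (splitLocus W R v).Pt T) t
    have hopn : ∀ y : Functions T, t ∈ unitLocus y →
        t ∈ Set.range (opnι T (unitLocus y)).left ∧ IsUnit (Functions.map (opnι T (unitLocus y)) y) :=
      fun y hy => ⟨by rw [range_opnι]; exact hy,
        isUnit_map_of_range_subset _ _ (range_opnι _ _).subset⟩
    by_cases h : t ∈ unitLocus x.fn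
    · obtain ⟨h₁, h₂⟩ := hopn _ h
      exact ⟨_, opnι T (unitLocus x.fn), h₁, Or.inl ((zeroLocusToSplit_iff hLR (x.res _)).2 h₂)⟩
    · have h' : t ∈ unitLocus (1 - x.fn) := by
        refine notMem_pointIdeal.1 fun h₁ => ?_
        have h₂ : x.fn ∈ pointIdeal T t := by
          by_contra h₃
          exact h (notMem_pointIdeal.1 h₃)
        have h₄ := Ideal.add_mem _ h₁ h₂
        rw [sub_add_cancel] at h₄
        exact (inferInstance : (pointIdeal T t).IsPrime).ne_top ((Ideal.eq_top_iff_one _).2 h₄)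
      obtain ⟨h₁, h₂⟩ := hopn _ h'
      rw [map_sub, map_one] at h₂
      exact ⟨_, opnι T (unitLocus (1 - x.fn)), h₁,
        Or.inr ((openLocusToSplit_iff (x.res _)).2 h₂)⟩
  · intro T z₁ (z₂ : (openLocus W R v).Pt T) h
    refine isEmpty_of_one_eq_zero ?_
    have h₁ : (1 : Functions T) = z₂.fn := congrArg PairLocus.Pt.fn h
    rw [h₁, (openLocus_spec z₂).2]

/-- If all cofactors vanished in the residue field of a point, so would R, which is excluded on the
base. -/
theorem exists_cofactor_ne_zero (hLR : IsLinearFactorization W L R) {T : SchC}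
    (x : (baseLocus L R v).Pt T) (t : T.left) : ∃ k, t ∈ unitLocus (cofactor L R x.rep k) := by
  by_contra! hc
  obtain ⟨T', f, hne, hf⟩ := exists_residue_point T t
  refine hne.elim (x.ineqs T' f ((entries_map_iff f _ _).2 ?_)).elim
  exact evalBlock_eq_zero_of_cofactor hLR _ fun k => by rw [cofactor_map, hf _ (hc k)]

/-- The projections to the base are Zariski fibrations, the fibres of which are affine spaces. -/
theorem isZariskiFibration_killL [∀ i j : I, Finite (i ⟶ j)] (hLR : IsLinearFactorization W L R)
    (c : ℂ) {X : SchCᵒᵖ ⥤ Type} {ρ : GroupAction (GLFunctor v) X}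
    (η : EquivariantMap ρ (baseLocus L R v).action) {Y₀ : SchC} {y₀ : X.obj (op Y₀)}
    (hY : IsUniv X y₀) (rp : ∀ T : SchC, X.obj (op T) → Rep v (Functions T))
    (rp_res : ∀ {T T' : SchC} (f : T' ⟶ T) z, rp T' (res X f z) = (rp T z).map (Functions.map f))
    (rp_inj : ∀ T, Function.Injective (rp T))
    (hη : ∀ T z, PairLocus.Pt.rep (Z := baseLocus L R v) (η.app T z) = killL L (rp T z))
    (htr : ∀ T z, traceFun W (rp T z) = algebraMap ℂ _ c)
    (hex : ∀ T (b : (baseLocus L R v).Pt T) (m : Rep v (Functions T)), killL L m = b.rep →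
      traceFun W m = algebraMap ℂ _ c → ∃ z, rp T z = m) {n : ℕ}
    (hn : Fintype.card (LIndex L v) - 1 = n) {Φ : SchC}
    {coord : ∀ W : SchC, (W ⟶ Φ) → Fin n → Functions W}
    (hcoord : ∀ W, Function.Bijective (coord W))
    (coord_comp : ∀ {W W' : SchC} (l : W' ⟶ W) (r : W ⟶ Φ) (i : Fin n),
        coord W' (l ≫ r) i = Functions.map l (coord W r i)) :
    IsZariskiFibration η.mapStack Φ := by
  classical
  obtain ⟨X₀, x₀, hX, -⟩ := (baseLocus L R v).exists_isUniv
  refine isZariskiFibration_mapStack η (hasZariskiSections_GL v) hX hY Φ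
    fun T (x : (baseLocus L R v).Pt T) t => ?_
  -- On the open subset where this cofactor is invertible, the equation Tr W = c can be solved for
  -- the unknown with index `k₀`; the other unknowns are free coordinates.
  obtain ⟨k₀, hk₀⟩ := exists_cofactor_ne_zero hLR x t
  let ι := opnι T (unitLocus (cofactor L R x.rep k₀))
  let b := x.res ι
  have hu : IsUnit (cofactor L R b.rep k₀) := by
    change IsUnit (cofactor L R (x.rep.map (Functions.map ι)) k₀)
    rw [cofactor_map]
    exact isUnit_map_of_range_subset _ _ (range_opnι _ _).subset
  obtain ⟨w, hw⟩ := hu.exists_left_inv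
  -- The truncated subtraction in `n` is harmless: this point is reached only if there is an index
  -- `k₀`.
  let e : {k // k ≠ k₀} ≃ Fin n := Fintype.equivFinOfCardEq (by
    rw [← hn, Fintype.card_subtype_compl, Fintype.card_subtype_eq])
  -- The values of the entries of the arrows of `L` that correspond to a point `r` of affine space.
  let sol : ∀ V : SchC, (V ⟶ opn T (unitLocus (cofactor L R x.rep k₀))) → (V ⟶ Φ) →
      LIndex L v → Functions V := fun V f r => solveLinear k₀ (Functions.map f w)
        (algebraMap ℂ _ c) (cofactor L R (b.rep.map (Functions.map f))) fun k => coord V r (e k)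
  have hwf : ∀ (V : SchC) (f : V ⟶ opn T (unitLocus (cofactor L R x.rep k₀))),
      Functions.map f w * cofactor L R (b.rep.map (Functions.map f)) k₀ = 1 := fun V f => by
    rw [cofactor_map, ← map_mul, hw, map_one]
  have hkill : ∀ (V : SchC) (f : V ⟶ opn T (unitLocus (cofactor L R x.rep k₀)))
      (a : LIndex L v → Functions V),
      killL L (insertL L (b.rep.map (Functions.map f)) a) = (b.res f).rep := fun V f a => by
    rw [killL_insertL]
    exact (baseLocus_spec (b.res f)).2
  have htrace : ∀ (V : SchC) (f : V ⟶ opn T (unitLocus (cofactor L R x.rep k₀))) (r : V ⟶ Φ),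
      traceFun W (insertL L (b.rep.map (Functions.map f)) (sol V f r)) = algebraMap ℂ _ c :=
    fun V f r => by
      rw [traceFun_eq_sum_coordL hLR, coordL_insertL hLR]
      simp only [cofactor_insertL hLR]
      exact sum_solveLinear k₀ (hwf V f) _
  choose pt hpt using fun V f r => hex V (b.res f) _ (hkill V f (sol V f r)) (htrace V f r)
  have hbres : ∀ (V : SchC) (f : V ⟶ opn T (unitLocus (cofactor L R x.rep k₀))),
      res (baseLocus L R v).functor (f ≫ ι) x = b.res f := fun V f =>
    (res_res (baseLocus L R v).functor ι f x).symm
  refine ⟨_, ι, inferInstanceAs (IsOpenImmersion (opnι _ _).left), ?_, pt,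
    fun {V V'} l f r => ?_, fun V f r => ?_, fun V f z hz => ?_⟩
  · rw [range_opnι]; exact hk₀
  · refine rp_inj _ ?_
    rw [rp_res, hpt, hpt, insertL_map, Rep.map_Functions_comp]
    congr 1
    refine (map_solveLinear k₀ (Functions.map l).toRingHom _ _ _ _).trans ?_
    change solveLinear k₀ (Functions.map l (Functions.map f w)) (Functions.map l (algebraMap ℂ _ c))
      _ _ = solveLinear k₀ _ _ _ _
    rw [Functions.map_apply_comp, AlgHom.commutes]
    congr 1
    · funext k
      rw [← Rep.map_Functions_comp, cofactor_map]
      rfl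
    · funext k
      exact (coord_comp l r _).symm
  · rw [hbres]
    refine PairLocus.Pt.ext ?_ ?_
    · rw [hη, hpt, hkill]
    · exact (baseLocus_spec (L := L) (R := R) (v := v) (η.app V (pt V f r))).1.trans
        (baseLocus_spec (b.res f)).1.symm
  · rw [hbres] at hz
    have hzk : killL L (rp V z) = b.rep.map (Functions.map f) :=
      (hη V z).symm.trans (congrArg PairLocus.Pt.rep hz)
    have hcof : ∀ k, cofactor L R (rp V z) k = cofactor L R (b.rep.map (Functions.map f)) k :=
      fun k => by rw [← hzk, cofactor_killL hLR]
    have hsum : ∑ k, coordL L (rp V z) k * cofactor L R (b.rep.map (Functions.map f)) k =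
        algebraMap ℂ _ c := by
      rw [← htr V z, traceFun_eq_sum_coordL hLR]
      exact Finset.sum_congr rfl fun k _ => by rw [hcof]
    -- A point of the fibre is recovered from its entries at the arrows of `L`; that at `k₀` is
    -- forced by the equation, so only the coordinates of `r` have to be matched.
    have hiff : ∀ r : V ⟶ Φ, pt V f r = z ↔
        coord V r = fun i => coordL L (rp V z) (e.symm i) := by
      intro r
      have h₁ : pt V f r = z ↔ sol V f r = coordL L (rp V z) := by
        constructor
        · rintro rfl
          rw [hpt, coordL_insertL hLR]
        · intro h
          refine rp_inj _ ?_
          rw [hpt, h, ← hzk, insertL_killL_coordL]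
      rw [h₁]
      constructor
      · intro h
        funext i
        rw [← h]
        refine Eq.trans ?_ (solveLinear_ne k₀ _ _ _ _ (e.symm i)).symm
        rw [Equiv.apply_symm_apply]
      · intro h
        refine Eq.trans ?_ (solveLinear_eq k₀ (hwf V f) hsum)
        change solveLinear k₀ _ _ _ _ = solveLinear k₀ _ _ _ _
        congr 1
        funext k
        refine (congrFun h (e k)).trans ?_
        rw [Equiv.symm_apply_apply]
    obtain ⟨r, hr, hru⟩ := (hcoord V).existsUnique fun i => coordL L (rp V z) (e.symm i)
    exact ⟨r, (hiff r).2 hr, fun r' hr' => hru r' ((hiff r').1 hr')⟩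

end Strata

end QuiverStack

end

/-! ### Relations between classes and the final computation -/

noncomputable section
namespace QuiverStack

theorem stackClass_eq_of_relation {X Y : ArtinStack}
    (h : Relation (FreeAbelianGroup.of X - FreeAbelianGroup.of Y)) :
    stackClass X = stackClass Y := by
  refine QuotientAddGroup.eq.2 ?_
  have h₁ := AddSubgroup.neg_mem _ (AddSubgroup.subset_closure (k := {r | Relation r}) h)
  rwa [neg_sub, sub_eq_neg_add] at h₁

theorem stackClass_eq_add_of_relation {X Y Z : ArtinStack}
    (h : Relation (FreeAbelianGroup.of Z - (FreeAbelianGroup.of X + FreeAbelianGroup.of Y))) :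
    stackClass Z = stackClass X + stackClass Y := by
  refine QuotientAddGroup.eq.2 ?_
  have h₁ := AddSubgroup.neg_mem _ (AddSubgroup.subset_closure (k := {r | Relation r}) h)
  rwa [neg_sub, sub_eq_neg_add] at h₁

end QuiverStack

end

theorem proposition7p1 {I : Type} [Fintype I] [Quiver.{0} I] [∀ i j : I, Finite (i ⟶ j)]
    (W L R : PathAlgebra I) (hW : IsSuperpotential W) (hLR : IsLinearFactorization W L R)
    (v : I → ℕ) :
    ∃ (h₀ : IsArtinStack (traceFibre W v 0).stack)
      (h₁ : IsArtinStack (traceFibre W v 1).stack)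
      (hR : IsArtinStack (zeroLocus R v).stack),
      stackClass ⟨(traceFibre W v 0).stack, h₀⟩ - stackClass ⟨(traceFibre W v 1).stack, h₁⟩ =
        stackClass ⟨(zeroLocus R v).stack, hR⟩ := by
  obtain ⟨M₀, m₀, hM₀, a₁, a₂, a₃⟩ := exists_isUniv_traceFibre W v 0
  obtain ⟨M₁, m₁, hM₁, b₁, b₂, b₃⟩ := exists_isUniv_traceFibre W v 1
  obtain ⟨Z₀, z₀, hZ₀, c₁, c₂, c₃⟩ := exists_isUniv_zeroLocus R v
  obtain ⟨U₀, u₀, hU₀, -⟩ := (openLocus W R v).exists_isUniv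
  have h₀ : IsArtinStack (traceFibre W v 0).stack := InvariantLocus.isArtinStack hM₀ a₁ a₂ a₃
  have h₁ : IsArtinStack (traceFibre W v 1).stack := InvariantLocus.isArtinStack hM₁ b₁ b₂ b₃
  have hR : IsArtinStack (zeroLocus R v).stack := InvariantLocus.isArtinStack hZ₀ c₁ c₂ c₃
  -- One unknown is eliminated by the trace equation. If `L` contributes no matrix entries at all,
  -- the base is empty and the truncated dimension plays no role.
  obtain ⟨Φ, coord, hcoord, coord_comp⟩ := exists_affineSpace (Fintype.card (LIndex L v) - 1)
  let S : ArtinStack := ⟨_, (splitLocus W R v).isArtinStack⟩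
  let U : ArtinStack := ⟨_, (openLocus W R v).isArtinStack⟩
  let B : ArtinStack := ⟨_, (baseLocus L R v).isArtinStack⟩
  have e₁ : stackClass S = stackClass ⟨_, h₀⟩ :=
    stackClass_eq_of_relation (.geometricBijection S ⟨_, h₀⟩ _ isGeometricBijection_split)
  have e₂ : stackClass S = stackClass ⟨_, hR⟩ + stackClass U :=
    stackClass_eq_add_of_relation
      (.disjointUnion ⟨_, hR⟩ U S _ _ (isDisjointUnion_split hLR))
  -- The same statement on hyperplanes is applied to the open stratum with constant 0 and to the
  -- general fibre with constant 1; both have the fibre `Φ` over the same base.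
  have f₁ : IsZariskiFibration (openLocusToBase W hLR v).mapStack Φ :=
    isZariskiFibration_killL hLR 0 _ hU₀
      (fun T (z : (openLocus W R v).Pt T) => z.rep) (fun f z => rfl)
      (fun T (z z' : (openLocus W R v).Pt T) h => PairLocus.Pt.ext h
        ((openLocus_spec z).2.trans (openLocus_spec z').2.symm)) (fun T z => rfl)
      (fun T (z : (openLocus W R v).Pt T) => by rw [(openLocus_spec z).1, map_zero])
      (fun T b m hm hW => ⟨(
        { rep := m
          fn := 0
          eqs := PairFun.insert_iff.2 ⟨PairFun.trace_iff.2 hW, PairFun.singleton_iff.2 rfl⟩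
          ineqs := fun T' f h => b.ineqs T' f ((entries_map_iff f _ _).2 fun i j => by
            rw [← hm, killL_map, evalBlock_killL hLR]
            exact (entries_map_iff f _ _).1 h i j) } : (openLocus W R v).Pt T), rfl⟩)
      rfl hcoord coord_comp
  have f₂ : IsZariskiFibration (traceFibreToBase hLR v).mapStack Φ :=
    isZariskiFibration_killL hLR 1 _ hM₁
      (fun T (z : {m : Rep v (Functions T) // (traceFibre W v 1).mem _ m}) => z.1)
      (fun f z => rfl) (fun T z z' h => Subtype.ext h) (fun T z => rfl) (fun T z => z.2)
      (fun T b m hm hW =>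
        ⟨(⟨m, hW⟩ : {m : Rep v (Functions T) // (traceFibre W v 1).mem _ m}), rfl⟩)
      rfl hcoord coord_comp
  have e₃ : stackClass U = stackClass ⟨_, h₁⟩ :=
    stackClass_eq_of_relation (.zariskiFibration U ⟨_, h₁⟩ B Φ _ _ f₁ f₂)
  refine ⟨h₀, h₁, hR, ?_⟩
  -- [M₀] − [M₁] = [S] − [M₁] = [{R = 0}] + [U] − [M₁], and [U] = [M₁].
  rw [← e₁, e₂, e₃, add_sub_cancel_right]
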